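/- Let $\nu\ge 0$ be an integer, let $f_1(x_1,\delta)$ and $f_2(x_1,x_2,\delta)$ be real-valued $C^\infty$ functions defined in open neighborhoods of the origin of $\mathbb R\times\mathbb R^\nu$ and $\mathbb R^2\times\mathbb R^\nu$ respectively. For an amplitude $a(x,\delta)$, and for $\lambda>0$, $\sigma\in\mathbb R$, $\delta\in\mathbb R^\nu$, put $$J(\lambda,\sigma,\delta)=\int_{\mathbb R^2}e^{i\lambda\left(f_1(x_1,\delta)+\sigma f_2(x_1,x_2,\delta)\right)}a(x,\delta)\,dx .$$ Assume that $$|\partial_1f_1(0,0)|+|\partial_1^2f_1(0,0)|+|\partial_1^3f_1(0,0)|\neq 0,\qquad \partial_1\partial_2f_2(0,0,0)\neq0,$$ and that there is an integer $m\ge2$ such that $\partial_2^lf_2(0,0,0)=0$ for $l=1,\dots,m-1$ and $\partial_2^mf_2(0,0,0)\ne0$. Put $l_m=\frac16$, $c_m=1$ if $m<6$, and $l_m=\frac{m-3}{2(2m-3)}$, $c_m=2$ if $m\ge6$. Then there exist an open neighborhood $U\subset\mathbb R^2$ of the origin and constants $\varepsilon,\varepsilon'>0$, such that $f_1(x_1,\delta)$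 and $f_2(x,\delta)$ are defined for all $x\in U$, $|\delta|\le\varepsilon'$, with the following property. Let $a$ be any complex-valued amplitude which is $C^\infty$ on $\mathbb R^2\times W$ for some open set $W\subset\mathbb R^\nu$ containing $\{|\delta|\le\varepsilon'\}$, and for which there is a compact set $K\subset U$ such that $\operatorname{supp}a(\cdot,\delta)\subset K$ for every $\delta\in W$. Then there is a constant $C$ such that $$|J(\lambda,\sigma,\delta)|\le\frac{C}{\lambda^{\frac12+\varepsilon}\,|\sigma|^{\,l_m+c_m\varepsilon}}$$ for all $\lambda>0$, all $\sigma\neq0$ and all $\delta$ with $|\sigma|+|\delta|<\varepsilon'$. -/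

import Mathlib

open MeasureTheory Set
open scoped ContDiff

/-- The phase `F(x, σ, δ) = f₁(x₁, δ) + σ f₂(x₁, x₂, δ)`, with parameter vector `δ ∈ ℝ^ν`. -/
def airyPhase {ν : ℕ} (f₁ : ℝ × EuclideanSpace ℝ (Fin ν) → ℝ)
    (f₂ : (ℝ × ℝ) × EuclideanSpace ℝ (Fin ν) → ℝ)
    (x : ℝ × ℝ) (σ : ℝ) (δ : EuclideanSpace ℝ (Fin ν)) : ℝ :=
  f₁ (x.1, δ) + σ * f₂ (x, δ)

/-- The oscillatory integral `J(λ, σ, δ) = ∫_{ℝ²} exp(i λ F(x, σ, δ)) a(x, δ) dx`. -/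
noncomputable def airyIntegral {ν : ℕ} (f₁ : ℝ × EuclideanSpace ℝ (Fin ν) → ℝ)
    (f₂ : (ℝ × ℝ) × EuclideanSpace ℝ (Fin ν) → ℝ)
    (a : (ℝ × ℝ) × EuclideanSpace ℝ (Fin ν) → ℂ)
    (lam σ : ℝ) (δ : EuclideanSpace ℝ (Fin ν)) : ℂ :=
  ∫ x : ℝ × ℝ, Complex.exp (Complex.I * ((lam * airyPhase f₁ f₂ x σ δ : ℝ) : ℂ)) * a (x, δ)

/-- `l_m = 1/6` for `m < 6` and `l_m = (m - 3) / (2 (2 m - 3))` for `m ≥ 6`. -/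
noncomputable def airyL (m : ℕ) : ℝ :=
  if m < 6 then 1 / 6 else ((m : ℝ) - 3) / (2 * (2 * (m : ℝ) - 3))

/-- `c_m = 1` for `m < 6` and `c_m = 2` for `m ≥ 6`. -/
noncomputable def airyC (m : ℕ) : ℝ :=
  if m < 6 then 1 else 2

/-- `a` is a smooth amplitude, for parameters `δ` in the set `W`, compactly supported in `U`:
there is one compact `K ⊆ U` which contains the support of `a(·, δ)` for every `δ ∈ W`. -/
def IsAmplitudeIn {ν : ℕ} (U : Set (ℝ × ℝ)) (W : Set (EuclideanSpace ℝ (Fin ν)))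
    (a : (ℝ × ℝ) × EuclideanSpace ℝ (Fin ν) → ℂ) : Prop :=
  ContDiffOn ℝ ∞ a (univ ×ˢ W) ∧
    ∃ K : Set (ℝ × ℝ), IsCompact K ∧ K ⊆ U ∧ ∀ δ ∈ W, tsupport (fun x => a (x, δ)) ⊆ K

/-!
Write `F = f₁ + σ f₂` and `p = (δ, σ)`; all estimates are uniform for small `p`. The phase `F` does
not depend on `x₂` when `σ = 0`, so decay beyond `lam ^ (-1 / 2)` has to come from an oscillation in
`x₂` that is as weak as `σ`, which is exploited through van der Corput's lemma. After `f₁`, `f₂` and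
the amplitude have been replaced by globally smooth functions, three cases are distinguished in
`hasAiryBound_sigmaPhase`, according to the first derivative of `f₁(·, 0)` at `0` that does not
vanish.

* Order one: a single integration by parts in `x₁` gives `lam⁻¹`, which suffices
  (`hasAiryBound_of_deriv_ne_zero`).

* Order two: `F` has one critical curve `x₁ = Z(x₂, p)`. On its translates `x₁ = Z + t` the phase is
  `σ K` up to a term independent of `x₂`, where `K` has a nonvanishing `m`-th derivative in `x₂`.
  The integral in `x₂` along the translates gains a power of `lam |σ|`, and stationary phase in `t`,
  which keeps this gain, contributes `lam ^ (-1 / 2)` (`hasAiryBound_of_deriv_two_ne_zero`).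

* Order three: here the mixed derivative `∂₁∂₂f₂` matters. On the zero set `x₁ = ξ(x₂, p)` of
  `∂₁²F` the value of `∂₁F` is `B(p) + σ x`, and `x` may replace `x₂` as a coordinate because of the
  mixed derivative. If `s` is the coordinate in which `∂₁F = B + σ x + s²`, the phase becomes
  `H(p) + σ h(x, p) + ∫₀ˢ (B + σ x + ζ²) W(ζ, x, p) dζ`,
  where `W = W₀ + σ W₁` and `W₀` is independent of `x` (`AiryNormalForm`, `exists_airyNormalForm`).

In the last case the integral is cut into the pieces where `|B + σ x|` is comparable to `r²`, for
dyadic `r` between `lam ^ (-1 / 3)` and `1` (`AiryNormalForm.exists_norm_integral_le`). On such a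
piece `s = r z` and `U = (B + σ x) / r²` turn the phase into one with the large parameter `lam r³`
and critical points `z = ±√(-U)`. Near these, stationary phase gives `(lam r³) ^ (-1 / 2)` times the
decay in `x` along the curves `z = ±(√(-U) + t)`; elsewhere integration by parts gives `(lam r³)⁻¹`
times the decay in `x` for fixed `z`. Along a critical curve the phase is, up to smaller terms, a
sum of `σ h`, whose `m`-th derivative is of size `σ`, and of a multiple of `r³ (-U) ^ (3 / 2)`, none
of whose derivatives vanishes and whose `m`-th derivative is of size `r³ (σ / r²) ^ m`. The first
dominates if `σ ^ (m - 1)` is small compared to `r ^ (2 m - 3)`. In the opposite case the `m + 1`-st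
derivative of the second dominates, since there the slope `σ / r²` is large
(`AiryNormalForm.exists_oscBound_airyCurve`). The exponents then are a matter of linear inequalities
(`exponent_le_of_le`, `exponent_le_of_outer`, `exponent_le_of_inner`). The extreme cases occur at
the smallest scale `r = lam ^ (-1 / 3)`: there `lam σ = 1` produces the exponent `1 / 6`, and `r ^
(2 m - 3) = σ ^ (m - 1)` produces `(m - 3) / (2 (2 m - 3))`, which is the larger one for `m > 6`.
Each piece is better than the asserted bound by a factor `(lam r³) ^ (-ε)`, so that the sum over the
dyadic scales converges.
-/

/-! ### Van der Corput's lemma -/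

theorem norm_integral_exp_le_of_deriv {φ : ℝ → ℝ} (hφ : ContDiff ℝ 2 φ) {a b D : ℝ} (hab : a ≤ b)
    (hD : 0 < D) (h1 : ∀ x ∈ Icc a b, D ≤ |deriv φ x|)
    (h2 : ∀ x ∈ Icc a b, deriv (deriv φ) x ≠ 0) :
    ‖∫ x in a..b, Complex.exp (Complex.I * (φ x : ℝ))‖ ≤ 4 * D⁻¹ := by
  have hd1 : ∀ x, HasDerivAt φ (deriv φ x) x := fun x =>
    (hφ.differentiable (by norm_num)).differentiableAt.hasDerivAt
  have hφ1 : ContDiff ℝ 1 (deriv φ) := by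
    have : ContDiff ℝ (1 + 1) φ := by simpa [one_add_one_eq_two] using hφ
    exact (contDiff_succ_iff_deriv.1 this).2.2
  have hd2 : ∀ x, HasDerivAt (deriv φ) (deriv (deriv φ) x) x := fun x =>
    (hφ1.differentiable (by norm_num)).differentiableAt.hasDerivAt
  have hc2 : Continuous (deriv (deriv φ)) := hφ1.continuous_deriv (by norm_num)
  have hne : ∀ x ∈ Icc a b, deriv φ x ≠ 0 := fun x hx h => by
    have := h1 x hx; rw [h, abs_zero] at this; linarith
  have hu : uIcc a b = Icc a b := uIcc_of_le hab
  set w : ℝ → ℝ := fun x => -(deriv (deriv φ) x) / (deriv φ x) ^ 2 with hw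
  have hwd : ∀ x ∈ uIcc a b, HasDerivAt (fun x => (deriv φ x)⁻¹) (w x) x := fun x hx =>
    (hd2 x).fun_inv (hne x (hu ▸ hx))
  have hwc : ContinuousOn w (uIcc a b) := by
    rw [hu]
    exact (hc2.neg.continuousOn).div ((hφ1.continuous.pow 2).continuousOn)
      (fun x hx => pow_ne_zero 2 (hne x hx))
  have hwi : IntervalIntegrable w volume a b := hwc.intervalIntegrable
  have hwint : |∫ x in a..b, w x| ≤ 2 * D⁻¹ := by
    rw [intervalIntegral.integral_eq_sub_of_hasDerivAt hwd hwi]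
    have e : ∀ x ∈ Icc a b, |(deriv φ x)⁻¹| ≤ D⁻¹ := fun x hx => by
      rw [abs_inv]; exact inv_anti₀ hD (h1 x hx)
    calc _ ≤ |(deriv φ b)⁻¹| + |(deriv φ a)⁻¹| := abs_sub _ _
      _ ≤ D⁻¹ + D⁻¹ := add_le_add (e b ⟨hab, le_rfl⟩) (e a ⟨le_rfl, hab⟩)
      _ = _ := by ring
  -- `φ''` has constant sign, so that the total variation of `1 / φ'` is a difference of two values
  have hsign : (∀ x ∈ Icc a b, 0 ≤ w x) ∨ (∀ x ∈ Icc a b, w x ≤ 0) := by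
    have hpc : IsPreconnected (Icc a b) := isPreconnected_Icc
    by_contra hcon
    push Not at hcon
    obtain ⟨⟨x, hx, hx'⟩, ⟨y, hy, hy'⟩⟩ := hcon
    obtain ⟨z, hz, hz'⟩ := hpc.intermediate_value hx hy (hu ▸ hwc) ⟨hx'.le, hy'.le⟩
    have : -(deriv (deriv φ) z) / (deriv φ z) ^ 2 ≠ 0 :=
      div_ne_zero (neg_ne_zero.2 (h2 z hz)) (pow_ne_zero 2 (hne z hz))
    exact this hz'
  have hwabs : ∫ x in a..b, |w x| ≤ 2 * D⁻¹ := by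
    rcases hsign with h | h
    · rw [intervalIntegral.integral_congr (g := w)
        (fun x hx => abs_of_nonneg (h x (hu ▸ hx)))]
      exact (le_abs_self _).trans hwint
    · rw [intervalIntegral.integral_congr (g := fun x => - w x)
        (fun x hx => abs_of_nonpos (h x (hu ▸ hx))), intervalIntegral.integral_neg]
      exact (neg_le_abs _).trans hwint
  have hexpd : ∀ x ∈ uIcc a b, HasDerivAt (fun x => Complex.exp (Complex.I * (φ x : ℝ)))
      (Complex.exp (Complex.I * (φ x : ℝ)) * (Complex.I * (deriv φ x : ℝ))) x := fun x _ =>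
    ((hd1 x).ofReal_comp.const_mul Complex.I).cexp
  have hEc : Continuous fun x => Complex.exp (Complex.I * (φ x : ℝ)) := by
    have := hφ.continuous
    fun_prop
  have hibp := intervalIntegral.integral_mul_deriv_eq_deriv_mul
    (u := fun x => (((deriv φ x)⁻¹ : ℝ) : ℂ)) (u' := fun x => ((w x : ℝ) : ℂ))
    (fun x hx => (hwd x hx).ofReal_comp) hexpd
    ⟨hwi.1.ofReal, hwi.2.ofReal⟩
    (by
      apply Continuous.intervalIntegrable
      have := hφ1.continuous
      fun_prop)
  have hmain : ∫ x in a..b, Complex.exp (Complex.I * (φ x : ℝ))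
      = -Complex.I * ∫ x in a..b, (((deriv φ x)⁻¹ : ℝ) : ℂ) *
        (Complex.exp (Complex.I * (φ x : ℝ)) * (Complex.I * (deriv φ x : ℝ))) := by
    rw [← intervalIntegral.integral_const_mul]
    apply intervalIntegral.integral_congr
    intro x hx
    have : ((deriv φ x : ℝ) : ℂ) ≠ 0 := by exact_mod_cast hne x (hu ▸ hx)
    push_cast
    field_simp
    simp
  have hn : ∀ x : ℝ, ‖Complex.exp (Complex.I * (φ x : ℝ))‖ = 1 := fun x =>
    Complex.norm_exp_I_mul_ofReal _
  rw [hmain, norm_mul, hibp]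
  have hb : ∀ x ∈ Icc a b, ‖(((deriv φ x)⁻¹ : ℝ) : ℂ) * Complex.exp (Complex.I * (φ x : ℝ))‖
      ≤ D⁻¹ := fun x hx => by
    rw [norm_mul, hn, mul_one, Complex.norm_real, Real.norm_eq_abs, abs_inv]
    exact inv_anti₀ hD (h1 x hx)
  have hint : ‖∫ x in a..b, ((w x : ℝ) : ℂ) * Complex.exp (Complex.I * (φ x : ℝ))‖ ≤ 2 * D⁻¹ := by
    refine (intervalIntegral.norm_integral_le_integral_norm hab).trans ?_
    simpa only [norm_mul, hn, mul_one, Complex.norm_real, Real.norm_eq_abs] using hwabs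
  rw [norm_neg, Complex.norm_I, one_mul]
  calc _ ≤ ‖(((deriv φ b)⁻¹ : ℝ) : ℂ) * Complex.exp (Complex.I * (φ b : ℝ))‖
        + ‖(((deriv φ a)⁻¹ : ℝ) : ℂ) * Complex.exp (Complex.I * (φ a : ℝ))‖ + 2 * D⁻¹ :=
        (norm_sub_le _ _).trans (add_le_add (norm_sub_le _ _) hint)
    _ ≤ D⁻¹ + D⁻¹ + 2 * D⁻¹ := by
        gcongr
        · exact hb b ⟨hab, le_rfl⟩
        · exact hb a ⟨le_rfl, hab⟩
    _ = 4 * D⁻¹ := by ring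

/-- A function whose derivative is at least `D` in absolute value grows linearly away from the
point where its absolute value is smallest. -/
theorem exists_mul_abs_sub_le_abs {g : ℝ → ℝ} (hg : ContDiff ℝ 1 g) {a b D : ℝ} (hab : a ≤ b)
    (h : ∀ x ∈ Icc a b, D ≤ |deriv g x|) :
    ∃ c ∈ Icc a b, ∀ x ∈ Icc a b, D * |x - c| ≤ |g x| := by
  have hcont : Continuous g := hg.continuous
  obtain ⟨c, hc, hmin⟩ := isCompact_Icc.exists_isMinOn (nonempty_Icc.2 hab)
    (hcont.abs.continuousOn (s := Icc a b))
  refine ⟨c, hc, fun x hx => ?_⟩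
  have hmvt : D * |x - c| ≤ |g x - g c| := by
    rcases eq_or_ne x c with rfl | hne
    · simp
    have hdiff : Differentiable ℝ g := hg.differentiable (by norm_num)
    rcases lt_or_gt_of_ne hne with hlt | hlt
    · obtain ⟨y, hy, hy'⟩ := exists_deriv_eq_slope g hlt hcont.continuousOn
        hdiff.differentiableOn
      have hyI : y ∈ Icc a b := ⟨hx.1.trans hy.1.le, hy.2.le.trans hc.2⟩
      have := h y hyI
      rw [hy', abs_div, le_div_iff₀ (abs_pos.2 (sub_ne_zero.2 hlt.ne'))] at this
      rwa [abs_sub_comm x c, abs_sub_comm (g x)]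
    · obtain ⟨y, hy, hy'⟩ := exists_deriv_eq_slope g hlt hcont.continuousOn
        hdiff.differentiableOn
      have hyI : y ∈ Icc a b := ⟨hc.1.trans hy.1.le, hy.2.le.trans hx.2⟩
      have := h y hyI
      rwa [hy', abs_div, le_div_iff₀ (abs_pos.2 (sub_ne_zero.2 hlt.ne'))] at this
  have hm : |g c| ≤ |g x| := hmin hx
  rcases eq_or_ne (g c) 0 with h0 | h0
  · simpa [h0] using hmvt
  -- no zero at the minimum, hence `g` has constant sign
  have hsame : 0 ≤ g x * g c := by
    by_contra hneg
    push Not at hneg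
    have hz : (0 : ℝ) ∈ g '' Icc a b := by
      rcases lt_or_gt_of_ne h0 with hlt | hgt
      · have : 0 < g x := by nlinarith
        exact isPreconnected_Icc.intermediate_value hc hx hcont.continuousOn ⟨hlt.le, this.le⟩
      · have : g x < 0 := by nlinarith
        exact isPreconnected_Icc.intermediate_value hx hc hcont.continuousOn ⟨this.le, hgt.le⟩
    obtain ⟨z, hz, hz'⟩ := hz
    have h3 : |g c| ≤ |g z| := hmin hz
    rw [hz', abs_zero] at h3
    exact h0 (abs_eq_zero.1 (le_antisymm h3 (abs_nonneg _)))
  refine hmvt.trans ?_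
  rcases lt_or_gt_of_ne h0 with hlt | hgt
  · have hx0 : g x ≤ 0 := by nlinarith
    rw [abs_of_nonpos hx0, abs_of_neg hlt] at *
    rw [abs_le]; constructor <;> linarith
  · have hx0 : 0 ≤ g x := by nlinarith
    rw [abs_of_nonneg hx0, abs_of_pos hgt] at *
    rw [abs_le]; constructor <;> linarith

/-- The induction step of van der Corput's lemma: an interval of length `2 η` around the point
where `|g|` is smallest is cut out, and `|g| ≥ D η` on what remains. -/
theorem norm_integral_le_of_abs_deriv_ge {f : ℝ → ℂ} (hf : Continuous f) (hf1 : ∀ x, ‖f x‖ ≤ 1)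
    {g : ℝ → ℝ} (hg : ContDiff ℝ 1 g) {a b D c : ℝ} {k : ℕ} (hk : 1 ≤ k) (hab : a ≤ b)
    (hD : 0 < D) (hc : 0 ≤ c)
    (h : ∀ a' b' D' : ℝ, a ≤ a' → a' ≤ b' → b' ≤ b → 0 < D' → (∀ x ∈ Icc a' b', D' ≤ |g x|) →
      ‖∫ x in a'..b', f x‖ ≤ c * D' ^ (-(1 : ℝ) / k))
    (hder : ∀ x ∈ Icc a b, D ≤ |deriv g x|) :
    ‖∫ x in a..b, f x‖ ≤ (2 * c + 2) * D ^ (-(1 : ℝ) / ((k + 1 : ℕ) : ℝ)) := by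
  obtain ⟨x₀, hx₀, hlin⟩ := exists_mul_abs_sub_le_abs hg hab hder
  have hk0 : (0 : ℝ) < k := by exact_mod_cast hk
  set η : ℝ := D ^ (-(1 : ℝ) / ((k + 1 : ℕ) : ℝ)) with hη
  have hη0 : 0 < η := Real.rpow_pos_of_pos hD _
  have hpow : (D * η) ^ (-(1 : ℝ) / k) = η := by
    have : D * η = D ^ ((k : ℝ) / ((k + 1 : ℕ) : ℝ)) := by
      rw [hη]
      nth_rewrite 1 [← Real.rpow_one D]
      rw [← Real.rpow_add hD]
      congr 1
      push_cast
      field_simp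
      ring
    rw [this, ← Real.rpow_mul hD.le, hη]
    congr 1
    push_cast
    field_simp
  set l : ℝ := max a (x₀ - η) with hl
  set u : ℝ := min b (x₀ + η) with hu
  have hal : a ≤ l := le_max_left _ _
  have hub : u ≤ b := min_le_left _ _
  have hlx : l ≤ x₀ := max_le hx₀.1 (by linarith)
  have hxu : x₀ ≤ u := le_min hx₀.2 (by linarith)
  have hi : ∀ s t, IntervalIntegrable f volume s t := fun s t => hf.intervalIntegrable _ _
  have hsplit : ∫ x in a..b, f x
      = (∫ x in a..l, f x) + (∫ x in l..u, f x) + ∫ x in u..b, f x := by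
    rw [intervalIntegral.integral_add_adjacent_intervals (hi _ _) (hi _ _),
      intervalIntegral.integral_add_adjacent_intervals (hi _ _) (hi _ _)]
  have hmid : ‖∫ x in l..u, f x‖ ≤ 2 * η := by
    refine (intervalIntegral.norm_integral_le_of_norm_le_const (C := 1) fun x _ => hf1 x).trans ?_
    rw [one_mul, abs_of_nonneg (by linarith)]
    have h1 : x₀ - η ≤ l := le_max_right _ _
    have h2 : u ≤ x₀ + η := min_le_right _ _
    linarith
  have hleft : ‖∫ x in a..l, f x‖ ≤ c * η := by
    rcases le_total (x₀ - η) a with hcase | hcase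
    · have : l = a := max_eq_left hcase
      rw [this, intervalIntegral.integral_same, norm_zero]; positivity
    · have hl' : l = x₀ - η := max_eq_right hcase
      have := h a l (D * η) le_rfl hal (hlx.trans hx₀.2) (by positivity) (fun x hx => by
        refine le_trans ?_ (hlin x ⟨hx.1, hx.2.trans (hlx.trans hx₀.2)⟩)
        gcongr
        rw [abs_sub_comm]
        refine le_trans ?_ (le_abs_self _)
        have := hx.2
        linarith)
      rwa [hpow] at this
  have hright : ‖∫ x in u..b, f x‖ ≤ c * η := by
    rcases le_total b (x₀ + η) with hcase | hcase
    · have : u = b := min_eq_left hcase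
      rw [this, intervalIntegral.integral_same, norm_zero]; positivity
    · have hl' : u = x₀ + η := min_eq_right hcase
      have := h u b (D * η) (hx₀.1.trans hxu) hub le_rfl (by positivity) (fun x hx => by
        refine le_trans ?_ (hlin x ⟨(hx₀.1.trans hxu).trans hx.1, hx.2⟩)
        gcongr
        refine le_trans ?_ (le_abs_self _)
        have := hx.1
        linarith)
      rwa [hpow] at this
  rw [hsplit]
  calc _ ≤ ‖∫ x in a..l, f x‖ + ‖∫ x in l..u, f x‖ + ‖∫ x in u..b, f x‖ := norm_add₃_le
    _ ≤ c * η + 2 * η + c * η := by gcongr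
    _ = _ := by ring

/-- Van der Corput's lemma for derivatives of order `k ≥ 2`. -/
theorem exists_norm_integral_exp_le (k : ℕ) (hk : 2 ≤ k) :
    ∃ c : ℝ, 0 ≤ c ∧ ∀ (φ : ℝ → ℝ) (a b D : ℝ), ContDiff ℝ k φ → a ≤ b → 0 < D →
      (∀ x ∈ Icc a b, D ≤ |iteratedDeriv k φ x|) →
      ‖∫ x in a..b, Complex.exp (Complex.I * (φ x : ℝ))‖ ≤ c * D ^ (-(1 : ℝ) / k) := by
  induction k, hk using Nat.le_induction with
  | base =>
    refine ⟨2 * 4 + 2, by norm_num, fun φ a b D hφ hab hD h => ?_⟩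
    have hφ' : ContDiff ℝ 2 φ := by exact_mod_cast hφ
    have hφ1 : ContDiff ℝ 1 (deriv φ) := by
      have : ContDiff ℝ (1 + 1) φ := by simpa [one_add_one_eq_two] using hφ'
      exact (contDiff_succ_iff_deriv.1 this).2.2
    have h2 : ∀ x, iteratedDeriv 2 φ x = deriv (deriv φ) x := fun x => by
      rw [iteratedDeriv_succ, iteratedDeriv_one]
    have hc := hφ.continuous
    have := norm_integral_le_of_abs_deriv_ge (k := 1)
      (f := fun x => Complex.exp (Complex.I * (φ x : ℝ)))
      (by fun_prop) (fun x => (Complex.norm_exp_I_mul_ofReal _).le) hφ1 le_rfl hab hD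
      (by norm_num : (0 : ℝ) ≤ 4)
      (fun a' b' D' ha hab' hb hD' hx => by
        have := norm_integral_exp_le_of_deriv hφ' hab' hD' hx (fun x hx h0 => by
          have := h x ⟨ha.trans hx.1, hx.2.trans hb⟩
          rw [h2, h0, abs_zero] at this
          linarith)
        simpa [Real.rpow_neg_one] using this)
      (fun x hx => h2 x ▸ h x hx)
    exact this
  | succ k hk ih =>
    obtain ⟨c, hc0, hc⟩ := ih
    refine ⟨2 * c + 2, by positivity, fun φ a b D hφ hab hD h => ?_⟩
    have hcont := hφ.continuous
    have hg : ContDiff ℝ 1 (iteratedDeriv k φ) := by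
      rw [iteratedDeriv_eq_iterate]
      exact ContDiff.iterate_deriv' 1 k (by rw [add_comm]; exact_mod_cast hφ)
    exact norm_integral_le_of_abs_deriv_ge (f := fun x => Complex.exp (Complex.I * (φ x : ℝ)))
      (by fun_prop) (fun x => (Complex.norm_exp_I_mul_ofReal _).le) hg (by omega) hab hD hc0
      (fun a' b' D' ha hab' hb hD' hx => hc φ a' b' D' (hφ.of_le (by norm_cast; omega)) hab' hD' hx)
      (fun x hx => by simpa only [iteratedDeriv_succ] using h x hx)

/-! ### Oscillatory integrals with amplitudes -/

/-- `OscBound ψ a b E` says that integrals of `exp (i ψ)` over `[a, b]` against a `C¹` amplitude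
are at most `E` times a norm of the amplitude that controls its supremum and its variation. -/
def OscBound (ψ : ℝ → ℝ) (a b E : ℝ) : Prop :=
  ∀ (g g' : ℝ → ℂ) (M₀ M₁ : ℝ), (∀ x, HasDerivAt g (g' x) x) → Continuous g' →
    ‖g b‖ ≤ M₀ → (∀ x ∈ Icc a b, ‖g' x‖ ≤ M₁) →
    ‖∫ x in a..b, Complex.exp (Complex.I * (ψ x : ℝ)) * g x‖ ≤ E * (M₀ + M₁ * (b - a))

theorem OscBound.mono {ψ : ℝ → ℝ} {a b E E' : ℝ} (h : OscBound ψ a b E) (hab : a ≤ b)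
    (hE : E ≤ E') : OscBound ψ a b E' := fun g g' M₀ M₁ hg hg' h0 h1 => by
  refine (h g g' M₀ M₁ hg hg' h0 h1).trans ?_
  have : 0 ≤ M₀ := (norm_nonneg _).trans h0
  have : 0 ≤ M₁ := (norm_nonneg _).trans (h1 a ⟨le_rfl, hab⟩)
  have : 0 ≤ b - a := sub_nonneg.2 hab
  gcongr

theorem oscBound_length {ψ : ℝ → ℝ} {a b : ℝ} (hab : a ≤ b) :
    OscBound ψ a b (b - a) := fun g g' M₀ M₁ hg hg' h0 h1 => by
  have hM1 : 0 ≤ M₁ := (norm_nonneg _).trans (h1 a ⟨le_rfl, hab⟩)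
  have key : ∀ x ∈ Icc a b, ‖g x‖ ≤ M₀ + M₁ * (b - a) := fun x hx => by
    have h2 : ‖g x - g b‖ ≤ M₁ * ‖x - b‖ :=
      (convex_Icc a b).norm_image_sub_le_of_norm_hasDerivWithin_le
        (fun y _ => (hg y).hasDerivWithinAt) h1 ⟨hab, le_rfl⟩ hx
    have h3 : ‖x - b‖ ≤ b - a := by
      rw [Real.norm_eq_abs, abs_sub_comm, abs_of_nonneg (by linarith [hx.2])]
      linarith [hx.1]
    calc ‖g x‖ = ‖g b + (g x - g b)‖ := by ring_nf
      _ ≤ ‖g b‖ + ‖g x - g b‖ := norm_add_le _ _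
      _ ≤ M₀ + M₁ * (b - a) := add_le_add h0 (h2.trans (by gcongr))
  refine (intervalIntegral.norm_integral_le_of_norm_le_const
    (C := M₀ + M₁ * (b - a)) fun x hx => ?_).trans ?_
  · rw [uIoc_of_le hab] at hx
    rw [norm_mul, Complex.norm_exp_I_mul_ofReal, one_mul]
    exact key x ⟨hx.1.le, hx.2⟩
  · rw [abs_of_nonneg (sub_nonneg.2 hab), mul_comm]

/-- Van der Corput's lemma with an amplitude. -/
theorem exists_oscBound_of_iteratedDeriv (k : ℕ) (hk : 2 ≤ k) :
    ∃ c : ℝ, 0 ≤ c ∧ ∀ (φ : ℝ → ℝ) (a b D : ℝ), ContDiff ℝ k φ → a ≤ b → 0 < D →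
      (∀ x ∈ Icc a b, D ≤ |iteratedDeriv k φ x|) → OscBound φ a b (c * D ^ (-(1 : ℝ) / k)) := by
  obtain ⟨c, hc0, hc⟩ := exists_norm_integral_exp_le k hk
  refine ⟨c, hc0, fun φ a b D hφ hab hD h g g' M₀ M₁ hg hg' h0 h1 => ?_⟩
  set e : ℝ → ℂ := fun x => Complex.exp (Complex.I * (φ x : ℝ)) with he
  have hφc := hφ.continuous
  have hec : Continuous e := by fun_prop
  set G : ℝ → ℂ := fun x => ∫ y in a..x, e y with hG
  have hGd : ∀ x, HasDerivAt G (e x) x := fun x =>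
    intervalIntegral.integral_hasDerivAt_right (hec.intervalIntegrable _ _)
      hec.aestronglyMeasurable.stronglyMeasurableAtFilter hec.continuousAt
  set K : ℝ := c * D ^ (-(1 : ℝ) / k) with hK
  have hK0 : 0 ≤ K := by positivity
  have hGb : ∀ x ∈ Icc a b, ‖G x‖ ≤ K := fun x hx =>
    hc φ a x D hφ hx.1 hD fun y hy => h y ⟨hy.1, hy.2.trans hx.2⟩
  have hGc : Continuous G := continuous_iff_continuousAt.2 fun x => (hGd x).continuousAt
  have hibp := intervalIntegral.integral_mul_deriv_eq_deriv_mul (a := a) (b := b)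
    (u := g) (u' := g') (v := G) (v' := e) (fun x _ => hg x) (fun x _ => hGd x)
    (hg'.intervalIntegrable _ _) (hec.intervalIntegrable _ _)
  have hGa : G a = 0 := intervalIntegral.integral_same
  have hcomm : ∫ x in a..b, e x * g x = ∫ x in a..b, g x * e x := by
    simp_rw [mul_comm]
  change ‖∫ x in a..b, e x * g x‖ ≤ _
  rw [hcomm, hibp, hGa, mul_zero, sub_zero]
  have hM1 : 0 ≤ M₁ := (norm_nonneg _).trans (h1 a ⟨le_rfl, hab⟩)
  have h2 : ‖∫ x in a..b, g' x * G x‖ ≤ M₁ * K * |b - a| :=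
    intervalIntegral.norm_integral_le_of_norm_le_const fun x hx => by
      rw [uIoc_of_le hab] at hx
      have hx' : x ∈ Icc a b := ⟨hx.1.le, hx.2⟩
      rw [norm_mul]
      exact mul_le_mul (h1 x hx') (hGb x hx') (norm_nonneg _) hM1
  rw [abs_of_nonneg (sub_nonneg.2 hab)] at h2
  calc _ ≤ ‖g b * G b‖ + ‖∫ x in a..b, g' x * G x‖ := norm_sub_le _ _
    _ ≤ M₀ * K + M₁ * K * (b - a) := by
        refine add_le_add ?_ h2
        rw [norm_mul]
        exact mul_le_mul h0 (hGb b ⟨hab, le_rfl⟩) (norm_nonneg _) ((norm_nonneg _).trans h0)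
    _ = _ := by ring

/-- Integration by parts in `t`, followed by an estimate of the remaining integrals in `x`. -/
theorem norm_integral_integral_mul_deriv_le {Φ Φt : ℝ → ℝ → ℝ} {β βt : ℝ → ℝ → ℂ}
    {τ₁ τ₂ a b lam n₀ : ℝ} {n : ℝ → ℝ} (hτ : τ₁ ≤ τ₂) (hab : a ≤ b) (hlam : 0 < lam)
    (hΦ : ∀ t ∈ Icc τ₁ τ₂, ∀ x ∈ Icc a b, HasDerivAt (fun t => Φ t x) (Φt t x) t)
    (hβ : ∀ t ∈ Icc τ₁ τ₂, ∀ x ∈ Icc a b, HasDerivAt (fun t => β t x) (βt t x) t)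
    (hΦc : ContinuousOn (fun q : ℝ × ℝ => Φ q.1 q.2) (Icc τ₁ τ₂ ×ˢ Icc a b))
    (hΦtc : ContinuousOn (fun q : ℝ × ℝ => Φt q.1 q.2) (Icc τ₁ τ₂ ×ˢ Icc a b))
    (hβc : ContinuousOn (fun q : ℝ × ℝ => β q.1 q.2) (Icc τ₁ τ₂ ×ˢ Icc a b))
    (hβtc : ContinuousOn (fun q : ℝ × ℝ => βt q.1 q.2) (Icc τ₁ τ₂ ×ˢ Icc a b))
    (h1 : ‖∫ x in a..b, Complex.exp (Complex.I * ((lam * Φ τ₁ x : ℝ) : ℂ)) * β τ₁ x‖ ≤ n₀)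
    (h2 : ‖∫ x in a..b, Complex.exp (Complex.I * ((lam * Φ τ₂ x : ℝ) : ℂ)) * β τ₂ x‖ ≤ n₀)
    (hn : IntervalIntegrable n volume τ₁ τ₂)
    (h3 : ∀ t ∈ Icc τ₁ τ₂,
      ‖∫ x in a..b, Complex.exp (Complex.I * ((lam * Φ t x : ℝ) : ℂ)) * βt t x‖ ≤ n t) :
    ‖∫ x in a..b, ∫ t in τ₁..τ₂,
        Complex.exp (Complex.I * ((lam * Φ t x : ℝ) : ℂ)) * ((Φt t x : ℝ) * β t x)‖
      ≤ lam⁻¹ * (2 * n₀ + ∫ t in τ₁..τ₂, n t) := by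
  set e : ℝ → ℝ → ℂ := fun t x => Complex.exp (Complex.I * ((lam * Φ t x : ℝ) : ℂ)) with he
  have hlamC : (lam : ℂ) ≠ 0 := by exact_mod_cast hlam.ne'
  have hec : ContinuousOn (fun q : ℝ × ℝ => e q.1 q.2) (Icc τ₁ τ₂ ×ˢ Icc a b) := by
    refine Complex.continuous_exp.comp_continuousOn ?_
    refine continuousOn_const.mul (Complex.continuous_ofReal.comp_continuousOn ?_)
    exact continuousOn_const.mul hΦc
  have hsec : ∀ {f : ℝ → ℝ → ℂ}, ContinuousOn (fun q : ℝ × ℝ => f q.1 q.2) (Icc τ₁ τ₂ ×ˢ Icc a b) →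
      ∀ x ∈ Icc a b, ContinuousOn (fun t => f t x) (Icc τ₁ τ₂) := fun {f} hf x hx =>
    hf.comp (f := fun t : ℝ => (t, x)) (by fun_prop) fun t ht => ⟨ht, hx⟩
  have hsec2 : ∀ {f : ℝ → ℝ → ℂ}, ContinuousOn (fun q : ℝ × ℝ => f q.1 q.2) (Icc τ₁ τ₂ ×ˢ Icc a b) →
      ∀ t ∈ Icc τ₁ τ₂, ContinuousOn (fun x => f t x) (Icc a b) := fun {f} hf t ht =>
    hf.comp (f := fun x : ℝ => (t, x)) (by fun_prop) fun x hx => ⟨ht, hx⟩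
  have hu : uIcc a b = Icc a b := uIcc_of_le hab
  have hut : uIcc τ₁ τ₂ = Icc τ₁ τ₂ := uIcc_of_le hτ
  -- integration by parts for fixed `x`
  have hx : ∀ x ∈ uIcc a b, ∫ t in τ₁..τ₂, e t x * ((Φt t x : ℝ) * β t x)
      = (Complex.I * lam)⁻¹ *
        (e τ₂ x * β τ₂ x - e τ₁ x * β τ₁ x - ∫ t in τ₁..τ₂, e t x * βt t x) := by
    intro x hx
    rw [hu] at hx
    have hibp := intervalIntegral.integral_mul_deriv_eq_deriv_mul (a := τ₁) (b := τ₂)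
      (u := fun t => β t x) (u' := fun t => βt t x) (v := fun t => e t x)
      (v' := fun t => e t x * (Complex.I * ((lam * Φt t x : ℝ) : ℂ)))
      (fun t ht => hβ t (hut ▸ ht) x hx)
      (fun t ht => (((hΦ t (hut ▸ ht) x hx).const_mul lam).ofReal_comp.const_mul Complex.I).cexp)
      (ContinuousOn.intervalIntegrable (by rw [hut]; exact hsec hβtc x hx))
      (ContinuousOn.intervalIntegrable (by
        rw [hut]
        refine hsec (f := fun t x => e t x * (Complex.I * ((lam * Φt t x : ℝ) : ℂ))) ?_ x hx
        refine hec.mul (continuousOn_const.mul (Complex.continuous_ofReal.comp_continuousOn ?_))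
        exact continuousOn_const.mul hΦtc))
    have e1 : ∫ t in τ₁..τ₂, e t x * ((Φt t x : ℝ) * β t x)
        = (Complex.I * lam)⁻¹ * ∫ t in τ₁..τ₂, β t x *
          (e t x * (Complex.I * ((lam * Φt t x : ℝ) : ℂ))) := by
      rw [← intervalIntegral.integral_const_mul]
      apply intervalIntegral.integral_congr
      intro t _
      push_cast
      field_simp
    rw [e1, hibp]
    congr 1
    simp_rw [mul_comm]
  rw [intervalIntegral.integral_congr hx, intervalIntegral.integral_const_mul]
  have hI2 : IntervalIntegrable (fun x => ∫ t in τ₁..τ₂, e t x * βt t x) volume a b := by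
    have hcc : ContinuousOn (fun q : ℝ × ℝ => e q.1 q.2 * βt q.1 q.2) (Icc τ₁ τ₂ ×ˢ Icc a b) :=
      hec.mul hβtc
    have hint : IntegrableOn (fun q : ℝ × ℝ => e q.1 q.2 * βt q.1 q.2)
        (Icc τ₁ τ₂ ×ˢ Icc a b) (volume.prod volume) :=
      hcc.integrableOn_compact (isCompact_Icc.prod isCompact_Icc)
    have h4 : Integrable (fun q : ℝ × ℝ => e q.1 q.2 * βt q.1 q.2)
        ((volume.restrict (Ioc τ₁ τ₂)).prod (volume.restrict (Ioc a b))) := by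
      rw [Measure.prod_restrict]
      exact hint.mono_set (prod_mono Ioc_subset_Icc_self Ioc_subset_Icc_self)
    rw [intervalIntegrable_iff_integrableOn_Ioc_of_le hab]
    simp_rw [intervalIntegral.integral_of_le hτ]
    exact h4.integral_prod_right
  have hsl : ∀ t ∈ Icc τ₁ τ₂, IntervalIntegrable (fun x => e t x * β t x) volume a b :=
    fun t ht => ContinuousOn.intervalIntegrable (by
      rw [hu]; exact hsec2 (f := fun t x => e t x * β t x) (hec.mul hβc) t ht)
  have h1' := hsl τ₁ ⟨le_rfl, hτ⟩
  have h2' := hsl τ₂ ⟨hτ, le_rfl⟩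
  rw [intervalIntegral.integral_sub (h2'.sub h1') hI2, intervalIntegral.integral_sub h2' h1']
  have hswap : ∫ x in a..b, ∫ t in τ₁..τ₂, e t x * βt t x
      = ∫ t in τ₁..τ₂, ∫ x in a..b, e t x * βt t x := by
    refine (intervalIntegral_intervalIntegral_swap ?_).symm
    refine ((hec.mul hβtc).integrableOn_compact (isCompact_Icc.prod isCompact_Icc)).mono_set ?_
    rw [uIoc_of_le hab, uIoc_of_le hτ]
    exact prod_mono Ioc_subset_Icc_self Ioc_subset_Icc_self
  have h5 : ‖∫ t in τ₁..τ₂, ∫ x in a..b, e t x * βt t x‖ ≤ ∫ t in τ₁..τ₂, n t :=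
    intervalIntegral.norm_integral_le_of_norm_le hτ
      (Filter.Eventually.of_forall fun t ht => h3 t ⟨ht.1.le, ht.2⟩) hn
  rw [hswap, norm_mul, norm_inv, norm_mul, Complex.norm_I, one_mul, Complex.norm_real,
    Real.norm_of_nonneg hlam.le]
  gcongr
  calc _ ≤ ‖∫ x in a..b, e τ₂ x * β τ₂ x‖ + ‖∫ x in a..b, e τ₁ x * β τ₁ x‖
        + ‖∫ t in τ₁..τ₂, ∫ x in a..b, e t x * βt t x‖ :=
        (norm_sub_le _ _).trans (add_le_add (norm_sub_le _ _) le_rfl)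
    _ ≤ n₀ + n₀ + ∫ t in τ₁..τ₂, n t := by gcongr
    _ = _ := by ring

/-- A one-dimensional stationary phase estimate, uniform in `x`, in which the integral over `x`
supplies the additional factor `M`: the phase satisfies `∂ₜ Φ = t E`, the amplitude is `E β`. The
part `|t| ≤ lam ^ (-1/2)` is integrated in `x` only; elsewhere one integration by parts in `t` is
done before. -/
theorem norm_integral_integral_stationary_le {Φ E : ℝ → ℝ → ℝ} {β βt : ℝ → ℝ → ℂ}
    {T a b lam M : ℝ} (hT : 0 < T) (hab : a ≤ b) (hlam : 0 < lam)
    (hΦ : ∀ t ∈ Icc (-T) T, ∀ x ∈ Icc a b, HasDerivAt (fun t => Φ t x) (t * E t x) t)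
    (hβ : ∀ t ∈ Icc (-T) T, ∀ x ∈ Icc a b, HasDerivAt (fun t => β t x) (βt t x) t)
    (hΦc : ContinuousOn (fun q : ℝ × ℝ => Φ q.1 q.2) (Icc (-T) T ×ˢ Icc a b))
    (hEc : ContinuousOn (fun q : ℝ × ℝ => E q.1 q.2) (Icc (-T) T ×ˢ Icc a b))
    (hβc : ContinuousOn (fun q : ℝ × ℝ => β q.1 q.2) (Icc (-T) T ×ˢ Icc a b))
    (hβtc : ContinuousOn (fun q : ℝ × ℝ => βt q.1 q.2) (Icc (-T) T ×ˢ Icc a b))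
    (h0 : ∀ t ∈ Icc (-T) T,
      ‖∫ x in a..b, Complex.exp (Complex.I * ((lam * Φ t x : ℝ) : ℂ)) * ((E t x : ℝ) * β t x)‖ ≤ M)
    (h1 : ∀ t ∈ Icc (-T) T,
      ‖∫ x in a..b, Complex.exp (Complex.I * ((lam * Φ t x : ℝ) : ℂ)) * β t x‖ ≤ M)
    (h2 : ∀ t ∈ Icc (-T) T,
      ‖∫ x in a..b, Complex.exp (Complex.I * ((lam * Φ t x : ℝ) : ℂ)) * βt t x‖ ≤ M) :
    ‖∫ x in a..b, ∫ t in (-T)..T,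
        Complex.exp (Complex.I * ((lam * Φ t x : ℝ) : ℂ)) * ((E t x : ℝ) * β t x)‖
      ≤ (8 + 2 * T) * (M * lam ^ (-(1 / 2) : ℝ)) := by
  set e : ℝ → ℝ → ℂ := fun t x => Complex.exp (Complex.I * ((lam * Φ t x : ℝ) : ℂ)) with he
  set τ : ℝ := lam ^ (-(1 / 2) : ℝ) with hτdef
  have hτ0 : 0 < τ := Real.rpow_pos_of_pos hlam _
  have hττ : lam * (τ * τ) = 1 := by
    rw [hτdef, ← Real.rpow_add hlam]
    norm_num [Real.rpow_neg_one]
    exact mul_inv_cancel₀ hlam.ne'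
  have hM : 0 ≤ M := (norm_nonneg _).trans (h0 0 ⟨by linarith, hT.le⟩)
  have hec : ContinuousOn (fun q : ℝ × ℝ => e q.1 q.2) (Icc (-T) T ×ˢ Icc a b) := by
    refine Complex.continuous_exp.comp_continuousOn ?_
    refine continuousOn_const.mul (Complex.continuous_ofReal.comp_continuousOn ?_)
    exact continuousOn_const.mul hΦc
  have hAc : ContinuousOn (fun q : ℝ × ℝ => e q.1 q.2 * ((E q.1 q.2 : ℝ) * β q.1 q.2))
      (Icc (-T) T ×ˢ Icc a b) :=
    hec.mul ((Complex.continuous_ofReal.comp_continuousOn hEc).mul hβc)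
  have hu : uIcc a b = Icc a b := uIcc_of_le hab
  -- the contribution of an interval around the stationary point
  have hmid : ∀ s, 0 ≤ s → s ≤ T →
      ‖∫ x in a..b, ∫ t in (-s)..s, e t x * ((E t x : ℝ) * β t x)‖ ≤ 2 * s * M := by
    intro s hs hsT
    have hsub : Icc (-s) s ⊆ Icc (-T) T := Icc_subset_Icc (by linarith) hsT
    have hswap : ∫ x in a..b, ∫ t in (-s)..s, e t x * ((E t x : ℝ) * β t x)
        = ∫ t in (-s)..s, ∫ x in a..b, e t x * ((E t x : ℝ) * β t x) := by
      refine (intervalIntegral_intervalIntegral_swap ?_).symm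
      refine (hAc.integrableOn_compact (isCompact_Icc.prod isCompact_Icc)).mono_set ?_
      rw [uIoc_of_le hab, uIoc_of_le (by linarith)]
      exact prod_mono (Ioc_subset_Icc_self.trans hsub) Ioc_subset_Icc_self
    rw [hswap]
    refine (intervalIntegral.norm_integral_le_of_norm_le_const (C := M) fun t ht => ?_).trans ?_
    · rw [uIoc_of_le (by linarith)] at ht
      exact h0 t (hsub ⟨ht.1.le, ht.2⟩)
    · rw [abs_of_nonneg (by linarith)]
      linarith
  rcases le_total T τ with hTτ | hTτ
  · refine (hmid T hT.le le_rfl).trans ?_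
    have : 0 ≤ M * τ := by positivity
    nlinarith [mul_le_mul_of_nonneg_left hTτ hM]
  have hsec : ∀ x ∈ Icc a b, ∀ s t, s ∈ Icc (-T) T → t ∈ Icc (-T) T →
      IntervalIntegrable (fun t => e t x * ((E t x : ℝ) * β t x)) volume s t :=
    fun x hx s t hs ht => ContinuousOn.intervalIntegrable
      (hAc.comp (f := fun t : ℝ => (t, x)) (by fun_prop) fun r hr =>
        ⟨uIcc_subset_Icc hs ht hr, hx⟩)
  have hsecI : ∀ s t, s ≤ t → s ∈ Icc (-T) T → t ∈ Icc (-T) T →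
      IntervalIntegrable (fun x => ∫ r in s..t, e r x * ((E r x : ℝ) * β r x)) volume a b := by
    intro s t hst hs ht
    have hint : IntegrableOn (fun q : ℝ × ℝ => e q.1 q.2 * ((E q.1 q.2 : ℝ) * β q.1 q.2))
        (Icc (-T) T ×ˢ Icc a b) (volume.prod volume) :=
      hAc.integrableOn_compact (isCompact_Icc.prod isCompact_Icc)
    have h4 : Integrable (fun q : ℝ × ℝ => e q.1 q.2 * ((E q.1 q.2 : ℝ) * β q.1 q.2))
        ((volume.restrict (Ioc s t)).prod (volume.restrict (Ioc a b))) := by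
      rw [Measure.prod_restrict]
      refine hint.mono_set (prod_mono ?_ Ioc_subset_Icc_self)
      exact Ioc_subset_Icc_self.trans (Icc_subset_Icc hs.1 ht.2)
    rw [intervalIntegrable_iff_integrableOn_Ioc_of_le hab]
    simp_rw [intervalIntegral.integral_of_le hst]
    exact h4.integral_prod_right
  have m1 : -T ∈ Icc (-T) T := ⟨le_rfl, by linarith⟩
  have m2 : -τ ∈ Icc (-T) T := ⟨by linarith, by linarith⟩
  have m3 : τ ∈ Icc (-T) T := ⟨by linarith, hTτ⟩
  have m4 : T ∈ Icc (-T) T := ⟨by linarith, le_rfl⟩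
  -- the contribution of an interval on one side of the stationary point
  have hside : ∀ s₁ s₂, s₁ ≤ s₂ → s₁ ∈ Icc (-T) T → s₂ ∈ Icc (-T) T →
      (∀ t ∈ Icc s₁ s₂, τ ≤ |t|) → (∫ t in s₁..s₂, (t ^ 2)⁻¹) ≤ τ⁻¹ →
      ‖∫ x in a..b, ∫ t in s₁..s₂, e t x * ((E t x : ℝ) * β t x)‖ ≤ (3 + T) * (M * τ) := by
    intro s₁ s₂ hs hs1 hs2 hτt hint
    have hsub : Icc s₁ s₂ ⊆ Icc (-T) T := Icc_subset_Icc hs1.1 hs2.2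
    have hsub2 : Icc s₁ s₂ ×ˢ Icc a b ⊆ Icc (-T) T ×ˢ Icc a b := prod_mono hsub subset_rfl
    have hne : ∀ t ∈ Icc s₁ s₂, t ≠ 0 := fun t ht h => by
      have := hτt t ht; rw [h, abs_zero] at this; linarith
    have hneC : ∀ t ∈ Icc s₁ s₂, (t : ℂ) ≠ 0 := fun t ht => by exact_mod_cast hne t ht
    have hinvc : ContinuousOn (fun q : ℝ × ℝ => ((q.1 : ℝ) : ℂ)⁻¹) (Icc s₁ s₂ ×ˢ Icc a b) :=
      ContinuousOn.inv₀ (by fun_prop) fun q hq => hneC q.1 hq.1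
    have hn0 : ∀ t ∈ Icc s₁ s₂, ‖∫ x in a..b, e t x * ((t : ℂ)⁻¹ * β t x)‖ ≤ τ⁻¹ * M := by
      intro t ht
      have : ∫ x in a..b, e t x * ((t : ℂ)⁻¹ * β t x)
          = (t : ℂ)⁻¹ * ∫ x in a..b, e t x * β t x := by
        rw [← intervalIntegral.integral_const_mul]
        apply intervalIntegral.integral_congr
        intro x _
        ring
      rw [this, norm_mul, norm_inv, Complex.norm_real, Real.norm_eq_abs]
      exact mul_le_mul (inv_anti₀ hτ0 (hτt t ht)) (h1 t (hsub ht)) (norm_nonneg _)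
        (inv_nonneg.2 hτ0.le)
    have hmain := norm_integral_integral_mul_deriv_le (Φ := Φ) (Φt := fun t x => t * E t x)
      (β := fun t x => (t : ℂ)⁻¹ * β t x)
      (βt := fun t x => (t : ℂ)⁻¹ * βt t x - ((t : ℂ)⁻¹ * (t : ℂ)⁻¹) * β t x)
      (n := fun t => (T + 1) * M * (t ^ 2)⁻¹) (n₀ := τ⁻¹ * M) hs hab hlam
      (fun t ht x hx => hΦ t (hsub ht) x hx)
      (fun t ht x hx => by
        have hi : HasDerivAt (fun t : ℝ => ((t : ℝ) : ℂ)⁻¹) (-1 / (t : ℂ) ^ 2) t := by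
          have := (hasDerivAt_id t).ofReal_comp.fun_inv (hneC t ht)
          simpa using this
        refine (hi.mul (hβ t (hsub ht) x hx)).congr_deriv ?_
        have := hneC t ht
        field_simp
        ring)
      (hΦc.mono hsub2)
      ((continuous_fst.continuousOn).mul (hEc.mono hsub2))
      (hinvc.mul (hβc.mono hsub2))
      ((hinvc.mul (hβtc.mono hsub2)).sub ((hinvc.mul hinvc).mul (hβc.mono hsub2)))
      (hn0 s₁ ⟨le_rfl, hs⟩) (hn0 s₂ ⟨hs, le_rfl⟩)
      (ContinuousOn.intervalIntegrable (by
        rw [uIcc_of_le hs]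
        refine continuousOn_const.mul (ContinuousOn.inv₀ (by fun_prop) fun t ht => ?_)
        exact pow_ne_zero 2 (hne t ht)))
      (fun t ht => by
        have hslice : ∀ {f : ℝ → ℝ → ℂ},
            ContinuousOn (fun q : ℝ × ℝ => f q.1 q.2) (Icc (-T) T ×ˢ Icc a b) →
            IntervalIntegrable (fun x => e t x * f t x) volume a b := fun {f} hf =>
          ContinuousOn.intervalIntegrable (by
            rw [hu]
            exact (hec.mul hf).comp (f := fun x : ℝ => (t, x)) (by fun_prop)
              fun x hx => ⟨hsub ht, hx⟩)
        have hsum : ∫ x in a..b, e t x *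
            ((t : ℂ)⁻¹ * βt t x - ((t : ℂ)⁻¹ * (t : ℂ)⁻¹) * β t x)
            = (t : ℂ)⁻¹ * (∫ x in a..b, e t x * βt t x)
              - ((t : ℂ)⁻¹ * (t : ℂ)⁻¹) * ∫ x in a..b, e t x * β t x := by
          rw [← intervalIntegral.integral_const_mul, ← intervalIntegral.integral_const_mul,
            ← intervalIntegral.integral_sub ((hslice hβtc).const_mul _)
              ((hslice hβc).const_mul _)]
          apply intervalIntegral.integral_congr
          intro x _
          ring
        change ‖∫ x in a..b, e t x *
            ((t : ℂ)⁻¹ * βt t x - ((t : ℂ)⁻¹ * (t : ℂ)⁻¹) * β t x)‖ ≤ _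
        rw [hsum]
        have ht0 : 0 < |t| := abs_pos.2 (hne t ht)
        have htT : |t| ≤ T := abs_le.2 ⟨(hsub ht).1, (hsub ht).2⟩
        have e1 : ‖((t : ℝ) : ℂ)⁻¹‖ = |t|⁻¹ := by
          rw [norm_inv, Complex.norm_real, Real.norm_eq_abs]
        calc _ ≤ |t|⁻¹ * M + |t|⁻¹ * |t|⁻¹ * M := by
              refine (norm_sub_le _ _).trans (add_le_add ?_ ?_)
              · rw [norm_mul, e1]
                exact mul_le_mul_of_nonneg_left (h2 t (hsub ht)) (by positivity)
              · rw [norm_mul, norm_mul, e1]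
                exact mul_le_mul_of_nonneg_left (h1 t (hsub ht)) (by positivity)
          _ = (|t| + 1) * M * (t ^ 2)⁻¹ := by
              rw [← sq_abs t]
              field_simp
          _ ≤ (T + 1) * M * (t ^ 2)⁻¹ := by
              gcongr)
    have hcongr : ∫ x in a..b, ∫ t in s₁..s₂, e t x * ((E t x : ℝ) * β t x)
        = ∫ x in a..b, ∫ t in s₁..s₂,
          e t x * (((t * E t x : ℝ) : ℂ) * ((t : ℂ)⁻¹ * β t x)) := by
      apply intervalIntegral.integral_congr
      intro x _
      apply intervalIntegral.integral_congr
      intro t ht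
      rw [uIcc_of_le hs] at ht
      have := hneC t ht
      push_cast
      field_simp
    rw [hcongr]
    refine hmain.trans ?_
    rw [intervalIntegral.integral_const_mul]
    have hl : lam⁻¹ = τ * τ := by
      field_simp
      linarith
    calc _ ≤ lam⁻¹ * (2 * (τ⁻¹ * M) + (T + 1) * M * τ⁻¹) := by gcongr
      _ = (3 + T) * (M * τ) := by
        rw [hl]; field_simp; ring
  have hprim : ∀ s₁ s₂ : ℝ, (∀ t ∈ uIcc s₁ s₂, t ≠ 0) →
      ∫ t in s₁..s₂, (t ^ 2)⁻¹ = s₁⁻¹ - s₂⁻¹ := by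
    intro s₁ s₂ hne
    rw [intervalIntegral.integral_eq_sub_of_hasDerivAt (f := fun t => -t⁻¹)
      (f' := fun t => (t ^ 2)⁻¹)
      (fun t ht => by
        have := (hasDerivAt_inv (hne t ht)).fun_neg
        simpa using this)
      (ContinuousOn.intervalIntegrable (ContinuousOn.inv₀ (f := fun t : ℝ => t ^ 2) (by fun_prop)
        fun t ht => pow_ne_zero 2 (hne t ht)))]
    ring
  have hT0 : 0 < T⁻¹ := by positivity
  have hA := hside (-T) (-τ) (by linarith) m1 m2
    (fun t ht => by rw [le_abs]; right; linarith [ht.2])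
    (by
      rw [hprim _ _ (fun t ht => by
        rw [uIcc_of_le (by linarith)] at ht
        intro h; linarith [ht.2]), inv_neg, inv_neg]
      linarith)
  have hB := hside τ T hTτ m3 m4
    (fun t ht => by rw [le_abs]; left; linarith [ht.1])
    (by
      rw [hprim _ _ (fun t ht => by
        rw [uIcc_of_le hTτ] at ht
        intro h; linarith [ht.1])]
      linarith)
  have hC := hmid τ hτ0.le hTτ
  have hsplit : ∫ x in a..b, ∫ t in (-T)..T, e t x * ((E t x : ℝ) * β t x)
      = (∫ x in a..b, ∫ t in (-T)..(-τ), e t x * ((E t x : ℝ) * β t x))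
      + (∫ x in a..b, ∫ t in (-τ)..τ, e t x * ((E t x : ℝ) * β t x))
      + ∫ x in a..b, ∫ t in τ..T, e t x * ((E t x : ℝ) * β t x) := by
    rw [← intervalIntegral.integral_add (hsecI _ _ (by linarith) m1 m2)
      (hsecI _ _ (by linarith) m2 m3),
      ← intervalIntegral.integral_add ((hsecI _ _ (by linarith) m1 m2).add
      (hsecI _ _ (by linarith) m2 m3)) (hsecI _ _ hTτ m3 m4)]
    apply intervalIntegral.integral_congr
    intro x hx
    rw [hu] at hx
    change _ = (_ + _) + _
    rw [intervalIntegral.integral_add_adjacent_intervals (hsec x hx _ _ m1 m2)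
        (hsec x hx _ _ m2 m3),
      intervalIntegral.integral_add_adjacent_intervals (hsec x hx _ _ m1 m3)
        (hsec x hx _ _ m3 m4)]
  rw [hsplit]
  calc _ ≤ (3 + T) * (M * τ) + 2 * τ * M + (3 + T) * (M * τ) :=
        norm_add₃_le.trans (add_le_add (add_le_add hA hC) hB)
    _ = _ := by ring

/-! ### Exponents -/

/-- The gain `ε` over the exponent `1 / 2`; any sufficiently small multiple of `1 / (m + 1)` would
do. -/
noncomputable def airyEps (m : ℕ) : ℝ := 1 / (100 * ((m : ℝ) + 1))

/-- The right-hand side of the estimate, without the constant. -/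
noncomputable def airyRhs (m : ℕ) (lam σ : ℝ) : ℝ :=
  lam ^ (-(1 / 2 + airyEps m)) * σ ^ (-(airyL m + airyC m * airyEps m))

theorem airyEps_pos (m : ℕ) : 0 < airyEps m := by unfold airyEps; positivity

theorem airyEps_le {m : ℕ} (hm : 2 ≤ m) : airyEps m ≤ 1 / 300 := by
  have : (2 : ℝ) ≤ m := by exact_mod_cast hm
  unfold airyEps
  exact one_div_le_one_div_of_le (by norm_num) (by linarith)

theorem one_sixth_le_airyL {m : ℕ} : 1 / 6 ≤ airyL m := by
  unfold airyL
  split_ifs with h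
  · exact le_rfl
  · have : (6 : ℝ) ≤ m := by exact_mod_cast (not_lt.1 h)
    rw [div_le_div_iff₀ (by norm_num) (by linarith)]
    linarith

theorem one_le_airyC {m : ℕ} : 1 ≤ airyC m := by
  unfold airyC; split_ifs <;> norm_num

theorem airyRhs_pos {m : ℕ} {lam σ : ℝ} (hl : 0 < lam) (hσ : 0 < σ) : 0 < airyRhs m lam σ := by
  unfold airyRhs; positivity

/-- The comparison of a piece at scale `r` with `airyRhs` in the range `lam σ ≤ 1`, in terms of
`A = log lam`, `S = -log σ` and `ρ = -log r`. -/
theorem exponent_le_of_le {m : ℕ} (hm : 2 ≤ m) {A S ρ : ℝ} (hAS : A ≤ S) (hρ : 3 * ρ ≤ A)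
    (hS : 0 ≤ S) :
    -ρ - (A - 3 * ρ) / 2 ≤
      -(1 / 2 + airyEps m) * A + (airyL m + airyC m * airyEps m) * S
        - airyEps m * (A - 3 * ρ) := by
  have h1 := airyEps_pos m
  have h2 := airyEps_le hm
  have h3 : 1 / 6 * S ≤ airyL m * S := mul_le_mul_of_nonneg_right one_sixth_le_airyL hS
  have h4 : airyEps m * S ≤ airyC m * airyEps m * S := by
    refine mul_le_mul_of_nonneg_right ?_ hS
    nlinarith [one_le_airyC (m := m)]
  have h5 : (1 / 2 - 3 * airyEps m) * ρ ≤ (1 / 2 - 3 * airyEps m) * (A / 3) :=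
    mul_le_mul_of_nonneg_left (by linarith) (by linarith)
  have h6 : (1 / 6 + airyEps m) * A ≤ (1 / 6 + airyEps m) * S :=
    mul_le_mul_of_nonneg_left hAS (by linarith)
  nlinarith

/-- The comparison for pieces with `r ^ (2 m - 3) ≳ σ ^ (m - 1)`, in terms of `A = log lam`,
`S = -log σ` and `ρ = -log r`. The slack `k` absorbs the constant in this relation. -/
theorem exponent_le_of_outer {m : ℕ} (hm : 2 ≤ m) {A S ρ k : ℝ} (hAS : S ≤ A) (hρ : 3 * ρ ≤ A)
    (hS : 0 ≤ S) (hk : 0 ≤ k) (hr : (2 * (m : ℝ) - 3) * ρ ≤ ((m : ℝ) - 1) * S + k) :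
    -ρ - (A - 3 * ρ) / 2 - (A - S) / m ≤
      k + (-(1 / 2 + airyEps m) * A + (airyL m + airyC m * airyEps m) * S
        - airyEps m * (A - 3 * ρ)) := by
  have h1 := airyEps_pos m
  have h2 := airyEps_le hm
  have hm2 : (2 : ℝ) ≤ m := by exact_mod_cast hm
  have h5 : (1 / 2 - 3 * airyEps m) * ρ ≤ (1 / 2 - 3 * airyEps m) * (A / 3) :=
    mul_le_mul_of_nonneg_left (by linarith) (by linarith)
  by_cases h6 : m < 6
  · have hm5 : (m : ℝ) ≤ 5 := by exact_mod_cast Nat.lt_succ_iff.1 h6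
    have e1 : airyL m = 1 / 6 := by simp [airyL, h6]
    have e2 : airyC m = 1 := by simp [airyC, h6]
    have h7 : 1 / 5 ≤ 1 / (m : ℝ) := one_div_le_one_div_of_le (by linarith) hm5
    have h8 : (1 / 6 + airyEps m) * (A - S) ≤ (1 / (m : ℝ)) * (A - S) :=
      mul_le_mul_of_nonneg_right (by linarith) (by linarith)
    have h9 : (A - S) / m = (1 / (m : ℝ)) * (A - S) := by ring
    rw [e1, e2, h9]
    nlinarith
  · have hm6 : (6 : ℝ) ≤ m := by exact_mod_cast not_lt.1 h6
    have e1 : airyL m = ((m : ℝ) - 3) / (2 * (2 * (m : ℝ) - 3)) := by simp [airyL, h6]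
    have e2 : airyC m = 2 := by simp [airyC, h6]
    have hd : 0 < 2 * (m : ℝ) - 3 := by linarith
    have hεm : airyEps m ≤ 1 / (100 * m) := by
      unfold airyEps
      exact one_div_le_one_div_of_le (by positivity) (by linarith)
    -- the weights with which the upper bounds `A / 3` and `(m - 1) / (2 m - 3) S + k` for `ρ` are
    -- combined; they add up to the coefficient `1 / 2 - 3 ε` of `ρ`
    set ε := airyEps m
    have hθ1 : 0 ≤ 3 / (m : ℝ) - 6 * ε := by
      have : 1 / (100 * (m : ℝ)) = (1 / 100) * (1 / m) := by field_simp
      have h0 : 0 < 1 / (m : ℝ) := by positivity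
      have : 3 / (m : ℝ) = 3 * (1 / m) := by ring
      nlinarith
    have hθ2 : 0 ≤ 1 / 2 - 3 / (m : ℝ) + 3 * ε := by
      have : 3 / (m : ℝ) ≤ 1 / 2 := by rw [div_le_div_iff₀ (by linarith) (by norm_num)]; linarith
      linarith
    have hr' : ρ ≤ ((m : ℝ) - 1) / (2 * m - 3) * S + k := by
      have hkk : k ≤ (2 * (m : ℝ) - 3) * k := by nlinarith
      have : (2 * (m : ℝ) - 3) * ρ ≤ (2 * (m : ℝ) - 3) * (((m : ℝ) - 1) / (2 * m - 3) * S + k) := by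
        have e : (2 * (m : ℝ) - 3) * (((m : ℝ) - 1) / (2 * m - 3) * S + k)
            = ((m : ℝ) - 1) * S + (2 * (m : ℝ) - 3) * k := by field_simp
        rw [e]; linarith
      exact le_of_mul_le_mul_left this hd
    have b1 := mul_le_mul_of_nonneg_left hr' hθ2
    have b2 := mul_le_mul_of_nonneg_left (show ρ ≤ A / 3 by linarith) hθ1
    have b3 : (1 / 2 - 3 / (m : ℝ) + 3 * ε) * k ≤ k := by
      have : 1 / 2 - 3 / (m : ℝ) + 3 * ε ≤ 1 := by
        have : 0 < 3 / (m : ℝ) := by positivity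
        linarith
      nlinarith
    have b4 : (1 / 2 - 3 / (m : ℝ) + 3 * ε) * (((m : ℝ) - 1) / (2 * m - 3) * S) + S / m
        ≤ ((m : ℝ) - 3) / (2 * (2 * m - 3)) * S + 2 * ε * S := by
      have e : (1 / 2 - 3 / (m : ℝ) + 3 * ε) * (((m : ℝ) - 1) / (2 * m - 3) * S) + S / m
        = ((m : ℝ) - 3) / (2 * (2 * m - 3)) * S + (3 * ((m : ℝ) - 1) / (2 * m - 3)) * (ε * S) := by
        field_simp
        ring
      rw [e]
      have h9 : 3 * ((m : ℝ) - 1) / (2 * m - 3) ≤ 2 := by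
        rw [div_le_iff₀ hd]; linarith
      have := mul_le_mul_of_nonneg_right h9 (mul_nonneg h1.le hS)
      linarith
    have b5 : (3 / (m : ℝ) - 6 * ε) * (A / 3) + 2 * ε * A = A / m := by ring
    have b6 : (A - S) / m = A / m - S / m := by ring
    rw [e1, e2, b6]
    nlinarith

/-- The comparison for pieces with `r ^ (2 m - 3) ≲ σ ^ (m - 1)`, in the notation of
`exponent_le_of_outer`. -/
theorem exponent_le_of_inner {m : ℕ} (hm : 2 ≤ m) {A S ρ k : ℝ} (hρ : 3 * ρ ≤ A)
    (hS : 0 ≤ S) (hk : 0 ≤ k) (hr : ((m : ℝ) - 1) * S ≤ (2 * (m : ℝ) - 3) * ρ + k) :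
    -ρ - (A - 3 * ρ) / 2 - (A - 3 * ρ) / ((m : ℝ) + 1) + (S - 2 * ρ) ≤
      2 * k + (-(1 / 2 + airyEps m) * A + (airyL m + airyC m * airyEps m) * S
        - airyEps m * (A - 3 * ρ)) := by
  have h1 := airyEps_pos m
  have h2 := airyEps_le hm
  have hm2 : (2 : ℝ) ≤ m := by exact_mod_cast hm
  have hd : 0 < 2 * (m : ℝ) - 3 := by linarith
  have hε : airyEps m = (1 / 100) * (1 / ((m : ℝ) + 1)) := by
    unfold airyEps; field_simp
  set ε := airyEps m
  have hi : 0 < 1 / ((m : ℝ) + 1) := by positivity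
  have b1 : 0 ≤ (1 / ((m : ℝ) + 1) - 2 * ε) * (A - 3 * ρ) :=
    mul_nonneg (by linarith) (by linarith)
  have hr' : ((m : ℝ) - 1) / (2 * m - 3) * S - k ≤ ρ := by
    have hkk : k ≤ (2 * (m : ℝ) - 3) * k := by nlinarith
    have : (2 * (m : ℝ) - 3) * (((m : ℝ) - 1) / (2 * m - 3) * S - k) ≤ (2 * (m : ℝ) - 3) * ρ := by
      have e : (2 * (m : ℝ) - 3) * (((m : ℝ) - 1) / (2 * m - 3) * S - k)
          = ((m : ℝ) - 1) * S - (2 * (m : ℝ) - 3) * k := by field_simp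
      rw [e]; linarith
    exact le_of_mul_le_mul_left this hd
  have b2 := mul_le_mul_of_nonneg_left hr' (show 0 ≤ 3 / 2 - 3 * ε by linarith)
  have b3 : (3 / 2 - 3 * ε) * k ≤ 2 * k := by nlinarith
  have b4 : (1 - airyL m - airyC m * ε) * S
      ≤ (3 / 2 - 3 * ε) * (((m : ℝ) - 1) / (2 * m - 3)) * S := by
    refine mul_le_mul_of_nonneg_right ?_ hS
    have e0 : (3 / 2 - 3 * ε) * (((m : ℝ) - 1) / (2 * m - 3))
        = (3 / 2 - 3 * ε) * ((m : ℝ) - 1) / (2 * m - 3) := by ring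
    rw [e0, le_div_iff₀ hd]
    by_cases h6 : m < 6
    · have e1 : airyL m = 1 / 6 := by simp [airyL, h6]
      have e2 : airyC m = 1 := by simp [airyC, h6]
      have hm5 : (m : ℝ) ≤ 5 := by exact_mod_cast Nat.lt_succ_iff.1 h6
      rw [e1, e2]
      nlinarith
    · have hm6 : (6 : ℝ) ≤ m := by exact_mod_cast not_lt.1 h6
      have e1 : airyL m = ((m : ℝ) - 3) / (2 * (2 * (m : ℝ) - 3)) := by simp [airyL, h6]
      have e2 : airyC m = 2 := by simp [airyC, h6]
      have e3 : airyL m * (2 * (m : ℝ) - 3) = ((m : ℝ) - 3) / 2 := by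
        rw [e1, div_mul_eq_mul_div, div_eq_div_iff (mul_pos two_pos hd).ne' two_ne_zero]; ring
      have e4 : (1 - airyL m - airyC m * ε) * (2 * (m : ℝ) - 3)
          = (2 * (m : ℝ) - 3) - airyL m * (2 * (m : ℝ) - 3) - 2 * ε * (2 * m - 3) := by
        rw [e2]; ring
      rw [e4, e3]
      nlinarith
  have b5 : (A - 3 * ρ) / ((m : ℝ) + 1) = 1 / ((m : ℝ) + 1) * (A - 3 * ρ) := by ring
  rw [b5]
  nlinarith

theorem log_airyRhs_mul (m : ℕ) {lam σ r : ℝ} (hl : 0 < lam) (hσ : 0 < σ) (hr : 0 < r) :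
    Real.log (airyRhs m lam σ * (lam * r ^ 3) ^ (-airyEps m)) =
      -(1 / 2 + airyEps m) * Real.log lam + (airyL m + airyC m * airyEps m) * (-Real.log σ)
        - airyEps m * (Real.log lam - 3 * (-Real.log r)) := by
  unfold airyRhs
  rw [Real.log_mul (by positivity) (by positivity), Real.log_mul (by positivity) (by positivity),
    Real.log_rpow hl, Real.log_rpow hσ, Real.log_rpow (by positivity),
    Real.log_mul (by positivity) (by positivity), Real.log_pow]
  push_cast
  ring

theorem log_mul_rpow_neg_half {lam r : ℝ} (hl : 0 < lam) (hr : 0 < r) :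
    Real.log (r * (lam * r ^ 3) ^ (-(1 / 2) : ℝ)) =
      -(-Real.log r) - (Real.log lam - 3 * (-Real.log r)) / 2 := by
  rw [Real.log_mul (by positivity) (by positivity), Real.log_rpow (by positivity),
    Real.log_mul (by positivity) (by positivity), Real.log_pow]
  push_cast
  ring

theorem log_scale_nonneg {lam r : ℝ} (hl : 0 < lam) (hr : 0 < r) (h : 1 ≤ lam * r ^ 3) :
    3 * (-Real.log r) ≤ Real.log lam := by
  have := Real.log_nonneg h
  rw [Real.log_mul (by positivity) (by positivity), Real.log_pow] at this
  push_cast at this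
  linarith

theorem le_airyRhs_of_le {m : ℕ} (hm : 2 ≤ m) {lam σ r : ℝ} (hl : 0 < lam) (hσ : 0 < σ)
    (hσ1 : σ ≤ 1) (hr : 0 < r) (h : 1 ≤ lam * r ^ 3) (hls : lam * σ ≤ 1) :
    r * (lam * r ^ 3) ^ (-(1 / 2) : ℝ) ≤ airyRhs m lam σ * (lam * r ^ 3) ^ (-airyEps m) := by
  have hR := airyRhs_pos (m := m) hl hσ
  rw [← Real.log_le_log_iff (by positivity) (by positivity), log_airyRhs_mul m hl hσ hr,
    log_mul_rpow_neg_half hl hr]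
  refine exponent_le_of_le hm ?_ (log_scale_nonneg hl hr h)
    (neg_nonneg.2 (Real.log_nonpos hσ.le hσ1))
  have := Real.log_nonpos (by positivity) hls
  rw [Real.log_mul hl.ne' hσ.ne'] at this
  linarith

theorem le_airyRhs_of_outer {m : ℕ} (hm : 2 ≤ m) {K : ℝ} (hK : 1 ≤ K) {lam σ r : ℝ}
    (hl : 0 < lam) (hσ : 0 < σ)
    (hσ1 : σ ≤ 1) (hr : 0 < r) (h : 1 ≤ lam * r ^ 3) (hls : 1 ≤ lam * σ)
    (hreg : σ ^ (m - 1) ≤ K * r ^ (2 * m - 3)) :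
    r * (lam * r ^ 3) ^ (-(1 / 2) : ℝ) * (lam * σ) ^ (-(1 : ℝ) / m)
      ≤ K * (airyRhs m lam σ * (lam * r ^ 3) ^ (-airyEps m)) := by
  have hR := airyRhs_pos (m := m) hl hσ
  have hK0 : 0 < K := by linarith
  rw [← Real.log_le_log_iff (by positivity) (by positivity), Real.log_mul hK0.ne' (by positivity),
    log_airyRhs_mul m hl hσ hr, Real.log_mul (by positivity) (by positivity),
    log_mul_rpow_neg_half hl hr, Real.log_rpow (by positivity), Real.log_mul hl.ne' hσ.ne']
  have e : -(1 : ℝ) / m * (Real.log lam + Real.log σ)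
      = -((Real.log lam - (-Real.log σ)) / m) := by ring
  rw [e, ← sub_eq_add_neg]
  refine exponent_le_of_outer hm ?_ (log_scale_nonneg hl hr h)
    (neg_nonneg.2 (Real.log_nonpos hσ.le hσ1)) (Real.log_nonneg hK) ?_
  · have := Real.log_nonneg hls
    rw [Real.log_mul hl.ne' hσ.ne'] at this
    linarith
  · have := Real.log_le_log (by positivity) hreg
    rw [Real.log_mul hK0.ne' (by positivity), Real.log_pow, Real.log_pow,
      Nat.cast_sub (by omega), Nat.cast_sub (by omega)] at this
    push_cast at this
    linarith

theorem le_airyRhs_of_inner {m : ℕ} (hm : 2 ≤ m) {K : ℝ} (hK : 1 ≤ K) {lam σ r : ℝ}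
    (hl : 0 < lam) (hσ : 0 < σ)
    (hσ1 : σ ≤ 1) (hr : 0 < r) (h : 1 ≤ lam * r ^ 3)
    (hreg : r ^ (2 * m - 3) ≤ K * σ ^ (m - 1)) :
    r * (lam * r ^ 3) ^ (-(1 / 2) : ℝ)
        * ((lam * r ^ 3) ^ (-(1 : ℝ) / ((m + 1 : ℕ) : ℝ)) * (σ / r ^ 2)⁻¹)
      ≤ K ^ 2 * (airyRhs m lam σ * (lam * r ^ 3) ^ (-airyEps m)) := by
  have hR := airyRhs_pos (m := m) hl hσ
  have hK0 : 0 < K := by linarith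
  rw [← Real.log_le_log_iff (by positivity) (by positivity),
    Real.log_mul (x := K ^ 2) (by positivity) (by positivity), Real.log_pow K,
    log_airyRhs_mul m hl hσ hr, Real.log_mul (by positivity) (by positivity),
    log_mul_rpow_neg_half hl hr, Real.log_mul (by positivity) (by positivity),
    Real.log_rpow (by positivity), Real.log_inv, Real.log_div hσ.ne' (by positivity),
    Real.log_mul hl.ne' (by positivity), Real.log_pow, Real.log_pow]
  push_cast
  have e : -(1 : ℝ) / ((m : ℝ) + 1) * (Real.log lam + 3 * Real.log r)
      + -(Real.log σ - 2 * Real.log r)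
      = -((Real.log lam - 3 * (-Real.log r)) / ((m : ℝ) + 1))
        + ((-Real.log σ) - 2 * (-Real.log r)) := by ring
  rw [e, ← add_assoc, ← sub_eq_add_neg]
  refine exponent_le_of_inner hm (log_scale_nonneg hl hr h)
    (neg_nonneg.2 (Real.log_nonpos hσ.le hσ1)) (Real.log_nonneg hK) ?_
  have := Real.log_le_log (by positivity) hreg
  rw [Real.log_mul hK0.ne' (by positivity), Real.log_pow, Real.log_pow,
    Nat.cast_sub (by omega), Nat.cast_sub (by omega)] at this
  push_cast at this
  linarith

/-! ### Smooth functions near a point -/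

open Filter Topology in
theorem exists_contDiff_eventuallyEq {X F : Type*} [NormedAddCommGroup X] [NormedSpace ℝ X]
    [FiniteDimensional ℝ X] [NormedAddCommGroup F] [NormedSpace ℝ F] {n : WithTop ℕ∞} (hn : n ≤ ∞)
    {f : X → F} {V : Set X} (hV : IsOpen V) (hf : ContDiffOn ℝ n f V) {x₀ : X} (hx₀ : x₀ ∈ V) :
    ∃ g : X → F, ContDiff ℝ n g ∧ g =ᶠ[𝓝 x₀] f := by
  obtain ⟨r, hr, hrV⟩ := Metric.isOpen_iff.1 hV x₀ hx₀
  let b : ContDiffBump x₀ := ⟨r / 3, r / 2, by positivity, by linarith⟩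
  refine ⟨fun x => b x • f x, ?_, ?_⟩
  · rw [contDiff_iff_contDiffAt]
    intro x
    by_cases hx : x ∈ V
    · exact (b.contDiff.contDiffAt.of_le hn).smul (hf.contDiffAt (hV.mem_nhds hx))
    · have hxs : x ∉ tsupport b := by
        rw [b.tsupport_eq]
        intro h
        exact hx (hrV (Metric.closedBall_subset_ball (by change r / 2 < r; linarith) h))
      have : (fun x => b x • f x) =ᶠ[𝓝 x] fun _ => 0 := by
        filter_upwards [(isClosed_tsupport b).isOpen_compl.mem_nhds hxs] with y hy
        rw [image_eq_zero_of_notMem_tsupport hy, zero_smul]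
      exact contDiffAt_const.congr_of_eventuallyEq this
  · filter_upwards [b.eventuallyEq_one] with x hx
    change b x = 1 at hx
    rw [hx, one_smul]

open Filter Topology in
theorem exists_contDiff_eventuallyEq_of_contDiffAt {X F : Type*} [NormedAddCommGroup X]
    [NormedSpace ℝ X] [FiniteDimensional ℝ X] [NormedAddCommGroup F] [NormedSpace ℝ F] {f : X → F}
    {x₀ : X} (hf : ContDiffAt ℝ ∞ f x₀) (n : ℕ) :
    ∃ g : X → F, ContDiff ℝ n g ∧ g =ᶠ[𝓝 x₀] f := by
  have h1 : ContDiffAt ℝ n f x₀ := hf.of_le (by exact_mod_cast le_top)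
  obtain ⟨u, hu, hx, hc⟩ := h1.contDiffOn' (m := n) le_rfl (by simp)
  simp only [mem_univ, insert_eq_of_mem, univ_inter] at hc
  exact exists_contDiff_eventuallyEq (by exact_mod_cast le_top) hu hc hx

/-- Integrals over `[0, 1]` depend smoothly on parameters. -/
theorem contDiff_integral_zero_one {X : Type*} [NormedAddCommGroup X] [NormedSpace ℝ X]
    [FiniteDimensional ℝ X] (n : ℕ) :
    ∀ {f : X × ℝ → ℝ}, ContDiff ℝ n f → ContDiff ℝ n fun x => ∫ τ in (0 : ℝ)..1, f (x, τ) := by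
  have : ProperSpace X := FiniteDimensional.proper ℝ X
  induction n with
  | zero =>
    intro f hf
    have hc : Continuous f := contDiff_zero.1 hf
    refine contDiff_zero.2 ?_
    exact intervalIntegral.continuous_parametric_intervalIntegral_of_continuous'
      (f := fun x τ => f (x, τ)) (by exact hc) 0 1
  | succ n ih =>
    intro f hf
    have hc : Continuous f := hf.continuous
    have hd : Differentiable ℝ f := hf.differentiable (by simp)
    have hfd : Continuous (fderiv ℝ f) := hf.continuous_fderiv (by simp)
    set L : X →L[ℝ] X × ℝ := ContinuousLinearMap.inl ℝ X ℝ
    have hder : ∀ x₀ : X, HasFDerivAt (fun x => ∫ τ in (0 : ℝ)..1, f (x, τ))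
        (∫ τ in (0 : ℝ)..1, (fderiv ℝ f (x₀, τ)).comp L) x₀ := by
      intro x₀
      have hcL : Continuous fun q : X × ℝ => (fderiv ℝ f q).comp L := by fun_prop
      obtain ⟨C, hC⟩ := ((isCompact_closedBall x₀ 1).prod
        (isCompact_Icc (a := (0 : ℝ)) (b := 1))).exists_bound_of_continuousOn hcL.continuousOn
      refine intervalIntegral.hasFDerivAt_integral_of_dominated_of_fderiv_le
        (F := fun x τ => f (x, τ)) (F' := fun x τ => (fderiv ℝ f (x, τ)).comp L)
        (bound := fun _ => C) (Metric.closedBall_mem_nhds x₀ one_pos) ?_ ?_ ?_ ?_ ?_ ?_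
      · refine Filter.Eventually.of_forall fun x => ?_
        exact (by fun_prop : Continuous fun τ => f (x, τ)).aestronglyMeasurable
      · exact (by fun_prop : Continuous fun τ => f (x₀, τ)).intervalIntegrable _ _
      · exact (by fun_prop :
          Continuous fun τ : ℝ => (fderiv ℝ f (x₀, τ)).comp L).aestronglyMeasurable
      · refine Filter.Eventually.of_forall fun τ hτ x hx => hC (x, τ) ⟨hx, ?_⟩
        rw [uIoc_of_le zero_le_one] at hτ
        exact ⟨hτ.1.le, hτ.2⟩
      · exact intervalIntegrable_const
      · refine Filter.Eventually.of_forall fun τ _ x _ => ?_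
        exact (hd (x, τ)).hasFDerivAt.comp x (hasFDerivAt_prodMk_left x τ)
    have hn1 : ((n + 1 : ℕ) : WithTop ℕ∞) = (n : WithTop ℕ∞) + 1 := by push_cast; rfl
    rw [hn1, contDiff_succ_iff_fderiv_apply]
    refine ⟨fun x => (hder x).differentiableAt, by simp, fun v => ?_⟩
    have hcd : ContDiff ℝ n fun q : X × ℝ => fderiv ℝ f q (v, 0) := by
      refine ContDiff.clm_apply ?_ contDiff_const
      exact hf.fderiv_right (by rw [hn1])
    have e : (fun x => fderiv ℝ (fun x => ∫ τ in (0 : ℝ)..1, f (x, τ)) x v)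
        = fun x => ∫ τ in (0 : ℝ)..1, fderiv ℝ f (x, τ) (v, 0) := by
      funext x
      have hcL : Continuous fun τ : ℝ => (fderiv ℝ f (x, τ)).comp L := by fun_prop
      rw [(hder x).fderiv, ContinuousLinearMap.intervalIntegral_apply (hcL.intervalIntegrable _ _)]
      rfl
    rw [e]
    exact ih hcd

open Filter Topology in
/-- Hadamard's lemma: a smooth function of `(q, y)` is `G (q, 0) + y K (q, y)` near `y = 0`. -/
theorem exists_eq_add_mul {X : Type*} [NormedAddCommGroup X] [NormedSpace ℝ X]
    [FiniteDimensional ℝ X] {G : X × ℝ → ℝ} {q₀ : X} (hG : ContDiffAt ℝ ∞ G (q₀, 0)) :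
    ∃ K : X × ℝ → ℝ, ContDiffAt ℝ ∞ K (q₀, 0) ∧
      (∀ᶠ z in 𝓝 (q₀, (0 : ℝ)), G z = G (z.1, 0) + z.2 * K z) ∧
      ∀ᶠ q in 𝓝 q₀, HasDerivAt (fun y => G (q, y)) (K (q, 0)) 0 := by
  set K : X × ℝ → ℝ := fun z => ∫ τ in (0 : ℝ)..1, fderiv ℝ G (z.1, τ * z.2) (0, 1) with hK
  have hball : ∀ r > 0, ∀ z ∈ Metric.ball (q₀, (0 : ℝ)) r, ∀ τ ∈ Icc (0 : ℝ) 1,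
      (z.1, τ * z.2) ∈ Metric.ball (q₀, (0 : ℝ)) r := by
    intro r hr z hz τ hτ
    rw [← ball_prod_same] at hz ⊢
    refine ⟨hz.1, ?_⟩
    have := hz.2
    rw [mem_ball_zero_iff, Real.norm_eq_abs] at this ⊢
    rw [abs_mul, abs_of_nonneg hτ.1]
    exact (mul_le_of_le_one_left (abs_nonneg _) hτ.2).trans_lt this
  refine ⟨K, ?_, ?_, ?_⟩
  · rw [contDiffAt_infty]
    intro n
    obtain ⟨g, hg, hge⟩ := exists_contDiff_eventuallyEq_of_contDiffAt hG (n + 1)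
    have h1 : ContDiff ℝ n fun z : X × ℝ =>
        ∫ τ in (0 : ℝ)..1, fderiv ℝ g (z.1, τ * z.2) (0, 1) := by
      refine contDiff_integral_zero_one n
        (f := fun w : (X × ℝ) × ℝ => fderiv ℝ g (w.1.1, w.2 * w.1.2) (0, 1)) ?_
      refine ContDiff.clm_apply ?_ contDiff_const
      refine (hg.fderiv_right (m := n) (by push_cast; rfl)).comp ?_
      fun_prop
    refine h1.contDiffAt.congr_of_eventuallyEq ?_
    obtain ⟨r, hr, hr'⟩ := Metric.eventually_nhds_iff_ball.1 (hge.fderiv (𝕜 := ℝ))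
    filter_upwards [Metric.ball_mem_nhds _ hr] with z hz
    refine intervalIntegral.integral_congr fun τ hτ => ?_
    rw [uIcc_of_le zero_le_one] at hτ
    rw [hr' _ (hball r hr z hz τ hτ)]
  · have h1 : ∀ᶠ z in 𝓝 (q₀, (0 : ℝ)), ContDiffAt ℝ 1 G z :=
      (hG.of_le (by exact_mod_cast le_top)).eventually (by simp)
    obtain ⟨r, hr, hr'⟩ := Metric.eventually_nhds_iff_ball.1 h1
    filter_upwards [Metric.ball_mem_nhds _ hr] with z hz
    have hd : ∀ τ ∈ uIcc (0 : ℝ) 1, HasDerivAt (fun τ => G (z.1, τ * z.2))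
        (z.2 * fderiv ℝ G (z.1, τ * z.2) (0, 1)) τ := by
      intro τ hτ
      rw [uIcc_of_le zero_le_one] at hτ
      have h2 := ((hr' _ (hball r hr z hz τ hτ)).differentiableAt (by simp)).hasFDerivAt
      have h3 : HasDerivAt (fun τ : ℝ => (z.1, τ * z.2)) ((0 : X), z.2) τ := by
        refine (hasDerivAt_const _ _).prodMk ?_
        simpa using (hasDerivAt_id τ).mul_const z.2
      have h4 := h2.comp_hasDerivAt τ h3
      refine h4.congr_deriv ?_
      have : ((0 : X), z.2) = z.2 • ((0 : X), (1 : ℝ)) := by simp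
      rw [this, map_smul, smul_eq_mul]
    have hci : ContinuousOn (fun τ : ℝ => z.2 * fderiv ℝ G (z.1, τ * z.2) (0, 1))
        (uIcc (0 : ℝ) 1) := by
      intro τ hτ
      rw [uIcc_of_le zero_le_one] at hτ
      have h2 := (hr' _ (hball r hr z hz τ hτ)).continuousAt_fderiv (by simp)
      have h3 : ContinuousAt (fun τ : ℝ => fderiv ℝ G (z.1, τ * z.2)) τ :=
        ContinuousAt.comp (f := fun τ : ℝ => (z.1, τ * z.2)) h2 (by fun_prop)
      exact (continuousAt_const.mul (h3.clm_apply continuousAt_const)).continuousWithinAt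
    have h5 := intervalIntegral.integral_eq_sub_of_hasDerivAt hd hci.intervalIntegrable
    rw [intervalIntegral.integral_const_mul] at h5
    simp only [one_mul, zero_mul] at h5
    change G z = G (z.1, 0) + z.2 * K z
    rw [hK]
    linarith
  · have h1 : ∀ᶠ z in 𝓝 (q₀, (0 : ℝ)), DifferentiableAt ℝ G z :=
      ((hG.of_le (m := 1) (by exact_mod_cast le_top)).eventually (by simp)).mono
        fun z hz => hz.differentiableAt (by simp)
    have h2 : ∀ᶠ q in 𝓝 q₀, DifferentiableAt ℝ G (q, 0) :=
      (by fun_prop : ContinuousAt (fun q : X => (q, (0 : ℝ))) q₀).eventually h1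
    filter_upwards [h2] with q hq
    have h3 : HasDerivAt (fun y : ℝ => (q, y)) ((0 : X), (1 : ℝ)) 0 :=
      (hasDerivAt_const _ _).prodMk (hasDerivAt_id 0)
    have h4 := hq.hasFDerivAt.comp_hasDerivAt (0 : ℝ) h3
    refine h4.congr_deriv ?_
    simp [hK]

open Filter Topology in
/-- The implicit function theorem for one real equation in one real unknown. -/
theorem exists_implicit {X : Type*} [NormedAddCommGroup X] [NormedSpace ℝ X]
    [FiniteDimensional ℝ X] {G : X × ℝ → ℝ} {q₀ : X} {d : ℝ} (hG : ContDiffAt ℝ ∞ G (q₀, 0))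
    (h0 : G (q₀, 0) = 0) (hd : HasDerivAt (fun y => G (q₀, y)) d 0) (hd0 : d ≠ 0) :
    ∃ φ : X → ℝ, ContDiffAt ℝ ∞ φ q₀ ∧ φ q₀ = 0 ∧ (∀ᶠ q in 𝓝 q₀, G (q, φ q) = 0) ∧
      ∀ᶠ v in 𝓝 (q₀, (0 : ℝ)), G v = 0 → v.2 = φ v.1 := by
  have : CompleteSpace X := FiniteDimensional.complete ℝ X
  have hn : (∞ : WithTop ℕ∞) ≠ 0 := by simp
  have hfd := (hG.differentiableAt (by simp)).hasFDerivAt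
  have h3 : HasDerivAt (fun y : ℝ => (q₀, y)) ((0 : X), (1 : ℝ)) 0 :=
    (hasDerivAt_const _ _).prodMk (hasDerivAt_id 0)
  have h4 : fderiv ℝ G (q₀, 0) (0, 1) = d := (hfd.comp_hasDerivAt (0 : ℝ) h3).unique hd
  have hinv : (fderiv ℝ G (q₀, 0) ∘L .inr ℝ X ℝ).IsInvertible := by
    refine ⟨ContinuousLinearEquiv.unitsEquivAut ℝ (Units.mk0 d hd0), ?_⟩
    ext
    simp [h4]
  refine ⟨hG.implicitFunction hn hinv, hG.contDiffAt_implicitFunction hn hinv,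
    hG.implicitFunction_apply_self hn hinv, ?_, ?_⟩
  · simpa [h0] using hG.eventually_apply_implicitFunction hn hinv
  · filter_upwards [hG.eventually_apply_eq_iff_implicitFunction hn hinv] with v hv h
    exact ((hv.1 (by rw [h, h0]))).symm

/-- Derivatives along a line. -/
theorem iteratedDeriv_comp_line {X F : Type*} [NormedAddCommGroup X] [NormedSpace ℝ X]
    [NormedAddCommGroup F] [NormedSpace ℝ F] {G : X → F} {k : ℕ} (hG : ContDiff ℝ k G) (y e : X)
    (x : ℝ) : iteratedDeriv k (fun x : ℝ => G (y + x • e)) x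
      = iteratedFDeriv ℝ k G (y + x • e) fun _ => e := by
  have h1 : (fun x : ℝ => G (y + x • e))
      = (fun z => G (y + z)) ∘ (ContinuousLinearMap.toSpanSingleton ℝ e) := by
    ext x; simp
  have h2 : ContDiff ℝ k fun z => G (y + z) := hG.comp (contDiff_const.add contDiff_id)
  rw [iteratedDeriv_eq_iteratedFDeriv, h1,
    ContinuousLinearMap.iteratedFDeriv_comp_right _ h2 x le_rfl]
  simp [iteratedFDeriv_comp_add_left]

/-! ### Cutoff functions and one-dimensional reductions -/

/-- A smooth function that agrees with a given one, positive on `[l, u]`, on a smaller interval,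
and is positive everywhere. -/
theorem exists_contDiff_pos {l u : ℝ} (hl : 0 < l) (hlu : l < u) :
    ∃ g : ℝ → ℝ, ContDiff ℝ ∞ g ∧ (∀ y, 0 < g y) ∧ ∀ y ∈ Icc l u, g y = y := by
  let b : ContDiffBump ((l + u) / 2) :=
    ⟨(u - l) / 2, (u - l) / 2 + l / 2, by linarith, by linarith⟩
  refine ⟨fun y => 1 + b y * (y - 1), ?_, fun y => ?_, fun y hy => ?_⟩
  · exact contDiff_const.add (b.contDiff.mul (contDiff_id.sub contDiff_const))
  · by_cases hy : y ∈ Metric.ball ((l + u) / 2) b.rOut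
    · have hy0 : 0 < y := by
        rw [Metric.mem_ball, Real.dist_eq, abs_lt] at hy
        have : b.rOut = (u - l) / 2 + l / 2 := rfl
        linarith [hy.1]
      have h0 : 0 ≤ b y := b.nonneg
      have h1 : b y ≤ 1 := b.le_one
      dsimp only
      rcases eq_or_lt_of_le h1 with h2 | h2
      · rw [h2]; linarith
      · nlinarith [mul_nonneg h0 hy0.le]
    · dsimp only
      rw [b.zero_of_le_dist (not_lt.1 hy)]
      norm_num
  · have : b y = 1 := b.one_of_mem_closedBall (by
      rw [Metric.mem_closedBall, Real.dist_eq, abs_le]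
      have : b.rIn = (u - l) / 2 := rfl
      constructor <;> linarith [hy.1, hy.2])
    dsimp only
    rw [this]; ring

theorem exists_contDiff_sqrt : ∃ sq : ℝ → ℝ, ContDiff ℝ ∞ sq ∧ (∀ U, 0 < sq U) ∧
    ∀ U ∈ Icc (-17 : ℝ) (-(1 / 2)), sq U = √(-U) := by
  obtain ⟨g, hg, hpos, heq⟩ := exists_contDiff_pos (l := 1 / 2) (u := 17) (by norm_num)
    (by norm_num)
  refine ⟨fun U => √(g (-U)), ?_, fun U => Real.sqrt_pos.2 (hpos _), fun U hU => ?_⟩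
  · exact (hg.comp contDiff_neg).sqrt fun x => (hpos _).ne'
  · dsimp only
    rw [heq (-U) ⟨by linarith [hU.2], by linarith [hU.1]⟩]

theorem exists_contDiff_inv : ∃ gi : ℝ → ℝ, ContDiff ℝ ∞ gi ∧
    ∀ y ∈ Icc (1 / 2 : ℝ) 20, y * gi y = 1 := by
  obtain ⟨g, hg, hpos, heq⟩ := exists_contDiff_pos (l := 1 / 2) (u := 20) (by norm_num)
    (by norm_num)
  refine ⟨fun y => (g y)⁻¹, hg.inv fun x => (hpos x).ne', fun y hy => ?_⟩
  dsimp only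
  rw [heq y hy]
  exact mul_inv_cancel₀ (by linarith [hy.1])

/-- Division of `1 - φ` by the variable, for a bump function `φ` at `0`. -/
theorem exists_quotient (φ : ContDiffBump (0 : ℝ)) (hφ : φ.rOut < 1) :
    ∃ (q : ℝ → ℝ) (C : ℝ), ContDiff ℝ ∞ q ∧ (∀ y, y * q y = 1 - φ y) ∧
      (∀ y, |q y| * (1 + |y|) ≤ C) ∧ (∀ y, |deriv q y| * (1 + |y|) ^ 2 ≤ C) ∧
      ∀ y, |deriv (deriv q) y| * (1 + |y|) ^ 2 ≤ C := by
  let φ₂ : ContDiffBump (0 : ℝ) := ⟨φ.rIn / 4, φ.rIn / 2, by linarith [φ.rIn_pos],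
    by linarith [φ.rIn_pos]⟩
  have hden : ∀ y : ℝ, 0 < y ^ 2 + φ₂ y := fun y => by
    rcases eq_or_ne y 0 with rfl | hy
    · rw [φ₂.one_of_mem_closedBall (by simp [φ₂.rIn_pos.le])]; norm_num
    · have := φ₂.nonneg (x := y)
      positivity
  set q : ℝ → ℝ := fun y => (1 - φ y) * y / (y ^ 2 + φ₂ y) with hq
  have hqc : ContDiff ℝ ∞ q :=
    ((contDiff_const.sub φ.contDiff).mul contDiff_id).div
      ((contDiff_id.pow 2).add φ₂.contDiff) fun y => (hden y).ne'
  have hmul : ∀ y, y * q y = 1 - φ y := fun y => by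
    by_cases hy : |y| ≤ φ.rIn
    · have : φ y = 1 := φ.one_of_mem_closedBall (by simpa using hy)
      simp [hq, this]
    · push Not at hy
      have h2 : φ₂ y = 0 := φ₂.zero_of_le_dist (by
        rw [Real.dist_eq, sub_zero]
        change φ.rIn / 2 ≤ |y|
        linarith [φ.rIn_pos])
      have hy0 : y ≠ 0 := fun h => by
        rw [h, abs_zero] at hy; linarith [φ.rIn_pos]
      simp only [hq, h2]
      field_simp
      ring
  have hout : ∀ y ∈ {y : ℝ | φ.rOut < |y|}, q y = y⁻¹ := fun y hy => by
    have hz : φ y = 0 := φ.zero_of_le_dist (by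
      rw [Real.dist_eq, sub_zero]; exact (le_of_lt hy))
    have := hmul y
    rw [hz, sub_zero] at this
    exact eq_inv_of_mul_eq_one_right this
  have hopen : IsOpen {y : ℝ | φ.rOut < |y|} := isOpen_lt continuous_const continuous_abs
  have hd1 : ∀ y ∈ {y : ℝ | φ.rOut < |y|}, deriv q y = -(y ^ 2)⁻¹ := fun y hy => by
    have : q =ᶠ[nhds y] fun y => y⁻¹ := by
      filter_upwards [hopen.mem_nhds hy] with z hz using hout z hz
    rw [this.deriv_eq, deriv_inv]
  have hd2 : ∀ y ∈ {y : ℝ | φ.rOut < |y|}, deriv (deriv q) y = 2 * (y ^ 3)⁻¹ := fun y hy => by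
    have : deriv q =ᶠ[nhds y] fun y => -(y ^ 2)⁻¹ := by
      filter_upwards [hopen.mem_nhds hy] with z hz using hd1 z hz
    rw [this.deriv_eq]
    have hy0 : y ≠ 0 := fun h => by
      rw [h] at hy; change _ < |(0 : ℝ)| at hy; rw [abs_zero] at hy; linarith [φ.rOut_pos]
    have := ((hasDerivAt_pow 2 y).fun_inv (pow_ne_zero 2 hy0)).fun_neg
    rw [this.deriv]
    push_cast
    field_simp
  have hc0 : Continuous q := hqc.continuous
  have hq1 : ContDiff ℝ ∞ (deriv q) := (contDiff_infty_iff_deriv.1 hqc).2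
  have hc1 : Continuous (deriv q) := hq1.continuous
  have hc2 : Continuous (deriv (deriv q)) := (contDiff_infty_iff_deriv.1 hq1).2.continuous
  obtain ⟨C0, hC0⟩ := (isCompact_Icc (a := (-1 : ℝ)) (b := 1)).exists_bound_of_continuousOn
    hc0.continuousOn
  obtain ⟨C1, hC1⟩ := (isCompact_Icc (a := (-1 : ℝ)) (b := 1)).exists_bound_of_continuousOn
    hc1.continuousOn
  obtain ⟨C2, hC2⟩ := (isCompact_Icc (a := (-1 : ℝ)) (b := 1)).exists_bound_of_continuousOn
    hc2.continuousOn
  have h00 : 0 ≤ C0 := (norm_nonneg _).trans (hC0 0 (by simp))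
  have h10 : 0 ≤ C1 := (norm_nonneg _).trans (hC1 0 (by simp))
  have h20 : 0 ≤ C2 := (norm_nonneg _).trans (hC2 0 (by simp))
  refine ⟨q, 8 + 4 * (C0 + C1 + C2), hqc, hmul, fun y => ?_, fun y => ?_, fun y => ?_⟩
  · rcases le_or_gt |y| 1 with hy | hy
    · have := hC0 y (abs_le.1 hy)
      rw [Real.norm_eq_abs] at this
      have h3 := mul_le_mul this (show 1 + |y| ≤ 2 by linarith) (by positivity) h00
      linarith
    · rw [hout y (hφ.trans hy), abs_inv]
      have : |y|⁻¹ * (1 + |y|) = |y|⁻¹ + 1 := by field_simp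
      rw [this]
      have := inv_le_one_of_one_le₀ hy.le
      linarith
  · rcases le_or_gt |y| 1 with hy | hy
    · have := hC1 y (abs_le.1 hy)
      rw [Real.norm_eq_abs] at this
      have h3 := mul_le_mul this (show (1 + |y|) ^ 2 ≤ 4 by nlinarith [abs_nonneg y])
        (by positivity) h10
      linarith
    · rw [hd1 y (hφ.trans hy), abs_neg, abs_inv, abs_pow]
      have : (|y| ^ 2)⁻¹ * (1 + |y|) ^ 2 = (|y|⁻¹ + 1) ^ 2 := by field_simp
      rw [this]
      have h3 := inv_le_one_of_one_le₀ hy.le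
      have : 0 ≤ |y|⁻¹ := by positivity
      nlinarith
  · rcases le_or_gt |y| 1 with hy | hy
    · have := hC2 y (abs_le.1 hy)
      rw [Real.norm_eq_abs] at this
      have h3 := mul_le_mul this (show (1 + |y|) ^ 2 ≤ 4 by nlinarith [abs_nonneg y])
        (by positivity) h20
      linarith
    · rw [hd2 y (hφ.trans hy), abs_mul, abs_inv, abs_pow, abs_of_pos (two_pos)]
      have : 2 * (|y| ^ 3)⁻¹ * (1 + |y|) ^ 2 = 2 * |y|⁻¹ * (|y|⁻¹ + 1) ^ 2 := by field_simp
      rw [this]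
      have h3 := inv_le_one_of_one_le₀ hy.le
      have h4 : 0 ≤ |y|⁻¹ := by positivity
      have h5 : (|y|⁻¹ + 1) ^ 2 ≤ 4 := by nlinarith
      have := mul_le_mul (show 2 * |y|⁻¹ ≤ 2 by linarith) h5 (by positivity) (by norm_num)
      linarith

/-- The points of `[-ρ, ρ]` at which an affine function takes values in `[u₁, u₂]` form an
interval. -/
theorem exists_interval_affine {ρ β γ u₁ u₂ : ℝ}
    (h : ∃ x ∈ Icc (-ρ) ρ, β + γ * x ∈ Icc u₁ u₂) :
    ∃ a b, -ρ ≤ a ∧ a ≤ b ∧ b ≤ ρ ∧ (∀ x ∈ Icc (-ρ) ρ, β + γ * x ∈ Icc u₁ u₂ ↔ x ∈ Icc a b) ∧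
      |γ| * (b - a) ≤ u₂ - u₁ := by
  set K : Set ℝ := {x | x ∈ Icc (-ρ) ρ ∧ β + γ * x ∈ Icc u₁ u₂} with hK
  have hcl : IsClosed {x : ℝ | β + γ * x ∈ Icc u₁ u₂} := isClosed_Icc.preimage (by fun_prop)
  have hcomp : IsCompact K := isCompact_Icc.inter_right hcl
  have hconv : Convex ℝ K := by
    refine (convex_Icc _ _).inter ?_
    intro x hx y hy s t hs ht hst
    have h1 := (convex_Icc u₁ u₂) hx hy hs ht hst
    simp only [smul_eq_mul] at h1 ⊢
    have e : s * (β + γ * x) + t * (β + γ * y) = β + γ * (s * x + t * y) := by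
      linear_combination β * hst
    change β + γ * (s * x + t * y) ∈ Icc u₁ u₂
    rwa [← e]
  have hne : K.Nonempty := by
    obtain ⟨x, hx, hx'⟩ := h
    exact ⟨x, hx, hx'⟩
  have heq := eq_Icc_of_connected_compact ⟨hne, hconv.isPreconnected⟩ hcomp
  have hab : sInf K ≤ sSup K := by
    rw [heq] at hne
    exact nonempty_Icc.1 hne
  have ha : sInf K ∈ K := hcomp.sInf_mem hne
  have hb : sSup K ∈ K := hcomp.sSup_mem hne
  refine ⟨sInf K, sSup K, ha.1.1, hab, hb.1.2, fun x hx => ?_, ?_⟩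
  · rw [← heq]
    exact ⟨fun h => ⟨hx, h⟩, fun h => h.2⟩
  · have h1 : |γ * (sSup K - sInf K)| ≤ u₂ - u₁ := by
      have e : γ * (sSup K - sInf K) = (β + γ * sSup K) - (β + γ * sInf K) := by ring
      rw [e, abs_le]
      constructor <;> linarith [ha.2.1, ha.2.2, hb.2.1, hb.2.2]
    rwa [abs_mul, abs_of_nonneg (sub_nonneg.2 hab)] at h1

theorem intervalIntegral_eq_of_eq_zero {f : ℝ → ℂ} {c d a b : ℝ} (hca : c ≤ a) (hab : a ≤ b)
    (hbd : b ≤ d) (h : ∀ x ∈ Icc c d, x ∉ Icc a b → f x = 0) :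
    ∫ x in c..d, f x = ∫ x in a..b, f x := by
  rw [intervalIntegral.integral_of_le (hca.trans (hab.trans hbd)),
    intervalIntegral.integral_of_le hab, ← integral_Icc_eq_integral_Ioc,
    ← integral_Icc_eq_integral_Ioc]
  exact setIntegral_eq_of_subset_of_forall_sdiff_eq_zero measurableSet_Icc
    (Icc_subset_Icc hca hbd) fun x hx => h x hx.1 hx.2

theorem intervalIntegral_eq_zero {f : ℝ → ℂ} {c d : ℝ} (hcd : c ≤ d)
    (h : ∀ x ∈ Icc c d, f x = 0) : ∫ x in c..d, f x = 0 := by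
  rw [intervalIntegral.integral_congr (g := fun _ => 0) fun x hx => h x (uIcc_of_le hcd ▸ hx)]
  simp

/-- The integral of a function that is supported near `± w`. -/
theorem integral_eq_add_of_support {f : ℝ → ℂ} (hf : Continuous f) {w t₀ R : ℝ} (hw : 1 ≤ w)
    (ht0 : 0 < t₀) (ht : t₀ < 1 / 2) (hR : w + t₀ ≤ R) (h : ∀ z, t₀ ≤ |z ^ 2 - w ^ 2| → f z = 0) :
    ∫ z in (-R)..R, f z
      = (∫ t in (-t₀)..t₀, f (w + t)) + ∫ t in (-t₀)..t₀, f (-(w + t)) := by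
  have hi : ∀ s t, IntervalIntegrable f volume s t := fun s t => hf.intervalIntegrable _ _
  have h1 : ∫ t in (-t₀)..t₀, f (w + t) = ∫ z in (w - t₀)..(w + t₀), f z := by
    rw [intervalIntegral.integral_comp_add_left f w, sub_eq_add_neg]
  have h2 : ∫ t in (-t₀)..t₀, f (-(w + t)) = ∫ z in (-(w + t₀))..(-(w - t₀)), f z := by
    have := intervalIntegral.integral_comp_sub_left (a := -t₀) (b := t₀) f (-w)
    have e : ∀ t : ℝ, -(w + t) = -w - t := fun t => by ring
    simp_rw [e]
    rw [this]
    congr 1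
    ring
  have hz : ∀ c d, c ≤ d → (∀ z ∈ Icc c d, t₀ ≤ |z ^ 2 - w ^ 2|) → ∫ z in c..d, f z = 0 :=
    fun c d hcd hh => intervalIntegral_eq_zero hcd fun z hz => h z (hh z hz)
  have z1 : ∫ z in (-R)..(-(w + t₀)), f z = 0 := hz _ _ (by linarith) fun z hz => by
    rw [le_abs]; left; nlinarith [hz.1, hz.2]
  have z2 : ∫ z in (-(w - t₀))..(w - t₀), f z = 0 := hz _ _ (by linarith) fun z hz => by
    rw [le_abs]; right
    have : z ^ 2 ≤ (w - t₀) ^ 2 := sq_le_sq' hz.1 hz.2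
    nlinarith
  have z3 : ∫ z in (w + t₀)..R, f z = 0 := hz _ _ (by linarith) fun z hz => by
    rw [le_abs]; left; nlinarith [hz.1, hz.2]
  rw [h1, h2, ← intervalIntegral.integral_add_adjacent_intervals (hi (-R) (-(w + t₀))) (hi _ R),
    ← intervalIntegral.integral_add_adjacent_intervals (hi (-(w + t₀)) (-(w - t₀))) (hi _ R),
    ← intervalIntegral.integral_add_adjacent_intervals (hi (-(w - t₀)) (w - t₀)) (hi _ R),
    ← intervalIntegral.integral_add_adjacent_intervals (hi (w - t₀) (w + t₀)) (hi _ R),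
    z1, z2, z3]
  ring

/-- An amplitude evaluated along a line. -/
theorem OscBound.norm_integral_comp_line_le {X : Type*} [NormedAddCommGroup X] [NormedSpace ℝ X]
    {ψ : ℝ → ℝ} {a b E C : ℝ} (h : OscBound ψ a b E) (hab : a ≤ b) {f : X → ℂ}
    (hf : ContDiff ℝ 1 f) (y v : X) (h0 : ∀ x ∈ Icc a b, ‖f (y + x • v)‖ ≤ C)
    (h1 : ∀ x ∈ Icc a b, ‖fderiv ℝ f (y + x • v)‖ ≤ C) :
    ‖∫ x in a..b, Complex.exp (Complex.I * (ψ x : ℝ)) * f (y + x • v)‖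
      ≤ E * (C * (1 + ‖v‖ * (b - a))) := by
  have hd : ∀ x, HasDerivAt (fun x : ℝ => f (y + x • v)) (fderiv ℝ f (y + x • v) v) x := by
    intro x
    have h2 : HasDerivAt (fun x : ℝ => y + x • v) v x := by
      simpa using ((hasDerivAt_id x).smul_const v).const_add y
    exact ((hf.differentiable (by simp)) _).hasFDerivAt.comp_hasDerivAt x h2
  have hc : Continuous fun x : ℝ => fderiv ℝ f (y + x • v) v := by
    have := hf.continuous_fderiv (by simp)
    fun_prop
  have := h (fun x => f (y + x • v)) _ C (C * ‖v‖) hd hc (h0 b ⟨hab, le_rfl⟩) fun x hx =>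
    (ContinuousLinearMap.le_opNorm _ _).trans (by gcongr; exact h1 x hx)
  refine this.trans (le_of_eq ?_)
  ring

/-- An amplitude that is the product of a slowly varying factor and of a function of an affine
function of `x`. -/
theorem OscBound.norm_integral_mul_comp_affine_le {ψ : ℝ → ℝ} {a b E C D β γ : ℝ}
    (h : OscBound ψ a b E) (hab : a ≤ b) {α α' : ℝ → ℂ} {κ κ' : ℝ → ℝ}
    (hα : ∀ x, HasDerivAt α (α' x) x) (hα' : Continuous α') (hκ : ∀ u, HasDerivAt κ (κ' u) u)
    (hκ' : Continuous κ') (h0 : ∀ x ∈ Icc a b, ‖α x‖ ≤ C) (h1 : ∀ x ∈ Icc a b, ‖α' x‖ ≤ C)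
    (h2 : ∀ x ∈ Icc a b, |κ (β + γ * x)| ≤ D) (h3 : ∀ x ∈ Icc a b, |κ' (β + γ * x)| ≤ D) :
    ‖∫ x in a..b, Complex.exp (Complex.I * (ψ x : ℝ)) * (α x * (κ (β + γ * x) : ℝ))‖
      ≤ E * (C * D * (1 + (1 + |γ|) * (b - a))) := by
  have hcα : Continuous α := continuous_iff_continuousAt.2 fun x => (hα x).continuousAt
  have hcκ : Continuous κ := continuous_iff_continuousAt.2 fun x => (hκ x).continuousAt
  have hd : ∀ x, HasDerivAt (fun x : ℝ => α x * (κ (β + γ * x) : ℝ))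
      (α' x * (κ (β + γ * x) : ℝ) + α x * ((κ' (β + γ * x) * γ : ℝ) : ℂ)) x := by
    intro x
    have h2 : HasDerivAt (fun x : ℝ => β + γ * x) γ x := by
      simpa using ((hasDerivAt_id x).const_mul γ).const_add β
    exact (hα x).mul ((hκ _).comp x h2).ofReal_comp
  have hb : b ∈ Icc a b := ⟨hab, le_rfl⟩
  have hC : 0 ≤ C := (norm_nonneg _).trans (h0 b hb)
  have := h _ _ (C * D) (C * D * (1 + |γ|)) hd (by fun_prop)
    (by
      rw [norm_mul, Complex.norm_real, Real.norm_eq_abs]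
      exact mul_le_mul (h0 b hb) (h2 b hb) (abs_nonneg _) hC)
    (fun x hx => by
      refine (norm_add_le _ _).trans ?_
      rw [norm_mul, norm_mul, Complex.norm_real, Complex.norm_real, Real.norm_eq_abs,
        Real.norm_eq_abs, abs_mul]
      have e1 := mul_le_mul (h1 x hx) (h2 x hx) (abs_nonneg _) hC
      have e2 := mul_le_mul (h0 x hx) (h3 x hx) (abs_nonneg _) hC
      have e3 := mul_le_mul_of_nonneg_right e2 (abs_nonneg γ)
      nlinarith)
  refine this.trans (le_of_eq ?_)
  ring

/-! ### The normal form of the phase -/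

/-- For `y = (z, U, x, r, p)` this is `∫₀ᶻ (U + ζ²) w (r ζ, x, p) dζ`, written as an integral over
`[0, 1]` so that it visibly depends smoothly on `y`. -/
noncomputable def airyPrim {E : Type} (w : ℝ × ℝ × (E × ℝ) → ℝ) (y : ℝ × ℝ × ℝ × ℝ × (E × ℝ)) :
    ℝ :=
  y.1 * ∫ τ in (0 : ℝ)..1, (y.2.1 + (τ * y.1) ^ 2) *
    w (y.2.2.2.1 * (τ * y.1), y.2.2.1, y.2.2.2.2)

theorem airyPrim_eq_integral {E : Type} (w : ℝ × ℝ × (E × ℝ) → ℝ) (z U x r : ℝ) (p : E × ℝ) :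
    airyPrim w (z, U, x, r, p) = ∫ ζ in (0 : ℝ)..z, (U + ζ ^ 2) * w (r * ζ, x, p) := by
  have := intervalIntegral.mul_integral_comp_mul_right (a := 0) (b := 1)
    (f := fun ζ => (U + ζ ^ 2) * w (r * ζ, x, p)) z
  simpa [airyPrim] using this

theorem airyPrim_scale {E : Type} (w : ℝ × ℝ × (E × ℝ) → ℝ) (z U x r : ℝ) (p : E × ℝ) :
    airyPrim w (r * z, r ^ 2 * U, x, 1, p) = r ^ 3 * airyPrim w (z, U, x, r, p) := by
  have : ∀ τ : ℝ, (r ^ 2 * U + (τ * (r * z)) ^ 2) * w (1 * (τ * (r * z)), x, p)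
      = r ^ 2 * ((U + (τ * z) ^ 2) * w (r * (τ * z), x, p)) := fun τ => by
    have e : 1 * (τ * (r * z)) = r * (τ * z) := by ring
    rw [e]; ring
  simp only [airyPrim, this, intervalIntegral.integral_const_mul]
  ring

theorem iteratedDeriv_affine {m : ℕ} (hm : 2 ≤ m) (a b x : ℝ) :
    iteratedDeriv m (fun x : ℝ => a + b * x) x = 0 := by
  obtain ⟨k, rfl⟩ := Nat.exists_eq_add_of_le' hm
  rw [show k + 2 = (k + 1) + 1 by ring, iteratedDeriv_succ']
  have : deriv (fun x : ℝ => a + b * x) = fun _ => b := by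
    funext x
    simp
  rw [this, iteratedDeriv_const]
  simp

theorem hasDerivAt_airyPrim {E : Type} [NormedAddCommGroup E] {w : ℝ × ℝ × (E × ℝ) → ℝ}
    (hw : Continuous w) (z U x r : ℝ) (p : E × ℝ) :
    HasDerivAt (fun z => airyPrim w (z, U, x, r, p)) ((U + z ^ 2) * w (r * z, x, p)) z := by
  simp_rw [airyPrim_eq_integral]
  have hc : Continuous fun ζ : ℝ => (U + ζ ^ 2) * w (r * ζ, x, p) := by fun_prop
  exact intervalIntegral.integral_hasDerivAt_right (hc.intervalIntegrable _ _)
    hc.aestronglyMeasurable.stronglyMeasurableAtFilter hc.continuousAt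

theorem airyPrim_add_mul {E : Type} [NormedAddCommGroup E] {w₀ w₁ : ℝ × ℝ × (E × ℝ) → ℝ}
    (h0 : Continuous w₀) (h1 : Continuous w₁) (z U x r : ℝ) (p : E × ℝ) :
    airyPrim (fun y => w₀ y + y.2.2.2 * w₁ y) (z, U, x, r, p)
      = airyPrim w₀ (z, U, x, r, p) + p.2 * airyPrim w₁ (z, U, x, r, p) := by
  simp only [airyPrim_eq_integral]
  rw [← intervalIntegral.integral_const_mul, ← intervalIntegral.integral_add
    ((by fun_prop : Continuous _).intervalIntegrable _ _)
    ((by fun_prop : Continuous _).intervalIntegrable _ _)]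
  refine intervalIntegral.integral_congr fun ζ _ => ?_
  ring

section NormalForm

variable {E : Type} [NormedAddCommGroup E] [NormedSpace ℝ E]

theorem contDiff_airyPrim [FiniteDimensional ℝ E] {w : ℝ × ℝ × (E × ℝ) → ℝ} {n : ℕ}
    (hw : ContDiff ℝ n w) : ContDiff ℝ n (airyPrim w) := by
  refine contDiff_fst.mul ?_
  refine contDiff_integral_zero_one n (f := fun v : (ℝ × ℝ × ℝ × ℝ × (E × ℝ)) × ℝ =>
    (v.1.2.1 + (v.2 * v.1.1) ^ 2) * w (v.1.2.2.2.1 * (v.2 * v.1.1), v.1.2.2.1, v.1.2.2.2.2)) ?_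
  have h1 : ContDiff ℝ n fun v : (ℝ × ℝ × ℝ × ℝ × (E × ℝ)) × ℝ =>
      (v.1.2.2.2.1 * (v.2 * v.1.1), v.1.2.2.1, v.1.2.2.2.2) := by fun_prop
  exact ContDiff.mul (by fun_prop) (hw.comp h1)

/-- The data of a phase `p.2 h (x, p) + ∫₀ˢ (B p + p.2 x + ζ²) W (ζ, x, p) dζ`, where
`W = W₀ + p.2 W₁` and `W₀` does not depend on `x`. The last coordinate of the parameter
`p ∈ E × ℝ` is the small parameter `σ`. Finite smoothness suffices, and
allows all functions to be defined globally although only their germs at `0` matter. -/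
structure AiryNormalForm (E : Type) [NormedAddCommGroup E] [NormedSpace ℝ E] (m : ℕ) where
  /-- the part of the weight that does not depend on `x` -/
  W₀ : ℝ × (E × ℝ) → ℝ
  /-- the coefficient of `σ` in the weight -/
  W₁ : ℝ × ℝ × (E × ℝ) → ℝ
  /-- the coefficient of `σ` in the phase on `s = 0` -/
  h : ℝ × (E × ℝ) → ℝ
  /-- the value of `∂ₛ phase / W` at `s = x = 0` -/
  B : E × ℝ → ℝ
  contDiff_W₀ : ContDiff ℝ (m + 5 : ℕ) W₀
  contDiff_W₁ : ContDiff ℝ (m + 5 : ℕ) W₁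
  contDiff_h : ContDiff ℝ (m + 5 : ℕ) h
  continuousAt_B : ContinuousAt B 0
  B_zero : B 0 = 0
  W₀_pos : 0 < W₀ 0
  two_le : 2 ≤ m
  h_ne : iteratedDeriv m (fun x => h (x, 0)) 0 ≠ 0

namespace AiryNormalForm

variable {m : ℕ} (N : AiryNormalForm E m)

/-- `W₀` as a function of all variables. -/
def w₀ (y : ℝ × ℝ × (E × ℝ)) : ℝ := N.W₀ (y.1, y.2.2)

/-- The weight `W₀ + σ W₁`. -/
def W (y : ℝ × ℝ × (E × ℝ)) : ℝ := N.w₀ y + y.2.2.2 * N.W₁ y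

/-- The phase `σ h (x, p) + ∫₀ˢ (B p + σ x + ζ²) W (ζ, x, p) dζ`. -/
noncomputable def phase (s x : ℝ) (p : E × ℝ) : ℝ :=
  p.2 * N.h (x, p) + airyPrim N.W (s, N.B p + p.2 * x, x, 1, p)

/-- The phase at `s = r z`, divided by `r³`. -/
noncomputable def scaled (r z x : ℝ) (p : E × ℝ) : ℝ :=
  p.2 / r ^ 3 * N.h (x, p) + airyPrim N.W (z, N.B p / r ^ 2 + p.2 / r ^ 2 * x, x, r, p)

theorem scaled_eq {r : ℝ} (hr : 0 < r) (z x : ℝ) (p : E × ℝ) :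
    r ^ 3 * N.scaled r z x p = N.phase (r * z) x p := by
  have e : N.B p + p.2 * x = r ^ 2 * (N.B p / r ^ 2 + p.2 / r ^ 2 * x) := by field_simp
  rw [phase, e, airyPrim_scale, scaled]
  field_simp

theorem contDiff_w₀ : ContDiff ℝ (m + 5 : ℕ) N.w₀ :=
  N.contDiff_W₀.comp (by fun_prop : ContDiff ℝ _ fun y : ℝ × ℝ × (E × ℝ) => (y.1, y.2.2))

theorem contDiff_W : ContDiff ℝ (m + 5 : ℕ) N.W :=
  N.contDiff_w₀.add (ContDiff.mul (by fun_prop) N.contDiff_W₁)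

theorem hasDerivAt_scaled (r z x : ℝ) (p : E × ℝ) :
    HasDerivAt (fun z => N.scaled r z x p)
      ((N.B p / r ^ 2 + p.2 / r ^ 2 * x + z ^ 2) * N.W (r * z, x, p)) z :=
  (hasDerivAt_airyPrim N.contDiff_W.continuous _ _ _ _ _).const_add _

theorem airyPrim_W (z U x r : ℝ) (p : E × ℝ) :
    airyPrim N.W (z, U, x, r, p)
      = airyPrim N.w₀ (z, U, x, r, p) + p.2 * airyPrim N.W₁ (z, U, x, r, p) :=
  airyPrim_add_mul N.contDiff_w₀.continuous N.contDiff_W₁.continuous _ _ _ _ _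

theorem airyPrim_w₀_congr (z U x x' r : ℝ) (p : E × ℝ) :
    airyPrim N.w₀ (z, U, x, r, p) = airyPrim N.w₀ (z, U, x', r, p) := by
  simp [airyPrim, w₀]

theorem continuous_scaled [FiniteDimensional ℝ E] (r : ℝ) (p : E × ℝ) :
    Continuous fun q : ℝ × ℝ => N.scaled r q.1 q.2 p := by
  have h1 := (contDiff_airyPrim N.contDiff_W).continuous
  have h2 := N.contDiff_h.continuous
  unfold scaled
  fun_prop

open Filter Topology in
/-- Away from `σ = 0` the phase has a large `m`-th derivative in `x`, for all fixed `s`. -/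
theorem exists_le_iteratedDeriv_phase [FiniteDimensional ℝ E] :
    ∃ c > 0, ∃ ρ > 0, ∀ (s x : ℝ) (p : E × ℝ), |s| ≤ ρ → |x| ≤ ρ → ‖p‖ ≤ ρ →
      c * |p.2| ≤ |iteratedDeriv m (fun x => N.phase s x p) x| := by
  set G : ℝ × ℝ × ℝ × (E × ℝ) → ℝ := fun y => N.h (y.1, y.2.2.2)
    + airyPrim N.W₁ (y.2.1, y.2.2.1 + y.2.2.2.2 * y.1, y.1, 1, y.2.2.2) with hG
  have hGc : ContDiff ℝ (m + 5 : ℕ) G := by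
    refine ContDiff.add ?_ ?_
    · exact N.contDiff_h.comp
        (by fun_prop : ContDiff ℝ _ fun y : ℝ × ℝ × ℝ × (E × ℝ) => (y.1, y.2.2.2))
    · exact (contDiff_airyPrim N.contDiff_W₁).comp
        (by fun_prop : ContDiff ℝ _ fun y : ℝ × ℝ × ℝ × (E × ℝ) =>
          (y.2.1, y.2.2.1 + y.2.2.2.2 * y.1, y.1, (1 : ℝ), y.2.2.2))
  have hGm : ContDiff ℝ m G := hGc.of_le (by norm_cast; omega)
  set e : ℝ × ℝ × ℝ × (E × ℝ) := (1, 0, 0, 0) with he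
  have hline : ∀ (q : ℝ × ℝ × (E × ℝ)) (x : ℝ), iteratedDeriv m (fun x => G (x, q)) x
      = iteratedFDeriv ℝ m G (x, q) fun _ => e := by
    intro q x
    have := iteratedDeriv_comp_line hGm (0, q) e x
    have e1 : ∀ x : ℝ, (0, q) + x • e = (x, q) := fun x => by simp [he]
    simpa only [e1] using this
  have hcont : Continuous fun y => |iteratedFDeriv ℝ m G y fun _ => e| := by
    have h1 : Continuous (iteratedFDeriv ℝ m G) := hGm.continuous_iteratedFDeriv le_rfl
    have h2 : Continuous fun y => iteratedFDeriv ℝ m G y fun _ => e :=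
      (ContinuousMultilinearMap.apply ℝ (fun _ : Fin m => ℝ × ℝ × ℝ × (E × ℝ)) ℝ
        (fun _ => e)).continuous.comp h1
    exact h2.abs
  have hval : iteratedFDeriv ℝ m G 0 (fun _ => e) = iteratedDeriv m (fun x => N.h (x, 0)) 0 := by
    have := hline 0 0
    rw [Prod.mk_zero_zero] at this
    rw [← this]
    congr 1
    funext x
    simp [hG, airyPrim]
  set c : ℝ := |iteratedDeriv m (fun x => N.h (x, 0)) 0| with hc
  have hc0 : 0 < c := abs_pos.2 N.h_ne
  have hev : ∀ᶠ y in 𝓝 (0 : ℝ × ℝ × ℝ × (E × ℝ)), c / 2 < |iteratedFDeriv ℝ m G y fun _ => e| := by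
    refine hcont.continuousAt.eventually_const_lt ?_
    change c / 2 < |iteratedFDeriv ℝ m G 0 fun _ => e|
    rw [hval]
    linarith
  obtain ⟨ρ₁, hρ₁, hb⟩ := Metric.eventually_nhds_iff_ball.1 hev
  obtain ⟨ρ₂, hρ₂, hb2⟩ := Metric.eventually_nhds_iff_ball.1
    (N.continuousAt_B.eventually (Metric.ball_mem_nhds (N.B 0) hρ₁))
  refine ⟨c / 2, by linarith, min ρ₁ ρ₂ / 2, by positivity, fun s x p hs hx hp => ?_⟩
  have hlt : min ρ₁ ρ₂ / 2 < min ρ₁ ρ₂ := half_lt_self (by positivity)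
  have hlt1 : min ρ₁ ρ₂ / 2 < ρ₁ := hlt.trans_le (min_le_left _ _)
  have hlt2 : min ρ₁ ρ₂ / 2 < ρ₂ := hlt.trans_le (min_le_right _ _)
  have hBp : |N.B p| < ρ₁ := by
    have := hb2 p (by rw [mem_ball_zero_iff]; linarith)
    rwa [N.B_zero, Real.dist_eq, sub_zero] at this
  have hmem : (x, s, N.B p, p) ∈ Metric.ball (0 : ℝ × ℝ × ℝ × (E × ℝ)) ρ₁ := by
    rw [mem_ball_zero_iff]
    simp only [Prod.norm_def, Real.norm_eq_abs, sup_lt_iff] at hp ⊢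
    refine ⟨by linarith, by linarith, hBp, lt_of_le_of_lt (le_max_left _ _) (hp.trans_lt hlt1),
      lt_of_le_of_lt (le_max_right _ _) (hp.trans_lt hlt1)⟩
  have h1 := hb _ hmem
  rw [← hline] at h1
  -- the part of the phase that comes from `W₀` is affine in `x`
  set I0 : ℝ := ∫ τ in (0 : ℝ)..1, N.W₀ (τ * s, p) with hI0
  set I2 : ℝ := ∫ τ in (0 : ℝ)..1, (τ * s) ^ 2 * N.W₀ (τ * s, p) with hI2
  have hW0c : Continuous fun τ : ℝ => N.W₀ (τ * s, p) := by
    have := N.contDiff_W₀.continuous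
    fun_prop
  have haff : ∀ x : ℝ, airyPrim N.w₀ (s, N.B p + p.2 * x, x, 1, p)
      = (s * (N.B p * I0 + I2)) + (s * p.2 * I0) * x := by
    intro x
    have e1 : ∫ τ in (0 : ℝ)..1, (N.B p + p.2 * x + (τ * s) ^ 2) * N.w₀ (1 * (τ * s), x, p)
        = (N.B p + p.2 * x) * I0 + I2 := by
      rw [hI0, hI2, ← intervalIntegral.integral_const_mul, ← intervalIntegral.integral_add
        ((hW0c.const_mul _).intervalIntegrable _ _)
        ((by fun_prop : Continuous fun τ : ℝ => (τ * s) ^ 2 * N.W₀ (τ * s, p)).intervalIntegrable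
          _ _)]
      refine intervalIntegral.integral_congr fun τ _ => ?_
      simp only [w₀, one_mul]
      ring
    simp only [airyPrim]
    rw [e1]
    ring
  have hphase : (fun x => N.phase s x p)
      = fun x => p.2 * G (x, s, N.B p, p) + ((s * (N.B p * I0 + I2)) + (s * p.2 * I0) * x) := by
    funext x
    rw [phase, airyPrim_W, haff, hG]
    ring
  have hGx : ContDiff ℝ m fun x => G (x, s, N.B p, p) := hGm.comp (by fun_prop)
  rw [hphase, iteratedDeriv_fun_add (by exact (contDiff_const.mul hGx).contDiffAt)
    (by exact ContDiff.contDiffAt (by fun_prop)), iteratedDeriv_affine N.two_le, add_zero,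
    iteratedDeriv_const_mul_field, abs_mul, mul_comm]
  exact mul_le_mul_of_nonneg_left h1.le (abs_nonneg _)

end AiryNormalForm
end NormalForm

/-! ### Decay in `x` along the critical curves -/

theorem iteratedDeriv_neg_rpow_ne_zero (k : ℕ) {c U : ℝ} (hc : c ≠ 0) (hU : U < 0) :
    iteratedDeriv k (fun U : ℝ => c * (-U) ^ (3 / 2 : ℝ)) U ≠ 0 := by
  rw [iteratedDeriv_const_mul_field, iteratedDeriv_comp_neg k (fun U : ℝ => U ^ (3 / 2 : ℝ)) U,
    iteratedDeriv_eq_iterate, Real.iter_deriv_rpow_const]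
  have hp : ∀ k : ℕ, (descPochhammer ℝ k).eval (3 / 2 : ℝ) ≠ 0 := fun k => by
    induction k with
    | zero => simp
    | succ k ih =>
      rw [descPochhammer_succ_eval]
      refine mul_ne_zero ih fun h => ?_
      have h3 : (3 : ℝ) = 2 * k := by linarith
      have h4 : 3 = 2 * k := by exact_mod_cast h3
      omega
  have := Real.rpow_pos_of_pos (neg_pos.2 hU) (3 / 2 - k)
  exact mul_ne_zero hc (smul_ne_zero (by simp) (mul_ne_zero (hp k) this.ne'))

theorem continuous_iteratedFDeriv_apply {X : Type*} [NormedAddCommGroup X] [NormedSpace ℝ X]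
    {f : X → ℝ} {k : ℕ} (hf : ContDiff ℝ k f) (e : X) :
    Continuous fun y => iteratedFDeriv ℝ k f y fun _ => e :=
  (ContinuousMultilinearMap.apply ℝ (fun _ : Fin k => X) ℝ fun _ => e).continuous.comp
    (hf.continuous_iteratedFDeriv le_rfl)

/-- A continuous function that is positive on `[u₁, u₂] × {0}` is bounded below near this set. -/
theorem exists_le_of_pos_on_Icc {Y : Type*} [NormedAddCommGroup Y] {f : ℝ × Y → ℝ}
    (hf : Continuous f) {u₁ u₂ : ℝ} (h : u₁ ≤ u₂) (hpos : ∀ U ∈ Icc u₁ u₂, 0 < f (U, 0)) :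
    ∃ c > 0, ∃ ρ > 0, ∀ U ∈ Icc u₁ u₂, ∀ y : Y, ‖y‖ ≤ ρ → c ≤ f (U, y) := by
  obtain ⟨U₀, hU₀, hmin⟩ := isCompact_Icc.exists_isMinOn (nonempty_Icc.2 h)
    (by fun_prop : ContinuousOn (fun U : ℝ => f (U, (0 : Y))) (Icc u₁ u₂))
  have hop : IsOpen {v : ℝ × Y | f (U₀, 0) / 2 < f v} := isOpen_lt continuous_const hf
  have hsub : Icc u₁ u₂ ×ˢ {(0 : Y)} ⊆ {v : ℝ × Y | f (U₀, 0) / 2 < f v} := by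
    rintro ⟨U, y⟩ ⟨hU, hy⟩
    obtain rfl : y = 0 := hy
    have h1 : f (U₀, 0) ≤ f (U, 0) := hmin hU
    have h2 := hpos U₀ hU₀
    change f (U₀, 0) / 2 < f (U, 0)
    linarith
  obtain ⟨u, v, -, hv, hu', hv', huv⟩ := generalized_tube_lemma isCompact_Icc
    isCompact_singleton hop hsub
  obtain ⟨ρ, hρ, hball⟩ := Metric.isOpen_iff.1 hv 0 (hv' rfl)
  refine ⟨f (U₀, 0) / 2, half_pos (hpos U₀ hU₀), ρ / 2, half_pos hρ, fun U hU y hy => ?_⟩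
  have : (U, y) ∈ u ×ˢ v := ⟨hu' hU, hball (by rw [mem_ball_zero_iff]; linarith)⟩
  exact le_of_lt (huv this)

theorem exists_abs_le_of_norm_le {Y : Type*} [NormedAddCommGroup Y] [ProperSpace Y] {f : Y → ℝ}
    (hf : Continuous f) (R : ℝ) : ∃ C, 0 ≤ C ∧ ∀ y, ‖y‖ ≤ R → |f y| ≤ C := by
  obtain ⟨C, hC⟩ := (isCompact_closedBall (0 : Y) R).exists_bound_of_continuousOn hf.continuousOn
  exact ⟨max C 0, le_max_right _ _, fun y hy =>
    (hC y (mem_closedBall_zero_iff.2 hy)).trans (le_max_left _ _)⟩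

/-- A smooth positive function which is `√(-U)` for `-17 ≤ U ≤ -1/2`. -/
noncomputable def airySqrt : ℝ → ℝ := exists_contDiff_sqrt.choose

theorem contDiff_airySqrt : ContDiff ℝ ∞ airySqrt := exists_contDiff_sqrt.choose_spec.1

theorem airySqrt_eq {U : ℝ} (hU : U ∈ Icc (-17 : ℝ) (-(1 / 2))) : airySqrt U = √(-U) :=
  exists_contDiff_sqrt.choose_spec.2.2 U hU

/-- The map `(U, x, t, r, p) ↦ (z, U, x, r, p)` with `z = e (√(-U) + t)`, for a sign `e`. -/
noncomputable def airyCurve {E : Type} (e : ℝ) (y : ℝ × ℝ × ℝ × ℝ × (E × ℝ)) :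
    ℝ × ℝ × ℝ × ℝ × (E × ℝ) :=
  (e * (airySqrt y.1 + y.2.2.1), y.1, y.2.1, y.2.2.2.1, y.2.2.2.2)

section

variable {E : Type} [NormedAddCommGroup E] [NormedSpace ℝ E]

theorem contDiff_airyCurve (e : ℝ) : ContDiff ℝ ∞ (airyCurve (E := E) e) := by
  have := contDiff_airySqrt
  unfold airyCurve
  have h1 : ContDiff ℝ ∞ fun y : ℝ × ℝ × ℝ × ℝ × (E × ℝ) => airySqrt y.1 :=
    this.comp contDiff_fst
  fun_prop

namespace AiryNormalForm

variable {m : ℕ} (N : AiryNormalForm E m)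

theorem contDiff_airyPrim_comp_airyCurve [FiniteDimensional ℝ E] {w : ℝ × ℝ × (E × ℝ) → ℝ} {n : ℕ}
    (hw : ContDiff ℝ n w) (e : ℝ) : ContDiff ℝ n fun y => airyPrim w (airyCurve e y) :=
  (contDiff_airyPrim hw).comp ((contDiff_airyCurve e).of_le (by exact_mod_cast le_top))

theorem iteratedDeriv_scaled_airyCurve [FiniteDimensional ℝ E] (e r t : ℝ) (p : E × ℝ) {k : ℕ}
    (hk : k ≤ m + 5) (x : ℝ) :
    ContDiff ℝ k (fun x => N.scaled r (e * (airySqrt (N.B p / r ^ 2 + p.2 / r ^ 2 * x) + t)) x p) ∧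
    iteratedDeriv k
      (fun x => N.scaled r (e * (airySqrt (N.B p / r ^ 2 + p.2 / r ^ 2 * x) + t)) x p) x
    = p.2 / r ^ 3 * iteratedDeriv k (fun x => N.h (x, p)) x
      + ((p.2 / r ^ 2) ^ k * iteratedFDeriv ℝ k (fun y => airyPrim N.w₀ (airyCurve e y))
          (N.B p / r ^ 2 + p.2 / r ^ 2 * x, 0, t, r, p) (fun _ => (1, 0))
        + p.2 * iteratedFDeriv ℝ k (fun y => airyPrim N.W₁ (airyCurve e y))
          (N.B p / r ^ 2 + p.2 / r ^ 2 * x, x, t, r, p) fun _ => (p.2 / r ^ 2, 1, 0)) := by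
  have hkk : ((k : ℕ) : WithTop ℕ∞) ≤ (m + 5 : ℕ) := by exact_mod_cast hk
  have h0 : ContDiff ℝ k fun y => airyPrim N.w₀ (airyCurve e y) :=
    (contDiff_airyPrim_comp_airyCurve N.contDiff_w₀ e).of_le hkk
  have h1 : ContDiff ℝ k fun y => airyPrim N.W₁ (airyCurve e y) :=
    (contDiff_airyPrim_comp_airyCurve N.contDiff_W₁ e).of_le hkk
  have hh : ContDiff ℝ k fun x => N.h (x, p) :=
    (N.contDiff_h.of_le hkk).comp (by fun_prop)
  set β := N.B p / r ^ 2
  set γ := p.2 / r ^ 2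
  set Q₀ := fun y => airyPrim N.w₀ (airyCurve e y) with hQ₀
  set Q₁ := fun y => airyPrim N.W₁ (airyCurve e y) with hQ₁
  set y₀ : ℝ × ℝ × ℝ × ℝ × (E × ℝ) := (β, 0, t, r, p) with hy₀
  set e₀ : ℝ × ℝ × ℝ × ℝ × (E × ℝ) := (1, 0) with he₀
  set v : ℝ × ℝ × ℝ × ℝ × (E × ℝ) := (γ, 1, 0) with hv
  have l0 : ∀ x : ℝ, y₀ + x • (γ • e₀) = (β + γ * x, 0, t, r, p) := fun x => by
    simp [hy₀, he₀, mul_comm]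
  have l1 : ∀ x : ℝ, y₀ + x • v = (β + γ * x, x, t, r, p) := fun x => by
    simp [hy₀, hv, mul_comm]
  have hf : (fun x => N.scaled r (e * (airySqrt (β + γ * x) + t)) x p)
      = fun x => p.2 / r ^ 3 * N.h (x, p)
        + (Q₀ (y₀ + x • (γ • e₀)) + p.2 * Q₁ (y₀ + x • v)) := by
    funext x
    rw [scaled, airyPrim_W, l0, l1, N.airyPrim_w₀_congr _ _ x 0]
    rfl
  have c1 : ContDiff ℝ k fun x => p.2 / r ^ 3 * N.h (x, p) := contDiff_const.mul hh
  have c2 : ContDiff ℝ k fun x : ℝ => Q₀ (y₀ + x • (γ • e₀)) := h0.comp (by fun_prop)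
  have c3 : ContDiff ℝ k fun x : ℝ => Q₁ (y₀ + x • v) := h1.comp (by fun_prop)
  have c4 : ContDiff ℝ k fun x : ℝ => p.2 * Q₁ (y₀ + x • v) := contDiff_const.mul c3
  rw [hf]
  refine ⟨c1.add (c2.add c4), ?_⟩
  rw [iteratedDeriv_fun_add c1.contDiffAt (c2.add c4).contDiffAt,
    iteratedDeriv_fun_add c2.contDiffAt c4.contDiffAt, iteratedDeriv_const_mul_field,
    iteratedDeriv_const_mul_field, iteratedDeriv_comp_line h0, iteratedDeriv_comp_line h1, l0, l1]
  have := (iteratedFDeriv ℝ k Q₀ (β + γ * x, 0, t, r, p)).map_smul_univ (fun _ => γ) fun _ => e₀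
  simp only [Finset.prod_const, Finset.card_univ, Fintype.card_fin, smul_eq_mul] at this
  rw [this]

theorem airyPrim_w₀_airyCurve_zero {e : ℝ} (he : e = 1 ∨ e = -1) {U : ℝ}
    (hU : U ∈ Icc (-17 : ℝ) (-(1 / 2))) :
    airyPrim N.w₀ (airyCurve e (U, 0)) = -(2 / 3 * e * N.W₀ 0) * (-U) ^ (3 / 2 : ℝ) := by
  have h0 : 0 ≤ -U := by linarith [hU.2]
  have hs : √(-U) ^ 2 = -U := Real.sq_sqrt h0
  have e1 : (-U) ^ (3 / 2 : ℝ) = -U * √(-U) := by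
    rw [show (3 / 2 : ℝ) = 1 + 1 / 2 by norm_num, Real.rpow_add (by linarith [hU.2]),
      Real.rpow_one, Real.sqrt_eq_rpow]
  have e2 : e ^ 2 = 1 := by rcases he with rfl | rfl <;> norm_num
  simp only [airyCurve, airySqrt_eq hU, Prod.fst_zero, Prod.snd_zero, add_zero,
    airyPrim_eq_integral, w₀, zero_mul]
  have : (N.W₀ (0, 0) : ℝ) = N.W₀ 0 := rfl
  simp_rw [this]
  rw [intervalIntegral.integral_mul_const, intervalIntegral.integral_add (by simp)
    ((by fun_prop : Continuous fun ζ : ℝ => ζ ^ 2).intervalIntegrable _ _), integral_pow, e1]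
  simp only [intervalIntegral.integral_const, smul_eq_mul]
  have e3 : (e * √(-U)) ^ (2 + 1) = e * (-U * √(-U)) := by
    rw [pow_succ, mul_pow, e2, hs]; ring
  rw [e3]
  push_cast
  ring

/-- The main term of the phase on a critical curve is a multiple of `(-U) ^ (3 / 2)`, all of whose
derivatives are nonzero. -/
theorem exists_le_iteratedFDeriv_airyCurve [FiniteDimensional ℝ E] {e : ℝ} (he : e = 1 ∨ e = -1) :
    ∃ c > 0, ∃ ρ > 0, ∀ U ∈ Icc (-16 : ℝ) (-1), ∀ y : ℝ × ℝ × ℝ × (E × ℝ), ‖y‖ ≤ ρ →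
      c ≤ |iteratedFDeriv ℝ (m + 1) (fun y => airyPrim N.w₀ (airyCurve e y)) (U, y)
        fun _ => (1, 0)| := by
  have hC : ContDiff ℝ (m + 1 : ℕ) fun y => airyPrim N.w₀ (airyCurve e y) :=
    (contDiff_airyPrim_comp_airyCurve N.contDiff_w₀ e).of_le (by norm_cast; omega)
  refine exists_le_of_pos_on_Icc (f := fun y => |iteratedFDeriv ℝ (m + 1)
    (fun y => airyPrim N.w₀ (airyCurve e y)) y fun _ => (1, 0)|) ?_ (by norm_num)
    fun U hU => abs_pos.2 ?_
  · exact (continuous_iteratedFDeriv_apply hC _).abs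
  · have hl := iteratedDeriv_comp_line hC 0 (1, 0) U
    have e1 : ∀ U : ℝ, (0 : ℝ × ℝ × ℝ × ℝ × (E × ℝ)) + U • (1, 0) = (U, 0) := fun U => by simp
    simp only [e1] at hl
    rw [← hl, Filter.EventuallyEq.iteratedDeriv_eq (m + 1)
      (g := fun U => -(2 / 3 * e * N.W₀ 0) * (-U) ^ (3 / 2 : ℝ))]
    · refine iteratedDeriv_neg_rpow_ne_zero _ ?_ (by linarith [hU.2])
      have := N.W₀_pos.ne'
      rcases he with rfl | rfl <;> simp [this]
    · filter_upwards [Ioo_mem_nhds (show (-17 : ℝ) < U by linarith [hU.1])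
        (show U < -(1 / 2) by linarith [hU.2])] with V hV
      exact N.airyPrim_w₀_airyCurve_zero he ⟨hV.1.le, hV.2.le⟩

/-- Decay in `x` along the critical curves `z = e (√(-U) + t)`, where `U = (B + σ x) / r²`. If
`σ ^ (m - 1)` is small compared to `r ^ (2 m - 3)`, the `m`-th derivative of `h` dominates,
otherwise the `m + 1`-st derivative of the main term `(-U) ^ (3 / 2)`. The threshold `c'` between
the two cases is left free, so that the same one can be used for both signs `e`. -/
theorem exists_oscBound_airyCurve [FiniteDimensional ℝ E] {e : ℝ} (he : e = 1 ∨ e = -1) :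
    ∃ c₀ > 0, ∀ c' : ℝ, 0 < c' → c' ≤ c₀ → ∃ ρ > 0, ∃ C : ℝ, 0 ≤ C ∧ ∀ (r t : ℝ) (p : E × ℝ)
      (a b lam : ℝ), 0 < r → r ≤ ρ → |t| ≤ ρ → ‖p‖ ≤ ρ → p.2 ≠ 0 → a ≤ b → 0 < lam →
      (∀ x ∈ Icc a b, |x| ≤ ρ) →
      (∀ x ∈ Icc a b, N.B p / r ^ 2 + p.2 / r ^ 2 * x ∈ Icc (-16 : ℝ) (-1)) →
      (|p.2| ^ (m - 1) ≤ c' * r ^ (2 * m - 3) →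
        OscBound (fun x => lam * r ^ 3 *
          N.scaled r (e * (airySqrt (N.B p / r ^ 2 + p.2 / r ^ 2 * x) + t)) x p) a b
          (C * (lam * |p.2|) ^ (-(1 : ℝ) / m))) ∧
      (c' * r ^ (2 * m - 3) ≤ |p.2| ^ (m - 1) →
        OscBound (fun x => lam * r ^ 3 *
          N.scaled r (e * (airySqrt (N.B p / r ^ 2 + p.2 / r ^ 2 * x) + t)) x p) a b
          (C * ((lam * r ^ 3) ^ (-(1 : ℝ) / ((m + 1 : ℕ) : ℝ)) * (|p.2| / r ^ 2)⁻¹))) := by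
  have hm := N.two_le
  set Q₀ := fun y => airyPrim N.w₀ (airyCurve e y) with hQ₀
  set Q₁ := fun y => airyPrim N.W₁ (airyCurve e y) with hQ₁
  have h0 : ContDiff ℝ (m + 5 : ℕ) Q₀ := contDiff_airyPrim_comp_airyCurve N.contDiff_w₀ e
  have h1 : ContDiff ℝ (m + 5 : ℕ) Q₁ := contDiff_airyPrim_comp_airyCurve N.contDiff_W₁ e
  -- upper bounds for all derivatives of order at most `m + 1` that occur
  have hup : ∀ k ≤ m + 5, ∃ C, 0 ≤ C ∧ (∀ y, ‖y‖ ≤ 16 →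
      |iteratedFDeriv ℝ k Q₀ y fun _ => (1, 0)| ≤ C) ∧
      (∀ y, ‖y‖ ≤ 16 → ‖iteratedFDeriv ℝ k Q₁ y‖ ≤ C) ∧
      ∀ (x : ℝ) (p : E × ℝ), |x| ≤ 16 → ‖p‖ ≤ 16 →
        |iteratedDeriv k (fun x => N.h (x, p)) x| ≤ C := by
    intro k hk
    have hk' : ((k : ℕ) : WithTop ℕ∞) ≤ (m + 5 : ℕ) := by exact_mod_cast hk
    have c0 : Continuous fun y => iteratedFDeriv ℝ k Q₀ y fun _ => (1, 0) :=
      continuous_iteratedFDeriv_apply (h0.of_le hk') _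
    have c1 : Continuous fun y => ‖iteratedFDeriv ℝ k Q₁ y‖ :=
      ((h1.of_le hk').continuous_iteratedFDeriv le_rfl).norm
    have c2 : Continuous fun y => iteratedFDeriv ℝ k N.h y fun _ => (1, 0) :=
      continuous_iteratedFDeriv_apply (N.contDiff_h.of_le hk') _
    obtain ⟨C0, hC0, b0⟩ := exists_abs_le_of_norm_le c0 16
    obtain ⟨C1, hC1, b1⟩ := exists_abs_le_of_norm_le c1 16
    obtain ⟨C2, hC2, b2⟩ := exists_abs_le_of_norm_le c2 16
    refine ⟨C0 + C1 + C2, by positivity, fun y hy => (b0 y hy).trans (by linarith),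
      fun y hy => ((le_abs_self _).trans (b1 y hy)).trans (by linarith), fun x p hx hp => ?_⟩
    have := iteratedDeriv_comp_line (N.contDiff_h.of_le hk') (0, p) (1, 0) x
    have e1 : ∀ x : ℝ, (0, p) + x • ((1, 0) : ℝ × (E × ℝ)) = (x, p) := fun x => by simp
    simp only [e1] at this
    rw [this]
    refine (b2 _ ?_).trans (by linarith)
    simp only [Prod.norm_def, Real.norm_eq_abs, sup_le_iff] at hp ⊢
    exact ⟨hx, hp⟩
  -- lower bound for the `m`-th derivative of `h`
  obtain ⟨ch, hch, ρh, hρh, hlow⟩ : ∃ c > 0, ∃ ρ > 0, ∀ (x : ℝ) (p : E × ℝ), |x| ≤ ρ → ‖p‖ ≤ ρ →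
      c ≤ |iteratedDeriv m (fun x => N.h (x, p)) x| := by
    have hk' : ((m : ℕ) : WithTop ℕ∞) ≤ (m + 5 : ℕ) := by norm_cast; omega
    have c2 : Continuous fun y => |iteratedFDeriv ℝ m N.h y fun _ => (1, 0)| :=
      (continuous_iteratedFDeriv_apply (N.contDiff_h.of_le hk') _).abs
    have hl : ∀ (x : ℝ) (p : E × ℝ), iteratedDeriv m (fun x => N.h (x, p)) x
        = iteratedFDeriv ℝ m N.h (x, p) fun _ => (1, 0) := fun x p => by
      have := iteratedDeriv_comp_line (N.contDiff_h.of_le hk') (0, p) (1, 0) x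
      have e1 : ∀ x : ℝ, (0, p) + x • ((1, 0) : ℝ × (E × ℝ)) = (x, p) := fun x => by simp
      simpa only [e1] using this
    have h0 : 0 < |iteratedFDeriv ℝ m N.h (0, 0) fun _ => (1, 0)| := by
      rw [← hl]; exact abs_pos.2 N.h_ne
    obtain ⟨ρ, hρ, hb⟩ := Metric.eventually_nhds_iff_ball.1
      (c2.continuousAt.eventually_const_lt (half_lt_self h0))
    refine ⟨_, half_pos h0, ρ / 2, half_pos hρ, fun x p hx hp => ?_⟩
    rw [hl]
    refine (hb (x, p) ?_).le
    rw [← Prod.zero_eq_mk, mem_ball_zero_iff, Prod.norm_mk]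
    exact max_lt (hx.trans_lt (half_lt_self hρ)) (hp.trans_lt (half_lt_self hρ))
  obtain ⟨c₁, hc₁, ρ₁, hρ₁, hlow1⟩ := N.exists_le_iteratedFDeriv_airyCurve he
  obtain ⟨Cm, hCm, a0, a1, -⟩ := hup m (by omega)
  obtain ⟨Cn, hCn, -, b1, b2⟩ := hup (m + 1) (by omega)
  obtain ⟨cI, hcI, hI⟩ := exists_oscBound_of_iteratedDeriv m hm
  obtain ⟨cII, hcII, hII⟩ := exists_oscBound_of_iteratedDeriv (m + 1) (by omega)
  refine ⟨ch / (4 * (Cm + 1)), by positivity, fun c' hc' hc'0 => ?_⟩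
  -- the size of the slope `|σ| / r²` above which the main term dominates
  set G : ℝ := 4 * (Cn / c') / c₁ + 1 with hG
  have hG1 : 1 ≤ G := by rw [hG]; linarith [show 0 ≤ 4 * (Cn / c') / c₁ by positivity]
  set ρ : ℝ := min (min 1 (min ρh ρ₁)) (min (ch / (4 * (Cm + 1) * (1 + c')))
    (min (c' / (2 * G ^ (m - 1))) (c₁ / (8 * (Cn + 1))))) with hρ
  have hρ0 : 0 < ρ := by positivity
  have hρ1 : ρ ≤ 1 := (min_le_left _ _).trans (min_le_left _ _)
  have hρ2 : ρ ≤ ρh := (min_le_left _ _).trans ((min_le_right _ _).trans (min_le_left _ _))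
  have hρ3 : ρ ≤ ρ₁ := (min_le_left _ _).trans ((min_le_right _ _).trans (min_le_right _ _))
  have hρ4 : ρ ≤ ch / (4 * (Cm + 1) * (1 + c')) := (min_le_right _ _).trans (min_le_left _ _)
  have hρ5 : ρ ≤ c' / (2 * G ^ (m - 1)) :=
    (min_le_right _ _).trans ((min_le_right _ _).trans (min_le_left _ _))
  have hρ6 : ρ ≤ c₁ / (8 * (Cn + 1)) :=
    (min_le_right _ _).trans ((min_le_right _ _).trans (min_le_right _ _))
  refine ⟨ρ, hρ0, cI * (ch / 2) ^ (-(1 : ℝ) / m)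
    + cII * (c₁ / 4) ^ (-(1 : ℝ) / ((m + 1 : ℕ) : ℝ)), by positivity, ?_⟩
  intro r t p a b lam hr hrρ ht hp hp2 hab hlam hx hU
  set s : ℝ := |p.2| with hs
  have hs0 : 0 < s := abs_pos.2 hp2
  have hsρ : s ≤ ρ := (le_max_right ‖p.1‖ ‖p.2‖).trans hp
  set g : ℝ := s / r ^ 2 with hg
  have hg0 : 0 < g := by positivity
  have habs : |p.2 / r ^ 2| = g := by rw [abs_div, abs_of_pos (by positivity : 0 < r ^ 2)]
  have habs3 : |p.2 / r ^ 3| = s / r ^ 3 := by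
    rw [abs_div, abs_of_pos (by positivity : 0 < r ^ 3)]
  have hnorm : ∀ x ∈ Icc a b, ∀ x', |x'| ≤ ρ →
      ‖(N.B p / r ^ 2 + p.2 / r ^ 2 * x, x', t, r, p)‖ ≤ 16 := by
    intro x hxx x' hx'
    have := hU x hxx
    have hU' : |N.B p / r ^ 2 + p.2 / r ^ 2 * x| ≤ 16 := abs_le.2 ⟨this.1, by linarith [this.2]⟩
    have hr' : |r| ≤ 16 := by rw [abs_of_pos hr]; linarith
    rw [Prod.norm_def, Prod.norm_def, Prod.norm_def, Prod.norm_def]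
    simp only [sup_le_iff, Real.norm_eq_abs]
    exact ⟨hU', by linarith, by linarith, hr', by linarith⟩
  -- the term with the factor `σ`
  have hT3 : ∀ k, ∀ C, 0 ≤ C → (∀ y, ‖y‖ ≤ 16 → ‖iteratedFDeriv ℝ k Q₁ y‖ ≤ C) → ∀ x ∈ Icc a b,
      |p.2 * iteratedFDeriv ℝ k Q₁ (N.B p / r ^ 2 + p.2 / r ^ 2 * x, x, t, r, p)
        fun _ => (p.2 / r ^ 2, 1, 0)| ≤ s * (C * (1 + g ^ k)) := by
    intro k C hC hb x hxx
    rw [abs_mul]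
    refine mul_le_mul_of_nonneg_left ?_ (abs_nonneg _)
    have h1 := (iteratedFDeriv ℝ k Q₁ (N.B p / r ^ 2 + p.2 / r ^ 2 * x, x, t, r, p)).le_opNorm
      fun _ => (p.2 / r ^ 2, 1, 0)
    have hv : ‖((p.2 / r ^ 2, 1, 0) : ℝ × ℝ × ℝ × ℝ × (E × ℝ))‖ = max g 1 := by
      simp only [Prod.norm_def, norm_zero, norm_one, Real.norm_eq_abs, habs]
      simp
    simp only [Finset.prod_const, Finset.card_univ, Fintype.card_fin, hv] at h1
    rw [Real.norm_eq_abs] at h1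
    refine h1.trans (mul_le_mul (hb _ (hnorm x hxx x (hx x hxx))) ?_ (by positivity) hC)
    rcases max_cases g 1 with ⟨h, -⟩ | ⟨h, -⟩ <;> rw [h]
    · linarith
    · rw [one_pow]; linarith [pow_pos hg0 k]
  have hr3 : r ^ 3 ≤ ρ := by
    calc r ^ 3 = r * r ^ 2 := by ring
      _ ≤ ρ * 1 := by
        gcongr
        exact pow_le_one₀ hr.le (hrρ.trans hρ1)
      _ = ρ := mul_one ρ
  obtain ⟨n, rfl⟩ : ∃ n, m = n + 2 := Nat.exists_eq_add_of_le' hm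
  simp only [show n + 2 - 1 = n + 1 by omega, show 2 * (n + 2) - 3 = 2 * n + 1 by omega] at *
  have hΛ : 0 < lam * r ^ 3 := by positivity
  constructor
  · intro hreg
    have hgm : g ^ (n + 2) ≤ c' * (s / r ^ 3) := by
      have e1 : g ^ (n + 2) = s / r ^ 3 * (s ^ (n + 1) / r ^ (2 * n + 1)) := by
        rw [hg, div_pow]; field_simp; ring
      rw [e1, mul_comm c']
      refine mul_le_mul_of_nonneg_left ?_ (by positivity)
      rwa [div_le_iff₀ (by positivity)]
    have hD : ∀ x ∈ Icc a b, lam * s * (ch / 2) ≤ |iteratedDeriv (n + 2) (fun x => lam * r ^ 3 *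
        N.scaled r (e * (airySqrt (N.B p / r ^ 2 + p.2 / r ^ 2 * x) + t)) x p) x| := by
      intro x hxx
      rw [iteratedDeriv_const_mul_field,
        (N.iteratedDeriv_scaled_airyCurve e r t p (by omega) x).2, abs_mul, abs_of_pos hΛ]
      have t1 := hlow x p ((hx x hxx).trans hρ2) (hp.trans hρ2)
      have t2 := a0 _ (hnorm x hxx 0 (by simpa using hρ0.le))
      have t3 := hT3 (n + 2) Cm hCm a1 x hxx
      set A := iteratedDeriv (n + 2) (fun x => N.h (x, p)) x
      set A' := iteratedFDeriv ℝ (n + 2) Q₀ (N.B p / r ^ 2 + p.2 / r ^ 2 * x, 0, t, r, p)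
        fun _ => (1, 0)
      set A'' := p.2 * iteratedFDeriv ℝ (n + 2) Q₁ (N.B p / r ^ 2 + p.2 / r ^ 2 * x, x, t, r, p)
        fun _ => (p.2 / r ^ 2, 1, 0)
      have u1 : s / r ^ 3 * ch ≤ |p.2 / r ^ 3 * A| := by
        rw [abs_mul, habs3]; gcongr
      have u2 : |(p.2 / r ^ 2) ^ (n + 2) * A'| ≤ s / r ^ 3 * (ch / 4) := by
        rw [abs_mul, abs_pow, habs]
        calc g ^ (n + 2) * |A'| ≤ c' * (s / r ^ 3) * Cm := by gcongr
          _ ≤ ch / (4 * (Cm + 1)) * (s / r ^ 3) * (Cm + 1) := by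
            gcongr
            linarith
          _ = s / r ^ 3 * (ch / 4) := by field_simp
      have u3 : |A''| ≤ s / r ^ 3 * (ch / 4) := by
        refine t3.trans ?_
        calc s * (Cm * (1 + g ^ (n + 2))) ≤ s * (Cm * (1 + c' * (s / r ^ 3))) := by gcongr
          _ = s / r ^ 3 * (Cm * (r ^ 3 + c' * s)) := by field_simp
          _ ≤ s / r ^ 3 * ((Cm + 1) * (ρ + c' * ρ)) := by
            gcongr
            linarith
          _ = s / r ^ 3 * ((Cm + 1) * (1 + c') * ρ) := by ring
          _ ≤ s / r ^ 3 * ((Cm + 1) * (1 + c') * (ch / (4 * (Cm + 1) * (1 + c')))) := by gcongr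
          _ = s / r ^ 3 * (ch / 4) := by field_simp
      have u4 : s / r ^ 3 * (ch / 2)
          ≤ |p.2 / r ^ 3 * A + ((p.2 / r ^ 2) ^ (n + 2) * A' + A'')| := by
        have v1 := abs_sub_abs_le_abs_sub (p.2 / r ^ 3 * A) (-((p.2 / r ^ 2) ^ (n + 2) * A' + A''))
        rw [abs_neg, sub_neg_eq_add] at v1
        have v2 := abs_add_le ((p.2 / r ^ 2) ^ (n + 2) * A') A''
        linarith
      calc lam * s * (ch / 2) = lam * r ^ 3 * (s / r ^ 3 * (ch / 2)) := by field_simp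
        _ ≤ _ := by gcongr
    have := hI _ a b _ (contDiff_const.mul
      (N.iteratedDeriv_scaled_airyCurve e r t p (by omega) 0).1) hab (by positivity) hD
    refine this.mono hab ?_
    rw [mul_comm (lam * s), Real.mul_rpow (by positivity) (by positivity), ← mul_assoc]
    gcongr
    linarith [show 0 ≤ cII * (c₁ / 4) ^ (-(1 : ℝ) / ((n + 2 + 1 : ℕ) : ℝ)) by positivity]
  · intro hreg
    have hgm : c' * (s / r ^ 3) ≤ g ^ (n + 2) := by
      have e1 : g ^ (n + 2) = s / r ^ 3 * (s ^ (n + 1) / r ^ (2 * n + 1)) := by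
        rw [hg, div_pow]; field_simp; ring
      rw [e1, mul_comm c']
      refine mul_le_mul_of_nonneg_left ?_ (by positivity)
      rwa [le_div_iff₀ (by positivity)]
    have hgG : G ≤ g := by
      by_contra! hlt
      have e1 : g ^ (n + 1) * r = s ^ (n + 1) / r ^ (2 * n + 1) := by
        rw [hg, div_pow]; field_simp; ring
      have e2 : c' ≤ g ^ (n + 1) * r := by
        rw [e1]; rwa [le_div_iff₀ (by positivity)]
      have e3 : g ^ (n + 1) * r ≤ G ^ (n + 1) * (c' / (2 * G ^ (n + 1))) := by
        gcongr
        exact hrρ.trans hρ5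
      have e4 : G ^ (n + 1) * (c' / (2 * G ^ (n + 1))) = c' / 2 := by
        have : 0 < G := by linarith
        field_simp
      linarith
    have hg1 : 1 ≤ g := hG1.trans hgG
    have hD : ∀ x ∈ Icc a b, lam * r ^ 3 * g ^ (n + 2 + 1) * (c₁ / 4)
        ≤ |iteratedDeriv (n + 2 + 1) (fun x => lam * r ^ 3 *
        N.scaled r (e * (airySqrt (N.B p / r ^ 2 + p.2 / r ^ 2 * x) + t)) x p) x| := by
      intro x hxx
      rw [iteratedDeriv_const_mul_field,
        (N.iteratedDeriv_scaled_airyCurve e r t p (by omega) x).2, abs_mul, abs_of_pos hΛ,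
        mul_assoc]
      have t1 := b2 x p ((hx x hxx).trans (by linarith)) (hp.trans (by linarith))
      have t2 := hlow1 _ (hU x hxx) (0, t, r, p) (by
        have hr' : |r| ≤ ρ₁ := by rw [abs_of_pos hr]; linarith
        rw [Prod.norm_def, Prod.norm_def, Prod.norm_def]
        simp only [sup_le_iff, Real.norm_eq_abs]
        exact ⟨by simpa using hρ₁.le, by linarith, hr', by linarith⟩)
      have t3 := hT3 (n + 2 + 1) Cn hCn b1 x hxx
      set A := iteratedDeriv (n + 2 + 1) (fun x => N.h (x, p)) x
      set A' := iteratedFDeriv ℝ (n + 2 + 1) Q₀ (N.B p / r ^ 2 + p.2 / r ^ 2 * x, 0, t, r, p)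
        fun _ => (1, 0)
      set A'' := p.2 * iteratedFDeriv ℝ (n + 2 + 1) Q₁
        (N.B p / r ^ 2 + p.2 / r ^ 2 * x, x, t, r, p) fun _ => (p.2 / r ^ 2, 1, 0)
      have u1 : |p.2 / r ^ 3 * A| ≤ g ^ (n + 2 + 1) * (c₁ / 4) := by
        rw [abs_mul, habs3]
        calc s / r ^ 3 * |A| ≤ s / r ^ 3 * Cn := by gcongr
          _ = c' * (s / r ^ 3) * (Cn / c') := by field_simp
          _ ≤ g ^ (n + 2) * (c₁ / 4 * G) := by
            gcongr
            rw [hG]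
            have : c₁ / 4 * (4 * (Cn / c') / c₁ + 1) = Cn / c' + c₁ / 4 := by field_simp
            linarith
          _ ≤ g ^ (n + 2) * (c₁ / 4 * g) := by gcongr
          _ = g ^ (n + 2 + 1) * (c₁ / 4) := by ring
      have u2 : g ^ (n + 2 + 1) * c₁ ≤ |(p.2 / r ^ 2) ^ (n + 2 + 1) * A'| := by
        rw [abs_mul, abs_pow, habs]
        gcongr
      have u3 : |A''| ≤ g ^ (n + 2 + 1) * (c₁ / 4) := by
        refine t3.trans ?_
        have h1g : 1 ≤ g ^ (n + 2 + 1) := one_le_pow₀ hg1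
        calc s * (Cn * (1 + g ^ (n + 2 + 1)))
            ≤ c₁ / (8 * (Cn + 1)) * ((Cn + 1) * (g ^ (n + 2 + 1) + g ^ (n + 2 + 1))) := by
              have := hsρ.trans hρ6
              gcongr
              linarith
          _ = g ^ (n + 2 + 1) * (c₁ / 4) := by field_simp; ring
      have u4 : g ^ (n + 2 + 1) * (c₁ / 4)
          ≤ |p.2 / r ^ 3 * A + ((p.2 / r ^ 2) ^ (n + 2 + 1) * A' + A'')| := by
        have v1 := abs_sub_abs_le_abs_sub ((p.2 / r ^ 2) ^ (n + 2 + 1) * A')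
          (-(p.2 / r ^ 3 * A + A''))
        rw [abs_neg, sub_neg_eq_add] at v1
        have v2 := abs_add_le (p.2 / r ^ 3 * A) A''
        have v3 : (p.2 / r ^ 2) ^ (n + 2 + 1) * A' + (p.2 / r ^ 3 * A + A'')
          = p.2 / r ^ 3 * A + ((p.2 / r ^ 2) ^ (n + 2 + 1) * A' + A'') := by ring
        rw [v3] at v1
        have v4 : 0 ≤ g ^ (n + 2 + 1) * c₁ := by positivity
        linarith
      gcongr
    have := hII _ a b _ (contDiff_const.mul
      (N.iteratedDeriv_scaled_airyCurve e r t p (by omega) 0).1) hab (by positivity) hD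
    refine this.mono hab ?_
    have e1 : (g ^ (n + 2 + 1)) ^ (-(1 : ℝ) / ((n + 2 + 1 : ℕ) : ℝ)) = g⁻¹ := by
      rw [← Real.rpow_natCast, ← Real.rpow_mul hg0.le, ← Real.rpow_neg_one]
      congr 1
      have : ((n + 2 + 1 : ℕ) : ℝ) ≠ 0 := by positivity
      field_simp
    rw [mul_comm _ (c₁ / 4), Real.mul_rpow (by positivity) (by positivity),
      Real.mul_rpow (by positivity) (by positivity), e1, ← mul_assoc]
    gcongr
    linarith [show 0 ≤ cI * (ch / 2) ^ (-(1 : ℝ) / ((n + 2 : ℕ) : ℝ)) by positivity]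

end AiryNormalForm
end

/-! ### Pieces on which `σ x + B` has a fixed size -/

theorem natCast_le_infty (n : ℕ) : (n : WithTop ℕ∞) ≤ ∞ := by exact_mod_cast le_top

theorem norm_prod_le_one {E : Type} [NormedAddCommGroup E] {s x : ℝ} {p : E × ℝ} (hs : |s| ≤ 1)
    (hx : |x| ≤ 1) (hp : ‖p‖ ≤ 1) :
    ‖(s, x, p)‖ ≤ 1 := by
  rw [Prod.norm_mk, Prod.norm_mk]
  exact max_le hs (max_le hx hp)

section

variable {E : Type} [NormedAddCommGroup E] [NormedSpace ℝ E]

theorem hasDerivAt_slice_snd {f : ℝ × ℝ × (E × ℝ) → ℂ} (hf : ContDiff ℝ 1 f) (s x : ℝ)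
    (p : E × ℝ) : HasDerivAt (fun x => f (s, x, p)) (fderiv ℝ f (s, x, p) (0, 1, 0)) x := by
  have h2 : HasDerivAt (fun x : ℝ => (s, x, p)) ((0, 1, 0) : ℝ × ℝ × (E × ℝ)) x :=
    (hasDerivAt_const x s).prodMk ((hasDerivAt_id x).prodMk (hasDerivAt_const x p))
  exact ((hf.differentiable (by simp)) _).hasFDerivAt.comp_hasDerivAt x h2

theorem hasDerivAt_slice_fst {f : ℝ × ℝ × (E × ℝ) → ℂ} (hf : ContDiff ℝ 1 f) (r z x : ℝ)
    (p : E × ℝ) :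
    HasDerivAt (fun z => f (r * z, x, p)) (r * fderiv ℝ f (r * z, x, p) (1, 0, 0)) z := by
  have h2 : HasDerivAt (fun z : ℝ => (r * z, x, p)) (r • ((1, 0, 0) : ℝ × ℝ × (E × ℝ))) z := by
    have h3 : HasDerivAt (fun z : ℝ => r * z) r z := by
      simpa using (hasDerivAt_id z).const_mul r
    have := h3.prodMk ((hasDerivAt_const z x).prodMk (hasDerivAt_const z p))
    simpa using this
  have := ((hf.differentiable (by simp)) _).hasFDerivAt.comp_hasDerivAt z h2
  rw [map_smul, Complex.real_smul] at this
  exact this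

theorem exists_norm_le_of_norm_le {Y F : Type*} [NormedAddCommGroup Y] [ProperSpace Y]
    [NormedAddCommGroup F] {f : Y → F} (hf : Continuous f) (R : ℝ) :
    ∃ C, 0 ≤ C ∧ ∀ y, ‖y‖ ≤ R → ‖f y‖ ≤ C := by
  obtain ⟨C, hC, h⟩ := exists_abs_le_of_norm_le hf.norm R
  exact ⟨C, hC, fun y hy => (le_abs_self _).trans (h y hy)⟩

/-- The factor `q(U + z²)` decays like `(1 + z²)⁻¹`, together with two derivatives, for bounded
`U`. -/
theorem exists_cutoff_quotient_bound {q χ : ℝ → ℝ} {Cq : ℝ} (hχ : ContDiff ℝ ∞ χ)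
    (h0 : ∀ y, |q y| * (1 + |y|) ≤ Cq) (h1 : ∀ y, |deriv q y| * (1 + |y|) ^ 2 ≤ Cq)
    (h2 : ∀ y, |deriv (deriv q) y| * (1 + |y|) ^ 2 ≤ Cq) :
    ∃ K, 0 ≤ K ∧ ∀ u z : ℝ, |u| ≤ 16 →
      |χ u * q (u + z ^ 2)| ≤ K * (1 + z ^ 2)⁻¹ ∧
      |deriv χ u * q (u + z ^ 2) + χ u * deriv q (u + z ^ 2)| ≤ K * (1 + z ^ 2)⁻¹ ∧
      |χ u * (deriv q (u + z ^ 2) * (2 * z))| ≤ K * (1 + z ^ 2)⁻¹ ∧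
      |deriv χ u * (deriv q (u + z ^ 2) * (2 * z))
        + χ u * (deriv (deriv q) (u + z ^ 2) * (2 * z))| ≤ K * (1 + z ^ 2)⁻¹ := by
  obtain ⟨A, hA, bA⟩ := exists_abs_le_of_norm_le hχ.continuous 16
  obtain ⟨A', hA', bA'⟩ := exists_abs_le_of_norm_le (hχ.continuous_deriv (by simp)) 16
  have hCq : 0 ≤ Cq := le_trans (by positivity) (h0 0)
  refine ⟨(A + A') * (2 * (289 * Cq)), by positivity, fun u z hu => ?_⟩
  have b0 := bA u (by simpa using hu)
  have b1 := bA' u (by simpa using hu)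
  set y := u + z ^ 2 with hy
  have hyz : 1 + z ^ 2 ≤ 17 * (1 + |y|) := by
    have h3 : z ^ 2 = y - u := by rw [hy]; ring
    have h4 := le_abs_self y
    have h5 := neg_le_of_abs_le hu
    have h6 := abs_nonneg y
    linarith
  have hz0 : 0 < 1 + z ^ 2 := by positivity
  have hy0 : 1 ≤ 1 + |y| := by linarith [abs_nonneg y]
  have hz2 : |2 * z| ≤ 1 + z ^ 2 := abs_le.2 ⟨by nlinarith [sq_nonneg (z + 1)],
    by nlinarith [sq_nonneg (z - 1)]⟩
  have c0 : |q y| ≤ 289 * Cq * (1 + z ^ 2)⁻¹ := by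
    rw [← div_eq_mul_inv, le_div_iff₀ hz0]
    have : |q y| * (1 + z ^ 2) ≤ |q y| * (17 * (1 + |y|)) := by gcongr
    linarith [h0 y]
  have gen : ∀ w : ℝ, |w| * (1 + |y|) ^ 2 ≤ Cq → |w| ≤ 289 * Cq * (1 + z ^ 2)⁻¹ ∧
      |w * (2 * z)| ≤ 289 * Cq * (1 + z ^ 2)⁻¹ := by
    intro w hw
    have e1 : |w| * (1 + z ^ 2) ^ 2 ≤ 289 * Cq := by
      calc |w| * (1 + z ^ 2) ^ 2 ≤ |w| * (17 * (1 + |y|)) ^ 2 := by gcongr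
        _ = 289 * (|w| * (1 + |y|) ^ 2) := by ring
        _ ≤ 289 * Cq := by gcongr
    rw [abs_mul, ← div_eq_mul_inv, le_div_iff₀ hz0, le_div_iff₀ hz0]
    constructor
    · refine le_trans ?_ e1
      have : 1 + z ^ 2 ≤ (1 + z ^ 2) ^ 2 := le_self_pow₀ (by linarith [sq_nonneg z]) (by norm_num)
      gcongr
    · calc |w| * |2 * z| * (1 + z ^ 2) ≤ |w| * (1 + z ^ 2) * (1 + z ^ 2) := by gcongr
        _ = |w| * (1 + z ^ 2) ^ 2 := by ring
        _ ≤ _ := e1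
  have c1 := gen _ (h1 y)
  have c2 := gen _ (h2 y)
  set K : ℝ := 289 * Cq * (1 + z ^ 2)⁻¹ with hK
  have hK0 : 0 ≤ K := by positivity
  have hKK : (A + A') * (2 * (289 * Cq)) * (1 + z ^ 2)⁻¹ = (A + A') * (2 * K) := by
    rw [hK]; ring
  rw [hKK]
  have prod1 : ∀ w, |w| ≤ K → |χ u * w| ≤ A * K := fun w hw => by
    rw [abs_mul]; gcongr
  have prod2 : ∀ w, |w| ≤ K → |deriv χ u * w| ≤ A' * K := fun w hw => by
    rw [abs_mul]; gcongr
  have n1 : 0 ≤ A * K := by positivity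
  have n2 : 0 ≤ A' * K := by positivity
  refine ⟨by linarith [prod1 _ c0], ?_, by linarith [prod1 _ c1.2], ?_⟩
  · have := abs_add_le (deriv χ u * q y) (χ u * deriv q y)
    linarith [prod2 _ c0, prod1 _ c1.1]
  · have := abs_add_le (deriv χ u * (deriv q y * (2 * z))) (χ u * (deriv (deriv q) y * (2 * z)))
    linarith [prod2 _ c1.2, prod1 _ c2.2]

namespace AiryNormalForm

variable {m : ℕ} (N : AiryNormalForm E m)

theorem W_zero_pos : 0 < N.W 0 := by
  have : N.W 0 = N.W₀ 0 := by simp [W, w₀, ← Prod.zero_eq_mk]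
  rw [this]
  exact N.W₀_pos

/-- A global inverse of the weight near `0`. -/
theorem exists_inv_W : ∃ V : ℝ × ℝ × (E × ℝ) → ℝ, ContDiff ℝ (m + 5 : ℕ) V ∧ ∃ ρ > 0,
    ∀ (s x : ℝ) (p : E × ℝ), |s| ≤ ρ → |x| ≤ ρ → ‖p‖ ≤ ρ → N.W (s, x, p) * V (s, x, p) = 1 := by
  have hpos := N.W_zero_pos
  obtain ⟨g, hg, hgpos, heq⟩ := exists_contDiff_pos (l := N.W 0 / 2) (u := 2 * N.W 0)
    (by linarith) (by linarith)
  have hev : ∀ᶠ y in nhds (0 : ℝ × ℝ × (E × ℝ)), N.W y ∈ Ioo (N.W 0 / 2) (2 * N.W 0) :=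
    N.contDiff_W.continuous.continuousAt.eventually
      (Ioo_mem_nhds (by linarith) (by linarith))
  obtain ⟨ρ, hρ, hb⟩ := Metric.eventually_nhds_iff_ball.1 hev
  refine ⟨fun y => (g (N.W y))⁻¹, ?_, ρ / 2, half_pos hρ, fun s x p hs hx hp => ?_⟩
  · exact ((hg.of_le (natCast_le_infty _)).comp N.contDiff_W).inv fun y => (hgpos _).ne'
  · have h1 := hb (s, x, p) (by
      rw [mem_ball_zero_iff, Prod.norm_mk, Prod.norm_mk]
      have := half_lt_self hρ
      exact max_lt (hs.trans_lt this) (max_lt (hx.trans_lt this) (hp.trans_lt this)))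
    dsimp only
    rw [heq _ ⟨h1.1.le, h1.2.le⟩]
    exact mul_inv_cancel₀ (by linarith [h1.1])

/-- Integration by parts in `z`, away from the critical points `z² = -U`, where `U = (B + σ x)/r²`.
Decay in `x` at fixed `z` is taken as a hypothesis. -/
theorem exists_norm_integral_nonstationary_le [FiniteDimensional ℝ E] {ρ : ℝ} (hρ : 0 < ρ)
    (hρ1 : ρ ≤ 1) {V : ℝ × ℝ × (E × ℝ) → ℝ} (hV : ContDiff ℝ (m + 5 : ℕ) V)
    (hWV : ∀ (s x : ℝ) (p : E × ℝ), |s| ≤ ρ → |x| ≤ ρ → ‖p‖ ≤ ρ → N.W (s, x, p) * V (s, x, p) = 1)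
    {A : ℝ × ℝ × (E × ℝ) → ℂ} (hA : ContDiff ℝ 2 A)
    (φ : ContDiffBump (0 : ℝ)) (hφ : φ.rOut < 1) {χ : ℝ → ℝ} (hχ : ContDiff ℝ ∞ χ)
    (hχ0 : ∀ u, 16 ≤ |u| → χ u = 0) :
    ∃ C, 0 ≤ C ∧ ∀ (lam r : ℝ) (p : E × ℝ) (K : ℝ), 0 < lam → 0 < r → r ≤ 1 → ‖p‖ ≤ ρ → 0 ≤ K →
      (∀ x, |x| ≤ ρ → A (ρ, x, p) = 0 ∧ A (-ρ, x, p) = 0) →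
      (∀ a b z : ℝ, -ρ ≤ a → a ≤ b → b ≤ ρ → |p.2 / r ^ 2| * (b - a) ≤ 32 → |r * z| ≤ ρ →
        OscBound (fun x => lam * r ^ 3 * N.scaled r z x p) a b K) →
      ‖∫ x in (-ρ)..ρ, ∫ z in (-(ρ / r))..(ρ / r),
        Complex.exp (Complex.I * ((lam * r ^ 3 * N.scaled r z x p : ℝ) : ℂ)) *
          (A (r * z, x, p) * ((χ (N.B p / r ^ 2 + p.2 / r ^ 2 * x) *
            (1 - φ (N.B p / r ^ 2 + p.2 / r ^ 2 * x + z ^ 2)) : ℝ) : ℂ))‖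
      ≤ C * ((lam * r ^ 3)⁻¹ * K) := by
  obtain ⟨q, Cq, hq, hq1, hq2, hq3, hq4⟩ := exists_quotient φ hφ
  obtain ⟨D, hD, hDb⟩ := exists_cutoff_quotient_bound hχ hq2 hq3 hq4
  -- the amplitude divided by the weight, and its derivatives
  set α : ℝ × ℝ × (E × ℝ) → ℂ := fun y => A y * (V y : ℂ) with hα
  have hαc : ContDiff ℝ 2 α := hA.mul (Complex.ofRealCLM.contDiff.comp
    (hV.of_le (by norm_cast; omega)))
  have hα1 : ContDiff ℝ 1 α := hαc.of_le (by norm_num)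
  set αs : ℝ × ℝ × (E × ℝ) → ℂ := fun y => fderiv ℝ α y (1, 0, 0) with hαs
  have hαsc : ContDiff ℝ 1 αs := by
    have : ContDiff ℝ 1 (fderiv ℝ α) := hαc.fderiv_right (by norm_num)
    exact this.clm_apply contDiff_const
  have hαx : Continuous fun y => fderiv ℝ α y (0, 1, 0) :=
    (hα1.continuous_fderiv (by simp)).clm_apply continuous_const
  have hαsx : Continuous fun y => fderiv ℝ αs y (0, 1, 0) :=
    (hαsc.continuous_fderiv (by simp)).clm_apply continuous_const
  obtain ⟨C0, hC0, bC0⟩ := exists_norm_le_of_norm_le hα1.continuous 1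
  obtain ⟨C1, hC1, bC1⟩ := exists_norm_le_of_norm_le hαx 1
  obtain ⟨C2, hC2, bC2⟩ := exists_norm_le_of_norm_le hαsc.continuous 1
  obtain ⟨C3, hC3, bC3⟩ := exists_norm_le_of_norm_le hαsx 1
  set M : ℝ := C0 + C1 + C2 + C3 with hM
  have hM0 : 0 ≤ M := by positivity
  refine ⟨2 * M * D * 35 * Real.pi, by have := Real.pi_pos; positivity, ?_⟩
  intro lam r p K hlam hr hr1 hp hK hA0 hosc
  have hΛ : 0 < lam * r ^ 3 := by positivity
  set β := N.B p / r ^ 2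
  set γ := p.2 / r ^ 2
  set f : ℝ → ℝ → ℂ := fun x z =>
    Complex.exp (Complex.I * ((lam * r ^ 3 * N.scaled r z x p : ℝ) : ℂ)) *
      (A (r * z, x, p) * ((χ (β + γ * x) * (1 - φ (β + γ * x + z ^ 2)) : ℝ) : ℂ)) with hf
  have hRHS : 0 ≤ 2 * M * D * 35 * Real.pi * ((lam * r ^ 3)⁻¹ * K) := by
    have := Real.pi_pos; positivity
  by_cases hex : ∃ x ∈ Icc (-ρ) ρ, β + γ * x ∈ Icc (-16 : ℝ) 16
  swap
  · rw [intervalIntegral_eq_zero (by linarith) fun x hx => ?_]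
    · simpa using hRHS
    · have : χ (β + γ * x) = 0 := hχ0 _ (by
        by_contra! h
        exact hex ⟨x, hx, abs_le.1 h.le⟩)
      simp [this]
  obtain ⟨a, b, ha, hab, hb, hiff, hlen⟩ := exists_interval_affine hex
  have hlen : |γ| * (b - a) ≤ 32 := by linarith
  rw [intervalIntegral_eq_of_eq_zero ha hab hb fun x hx hxab => ?_]
  swap
  · have : χ (β + γ * x) = 0 := hχ0 _ (by
      by_contra! h
      exact hxab ((hiff x hx).1 (abs_le.1 h.le)))
    simp [this]
  have hR : 0 < ρ / r := by positivity
  have hrz : ∀ z ∈ Icc (-(ρ / r)) (ρ / r), |r * z| ≤ ρ := fun z hz => by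
    rw [abs_mul, abs_of_pos hr]
    have := abs_le.2 hz
    rwa [le_div_iff₀ hr, mul_comm] at this
  have hxρ : ∀ x ∈ Icc a b, |x| ≤ ρ := fun x hx => abs_le.2 ⟨by linarith [hx.1], by linarith [hx.2]⟩
  have hqd : ∀ y, HasDerivAt q (deriv q y) y := fun y =>
    (hq.differentiable (by simp)).differentiableAt.hasDerivAt
  have hq' : ContDiff ℝ ∞ (deriv q) := hq.iterate_deriv 1
  have hqd' : ∀ y, HasDerivAt (deriv q) (deriv (deriv q) y) y := fun y =>
    (hq'.differentiable (by simp)).differentiableAt.hasDerivAt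
  have hχd : ∀ y, HasDerivAt χ (deriv χ y) y := fun y =>
    (hχ.differentiable (by simp)).differentiableAt.hasDerivAt
  have hqc := hq.continuous
  have hqc' := hq'.continuous
  have hqc'' := hq'.continuous_deriv (by simp)
  have hχc := hχ.continuous
  have hχc' := hχ.continuous_deriv (by simp)
  have hWc := N.contDiff_W.continuous
  have hαcc := hα1.continuous
  have hαscc := hαsc.continuous
  have hsc := N.continuous_scaled r p
  have key := norm_integral_integral_mul_deriv_le (Φ := fun z x => N.scaled r z x p)
    (Φt := fun z x => (β + γ * x + z ^ 2) * N.W (r * z, x, p))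
    (β := fun z x => α (r * z, x, p) * ((χ (β + γ * x) * q (β + γ * x + z ^ 2) : ℝ) : ℂ))
    (βt := fun z x => (r : ℂ) *
        (αs (r * z, x, p) * ((χ (β + γ * x) * q (β + γ * x + z ^ 2) : ℝ) : ℂ))
      + α (r * z, x, p) * ((χ (β + γ * x) * (deriv q (β + γ * x + z ^ 2) * (2 * z)) : ℝ) : ℂ))
    (τ₁ := -(ρ / r)) (τ₂ := ρ / r) (a := a) (b := b) (lam := lam * r ^ 3) (n₀ := 0)
    (n := fun z => 2 * M * D * 35 * K * (1 + z ^ 2)⁻¹) (by linarith) hab hΛ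
    (fun z _ x _ => N.hasDerivAt_scaled r z x p) ?_ (by fun_prop) (by fun_prop) (by fun_prop)
    (by fun_prop) ?_ ?_ ?_ ?_
  · -- the integrand has the form required for the integration by parts
    have e1 : ∫ x in a..b, ∫ z in (-(ρ / r))..(ρ / r), f x z
        = ∫ x in a..b, ∫ z in (-(ρ / r))..(ρ / r),
          Complex.exp (Complex.I * ((lam * r ^ 3 * N.scaled r z x p : ℝ) : ℂ)) *
          ((((β + γ * x + z ^ 2) * N.W (r * z, x, p) : ℝ) : ℂ) *
          (α (r * z, x, p) * ((χ (β + γ * x) * q (β + γ * x + z ^ 2) : ℝ) : ℂ))) := by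
      refine intervalIntegral.integral_congr fun x hx => ?_
      refine intervalIntegral.integral_congr fun z hz => ?_
      rw [uIcc_of_le hab] at hx
      rw [uIcc_of_le (by linarith)] at hz
      have h1 := hWV (r * z) x p (hrz z hz) (hxρ x hx) hp
      have h2 := hq1 (β + γ * x + z ^ 2)
      simp only [hf, hα]
      rw [← h2]
      have h3 : (N.W (r * z, x, p) : ℂ) * (V (r * z, x, p) : ℂ) = 1 := by exact_mod_cast h1
      push_cast
      linear_combination (-(Complex.exp (Complex.I * (lam * r ^ 3 * N.scaled r z x p)) *
        A (r * z, x, p) * χ (β + γ * x) * ((β + γ * x + z ^ 2) * q (β + γ * x + z ^ 2)))) * h3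
    rw [e1]
    refine key.trans ?_
    have e2 : ∫ z in (-(ρ / r))..(ρ / r), 2 * M * D * 35 * K * (1 + z ^ 2)⁻¹
        ≤ 2 * M * D * 35 * K * Real.pi := by
      rw [intervalIntegral.integral_const_mul, integral_inv_one_add_sq]
      have := Real.arctan_lt_pi_div_two (ρ / r)
      have := Real.neg_pi_div_two_lt_arctan (-(ρ / r))
      gcongr
      linarith
    calc (lam * r ^ 3)⁻¹ * (2 * 0 + ∫ z in (-(ρ / r))..(ρ / r), 2 * M * D * 35 * K * (1 + z ^ 2)⁻¹)
        ≤ (lam * r ^ 3)⁻¹ * (2 * 0 + 2 * M * D * 35 * K * Real.pi) := by gcongr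
      _ = _ := by ring
  · intro z _ x _
    have h1 : HasDerivAt (fun z : ℝ => β + γ * x + z ^ 2) (2 * z) z := by
      simpa using ((hasDerivAt_id z).pow 2).const_add (β + γ * x)
    have h2 := ((hqd _).comp z h1).const_mul (χ (β + γ * x))
    have h3 := (hasDerivAt_slice_fst hα1 r z x p).mul h2.ofReal_comp
    refine h3.congr_deriv ?_
    simp only [hαs, Function.comp_apply]
    ring
  · rw [intervalIntegral_eq_zero hab fun x hx => ?_, norm_zero]
    have : A (r * (-(ρ / r)), x, p) = 0 := by
      rw [mul_neg, mul_div_cancel₀ _ hr.ne']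
      exact (hA0 x (hxρ x hx)).2
    simp only [hα, this]
    simp
  · rw [intervalIntegral_eq_zero hab fun x hx => ?_, norm_zero]
    have : A (r * (ρ / r), x, p) = 0 := by
      rw [mul_div_cancel₀ _ hr.ne']
      exact (hA0 x (hxρ x hx)).1
    simp only [hα, this]
    simp
  · refine Continuous.intervalIntegrable ?_ _ _
    have : ∀ z : ℝ, 1 + z ^ 2 ≠ 0 := fun z => by positivity
    exact continuous_const.mul (Continuous.inv₀ (by fun_prop) this)
  · intro z hz
    have hO := hosc a b z ha hab hb hlen (hrz z hz)
    have hu : ∀ x ∈ Icc a b, |β + γ * x| ≤ 16 := fun x hx =>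
      abs_le.2 ((hiff x ⟨by linarith [hx.1], by linarith [hx.2]⟩).2 hx)
    have hy : ∀ x ∈ Icc a b, ‖(r * z, x, p)‖ ≤ 1 := fun x hx =>
      norm_prod_le_one ((hrz z hz).trans hρ1) ((hxρ x hx).trans hρ1) (hp.trans hρ1)
    have t1 := hO.norm_integral_mul_comp_affine_le hab (β := β) (γ := γ) (C := M)
      (D := D * (1 + z ^ 2)⁻¹)
      (α := fun x => αs (r * z, x, p)) (κ := fun u => χ u * q (u + z ^ 2))
      (κ' := fun u => deriv χ u * q (u + z ^ 2) + χ u * deriv q (u + z ^ 2))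
      (fun x => hasDerivAt_slice_snd hαsc (r * z) x p) (by fun_prop)
      (fun u => (hχd u).mul ((hqd _).comp_add_const u (z ^ 2))) (by fun_prop)
      (fun x hx => (bC2 _ (hy x hx)).trans (by linarith))
      (fun x hx => (bC3 _ (hy x hx)).trans (by linarith))
      (fun x hx => (hDb _ z (hu x hx)).1) (fun x hx => (hDb _ z (hu x hx)).2.1)
    have t2 := hO.norm_integral_mul_comp_affine_le hab (β := β) (γ := γ) (C := M)
      (D := D * (1 + z ^ 2)⁻¹)
      (α := fun x => α (r * z, x, p)) (κ := fun u => χ u * (deriv q (u + z ^ 2) * (2 * z)))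
      (κ' := fun u => deriv χ u * (deriv q (u + z ^ 2) * (2 * z))
        + χ u * (deriv (deriv q) (u + z ^ 2) * (2 * z)))
      (fun x => hasDerivAt_slice_snd hα1 (r * z) x p) (by fun_prop)
      (fun u => (hχd u).mul 
        (((hqd' _).comp_add_const u (z ^ 2)).mul_const (2 * z))) (by fun_prop)
      (fun x hx => (bC0 _ (hy x hx)).trans (by linarith))
      (fun x hx => (bC1 _ (hy x hx)).trans (by linarith))
      (fun x hx => (hDb _ z (hu x hx)).2.2.1) (fun x hx => (hDb _ z (hu x hx)).2.2.2)
    have hfac : 1 + (1 + |γ|) * (b - a) ≤ 35 := by linarith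
    have t0 : K * (M * (D * (1 + z ^ 2)⁻¹) * (1 + (1 + |γ|) * (b - a)))
        ≤ M * D * 35 * K * (1 + z ^ 2)⁻¹ := by
      calc K * (M * (D * (1 + z ^ 2)⁻¹) * (1 + (1 + |γ|) * (b - a)))
          ≤ K * (M * (D * (1 + z ^ 2)⁻¹) * 35) := by gcongr
        _ = _ := by ring
    simp_rw [mul_add]
    have hscz : Continuous fun x => N.scaled r z x p := by fun_prop
    rw [intervalIntegral.integral_add ((by fun_prop : Continuous _).intervalIntegrable _ _)
      ((by fun_prop : Continuous _).intervalIntegrable _ _)]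
    refine (norm_add_le _ _).trans ?_
    have e3 : ∀ x, Complex.exp (Complex.I * ((lam * r ^ 3 * N.scaled r z x p : ℝ) : ℂ)) *
        ((r : ℂ) * (αs (r * z, x, p) * ((χ (β + γ * x) * q (β + γ * x + z ^ 2) : ℝ) : ℂ)))
        = (r : ℂ) * (Complex.exp (Complex.I * ((lam * r ^ 3 * N.scaled r z x p : ℝ) : ℂ)) *
          (αs (r * z, x, p) * ((χ (β + γ * x) * q (β + γ * x + z ^ 2) : ℝ) : ℂ))) := fun x => by
      ring
    simp_rw [e3]
    rw [intervalIntegral.integral_const_mul, norm_mul, Complex.norm_real, Real.norm_of_nonneg hr.le]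
    refine (add_le_add ((mul_le_of_le_one_left (norm_nonneg _) hr1).trans (t1.trans t0))
      (t2.trans t0)).trans_eq (by ring)

end AiryNormalForm
end

/-! ### Pieces near the critical points -/

section

variable {E : Type} [NormedAddCommGroup E] [NormedSpace ℝ E]

theorem hasDerivAt_slice_third {f : ℝ × ℝ × ℝ × ℝ × (E × ℝ) → ℂ} (hf : ContDiff ℝ 1 f)
    (u x t r : ℝ) (p : E × ℝ) : HasDerivAt (fun t => f (u, x, t, r, p))
      (fderiv ℝ f (u, x, t, r, p) (0, 0, 1, 0)) t := by
  have h2 : HasDerivAt (fun t : ℝ => ((u, x, t, r, p) : ℝ × ℝ × ℝ × ℝ × (E × ℝ)))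
      (0, 0, 1, 0) t :=
    (hasDerivAt_const t u).prodMk ((hasDerivAt_const t x).prodMk ((hasDerivAt_id t).prodMk
      (hasDerivAt_const t (r, p))))
  exact ((hf.differentiable (by simp)) _).hasFDerivAt.comp_hasDerivAt t h2

namespace AiryNormalForm

variable {m : ℕ} (N : AiryNormalForm E m)

set_option maxHeartbeats 1000000 in
/-- Stationary phase in `z`, near the critical points `z² = -U`, where `U = (B + σ x)/r²`.
Decay in `x` along the curves `z = ± (√(-U) + t)` is taken as a hypothesis. -/
theorem exists_norm_integral_stationary_le [FiniteDimensional ℝ E] {ρ : ℝ}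
    (hρ1 : ρ ≤ 1) {V : ℝ × ℝ × (E × ℝ) → ℝ} (hV : ContDiff ℝ (m + 5 : ℕ) V)
    (hWV : ∀ (s x : ℝ) (p : E × ℝ), |s| ≤ ρ → |x| ≤ ρ → ‖p‖ ≤ ρ → N.W (s, x, p) * V (s, x, p) = 1)
    {A : ℝ × ℝ × (E × ℝ) → ℂ} (hA : ContDiff ℝ 2 A)
    (φ : ContDiffBump (0 : ℝ)) (hφ : φ.rOut < 1 / 2) {χ : ℝ → ℝ} (hχ : ContDiff ℝ ∞ χ)
    (hχ0 : ∀ u, 16 ≤ |u| → χ u = 0) (hχ1 : ∀ u, |u| ≤ 1 → χ u = 0) :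
    ∃ C, 0 ≤ C ∧ ∀ (lam r : ℝ) (p : E × ℝ) (K : ℝ), 0 < lam → 0 < r → 6 * r ≤ ρ → ‖p‖ ≤ ρ →
      0 ≤ K →
      (∀ e a b t : ℝ, (e = 1 ∨ e = -1) → -ρ ≤ a → a ≤ b → b ≤ ρ → |p.2 / r ^ 2| * (b - a) ≤ 32 →
        (∀ x ∈ Icc a b, N.B p / r ^ 2 + p.2 / r ^ 2 * x ∈ Icc (-16 : ℝ) (-1)) → |t| ≤ φ.rOut →
        OscBound (fun x => lam * r ^ 3 *
          N.scaled r (e * (airySqrt (N.B p / r ^ 2 + p.2 / r ^ 2 * x) + t)) x p) a b K) →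
      ‖∫ x in (-ρ)..ρ, ∫ z in (-(ρ / r))..(ρ / r),
        Complex.exp (Complex.I * ((lam * r ^ 3 * N.scaled r z x p : ℝ) : ℂ)) *
          (A (r * z, x, p) * ((χ (N.B p / r ^ 2 + p.2 / r ^ 2 * x) *
            φ (N.B p / r ^ 2 + p.2 / r ^ 2 * x + z ^ 2) : ℝ) : ℂ))‖
      ≤ C * ((lam * r ^ 3) ^ (-(1 / 2) : ℝ) * K) := by
  obtain ⟨gi, hgi, hgi1⟩ := exists_contDiff_inv
  set t₀ := φ.rOut with ht₀
  have ht₀0 : 0 < t₀ := φ.rOut_pos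
  have hsq := contDiff_airySqrt
  have hWc : ContDiff ℝ 2 N.W := N.contDiff_W.of_le (by norm_cast; omega)
  have hVc : ContDiff ℝ 2 V := hV.of_le (by norm_cast; omega)
  -- the second factor `Ef` of `∂ₜ scaled = t Ef` on the curves, and the amplitude divided by it,
  -- as functions of `y = (U, x, t, r, p)`
  set Ef : ℝ → ℝ × ℝ × ℝ × ℝ × (E × ℝ) → ℝ := fun e y =>
    e * (2 * airySqrt y.1 + y.2.2.1)
      * N.W (y.2.2.2.1 * (e * (airySqrt y.1 + y.2.2.1)), y.2.1, y.2.2.2.2) with hEf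
  set bf : ℝ → ℝ × ℝ × ℝ × ℝ × (E × ℝ) → ℂ := fun e y =>
    A (y.2.2.2.1 * (e * (airySqrt y.1 + y.2.2.1)), y.2.1, y.2.2.2.2) *
    ((V (y.2.2.2.1 * (e * (airySqrt y.1 + y.2.2.1)), y.2.1, y.2.2.2.2) *
      (χ y.1 * φ (y.2.2.1 * (2 * airySqrt y.1 + y.2.2.1)) *
      (e * gi (2 * airySqrt y.1 + y.2.2.1))) : ℝ) : ℂ) with hbf
  have hpt : ∀ e : ℝ, ContDiff ℝ 2 fun y : ℝ × ℝ × ℝ × ℝ × (E × ℝ) =>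
      (y.2.2.2.1 * (e * (airySqrt y.1 + y.2.2.1)), y.2.1, y.2.2.2.2) := by
    intro e
    have h1 : ContDiff ℝ 2 fun y : ℝ × ℝ × ℝ × ℝ × (E × ℝ) => airySqrt y.1 :=
      (hsq.of_le (natCast_le_infty 2)).comp contDiff_fst
    fun_prop
  have hlin : ContDiff ℝ 2 fun y : ℝ × ℝ × ℝ × ℝ × (E × ℝ) => 2 * airySqrt y.1 + y.2.2.1 := by
    have h1 : ContDiff ℝ 2 fun y : ℝ × ℝ × ℝ × ℝ × (E × ℝ) => airySqrt y.1 :=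
      (hsq.of_le (natCast_le_infty 2)).comp contDiff_fst
    fun_prop
  have hEfc : ∀ e, ContDiff ℝ 2 (Ef e) := fun e =>
    (contDiff_const.mul hlin).mul (hWc.comp (hpt e))
  have hbfc : ∀ e, ContDiff ℝ 2 (bf e) := fun e => by
    refine (hA.comp (hpt e)).mul (Complex.ofRealCLM.contDiff.comp
      ((hVc.comp (hpt e)).mul (ContDiff.mul (ContDiff.mul ?_ ?_) (contDiff_const.mul ?_))))
    · exact (hχ.of_le (natCast_le_infty 2)).comp contDiff_fst
    · exact (φ.contDiff (n := 2)).comp (ContDiff.mul (by fun_prop) hlin)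
    · exact (hgi.of_le (natCast_le_infty 2)).comp hlin
  set f₀ : ℝ → ℝ × ℝ × ℝ × ℝ × (E × ℝ) → ℂ := fun e y => (Ef e y : ℂ) * bf e y with hf₀
  have hf₀c : ∀ e, ContDiff ℝ 1 (f₀ e) := fun e =>
    ((Complex.ofRealCLM.contDiff.comp (hEfc e)).mul (hbfc e)).of_le (by norm_num)
  set f₂ : ℝ → ℝ × ℝ × ℝ × ℝ × (E × ℝ) → ℂ := fun e y =>
    fderiv ℝ (bf e) y (0, 0, 1, 0) with hf₂
  have hf₂c : ∀ e, ContDiff ℝ 1 (f₂ e) := fun e => by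
    have : ContDiff ℝ 1 (fderiv ℝ (bf e)) := (hbfc e).fderiv_right (by norm_num)
    exact this.clm_apply contDiff_const
  have hbf1 : ∀ e, ContDiff ℝ 1 (bf e) := fun e => (hbfc e).of_le (by norm_num)
  have hbd : ∀ f : ℝ × ℝ × ℝ × ℝ × (E × ℝ) → ℂ, ContDiff ℝ 1 f → ∃ C, 0 ≤ C ∧
      ∀ y, ‖y‖ ≤ 16 → ‖f y‖ ≤ C ∧ ‖fderiv ℝ f y‖ ≤ C := by
    intro f hf
    obtain ⟨C0, hC0, b0⟩ := exists_norm_le_of_norm_le hf.continuous 16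
    obtain ⟨C1, hC1, b1⟩ := exists_norm_le_of_norm_le (hf.continuous_fderiv (by simp)) 16
    exact ⟨C0 + C1, by positivity, fun y hy => ⟨(b0 y hy).trans (by linarith),
      (b1 y hy).trans (by linarith)⟩⟩
  have hCe : ∀ e : ℝ, ∃ C, 0 ≤ C ∧ ∀ y, ‖y‖ ≤ 16 → (‖f₀ e y‖ ≤ C ∧ ‖fderiv ℝ (f₀ e) y‖ ≤ C) ∧
      (‖bf e y‖ ≤ C ∧ ‖fderiv ℝ (bf e) y‖ ≤ C) ∧ (‖f₂ e y‖ ≤ C ∧ ‖fderiv ℝ (f₂ e) y‖ ≤ C) := by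
    intro e
    obtain ⟨c0, hc0, b0⟩ := hbd _ (hf₀c e)
    obtain ⟨c1, hc1, b1⟩ := hbd _ (hbf1 e)
    obtain ⟨c2, hc2, b2⟩ := hbd _ (hf₂c e)
    exact ⟨c0 + c1 + c2, by positivity, fun y hy =>
      ⟨⟨(b0 y hy).1.trans (by linarith), (b0 y hy).2.trans (by linarith)⟩,
      ⟨(b1 y hy).1.trans (by linarith), (b1 y hy).2.trans (by linarith)⟩,
      ⟨(b2 y hy).1.trans (by linarith), (b2 y hy).2.trans (by linarith)⟩⟩⟩
  obtain ⟨Cp, hCp, bp⟩ := hCe 1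
  obtain ⟨Cn, hCn, bn⟩ := hCe (-1)
  set M : ℝ := Cp + Cn with hM
  have hM0 : 0 ≤ M := by positivity
  have hMe : ∀ e : ℝ, e = 1 ∨ e = -1 → ∀ y, ‖y‖ ≤ 16 →
      (‖f₀ e y‖ ≤ M ∧ ‖fderiv ℝ (f₀ e) y‖ ≤ M) ∧
      (‖bf e y‖ ≤ M ∧ ‖fderiv ℝ (bf e) y‖ ≤ M) ∧ (‖f₂ e y‖ ≤ M ∧ ‖fderiv ℝ (f₂ e) y‖ ≤ M) := by
    rintro e (rfl | rfl) y hy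
    · have := bp y hy
      exact ⟨⟨this.1.1.trans (by linarith), this.1.2.trans (by linarith)⟩,
        ⟨this.2.1.1.trans (by linarith), this.2.1.2.trans (by linarith)⟩,
        ⟨this.2.2.1.trans (by linarith), this.2.2.2.trans (by linarith)⟩⟩
    · have := bn y hy
      exact ⟨⟨this.1.1.trans (by linarith), this.1.2.trans (by linarith)⟩,
        ⟨this.2.1.1.trans (by linarith), this.2.1.2.trans (by linarith)⟩,
        ⟨this.2.2.1.trans (by linarith), this.2.2.2.trans (by linarith)⟩⟩
  refine ⟨2 * ((8 + 2 * t₀) * (35 * M)), by positivity, ?_⟩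
  intro lam r p K hlam hr hr6 hp hK hosc
  have hΛ : 0 < lam * r ^ 3 := by positivity
  set β := N.B p / r ^ 2
  set γ := p.2 / r ^ 2
  set f : ℝ → ℝ → ℂ := fun x z =>
    Complex.exp (Complex.I * ((lam * r ^ 3 * N.scaled r z x p : ℝ) : ℂ)) *
      (A (r * z, x, p) * ((χ (β + γ * x) * φ (β + γ * x + z ^ 2) : ℝ) : ℂ)) with hf
  have hRHS : 0 ≤ 2 * ((8 + 2 * t₀) * (35 * M)) * ((lam * r ^ 3) ^ (-(1 / 2) : ℝ) * K) := by
    positivity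
  -- the product of the two cutoffs vanishes unless `-16 ≤ U ≤ -1`
  have hzero : ∀ u, u ∉ Icc (-16 : ℝ) (-1) → ∀ z : ℝ, χ u * φ (u + z ^ 2) = 0 := by
    intro u hu z
    by_cases h1 : 16 ≤ |u|
    · rw [hχ0 u h1, zero_mul]
    by_cases h2 : |u| ≤ 1
    · rw [hχ1 u h2, zero_mul]
    push Not at h1 h2
    have hu1 : 1 ≤ u := by
      by_contra! h3
      have h4 := abs_lt.1 h1
      rcases lt_abs.1 h2 with h | h
      · linarith
      · exact hu ⟨h4.1.le, by linarith⟩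
    rw [φ.zero_of_le_dist, mul_zero]
    rw [Real.dist_eq, sub_zero, abs_of_nonneg (by positivity)]
    nlinarith [sq_nonneg z]
  by_cases hex : ∃ x ∈ Icc (-ρ) ρ, β + γ * x ∈ Icc (-16 : ℝ) (-1)
  swap
  · rw [intervalIntegral_eq_zero (by linarith) fun x hx => ?_]
    · simpa using hRHS
    · simp [hzero (β + γ * x) fun h => hex ⟨x, hx, h⟩]
  obtain ⟨a, b, ha, hab, hb, hiff, hlen⟩ := exists_interval_affine hex
  have hlen : |γ| * (b - a) ≤ 32 := by linarith
  rw [intervalIntegral_eq_of_eq_zero ha hab hb fun x hx hxab => ?_]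
  swap
  · simp [hzero (β + γ * x) fun h => hxab ((hiff x hx).1 h)]
  have hxρ : ∀ x ∈ Icc a b, |x| ≤ ρ := fun x hx => abs_le.2 ⟨by linarith [hx.1], by linarith [hx.2]⟩
  have hU : ∀ x ∈ Icc a b, β + γ * x ∈ Icc (-16 : ℝ) (-1) := fun x hx =>
    (hiff x ⟨by linarith [hx.1], by linarith [hx.2]⟩).2 hx
  have hsqU : ∀ x ∈ Icc a b, airySqrt (β + γ * x) ^ 2 = -(β + γ * x) ∧
      1 ≤ airySqrt (β + γ * x) ∧ airySqrt (β + γ * x) ≤ 4 := by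
    intro x hx
    have h := hU x hx
    rw [airySqrt_eq ⟨by linarith [h.1], by linarith [h.2]⟩]
    refine ⟨Real.sq_sqrt (by linarith [h.2]), ?_, ?_⟩
    · rw [← Real.sqrt_one]; exact Real.sqrt_le_sqrt (by linarith [h.2])
    · rw [show (4 : ℝ) = √16 by rw [show (16 : ℝ) = 4 ^ 2 by norm_num]; simp]
      exact Real.sqrt_le_sqrt (by linarith [h.1])
  have hsc := N.continuous_scaled r p
  have hAc := hA.continuous
  have hχc := hχ.continuous
  have hφc : Continuous φ := φ.continuous
  have hsqc := hsq.continuous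
  have hsplit : ∫ x in a..b, ∫ z in (-(ρ / r))..(ρ / r), f x z
      = (∫ x in a..b, ∫ t in (-t₀)..t₀, f x (1 * (airySqrt (β + γ * x) + t)))
        + ∫ x in a..b, ∫ t in (-t₀)..t₀, f x (-1 * (airySqrt (β + γ * x) + t)) := by
    have hc : ∀ e : ℝ, Continuous fun x =>
        ∫ t in (-t₀)..t₀, f x (e * (airySqrt (β + γ * x) + t)) := by
      intro e
      refine intervalIntegral.continuous_parametric_intervalIntegral_of_continuous' ?_ _ _
      simp only [hf, Function.uncurry_def]
      fun_prop
    rw [← intervalIntegral.integral_add ((hc 1).intervalIntegrable _ _)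
      ((hc (-1)).intervalIntegrable _ _)]
    refine intervalIntegral.integral_congr fun x hx => ?_
    rw [uIcc_of_le hab] at hx
    obtain ⟨h1, h2, h3⟩ := hsqU x hx
    have hfc : Continuous (f x) := by
      simp only [hf]
      have : Continuous fun z => N.scaled r z x p := by fun_prop
      fun_prop
    rw [integral_eq_add_of_support hfc (w := airySqrt (β + γ * x)) (t₀ := t₀) h2 ht₀0 hφ]
    · simp only [one_mul, neg_one_mul]
    · rw [le_div_iff₀ hr]
      nlinarith
    · intro z hz
      have : φ (β + γ * x + z ^ 2) = 0 := by
        apply φ.zero_of_le_dist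
        rw [Real.dist_eq, sub_zero, show β + γ * x + z ^ 2 = z ^ 2 - airySqrt (β + γ * x) ^ 2 by
          rw [h1]; ring]
        exact hz
      simp [hf, this]
  rw [hsplit]
  have main : ∀ e : ℝ, e = 1 ∨ e = -1 →
      ‖∫ x in a..b, ∫ t in (-t₀)..t₀, f x (e * (airySqrt (β + γ * x) + t))‖
      ≤ (8 + 2 * t₀) * (35 * M * K * (lam * r ^ 3) ^ (-(1 / 2) : ℝ)) := by
    intro e he
    have he2 : e * e = 1 := by rcases he with rfl | rfl <;> norm_num
    set v : ℝ × ℝ × ℝ × ℝ × (E × ℝ) := (γ, 1, 0) with hv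
    have hl : ∀ t x : ℝ, ((β, 0, t, r, p) : ℝ × ℝ × ℝ × ℝ × (E × ℝ)) + x • v
        = (β + γ * x, x, t, r, p) := fun t x => by simp [hv, mul_comm]
    have hvn : ‖v‖ * (b - a) ≤ 34 := by
      have : ‖v‖ ≤ |γ| + 1 := by
        rw [hv, Prod.norm_mk, Prod.norm_mk]
        simp only [norm_one, norm_zero, Real.norm_eq_abs]
        refine max_le (by linarith) (max_le (by linarith [abs_nonneg γ])
          (by linarith [abs_nonneg γ]))
      calc ‖v‖ * (b - a) ≤ (|γ| + 1) * (b - a) := by gcongr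
        _ = |γ| * (b - a) + (b - a) := by ring
        _ ≤ 34 := by linarith
    have hyn : ∀ t ∈ Icc (-t₀) t₀, ∀ x ∈ Icc a b, ‖(β + γ * x, x, t, r, p)‖ ≤ 16 := by
      intro t ht x hx
      have hU' := hU x hx
      have ht' := abs_le.2 ht
      rw [Prod.norm_mk, Prod.norm_mk, Prod.norm_mk, Prod.norm_mk]
      simp only [Real.norm_eq_abs]
      refine max_le (abs_le.2 ⟨hU'.1, by linarith [hU'.2]⟩) (max_le (by linarith [hxρ x hx])
        (max_le (by linarith) (max_le ?_ (by linarith))))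
      rw [abs_of_pos hr]; linarith
    have hz2 : ∀ t, ∀ x ∈ Icc a b, β + γ * x + (e * (airySqrt (β + γ * x) + t)) ^ 2
        = t * (2 * airySqrt (β + γ * x) + t) := by
      intro t x hx
      have h1 := (hsqU x hx).1
      linear_combination (airySqrt (β + γ * x) + t) ^ 2 * he2 + h1
    have hgen : ∀ g : ℝ × ℝ × ℝ × ℝ × (E × ℝ) → ℂ, ContDiff ℝ 1 g →
        (∀ y, ‖y‖ ≤ 16 → ‖g y‖ ≤ M ∧ ‖fderiv ℝ g y‖ ≤ M) → ∀ t ∈ Icc (-t₀) t₀,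
        ‖∫ x in a..b, Complex.exp (Complex.I * ((lam * r ^ 3 *
          N.scaled r (e * (airySqrt (β + γ * x) + t)) x p : ℝ) : ℂ)) *
            g (β + γ * x, x, t, r, p)‖ ≤ 35 * M * K := by
      intro g hg hgM t ht
      have hO := hosc e a b t he ha hab hb hlen hU (abs_le.2 ht)
      have := hO.norm_integral_comp_line_le hab (C := M) hg (β, 0, t, r, p) v
        (fun x hx => by rw [hl]; exact (hgM _ (hyn t ht x hx)).1)
        (fun x hx => by rw [hl]; exact (hgM _ (hyn t ht x hx)).2)
      simp only [hl] at this
      refine this.trans ?_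
      calc K * (M * (1 + ‖v‖ * (b - a))) ≤ K * (M * 35) := by
            gcongr; linarith
        _ = _ := by ring
    have key := norm_integral_integral_stationary_le
      (Φ := fun t x => N.scaled r (e * (airySqrt (β + γ * x) + t)) x p)
      (E := fun t x => Ef e (β + γ * x, x, t, r, p))
      (β := fun t x => bf e (β + γ * x, x, t, r, p))
      (βt := fun t x => f₂ e (β + γ * x, x, t, r, p))
      (T := t₀) (a := a) (b := b) (lam := lam * r ^ 3) (M := 35 * M * K) ht₀0 hab hΛ ?_ ?_
      ?_ ?_ ?_ ?_ ?_ (hgen _ (hbf1 e) fun y hy => (hMe e he y hy).2.1)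
      (hgen _ (hf₂c e) fun y hy => (hMe e he y hy).2.2)
    · refine le_trans (le_of_eq ?_) key
      congr 1
      refine intervalIntegral.integral_congr fun x hx => ?_
      refine intervalIntegral.integral_congr fun t ht => ?_
      rw [uIcc_of_le hab] at hx
      rw [uIcc_of_le (by linarith)] at ht
      obtain ⟨h1, h2, h3⟩ := hsqU x hx
      simp only [hf, hEf, hbf]
      rw [hz2 t x hx]
      have h4 := hgi1 (2 * airySqrt (β + γ * x) + t) ⟨by linarith [ht.1], by linarith [ht.2]⟩
      have hs : |r * (e * (airySqrt (β + γ * x) + t))| ≤ ρ := by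
        have : |e| = 1 := by rcases he with rfl | rfl <;> norm_num
        rw [abs_mul, abs_mul, this, abs_of_pos hr, one_mul,
          abs_of_pos (by linarith [ht.1])]
        nlinarith [ht.2]
      have h5 := hWV _ x p hs (hxρ x hx) hp
      congr 1
      refine Eq.trans ?_ (mul_left_comm _ _ _)
      congr 1
      rw [← Complex.ofReal_mul]
      congr 1
      set c := χ (β + γ * x) * φ (t * (2 * airySqrt (β + γ * x) + t))
      set w := N.W (r * (e * (airySqrt (β + γ * x) + t)), x, p)
      set w' := V (r * (e * (airySqrt (β + γ * x) + t)), x, p)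
      set d := 2 * airySqrt (β + γ * x) + t
      linear_combination (-c * (e * e) * (d * gi d)) * h5 - c * (e * e) * h4 - c * he2
    · intro t ht x hx
      have h1 : HasDerivAt (fun t : ℝ => e * (airySqrt (β + γ * x) + t)) e t := by
        simpa using ((hasDerivAt_id t).const_add (airySqrt (β + γ * x))).const_mul e
      have h2 := (N.hasDerivAt_scaled r (e * (airySqrt (β + γ * x) + t)) x p).comp t h1
      refine h2.congr_deriv ?_
      have h3 := hz2 t x hx
      simp only [hEf]
      linear_combination (N.W (r * (e * (airySqrt (β + γ * x) + t)), x, p) * e) * h3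
    · exact fun t _ x _ => hasDerivAt_slice_third (hbf1 e) _ x t r p
    · fun_prop
    · have := (hEfc e).continuous
      fun_prop
    · have := (hbf1 e).continuous
      fun_prop
    · have := (hf₂c e).continuous
      fun_prop
    · exact hgen _ (hf₀c e) fun y hy => (hMe e he y hy).1
  calc _ ≤ _ := norm_add_le _ _
    _ ≤ (8 + 2 * t₀) * (35 * M * K * (lam * r ^ 3) ^ (-(1 / 2) : ℝ))
      + (8 + 2 * t₀) * (35 * M * K * (lam * r ^ 3) ^ (-(1 / 2) : ℝ)) :=
      add_le_add (main 1 (Or.inl rfl)) (main (-1) (Or.inr rfl))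
    _ = _ := by ring

end AiryNormalForm
end

/-! ### The estimate for phases in normal form -/

/-- Fubini's theorem, used to estimate the inner integral in the first variable. -/
theorem norm_integral_integral_le_of_forall {F : ℝ → ℝ → ℂ} {a b c d M : ℝ} (hcd : c ≤ d)
    (hF : Continuous fun q : ℝ × ℝ => F q.1 q.2)
    (h : ∀ z ∈ Icc c d, ‖∫ x in a..b, F x z‖ ≤ M) :
    ‖∫ x in a..b, ∫ z in c..d, F x z‖ ≤ M * (d - c) := by
  have hint : IntegrableOn (Function.uncurry F) (uIoc a b ×ˢ uIoc c d) volume := by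
    refine (ContinuousOn.integrableOn_compact (isCompact_uIcc.prod isCompact_uIcc)
      (hF.continuousOn (s := uIcc a b ×ˢ uIcc c d))).mono_set
      (prod_mono uIoc_subset_uIcc uIoc_subset_uIcc)
  rw [intervalIntegral_intervalIntegral_swap hint]
  refine (intervalIntegral.norm_integral_le_of_norm_le_const fun z hz => h z ?_).trans_eq ?_
  · rw [uIoc_of_le hcd] at hz
    exact ⟨hz.1.le, hz.2⟩
  · rw [abs_of_nonneg (by linarith)]

section

variable {E : Type} [NormedAddCommGroup E] [NormedSpace ℝ E]

namespace AiryNormalForm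

variable {m : ℕ} (N : AiryNormalForm E m)

/-- A bounded part of the `z`-line, without using oscillation in `z`. -/
theorem exists_norm_integral_bounded_le [FiniteDimensional ℝ E] {ρ : ℝ}
    (hρ1 : ρ ≤ 1) {A : ℝ × ℝ × (E × ℝ) → ℂ} (hA : ContDiff ℝ 2 A)
    (φ : ContDiffBump (0 : ℝ)) (hφ : φ.rOut < 1) {χ : ℝ → ℝ} (hχ : ContDiff ℝ ∞ χ)
    (hχ0 : ∀ u, 16 ≤ |u| → χ u = 0) :
    ∃ C, 0 ≤ C ∧ ∀ (lam r : ℝ) (p : E × ℝ) (K : ℝ), 0 < r → 6 * r ≤ ρ → ‖p‖ ≤ ρ → 0 ≤ K →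
      (∀ a b z : ℝ, -ρ ≤ a → a ≤ b → b ≤ ρ → |p.2 / r ^ 2| * (b - a) ≤ 32 → |r * z| ≤ ρ →
        OscBound (fun x => lam * r ^ 3 * N.scaled r z x p) a b K) →
      ‖∫ x in (-ρ)..ρ, ∫ z in (-(ρ / r))..(ρ / r),
        Complex.exp (Complex.I * ((lam * r ^ 3 * N.scaled r z x p : ℝ) : ℂ)) *
          (A (r * z, x, p) * ((χ (N.B p / r ^ 2 + p.2 / r ^ 2 * x) *
            φ (N.B p / r ^ 2 + p.2 / r ^ 2 * x + z ^ 2) : ℝ) : ℂ))‖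
      ≤ C * K := by
  have hA1 : ContDiff ℝ 1 A := hA.of_le (by norm_num)
  have hAx : Continuous fun y => fderiv ℝ A y (0, 1, 0) :=
    (hA1.continuous_fderiv (by simp)).clm_apply continuous_const
  obtain ⟨C0, hC0, bC0⟩ := exists_norm_le_of_norm_le hA1.continuous 1
  obtain ⟨C1, hC1, bC1⟩ := exists_norm_le_of_norm_le hAx 1
  have hφs : ContDiff ℝ ∞ φ := φ.contDiff
  have hχc := hχ.continuous
  have hφc := hφs.continuous
  have hχc' := hχ.continuous_deriv (by simp)
  have hφc' := hφs.continuous_deriv (by simp)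
  have hχd : ∀ y, HasDerivAt χ (deriv χ y) y := fun y =>
    (hχ.differentiable (by simp)).differentiableAt.hasDerivAt
  have hφd : ∀ y, HasDerivAt φ (deriv φ y) y := fun y =>
    (hφs.differentiable (by simp)).differentiableAt.hasDerivAt
  obtain ⟨D0, hD0, bD0⟩ := exists_abs_le_of_norm_le
    (f := fun y : ℝ × ℝ => χ y.1 * φ (y.1 + y.2 ^ 2)) (by fun_prop) 16
  obtain ⟨D1, hD1, bD1⟩ := exists_abs_le_of_norm_le
    (f := fun y : ℝ × ℝ => deriv χ y.1 * φ (y.1 + y.2 ^ 2) + χ y.1 * deriv φ (y.1 + y.2 ^ 2))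
    (by fun_prop) 16
  refine ⟨(C0 + C1) * (D0 + D1) * 35 * (5 - -5), by positivity, ?_⟩
  intro lam r p K hr hr6 hp hK hosc
  set β := N.B p / r ^ 2
  set γ := p.2 / r ^ 2
  set f : ℝ → ℝ → ℂ := fun x z =>
    Complex.exp (Complex.I * ((lam * r ^ 3 * N.scaled r z x p : ℝ) : ℂ)) *
      (A (r * z, x, p) * ((χ (β + γ * x) * φ (β + γ * x + z ^ 2) : ℝ) : ℂ)) with hf
  have hRHS : 0 ≤ (C0 + C1) * (D0 + D1) * 35 * (5 - -5) * K := by positivity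
  by_cases hex : ∃ x ∈ Icc (-ρ) ρ, β + γ * x ∈ Icc (-16 : ℝ) 16
  swap
  · rw [intervalIntegral_eq_zero (by linarith) fun x hx => ?_]
    · simpa using hRHS
    · have : χ (β + γ * x) = 0 := hχ0 _ (by
        by_contra! h
        exact hex ⟨x, hx, abs_le.1 h.le⟩)
      simp [this]
  obtain ⟨a, b, ha, hab, hb, hiff, hlen⟩ := exists_interval_affine hex
  have hlen : |γ| * (b - a) ≤ 32 := by linarith
  rw [intervalIntegral_eq_of_eq_zero ha hab hb fun x hx hxab => ?_]
  swap
  · have : χ (β + γ * x) = 0 := hχ0 _ (by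
      by_contra! h
      exact hxab ((hiff x hx).1 (abs_le.1 h.le)))
    simp [this]
  have hxρ : ∀ x ∈ Icc a b, |x| ≤ ρ := fun x hx => abs_le.2 ⟨by linarith [hx.1], by linarith [hx.2]⟩
  have hu : ∀ x ∈ Icc a b, |β + γ * x| ≤ 16 := fun x hx =>
    abs_le.2 ((hiff x ⟨by linarith [hx.1], by linarith [hx.2]⟩).2 hx)
  have hR : 6 ≤ ρ / r := by rwa [le_div_iff₀ hr]
  have hcut : ∫ x in a..b, ∫ z in (-(ρ / r))..(ρ / r), f x z
      = ∫ x in a..b, ∫ z in (-5 : ℝ)..5, f x z := by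
    refine intervalIntegral.integral_congr fun x hx => ?_
    rw [uIcc_of_le hab] at hx
    refine intervalIntegral_eq_of_eq_zero (by linarith) (by norm_num) (by linarith) fun z _ hz => ?_
    have h1 : φ (β + γ * x + z ^ 2) = 0 := by
      apply φ.zero_of_le_dist
      rw [Real.dist_eq, sub_zero]
      refine le_trans ?_ (le_abs_self _)
      have h2 := (abs_le.1 (hu x hx)).1
      have h3 : 25 ≤ z ^ 2 := by
        by_contra! h
        exact hz (abs_le.1 (abs_le_of_sq_le_sq (by linarith : z ^ 2 ≤ 5 ^ 2) (by norm_num)))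
      linarith
    simp [hf, h1]
  rw [hcut]
  have hsc := N.continuous_scaled r p
  have hAc := hA.continuous
  refine (norm_integral_integral_le_of_forall (M := (C0 + C1) * (D0 + D1) * 35 * K) (by norm_num)
    ?_ fun z hz => ?_).trans_eq (by ring)
  · simp only [hf]
    fun_prop
  · have hz5 : |z| ≤ 5 := abs_le.2 hz
    have hrz : |r * z| ≤ ρ := by
      rw [abs_mul, abs_of_pos hr]
      nlinarith
    have hO := hosc a b z ha hab hb hlen hrz
    have hy : ∀ x ∈ Icc a b, ‖(r * z, x, p)‖ ≤ 1 := fun x hx =>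
      norm_prod_le_one (hrz.trans hρ1) ((hxρ x hx).trans hρ1) (hp.trans hρ1)
    have hw : ∀ x ∈ Icc a b, ‖((β + γ * x, z) : ℝ × ℝ)‖ ≤ 16 := fun x hx => by
      rw [Prod.norm_mk]
      exact max_le (hu x hx) (by rw [Real.norm_eq_abs]; linarith)
    have := hO.norm_integral_mul_comp_affine_le hab (β := β) (γ := γ) (C := C0 + C1)
      (D := D0 + D1) (α := fun x => A (r * z, x, p)) (κ := fun u => χ u * φ (u + z ^ 2))
      (κ' := fun u => deriv χ u * φ (u + z ^ 2) + χ u * deriv φ (u + z ^ 2))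
      (fun x => hasDerivAt_slice_snd hA1 (r * z) x p) (by fun_prop)
      (fun u => (hχd u).mul ((hφd _).comp_add_const u (z ^ 2))) (by fun_prop)
      (fun x hx => (bC0 _ (hy x hx)).trans (by linarith))
      (fun x hx => (bC1 _ (hy x hx)).trans (by linarith))
      (fun x hx => (bD0 _ (hw x hx)).trans (by linarith))
      (fun x hx => (bD1 _ (hw x hx)).trans (by linarith))
    refine this.trans ?_
    calc K * ((C0 + C1) * (D0 + D1) * (1 + (1 + |γ|) * (b - a)))
        ≤ K * ((C0 + C1) * (D0 + D1) * 35) := by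
          gcongr
          linarith
      _ = _ := by ring

/-- For each scale `r` there are decay rates in `x`, `Ks` on the critical curves and `Kn` for fixed
`z`, which are good enough compared to `airyRhs`. They are trivial for `lam σ ≤ 1`; when
`r ^ (2 m - 3) ≲ σ ^ (m - 1)`, the rate `Kn` only uses the bound `32 r² / σ` for the length of the
interval. -/
theorem exists_oscBound_scaled [FiniteDimensional ℝ E] :
    ∃ ρ > 0, ρ ≤ 1 ∧ ∃ C, 0 ≤ C ∧ ∀ (lam r : ℝ) (p : E × ℝ), 0 < lam → 0 < r → r ≤ ρ →
      1 ≤ lam * r ^ 3 → ‖p‖ ≤ ρ → p.2 ≠ 0 → ∃ Ks Kn, 0 ≤ Ks ∧ 0 ≤ Kn ∧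
      (∀ e a b t : ℝ, (e = 1 ∨ e = -1) → -ρ ≤ a → a ≤ b → b ≤ ρ → |p.2 / r ^ 2| * (b - a) ≤ 32 →
        (∀ x ∈ Icc a b, N.B p / r ^ 2 + p.2 / r ^ 2 * x ∈ Icc (-16 : ℝ) (-1)) → |t| ≤ ρ →
        OscBound (fun x => lam * r ^ 3 *
          N.scaled r (e * (airySqrt (N.B p / r ^ 2 + p.2 / r ^ 2 * x) + t)) x p) a b Ks) ∧
      (∀ a b z : ℝ, -ρ ≤ a → a ≤ b → b ≤ ρ → |p.2 / r ^ 2| * (b - a) ≤ 32 → |r * z| ≤ ρ →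
        OscBound (fun x => lam * r ^ 3 * N.scaled r z x p) a b Kn) ∧
      r * ((lam * r ^ 3) ^ (-(1 / 2) : ℝ) * Ks + (lam * r ^ 3)⁻¹ * Kn)
        ≤ C * (airyRhs m lam |p.2| * (lam * r ^ 3) ^ (-airyEps m)) := by
  have hm := N.two_le
  obtain ⟨c₁, hc₁, h₁⟩ := N.exists_oscBound_airyCurve (e := 1) (Or.inl rfl)
  obtain ⟨c₂, hc₂, h₂⟩ := N.exists_oscBound_airyCurve (e := -1) (Or.inr rfl)
  set c' : ℝ := min c₁ c₂ with hc'
  have hc'0 : 0 < c' := by positivity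
  obtain ⟨ρ₁, hρ₁, C₁, hC₁, h₁⟩ := h₁ c' hc'0 (min_le_left _ _)
  obtain ⟨ρ₂, hρ₂, C₂, hC₂, h₂⟩ := h₂ c' hc'0 (min_le_right _ _)
  obtain ⟨cd, hcd, ρ₃, hρ₃, h₃⟩ := N.exists_le_iteratedDeriv_phase
  obtain ⟨cv, hcv, hvdc⟩ := exists_oscBound_of_iteratedDeriv m hm
  set C₃ : ℝ := cv * cd ^ (-(1 : ℝ) / m) with hC₃
  have hC₃0 : 0 ≤ C₃ := by positivity
  set K₁ : ℝ := max 1 c' with hK₁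
  set K₂ : ℝ := max 1 c'⁻¹ with hK₂
  have hK₁1 : 1 ≤ K₁ := le_max_left _ _
  have hK₂1 : 1 ≤ K₂ := le_max_left _ _
  set ρ : ℝ := min (min 1 ρ₁) (min ρ₂ ρ₃) with hρ
  have hρ0 : 0 < ρ := by positivity
  have hρ1 : ρ ≤ 1 := (min_le_left _ _).trans (min_le_left _ _)
  have hρρ₁ : ρ ≤ ρ₁ := (min_le_left _ _).trans (min_le_right _ _)
  have hρρ₂ : ρ ≤ ρ₂ := (min_le_right _ _).trans (min_le_left _ _)
  have hρρ₃ : ρ ≤ ρ₃ := (min_le_right _ _).trans (min_le_right _ _)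
  refine ⟨ρ, hρ0, hρ1, 4 + (C₁ + C₂ + C₃) * K₁ + (C₁ + C₂ + 32) * K₂ ^ 2, by positivity, ?_⟩
  intro lam r p hlam hr hrρ hΛ1 hp hp2
  have hΛ : 0 < lam * r ^ 3 := by positivity
  set s : ℝ := |p.2| with hs
  have hs0 : 0 < s := abs_pos.2 hp2
  have hs1 : s ≤ 1 := ((le_max_right ‖p.1‖ ‖p.2‖).trans hp).trans hρ1
  have hR := airyRhs_pos (m := m) hlam hs0
  set T : ℝ := airyRhs m lam s * (lam * r ^ 3) ^ (-airyEps m) with hT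
  have hT0 : 0 < T := by positivity
  set Λ2 : ℝ := (lam * r ^ 3) ^ (-(1 / 2) : ℝ) with hΛ2
  have hΛ20 : 0 < Λ2 := by positivity
  have hinv : (lam * r ^ 3)⁻¹ ≤ Λ2 := by
    rw [hΛ2, ← Real.rpow_neg_one]
    exact Real.rpow_le_rpow_of_exponent_le hΛ1 (by norm_num)
  have hxρ : ∀ {a b : ℝ}, -ρ ≤ a → b ≤ ρ → ∀ x ∈ Icc a b, |x| ≤ ρ := fun ha hb x hx =>
    abs_le.2 ⟨by linarith [hx.1], by linarith [hx.2]⟩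
  rcases le_total (lam * s) 1 with hls | hls
  · refine ⟨2, 2, by norm_num, by norm_num, fun e a b t _ ha hab hb _ _ _ =>
      (oscBound_length hab).mono hab (by linarith), fun a b z ha hab hb _ _ =>
      (oscBound_length hab).mono hab (by linarith), ?_⟩
    have := le_airyRhs_of_le hm hlam hs0 hs1 hr hΛ1 hls
    calc r * (Λ2 * 2 + (lam * r ^ 3)⁻¹ * 2) ≤ r * (Λ2 * 2 + Λ2 * 2) := by gcongr
      _ = 4 * (r * Λ2) := by ring
      _ ≤ 4 * T := by gcongr
      _ ≤ _ := by
        gcongr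
        have : 0 ≤ (C₁ + C₂ + C₃) * K₁ := by positivity
        have : 0 ≤ (C₁ + C₂ + 32) * K₂ ^ 2 := by positivity
        linarith
  rcases le_total (s ^ (m - 1)) (c' * r ^ (2 * m - 3)) with hreg | hreg
  · set L : ℝ := (lam * s) ^ (-(1 : ℝ) / m) with hL
    have hL0 : 0 < L := by positivity
    refine ⟨(C₁ + C₂) * L, C₃ * L, by positivity, by positivity, ?_, ?_, ?_⟩
    · rintro e a b t (rfl | rfl) ha hab hb - hU ht
      · refine OscBound.mono ((h₁ r t p a b lam hr (hrρ.trans hρρ₁) (ht.trans hρρ₁) (hp.trans hρρ₁)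
          hp2 hab hlam (fun x hx => (hxρ ha hb x hx).trans hρρ₁) hU).1 hreg) hab ?_
        gcongr
        linarith
      · refine OscBound.mono ((h₂ r t p a b lam hr (hrρ.trans hρρ₂) (ht.trans hρρ₂) (hp.trans hρρ₂)
          hp2 hab hlam (fun x hx => (hxρ ha hb x hx).trans hρρ₂) hU).1 hreg) hab ?_
        gcongr
        linarith
    · intro a b z ha hab hb _ hz
      have hph : (fun x => lam * r ^ 3 * N.scaled r z x p)
          = fun x => lam * N.phase (r * z) x p := by
        funext x
        rw [mul_assoc, N.scaled_eq hr]
      rw [hph]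
      have hcp : ContDiff ℝ m fun x => N.phase (r * z) x p := by
        have h1 : ContDiff ℝ m (airyPrim N.W) :=
          (contDiff_airyPrim N.contDiff_W).of_le (by norm_cast; omega)
        have h2 : ContDiff ℝ m N.h := N.contDiff_h.of_le (by norm_cast; omega)
        unfold phase
        refine ContDiff.add (contDiff_const.mul (h2.comp (by fun_prop)))
          (h1.comp (f := fun x : ℝ => (r * z, N.B p + p.2 * x, x, (1 : ℝ), p)) (by fun_prop))
      have := hvdc (fun x => lam * N.phase (r * z) x p) a b (cd * (lam * s))
        (contDiff_const.mul hcp) hab (by positivity) fun x hx => by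
          rw [iteratedDeriv_const_mul_field, abs_mul, abs_of_pos hlam]
          have := h₃ (r * z) x p (hz.trans hρρ₃) ((hxρ ha hb x hx).trans hρρ₃) (hp.trans hρρ₃)
          calc cd * (lam * s) = lam * (cd * s) := by ring
            _ ≤ _ := by gcongr
      rwa [Real.mul_rpow hcd.le (by positivity), ← mul_assoc] at this
    · have := le_airyRhs_of_outer hm hK₁1 hlam hs0 hs1 hr hΛ1 hls (hreg.trans (by
        gcongr
        exact le_max_right _ _))
      calc r * (Λ2 * ((C₁ + C₂) * L) + (lam * r ^ 3)⁻¹ * (C₃ * L))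
          ≤ r * (Λ2 * ((C₁ + C₂) * L) + Λ2 * (C₃ * L)) := by gcongr
        _ = (C₁ + C₂ + C₃) * (r * Λ2 * L) := by ring
        _ ≤ (C₁ + C₂ + C₃) * (K₁ * T) := by gcongr
        _ = (C₁ + C₂ + C₃) * K₁ * T := by ring
        _ ≤ _ := by
          gcongr
          have : 0 ≤ (C₁ + C₂ + 32) * K₂ ^ 2 := by positivity
          linarith
  · set L : ℝ := (lam * r ^ 3) ^ (-(1 : ℝ) / ((m + 1 : ℕ) : ℝ)) with hL
    have hL0 : 0 < L := by positivity
    set g : ℝ := s / r ^ 2 with hg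
    have hg0 : 0 < g := by positivity
    have habs : |p.2 / r ^ 2| = g := by rw [abs_div, abs_of_pos (by positivity : 0 < r ^ 2)]
    refine ⟨(C₁ + C₂) * (L * g⁻¹), 32 * g⁻¹, by positivity, by positivity, ?_, ?_, ?_⟩
    · rintro e a b t (rfl | rfl) ha hab hb - hU ht
      · refine OscBound.mono ((h₁ r t p a b lam hr (hrρ.trans hρρ₁) (ht.trans hρρ₁) (hp.trans hρρ₁)
          hp2 hab hlam (fun x hx => (hxρ ha hb x hx).trans hρρ₁) hU).2 hreg) hab ?_
        gcongr
        linarith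
      · refine OscBound.mono ((h₂ r t p a b lam hr (hrρ.trans hρρ₂) (ht.trans hρρ₂) (hp.trans hρρ₂)
          hp2 hab hlam (fun x hx => (hxρ ha hb x hx).trans hρρ₂) hU).2 hreg) hab ?_
        gcongr
        linarith
    · intro a b z ha hab hb hl _
      refine (oscBound_length hab).mono hab ?_
      rw [habs] at hl
      rw [← div_eq_mul_inv, le_div_iff₀ hg0]
      linarith
    · have hreg' : r ^ (2 * m - 3) ≤ K₂ * s ^ (m - 1) := by
        calc r ^ (2 * m - 3) = c'⁻¹ * (c' * r ^ (2 * m - 3)) := by field_simp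
          _ ≤ K₂ * s ^ (m - 1) := by
            gcongr
            exact le_max_right _ _
      have := le_airyRhs_of_inner hm hK₂1 hlam hs0 hs1 hr hΛ1 hreg'
      have hinv2 : (lam * r ^ 3)⁻¹ ≤ Λ2 * L := by
        rw [hΛ2, hL, ← Real.rpow_add hΛ, ← Real.rpow_neg_one]
        refine Real.rpow_le_rpow_of_exponent_le hΛ1 ?_
        have hm1 : (2 : ℝ) ≤ ((m + 1 : ℕ) : ℝ) := by norm_cast; omega
        rw [neg_div]
        have : 1 / ((m + 1 : ℕ) : ℝ) ≤ 1 / 2 := one_div_le_one_div_of_le (by norm_num) hm1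
        linarith
      calc r * (Λ2 * ((C₁ + C₂) * (L * g⁻¹)) + (lam * r ^ 3)⁻¹ * (32 * g⁻¹))
          ≤ r * (Λ2 * ((C₁ + C₂) * (L * g⁻¹)) + Λ2 * L * (32 * g⁻¹)) := by gcongr
        _ = (C₁ + C₂ + 32) * (r * Λ2 * (L * g⁻¹)) := by ring
        _ ≤ (C₁ + C₂ + 32) * (K₂ ^ 2 * T) := by gcongr
        _ = (C₁ + C₂ + 32) * K₂ ^ 2 * T := by ring
        _ ≤ _ := by
          gcongr
          have : 0 ≤ (C₁ + C₂ + C₃) * K₁ := by positivity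
          linarith

/-- The substitution `s = r z`. -/
theorem integral_integral_phase_eq {lam r ρ : ℝ} (hr : 0 < r) (A : ℝ × ℝ × (E × ℝ) → ℂ) (g : ℝ → ℝ)
    (p : E × ℝ) :
    ∫ x in (-ρ)..ρ, ∫ s in (-ρ)..ρ, Complex.exp (Complex.I * ((lam * N.phase s x p : ℝ) : ℂ)) *
        (A (s, x, p) * (g x : ℂ))
      = r * ∫ x in (-ρ)..ρ, ∫ z in (-(ρ / r))..(ρ / r),
        Complex.exp (Complex.I * ((lam * r ^ 3 * N.scaled r z x p : ℝ) : ℂ)) *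
          (A (r * z, x, p) * (g x : ℂ)) := by
  rw [← intervalIntegral.integral_const_mul]
  refine intervalIntegral.integral_congr fun x _ => ?_
  have := intervalIntegral.smul_integral_comp_mul_left (a := -(ρ / r)) (b := ρ / r)
    (fun s => Complex.exp (Complex.I * ((lam * N.phase s x p : ℝ) : ℂ)) *
        (A (s, x, p) * (g x : ℂ))) r
  rw [mul_neg, mul_div_cancel₀ _ hr.ne'] at this
  rw [← this, Complex.real_smul]
  congr 1
  refine intervalIntegral.integral_congr fun z _ => ?_
  rw [mul_assoc lam, N.scaled_eq hr]

theorem continuous_phase [FiniteDimensional ℝ E] (p : E × ℝ) :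
    Continuous fun q : ℝ × ℝ => N.phase q.1 q.2 p := by
  have h1 := (contDiff_airyPrim N.contDiff_W).continuous
  have h2 := N.contDiff_h.continuous
  unfold phase
  fun_prop

end AiryNormalForm
end

/-! ### Summation over the pieces -/

section

variable {E : Type} [NormedAddCommGroup E] [NormedSpace ℝ E]

namespace AiryNormalForm

variable {m : ℕ} (N : AiryNormalForm E m)

set_option maxHeartbeats 1000000 in
/-- The estimate for an oscillatory integral whose phase is in normal form. The integral is
decomposed dyadically according to the size of `B + σ x`, down to `lam ^ (-2 / 3)`. The amplitude
need not have small support in `x`, but boundary terms at `s = ± ρ` are excluded. -/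
theorem exists_norm_integral_le [FiniteDimensional ℝ E] {R : ℝ} (hR : 0 < R) :
    ∃ ρ > 0, ρ ≤ R ∧ ∃ ρ' > 0, ∀ A : ℝ × ℝ × (E × ℝ) → ℂ, ContDiff ℝ 2 A →
      ∃ C, 0 ≤ C ∧ ∀ (lam : ℝ) (p : E × ℝ), 0 < lam → p.2 ≠ 0 → ‖p‖ ≤ ρ' →
      (∀ x, |x| ≤ ρ → A (ρ, x, p) = 0 ∧ A (-ρ, x, p) = 0) →
      ‖∫ x in (-ρ)..ρ, ∫ s in (-ρ)..ρ, Complex.exp (Complex.I * ((lam * N.phase s x p : ℝ) : ℂ)) *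
        A (s, x, p)‖ ≤ C * airyRhs m lam |p.2| := by
  obtain ⟨V, hV, ρ₁, hρ₁, hWV⟩ := N.exists_inv_W
  obtain ⟨ρ₂, hρ₂, hρ₂1, Ck, hCk, hosc⟩ := N.exists_oscBound_scaled
  set ρ : ℝ := min (min ρ₁ ρ₂) R with hρ
  have hρ0 : 0 < ρ := by positivity
  have hρρ₁ : ρ ≤ ρ₁ := (min_le_left _ _).trans (min_le_left _ _)
  have hρρ₂ : ρ ≤ ρ₂ := (min_le_left _ _).trans (min_le_right _ _)
  have hρ1 : ρ ≤ 1 := hρρ₂.trans hρ₂1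
  set rc : ℝ := ρ / 6 with hrc
  have hrc0 : 0 < rc := by positivity
  obtain ⟨ρ₃, hρ₃, hB⟩ := Metric.continuousAt_iff.1 N.continuousAt_B (rc ^ 2 / 2) (by positivity)
  set ρ' : ℝ := min (min ρ (ρ₃ / 2)) (rc ^ 2 / 2) with hρ'
  have hρ'0 : 0 < ρ' := by positivity
  have hρ'ρ : ρ' ≤ ρ := (min_le_left _ _).trans (min_le_left _ _)
  have hρ'3 : ρ' < ρ₃ := by
    have : ρ' ≤ ρ₃ / 2 := (min_le_left _ _).trans (min_le_right _ _)
    linarith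
  have hρ'r : ρ' ≤ rc ^ 2 / 2 := min_le_right _ _
  refine ⟨ρ, hρ0, min_le_right _ _, ρ', hρ'0, fun A hA => ?_⟩
  -- the cutoffs
  set t₀ : ℝ := min ρ₂ (1 / 4) with ht₀
  have ht₀0 : 0 < t₀ := by positivity
  let φ : ContDiffBump (0 : ℝ) := ⟨t₀ / 2, t₀, by positivity, by linarith⟩
  have hφ4 : φ.rOut ≤ 1 / 4 := min_le_right _ _
  have hφρ : φ.rOut ≤ ρ₂ := min_le_left _ _
  let θ : ContDiffBump (0 : ℝ) := ⟨1, 4, by norm_num, by norm_num⟩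
  have hθs : ContDiff ℝ ∞ θ := θ.contDiff
  have hθ0 : ∀ u : ℝ, 4 ≤ |u| → θ u = 0 := fun u hu =>
    θ.zero_of_le_dist (by rw [Real.dist_eq, sub_zero]; exact hu)
  have hθ1 : ∀ u : ℝ, |u| ≤ 1 → θ u = 1 := fun u hu =>
    θ.one_of_mem_closedBall (by rw [mem_closedBall_zero_iff]; exact hu)
  set χ : ℝ → ℝ := fun u => θ (u / 4) - θ u with hχ
  have hχs : ContDiff ℝ ∞ χ := (hθs.comp (by fun_prop)).sub hθs
  have h4 : ∀ u : ℝ, |u / 4| = |u| / 4 := fun u => by rw [abs_div]; norm_num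
  have hχ0 : ∀ u, 16 ≤ |u| → χ u = 0 := fun u hu => by
    simp only [hχ]
    rw [hθ0 _ (by rw [h4]; linarith), hθ0 u (by linarith), sub_zero]
  have hχ1 : ∀ u, |u| ≤ 1 → χ u = 0 := fun u hu => by
    simp only [hχ]
    rw [hθ1 _ (by rw [h4]; linarith), hθ1 u hu, sub_self]
  have hWV' : ∀ (s x : ℝ) (p : E × ℝ), |s| ≤ ρ → |x| ≤ ρ → ‖p‖ ≤ ρ →
      N.W (s, x, p) * V (s, x, p) = 1 := fun s x p h1 h2 h3 =>
    hWV s x p (h1.trans hρρ₁) (h2.trans hρρ₁) (h3.trans hρρ₁)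
  obtain ⟨Cs, hCs, hs⟩ := N.exists_norm_integral_stationary_le hρ1 hV hWV' hA φ
    (by linarith) hχs hχ0 hχ1
  obtain ⟨Cn, hCn, hn⟩ := N.exists_norm_integral_nonstationary_le hρ0 hρ1 hV hWV' hA φ
    (by linarith) hχs hχ0
  obtain ⟨Cn', hCn', hn'⟩ := N.exists_norm_integral_nonstationary_le hρ0 hρ1 hV hWV' hA φ
    (by linarith) hθs (fun u hu => hθ0 u (by linarith))
  obtain ⟨Cb, hCb, hb⟩ := N.exists_norm_integral_bounded_le hρ1 hA φ
    (by linarith) hθs (fun u hu => hθ0 u (by linarith))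
  obtain ⟨CA, hCA, hbA⟩ := exists_norm_le_of_norm_le hA.continuous 1
  have hε := airyEps_pos m
  -- the ratio of the geometric series over the dyadic scales
  set κ : ℝ := (8 : ℝ) ^ (-airyEps m) with hκ
  have hκ0 : 0 < κ := by positivity
  have hκ1 : κ < 1 := Real.rpow_lt_one_of_one_lt_of_neg (by norm_num) (by linarith)
  set C1 : ℝ := CA * (ρ - -ρ) * (ρ - -ρ) * (rc⁻¹ ^ 3) ^ (1 / 2 + airyEps m) with hC1
  have hC10 : 0 ≤ C1 := by
    have : 0 ≤ ρ - -ρ := by linarith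
    positivity
  have hgeo : 0 ≤ (1 - κ)⁻¹ := inv_nonneg.2 (by linarith)
  refine ⟨C1 + ((Cn' + Cb) * Ck + (Cs + Cn) * Ck * (1 - κ)⁻¹), by positivity, ?_⟩
  intro lam p hlam hp2 hp hA0
  set s₀ : ℝ := |p.2| with hs₀
  have hs₀0 : 0 < s₀ := abs_pos.2 hp2
  have hs₀ρ : s₀ ≤ ρ' := (le_max_right ‖p.1‖ ‖p.2‖).trans hp
  have hRhs := airyRhs_pos (m := m) hlam hs₀0
  have hpρ : ‖p‖ ≤ ρ := hp.trans hρ'ρ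
  have hpρ₂ : ‖p‖ ≤ ρ₂ := hpρ.trans hρρ₂
  set e : ℝ → ℝ → ℂ := fun x s => Complex.exp (Complex.I * ((lam * N.phase s x p : ℝ) : ℂ)) with he
  have hphc := N.continuous_phase p
  have hAc := hA.continuous
  have hθc := hθs.continuous
  have hφc : Continuous φ := φ.continuous
  have hec : Continuous fun q : ℝ × ℝ => e q.1 q.2 := by
    simp only [he]
    have : Continuous fun q : ℝ × ℝ => N.phase q.2 q.1 p := hphc.comp continuous_swap
    fun_prop
  have hu : ∀ x ∈ Icc (-ρ) ρ, |N.B p + p.2 * x| ≤ rc ^ 2 := by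
    intro x hx
    have h1 : |N.B p| < rc ^ 2 / 2 := by
      have := hB (x := p) (by rw [dist_zero_right]; linarith)
      rwa [N.B_zero, Real.dist_eq, sub_zero] at this
    have h2 : |p.2 * x| ≤ rc ^ 2 / 2 := by
      rw [abs_mul]
      calc |p.2| * |x| ≤ ρ' * 1 := by
            have : |x| ≤ 1 := (abs_le.2 hx).trans hρ1
            gcongr
        _ ≤ _ := by linarith
    exact (abs_add_le _ _).trans (by linarith)
  -- small values of `lam`
  by_cases hsmall : 1 < lam * rc ^ 3
  swap
  · push Not at hsmall
    have htriv : ‖∫ x in (-ρ)..ρ, ∫ s in (-ρ)..ρ, e x s * A (s, x, p)‖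
        ≤ CA * (ρ - -ρ) * (ρ - -ρ) := by
      refine norm_integral_integral_le_of_forall (by linarith) (by fun_prop) fun s hs => ?_
      refine (intervalIntegral.norm_integral_le_of_norm_le_const (C := CA) fun x hx => ?_).trans_eq
        (by rw [abs_of_nonneg (by linarith)])
      rw [uIoc_of_le (by linarith)] at hx
      rw [norm_mul]
      have h1 : ‖e x s‖ = 1 := by
        simp only [he]
        rw [mul_comm, Complex.norm_exp_ofReal_mul_I]
      rw [h1, one_mul]
      exact hbA _ (norm_prod_le_one ((abs_le.2 hs).trans hρ1)
        ((abs_le.2 ⟨hx.1.le, hx.2⟩).trans hρ1) (hpρ.trans hρ1))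
    have hRl : 1 ≤ (rc⁻¹ ^ 3) ^ (1 / 2 + airyEps m) * airyRhs m lam s₀ := by
      have h1 : lam ≤ rc⁻¹ ^ 3 := by
        rw [inv_pow, ← one_div, le_div_iff₀ (by positivity)]
        exact hsmall
      have h2 : 1 ≤ (rc⁻¹ ^ 3) ^ (1 / 2 + airyEps m) * lam ^ (-(1 / 2 + airyEps m)) := by
        rw [Real.rpow_neg hlam.le, ← div_eq_mul_inv, one_le_div (by positivity)]
        exact Real.rpow_le_rpow hlam.le h1 (by positivity)
      have h3 : 1 ≤ s₀ ^ (-(airyL m + airyC m * airyEps m)) := by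
        refine Real.one_le_rpow_of_pos_of_le_one_of_nonpos hs₀0 (by linarith) ?_
        have := one_sixth_le_airyL (m := m)
        have := one_le_airyC (m := m)
        nlinarith
      unfold airyRhs
      rw [← mul_assoc]
      exact one_le_mul_of_one_le_of_one_le h2 h3
    calc ‖∫ x in (-ρ)..ρ, ∫ s in (-ρ)..ρ, e x s * A (s, x, p)‖
        ≤ CA * (ρ - -ρ) * (ρ - -ρ) * 1 := by rw [mul_one]; exact htriv
      _ ≤ CA * (ρ - -ρ) * (ρ - -ρ) * ((rc⁻¹ ^ 3) ^ (1 / 2 + airyEps m) * airyRhs m lam s₀) := by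
        have : 0 ≤ ρ - -ρ := by linarith
        gcongr
      _ = C1 * airyRhs m lam s₀ := by rw [hC1]; ring
      _ ≤ _ := by
        gcongr
        have : 0 ≤ (Cn' + Cb) * Ck + (Cs + Cn) * Ck * (1 - κ)⁻¹ := by positivity
        linarith
  -- the smallest scale
  set r₀ : ℝ := lam ^ (-(1 / 3) : ℝ) with hr₀
  have hr₀0 : 0 < r₀ := by positivity
  have hr₀3 : lam * r₀ ^ 3 = 1 := by
    have h3 : r₀ ^ 3 = lam⁻¹ := by
      rw [hr₀, ← Real.rpow_natCast, ← Real.rpow_mul hlam.le, ← Real.rpow_neg_one]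
      norm_num
    rw [h3, mul_inv_cancel₀ hlam.ne']
  have hr₀c : r₀ < rc := by
    have : r₀ ^ 3 < rc ^ 3 := by
      have : lam * r₀ ^ 3 < lam * rc ^ 3 := by rw [hr₀3]; exact hsmall
      exact lt_of_mul_lt_mul_left this hlam.le
    exact lt_of_pow_lt_pow_left₀ 3 hrc0.le this
  have hexJ : ∃ J : ℕ, rc ≤ 2 ^ J * r₀ := by
    obtain ⟨J, hJ⟩ := pow_unbounded_of_one_lt (rc / r₀) (by norm_num : (1 : ℝ) < 2)
    exact ⟨J, by rw [← div_le_iff₀ hr₀0]; exact hJ.le⟩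
  classical
  set J := Nat.find hexJ with hJ
  have hJ1 : rc ≤ 2 ^ J * r₀ := Nat.find_spec hexJ
  have hJ2 : ∀ j < J, 2 ^ j * r₀ < rc := fun j hj => not_le.1 (Nat.find_min hexJ hj)
  -- the dyadic decomposition
  have hdecomp : ∀ x ∈ Icc (-ρ) ρ, (1 : ℝ) = θ (N.B p / r₀ ^ 2 + p.2 / r₀ ^ 2 * x)
      + ∑ j ∈ Finset.range J,
        χ (N.B p / (2 ^ j * r₀) ^ 2 + p.2 / (2 ^ j * r₀) ^ 2 * x) := by
    intro x hx
    set F : ℕ → ℝ := fun j => θ (N.B p / (2 ^ j * r₀) ^ 2 + p.2 / (2 ^ j * r₀) ^ 2 * x) / 1 with hF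
    have h1 : ∀ j, χ (N.B p / (2 ^ j * r₀) ^ 2 + p.2 / (2 ^ j * r₀) ^ 2 * x) = F (j + 1) - F j := by
      intro j
      simp only [hχ, hF, div_one]
      congr 2
      rw [pow_succ]
      field_simp
      ring
    simp_rw [h1]
    rw [Finset.sum_range_sub]
    have h2 : F J = 1 := by
      simp only [hF, div_one]
      refine hθ1 _ ?_
      have h3 : N.B p / (2 ^ J * r₀) ^ 2 + p.2 / (2 ^ J * r₀) ^ 2 * x
          = (N.B p + p.2 * x) / (2 ^ J * r₀) ^ 2 := by field_simp
      rw [h3, abs_div, abs_of_pos (by positivity : 0 < (2 ^ J * r₀) ^ 2),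
        div_le_one (by positivity)]
      exact (hu x hx).trans (by gcongr)
    rw [h2]
    simp [hF]
  set I : (ℝ → ℝ) → ℂ := fun g => ∫ x in (-ρ)..ρ, ∫ s in (-ρ)..ρ,
    e x s * (A (s, x, p) * (g x : ℂ)) with hI
  have hIc : ∀ g : ℝ → ℝ, Continuous g →
      Continuous fun x => ∫ s in (-ρ)..ρ, e x s * (A (s, x, p) * (g x : ℂ)) := by
    intro g hg
    refine intervalIntegral.continuous_parametric_intervalIntegral_of_continuous' ?_ _ _
    simp only [Function.uncurry_def]
    fun_prop
  have hχc := hχs.continuous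
  have hsum : ∫ x in (-ρ)..ρ, ∫ s in (-ρ)..ρ, e x s * A (s, x, p)
      = I (fun x => θ (N.B p / r₀ ^ 2 + p.2 / r₀ ^ 2 * x)) + ∑ j ∈ Finset.range J,
        I (fun x => χ (N.B p / (2 ^ j * r₀) ^ 2 + p.2 / (2 ^ j * r₀) ^ 2 * x)) := by
    simp only [hI]
    rw [← intervalIntegral.integral_finsetSum fun j _ =>
        (hIc _ (by fun_prop)).intervalIntegrable _ _,
      ← intervalIntegral.integral_add ((hIc _ (by fun_prop)).intervalIntegrable _ _)
        (Continuous.intervalIntegrable (continuous_finsetSum _ fun j _ => hIc _ (by fun_prop)) _ _)]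
    refine intervalIntegral.integral_congr fun x hx => ?_
    rw [uIcc_of_le (by linarith)] at hx
    have hex : Continuous fun s => e x s := hec.comp (by fun_prop : Continuous fun s => (x, s))
    have hAx : Continuous fun s => A (s, x, p) := by fun_prop
    rw [← intervalIntegral.integral_finsetSum fun j _ =>
        Continuous.intervalIntegrable (by fun_prop) _ _,
      ← intervalIntegral.integral_add (Continuous.intervalIntegrable (by fun_prop) _ _)
        (Continuous.intervalIntegrable (by fun_prop) _ _)]
    refine intervalIntegral.integral_congr fun s _ => ?_
    rw [← Finset.mul_sum, ← mul_add, ← Finset.mul_sum, ← mul_add]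
    have := hdecomp x hx
    have h2 : (1 : ℂ) = (θ (N.B p / r₀ ^ 2 + p.2 / r₀ ^ 2 * x) : ℂ) + ∑ j ∈ Finset.range J,
        (χ (N.B p / (2 ^ j * r₀) ^ 2 + p.2 / (2 ^ j * r₀) ^ 2 * x) : ℂ) := by exact_mod_cast this
    rw [← h2, mul_one]
  -- a single cutoff, after the substitution `s = r z`
  have hpiece : ∀ (r : ℝ) (η : ℝ → ℝ), 0 < r → Continuous η →
      I (fun x => η (N.B p / r ^ 2 + p.2 / r ^ 2 * x)) = r *
      ((∫ x in (-ρ)..ρ, ∫ z in (-(ρ / r))..(ρ / r),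
        Complex.exp (Complex.I * ((lam * r ^ 3 * N.scaled r z x p : ℝ) : ℂ)) *
          (A (r * z, x, p) * ((η (N.B p / r ^ 2 + p.2 / r ^ 2 * x) *
            φ (N.B p / r ^ 2 + p.2 / r ^ 2 * x + z ^ 2) : ℝ) : ℂ)))
      + ∫ x in (-ρ)..ρ, ∫ z in (-(ρ / r))..(ρ / r),
        Complex.exp (Complex.I * ((lam * r ^ 3 * N.scaled r z x p : ℝ) : ℂ)) *
          (A (r * z, x, p) * ((η (N.B p / r ^ 2 + p.2 / r ^ 2 * x) *
            (1 - φ (N.B p / r ^ 2 + p.2 / r ^ 2 * x + z ^ 2)) : ℝ) : ℂ))) := by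
    intro r η hr hη
    simp only [hI, he]
    rw [N.integral_integral_phase_eq hr]
    congr 1
    have hsc := N.continuous_scaled r p
    have hsc' : Continuous fun q : ℝ × ℝ => N.scaled r q.2 q.1 p := hsc.comp continuous_swap
    rw [← intervalIntegral.integral_add]
    · refine intervalIntegral.integral_congr fun x _ => ?_
      have hscx : Continuous fun z => N.scaled r z x p := by fun_prop
      rw [← intervalIntegral.integral_add (Continuous.intervalIntegrable (by fun_prop) _ _)
        (Continuous.intervalIntegrable (by fun_prop) _ _)]
      refine intervalIntegral.integral_congr fun z _ => ?_
      push_cast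
      ring
    all_goals
      refine Continuous.intervalIntegrable ?_ _ _
      refine intervalIntegral.continuous_parametric_intervalIntegral_of_continuous' ?_ _ _
      simp only [Function.uncurry_def]
      fun_prop
  -- the decay rates in `x` at all scales
  have hK : ∀ r : ℝ, 0 < r → r < rc → 1 ≤ lam * r ^ 3 → ∃ Ks Kn, 0 ≤ Ks ∧ 0 ≤ Kn ∧
      ‖I (fun x => χ (N.B p / r ^ 2 + p.2 / r ^ 2 * x))‖
        ≤ r * (Cs * ((lam * r ^ 3) ^ (-(1 / 2) : ℝ) * Ks) + Cn * ((lam * r ^ 3)⁻¹ * Kn)) ∧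
      ‖I (fun x => θ (N.B p / r ^ 2 + p.2 / r ^ 2 * x))‖
        ≤ r * (Cb * Kn + Cn' * ((lam * r ^ 3)⁻¹ * Kn)) ∧
      r * ((lam * r ^ 3) ^ (-(1 / 2) : ℝ) * Ks + (lam * r ^ 3)⁻¹ * Kn)
        ≤ Ck * (airyRhs m lam s₀ * (lam * r ^ 3) ^ (-airyEps m)) := by
    intro r hr hrrc hΛ
    have hr6 : 6 * r ≤ ρ := by rw [hrc] at hrrc; linarith
    obtain ⟨Ks, Kn, hKs, hKn, o1, o2, o3⟩ := hosc lam r p hlam hr (by linarith) hΛ hpρ₂ hp2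
    have o1' := fun (e a b t : ℝ) (he : e = 1 ∨ e = -1) (ha : -ρ ≤ a) (hab : a ≤ b) (hb : b ≤ ρ) hl
      hU (ht : |t| ≤ φ.rOut) => o1 e a b t he (by linarith) hab (by linarith) hl hU (ht.trans hφρ)
    have o2' := fun (a b z : ℝ) (ha : -ρ ≤ a) (hab : a ≤ b) (hb : b ≤ ρ) hl
      (hz : |r * z| ≤ ρ) => o2 a b z (by linarith) hab (by linarith) hl (hz.trans hρρ₂)
    refine ⟨Ks, Kn, hKs, hKn, ?_, ?_, o3⟩
    · rw [hpiece r χ hr hχc, norm_mul, Complex.norm_real, Real.norm_of_nonneg hr.le]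
      exact mul_le_mul_of_nonneg_left ((norm_add_le _ _).trans
        (add_le_add (hs lam r p Ks hlam hr hr6 hpρ hKs o1')
          (hn lam r p Kn hlam hr (by linarith) hpρ hKn hA0 o2'))) hr.le
    · rw [hpiece r θ hr hθc, norm_mul, Complex.norm_real, Real.norm_of_nonneg hr.le]
      exact mul_le_mul_of_nonneg_left ((norm_add_le _ _).trans
        (add_le_add (hb lam r p Kn hr hr6 hpρ hKn o2')
          (hn' lam r p Kn hlam hr (by linarith) hpρ hKn hA0 o2'))) hr.le
  rw [hsum]
  have hfirst : ‖I (fun x => θ (N.B p / r₀ ^ 2 + p.2 / r₀ ^ 2 * x))‖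
      ≤ (Cn' + Cb) * Ck * airyRhs m lam s₀ := by
    obtain ⟨Ks, Kn, hKs, hKn, -, h2, h3⟩ := hK r₀ hr₀0 hr₀c hr₀3.ge
    simp only [hr₀3, Real.one_rpow, inv_one, one_mul, mul_one] at h2 h3
    calc _ ≤ r₀ * (Cb * Kn + Cn' * Kn) := h2
      _ = (Cn' + Cb) * (r₀ * Kn) := by ring
      _ ≤ (Cn' + Cb) * (r₀ * (Ks + Kn)) := by gcongr; linarith
      _ ≤ (Cn' + Cb) * (Ck * airyRhs m lam s₀) := by gcongr
      _ = _ := by ring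
  have hrest : ∀ j ∈ Finset.range J,
      ‖I (fun x => χ (N.B p / (2 ^ j * r₀) ^ 2 + p.2 / (2 ^ j * r₀) ^ 2 * x))‖
      ≤ (Cs + Cn) * Ck * airyRhs m lam s₀ * κ ^ j := by
    intro j hj
    have h8 : lam * (2 ^ j * r₀) ^ 3 = 8 ^ j := by
      rw [mul_pow, ← pow_mul, mul_comm j 3, pow_mul]
      linear_combination ((2 : ℝ) ^ 3) ^ j * hr₀3 + (by norm_num : ((2 : ℝ) ^ 3) ^ j - 8 ^ j = 0)
    obtain ⟨Ks, Kn, hKs, hKn, h1, -, h3⟩ := hK (2 ^ j * r₀) (by positivity)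
      (hJ2 j (Finset.mem_range.1 hj)) (by rw [h8]; exact one_le_pow₀ (by norm_num))
    have hκj : (lam * (2 ^ j * r₀) ^ 3) ^ (-airyEps m) = κ ^ j := by
      rw [h8, hκ, ← Real.rpow_natCast, ← Real.rpow_natCast, ← Real.rpow_mul (by norm_num),
        ← Real.rpow_mul (by norm_num), mul_comm]
    rw [hκj] at h3
    set a := (lam * (2 ^ j * r₀) ^ 3) ^ (-(1 / 2) : ℝ) * Ks
    set b := (lam * (2 ^ j * r₀) ^ 3)⁻¹ * Kn
    have ha : 0 ≤ a := by positivity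
    have hb : 0 ≤ b := by positivity
    calc _ ≤ 2 ^ j * r₀ * (Cs * a + Cn * b) := h1
      _ ≤ 2 ^ j * r₀ * ((Cs + Cn) * (a + b)) := by
        gcongr
        nlinarith [mul_nonneg hCs hb, mul_nonneg hCn ha]
      _ = (Cs + Cn) * (2 ^ j * r₀ * (a + b)) := by ring
      _ ≤ (Cs + Cn) * (Ck * (airyRhs m lam s₀ * κ ^ j)) := by gcongr
      _ = _ := by ring
  have hgeom : ∑ j ∈ Finset.range J, κ ^ j ≤ (1 - κ)⁻¹ := by
    rw [← tsum_geometric_of_lt_one hκ0.le hκ1]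
    exact (summable_geometric_of_lt_one hκ0.le hκ1).sum_le_tsum _ fun j _ => by positivity
  calc _ ≤ _ := norm_add_le _ _
    _ ≤ (Cn' + Cb) * Ck * airyRhs m lam s₀
        + ∑ j ∈ Finset.range J, (Cs + Cn) * Ck * airyRhs m lam s₀ * κ ^ j :=
      add_le_add hfirst ((norm_sum_le _ _).trans (Finset.sum_le_sum hrest))
    _ ≤ (Cn' + Cb) * Ck * airyRhs m lam s₀ + (Cs + Cn) * Ck * airyRhs m lam s₀ * (1 - κ)⁻¹ := by
      rw [← Finset.mul_sum]
      gcongr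
    _ ≤ _ := by
      have : 0 ≤ C1 * airyRhs m lam s₀ := by positivity
      linarith

end AiryNormalForm
end

open Filter Topology

/-! ### The estimate for a general phase, and the nondegenerate cases -/

/-- A function that does not vanish at `0` has an inverse near `0` that extends globally. -/
theorem exists_contDiff_mul_eq_one {X : Type*} [NormedAddCommGroup X] [NormedSpace ℝ X]
    {D : X → ℝ} {n : WithTop ℕ∞} (hn : n ≤ ∞) (hD : ContDiff ℝ n D) (h0 : D 0 ≠ 0) :
    ∃ V : X → ℝ, ContDiff ℝ n V ∧ ∃ R > 0, ∀ y, ‖y‖ ≤ R → D y * V y = 1 := by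
  have hpos : 0 < D 0 ^ 2 := by positivity
  obtain ⟨g, hg, hgpos, heq⟩ := exists_contDiff_pos (l := D 0 ^ 2 / 2) (u := 2 * D 0 ^ 2)
    (by linarith) (by linarith)
  have hev : ∀ᶠ y in 𝓝 (0 : X), D y ^ 2 ∈ Ioo (D 0 ^ 2 / 2) (2 * D 0 ^ 2) :=
    (by have := hD.continuous; fun_prop :
      Continuous fun y => D y ^ 2).continuousAt.eventually
        (Ioo_mem_nhds (by linarith) (by linarith))
  obtain ⟨ρ, hρ, hb⟩ := Metric.eventually_nhds_iff_ball.1 hev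
  refine ⟨fun y => D y * (g (D y ^ 2))⁻¹, ?_, ρ / 2, half_pos hρ, fun y hy => ?_⟩
  · exact hD.mul (((hg.of_le hn).comp (hD.pow 2)).inv fun y => (hgpos _).ne')
  · have h1 := hb y (by rw [mem_ball_zero_iff]; linarith)
    dsimp only
    rw [heq _ ⟨h1.1.le, h1.2.le⟩]
    have : D y ≠ 0 := fun h => by
      have := h1.1
      rw [h] at this
      norm_num at this
      linarith
    field_simp

theorem le_airyRhs_of_forall {m : ℕ} {lam σ : ℝ} (hl : 0 < lam) (hσ : 0 < σ) (hσ1 : σ ≤ 1) :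
    lam ^ (-(1 / 2 + airyEps m)) * σ ^ (-airyEps m) ≤ airyRhs m lam σ := by
  unfold airyRhs
  refine mul_le_mul_of_nonneg_left ?_ (by positivity)
  refine Real.rpow_le_rpow_of_exponent_ge hσ hσ1 ?_
  nlinarith [one_sixth_le_airyL (m := m), one_le_airyC (m := m), airyEps_pos m]

theorem min_inv_le_airyRhs {m : ℕ} (hm : 2 ≤ m) {lam σ : ℝ} (hl : 0 < lam) (hσ : 0 < σ)
    (hσ1 : σ ≤ 1) : min 1 lam⁻¹ ≤ airyRhs m lam σ := by
  have h1 := airyEps_pos m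
  have h2 := airyEps_le hm
  refine le_trans ?_ (le_airyRhs_of_forall hl hσ hσ1)
  have h3 : 1 ≤ σ ^ (-airyEps m) :=
    Real.one_le_rpow_of_pos_of_le_one_of_nonpos hσ hσ1 (by linarith)
  have h4 : min 1 lam⁻¹ ≤ lam ^ (-(1 / 2 + airyEps m)) := by
    rcases le_total lam 1 with h | h
    · exact (min_le_left _ _).trans
        (Real.one_le_rpow_of_pos_of_le_one_of_nonpos hl h (by linarith))
    · refine (min_le_right _ _).trans ?_
      rw [← Real.rpow_neg_one]
      exact Real.rpow_le_rpow_of_exponent_le h (by linarith)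
  exact h4.trans (le_mul_of_one_le_right (by positivity) h3)

theorem rpow_mul_min_le_airyRhs {m : ℕ} (hm : 2 ≤ m) {lam σ : ℝ} (hl : 0 < lam) (hσ : 0 < σ)
    (hσ1 : σ ≤ 1) :
    lam ^ (-(1 / 2) : ℝ) * min 1 ((lam * σ) ^ (-(1 : ℝ) / m)) ≤ airyRhs m lam σ := by
  have h1 := airyEps_pos m
  have hm0 : (0 : ℝ) < m := by exact_mod_cast (by omega : 0 < m)
  have h2 : airyEps m ≤ 1 / m := by
    unfold airyEps
    exact one_div_le_one_div_of_le hm0 (by linarith)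
  refine le_trans ?_ (le_airyRhs_of_forall hl hσ hσ1)
  have h4 : min 1 ((lam * σ) ^ (-(1 : ℝ) / m)) ≤ (lam * σ) ^ (-airyEps m) := by
    have hls : 0 < lam * σ := by positivity
    rcases le_total (lam * σ) 1 with h | h
    · exact (min_le_left _ _).trans
        (Real.one_le_rpow_of_pos_of_le_one_of_nonpos hls h (by linarith))
    · refine (min_le_right _ _).trans ?_
      refine Real.rpow_le_rpow_of_exponent_le h ?_
      rw [neg_div]
      linarith
  calc lam ^ (-(1 / 2) : ℝ) * min 1 ((lam * σ) ^ (-(1 : ℝ) / m))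
      ≤ lam ^ (-(1 / 2) : ℝ) * (lam * σ) ^ (-airyEps m) := by gcongr
    _ = lam ^ (-(1 / 2 + airyEps m)) * σ ^ (-airyEps m) := by
      rw [Real.mul_rpow hl.le hσ.le, ← mul_assoc, ← Real.rpow_add hl]
      ring_nf

section

variable {E : Type} [NormedAddCommGroup E]

/-- The asserted estimate, for all amplitudes with small support, for an oscillatory integral over
`x = (x₁, x₂)` whose phase `F (x₁, x₂, p)` depends on parameters `p ∈ E × ℝ`, the last of which
is `σ`. The amplitude need only be `C²`, and the integral is written as an iterated one over a
square that contains its support; the constant may depend on the amplitude. -/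
def HasAiryBound [NormedSpace ℝ E] (F : ℝ × ℝ × (E × ℝ) → ℝ) (m : ℕ) : Prop :=
  ∃ η > 0, ∀ a : ℝ × ℝ × (E × ℝ) → ℂ, ContDiff ℝ 2 a →
    (∀ (x₁ x₂ : ℝ) (p : E × ℝ), η ≤ |x₁| ∨ η ≤ |x₂| → a (x₁, x₂, p) = 0) →
    ∃ C, 0 ≤ C ∧ ∀ (lam : ℝ) (p : E × ℝ), 0 < lam → p.2 ≠ 0 → ‖p‖ ≤ η →
      ‖∫ x₂ in (-η)..η, ∫ x₁ in (-η)..η,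
        Complex.exp (Complex.I * ((lam * F (x₁, x₂, p) : ℝ) : ℂ)) * a (x₁, x₂, p)‖
      ≤ C * airyRhs m lam |p.2|

theorem norm_snd_le_of_norm_le {p : E × ℝ} {η : ℝ} (hp : ‖p‖ ≤ η) : |p.2| ≤ η :=
  (le_max_right ‖p.1‖ ‖p.2‖).trans hp

variable [NormedSpace ℝ E]

theorem hasDerivAt_slice_fst_real {f : ℝ × ℝ × (E × ℝ) → ℝ} (hf : ContDiff ℝ 1 f) (y x : ℝ)
    (p : E × ℝ) : HasDerivAt (fun y => f (y, x, p)) (fderiv ℝ f (y, x, p) (1, 0, 0)) y := by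
  have h2 : HasDerivAt (fun y : ℝ => (y, x, p)) ((1, 0, 0) : ℝ × ℝ × (E × ℝ)) y :=
    (hasDerivAt_id y).prodMk ((hasDerivAt_const y x).prodMk (hasDerivAt_const y p))
  exact ((hf.differentiable (by simp)) _).hasFDerivAt.comp_hasDerivAt y h2

theorem norm_exp_mul (u : ℝ) (z : ℂ) : ‖Complex.exp (Complex.I * (u : ℂ)) * z‖ = ‖z‖ := by
  rw [norm_mul, mul_comm Complex.I, Complex.norm_exp_ofReal_mul_I, one_mul]

theorem norm_intervalIntegral_exp_mul_le {ψ : ℝ → ℝ} {g : ℝ → ℂ} {a b M : ℝ} (hab : a ≤ b)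
    (h : ∀ x ∈ Icc a b, ‖g x‖ ≤ M) :
    ‖∫ x in a..b, Complex.exp (Complex.I * (ψ x : ℂ)) * g x‖ ≤ M * (b - a) := by
  refine (intervalIntegral.norm_integral_le_of_norm_le_const (C := M) fun x hx => ?_).trans_eq
    (by rw [abs_of_nonneg (by linarith)])
  rw [uIoc_of_le hab] at hx
  rw [norm_exp_mul]
  exact h x ⟨hx.1.le, hx.2⟩

/-- One integration by parts in `x₁`. -/
theorem hasAiryBound_of_deriv_ne_zero [FiniteDimensional ℝ E] {F : ℝ × ℝ × (E × ℝ) → ℝ}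
    (hF : ContDiff ℝ ∞ F) {m : ℕ} (hm : 2 ≤ m) (h : fderiv ℝ F 0 (1, 0, 0) ≠ 0) :
    HasAiryBound F m := by
  have hF1 : ContDiff ℝ 1 F := hF.of_le (natCast_le_infty 1)
  set D : ℝ × ℝ × (E × ℝ) → ℝ := fun y => fderiv ℝ F y (1, 0, 0) with hD
  have hDc : ContDiff ℝ ∞ D := (hF.fderiv_right (m := ∞) (by simp)).clm_apply contDiff_const
  obtain ⟨V, hV, R, hR, hDV⟩ := exists_contDiff_mul_eq_one le_rfl hDc h
  set η : ℝ := min R 1 with hη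
  have hη0 : 0 < η := by positivity
  have hη1 : η ≤ 1 := min_le_right _ _
  refine ⟨η, hη0, fun a ha ha0 => ?_⟩
  set β : ℝ × ℝ × (E × ℝ) → ℂ := fun y => a y * (V y : ℂ) with hβ
  have hβc : ContDiff ℝ 2 β := ha.mul (Complex.ofRealCLM.contDiff.comp
    (hV.of_le (natCast_le_infty 2)))
  have hβ1 : ContDiff ℝ 1 β := hβc.of_le (by norm_num)
  have hβt : Continuous fun y => fderiv ℝ β y (1, 0, 0) :=
    (hβ1.continuous_fderiv (by simp)).clm_apply continuous_const
  obtain ⟨C0, hC0, b0⟩ := exists_norm_le_of_norm_le ha.continuous 1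
  obtain ⟨C1, hC1, b1⟩ := exists_norm_le_of_norm_le hβt 1
  refine ⟨(C0 + C1) * (2 * η) * (2 * η), by positivity, fun lam p hlam hp2 hp => ?_⟩
  have hσ1 : |p.2| ≤ 1 := (norm_snd_le_of_norm_le hp).trans hη1
  have hFc := hF.continuous
  have hac := ha.continuous
  have hDcc := hDc.continuous
  have hβcc := hβc.continuous
  have hn : ∀ x₁ ∈ Icc (-η) η, ∀ x₂ ∈ Icc (-η) η, ‖(x₁, x₂, p)‖ ≤ η := by
    intro x₁ h1 x₂ h2
    rw [Prod.norm_mk, Prod.norm_mk]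
    exact max_le (abs_le.2 h1) (max_le (abs_le.2 h2) hp)
  have t1 : ‖∫ x₂ in (-η)..η, ∫ x₁ in (-η)..η,
      Complex.exp (Complex.I * ((lam * F (x₁, x₂, p) : ℝ) : ℂ)) * a (x₁, x₂, p)‖
      ≤ (C0 + C1) * (2 * η) * (2 * η) * 1 := by
    refine (norm_integral_integral_le_of_forall (M := C0 * (η - -η)) (by linarith) (by fun_prop)
      fun x₁ h1 => norm_intervalIntegral_exp_mul_le (by linarith) fun x₂ h2 =>
        b0 _ ((hn x₁ h1 x₂ h2).trans hη1)).trans ?_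
    have : 0 ≤ C1 * (2 * η) * (2 * η) := by positivity
    nlinarith
  have t2 : ‖∫ x₂ in (-η)..η, ∫ x₁ in (-η)..η,
      Complex.exp (Complex.I * ((lam * F (x₁, x₂, p) : ℝ) : ℂ)) * a (x₁, x₂, p)‖
      ≤ (C0 + C1) * (2 * η) * (2 * η) * lam⁻¹ := by
    have key := norm_integral_integral_mul_deriv_le (Φ := fun t x => F (t, x, p))
      (Φt := fun t x => D (t, x, p)) (β := fun t x => β (t, x, p))
      (βt := fun t x => fderiv ℝ β (t, x, p) (1, 0, 0)) (τ₁ := -η) (τ₂ := η) (a := -η) (b := η)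
      (lam := lam) (n₀ := 0) (n := fun _ => C1 * (η - -η)) (by linarith) (by linarith) hlam
      (fun t _ x _ => hasDerivAt_slice_fst_real hF1 t x p)
      (fun t _ x _ => by simpa using hasDerivAt_slice_fst hβ1 1 t x p)
      (by fun_prop) (by fun_prop) (by fun_prop)
      (by fun_prop) ?_ ?_ (by simp) fun t ht => norm_intervalIntegral_exp_mul_le (by linarith)
        fun x hx => b1 _ ((hn t ht x hx).trans hη1)
    · have e1 : ∫ x₂ in (-η)..η, ∫ x₁ in (-η)..η,
          Complex.exp (Complex.I * ((lam * F (x₁, x₂, p) : ℝ) : ℂ)) * a (x₁, x₂, p)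
          = ∫ x in (-η)..η, ∫ t in (-η)..η,
          Complex.exp (Complex.I * ((lam * F (t, x, p) : ℝ) : ℂ)) *
            ((D (t, x, p) : ℂ) * β (t, x, p)) := by
        refine intervalIntegral.integral_congr fun x hx => ?_
        refine intervalIntegral.integral_congr fun t ht => ?_
        rw [uIcc_of_le (by linarith)] at hx ht
        have h1 := hDV _ ((hn t ht x hx).trans (min_le_left _ _))
        have h2 : (D (t, x, p) : ℂ) * (V (t, x, p) : ℂ) = 1 := by exact_mod_cast h1
        simp only [hβ]
        linear_combination -(Complex.exp (Complex.I * ((lam * F (t, x, p) : ℝ) : ℂ)) *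
          a (t, x, p)) * h2
      rw [e1]
      refine key.trans ?_
      rw [intervalIntegral.integral_const, smul_eq_mul]
      have h1 : 0 ≤ C0 * (2 * η) * (2 * η) * lam⁻¹ := by positivity
      nlinarith
    · rw [intervalIntegral_eq_zero (by linarith) fun x hx => ?_, norm_zero]
      simp [hβ, ha0 (-η) x p (Or.inl (by rw [abs_neg]; exact le_abs_self η))]
    · rw [intervalIntegral_eq_zero (by linarith) fun x hx => ?_, norm_zero]
      simp [hβ, ha0 η x p (Or.inl (le_abs_self η))]
  have h3 := min_inv_le_airyRhs hm hlam (abs_pos.2 hp2) hσ1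
  refine le_trans ?_ (mul_le_mul_of_nonneg_left h3 (by positivity))
  rcases min_cases 1 lam⁻¹ with ⟨h4, -⟩ | ⟨h4, -⟩ <;> rw [h4]
  · exact t1
  · exact t2

/-- Division by `σ` of a function that vanishes for `σ = 0`. -/
theorem exists_eq_snd_mul [FiniteDimensional ℝ E] {Y : Type*} [NormedAddCommGroup Y]
    [NormedSpace ℝ Y] [FiniteDimensional ℝ Y] {M : Y × (E × ℝ) → ℝ} (hM : ContDiffAt ℝ ∞ M 0)
    (h0 : ∀ᶠ q : Y × E in 𝓝 0, M (q.1, q.2, 0) = 0) :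
    ∃ K : Y × (E × ℝ) → ℝ, ContDiffAt ℝ ∞ K 0 ∧ (∀ᶠ z in 𝓝 0, M z = z.2.2 * K z) ∧
      ∀ᶠ y in 𝓝 (0 : Y), HasDerivAt (fun σ => M (y, 0, σ)) (K (y, 0)) 0 := by
  have hM' : ContDiffAt ℝ ∞ (fun v : (Y × E) × ℝ => M (v.1.1, v.1.2, v.2)) (0, 0) :=
    ContDiffAt.comp (g := M) (f := fun v : (Y × E) × ℝ => (v.1.1, v.1.2, v.2)) _ hM
      (by fun_prop)
  obtain ⟨K, hK, hK1, hK2⟩ := exists_eq_add_mul hM'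
  have hc : Tendsto (fun z : Y × (E × ℝ) => (((z.1, z.2.1), z.2.2) : (Y × E) × ℝ)) (𝓝 0)
      (𝓝 ((0 : Y × E), (0 : ℝ))) :=
    (by fun_prop : Continuous fun z : Y × (E × ℝ) => (((z.1, z.2.1), z.2.2) : (Y × E) × ℝ)).tendsto'
      _ _ rfl
  have hc2 : Tendsto (fun z : Y × (E × ℝ) => ((z.1, z.2.1) : Y × E)) (𝓝 0) (𝓝 0) :=
    (by fun_prop : Continuous fun z : Y × (E × ℝ) => ((z.1, z.2.1) : Y × E)).tendsto' _ _ rfl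
  refine ⟨fun z => K ((z.1, z.2.1), z.2.2), ?_, ?_, ?_⟩
  · exact ContDiffAt.comp (g := K)
      (f := fun z : Y × (E × ℝ) => (((z.1, z.2.1), z.2.2) : (Y × E) × ℝ)) _ hK (by fun_prop)
  · filter_upwards [hc.eventually hK1, hc2.eventually h0] with z h1 h2
    simp only [Prod.mk.eta] at h1
    rw [h1, h2, zero_add]
  · have hc3 : Tendsto (fun y : Y => ((y, 0) : Y × E)) (𝓝 0) (𝓝 0) :=
      (by fun_prop : Continuous fun y : Y => ((y, 0) : Y × E)).tendsto' _ _ rfl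
    filter_upwards [hc3.eventually hK2] with y hy
    exact hy

/-- The critical points of a function of `x₁` that does not depend on `x₂` for `σ = 0`. -/
theorem exists_zero_curve [FiniteDimensional ℝ E] {G : ℝ × ℝ × (E × ℝ) → ℝ} (hG : ContDiff ℝ ∞ G)
    (hind : ∀ x₁ x₂ (δ : E), G (x₁, x₂, δ, 0) = G (x₁, 0, δ, 0)) (h0 : G 0 = 0)
    (h1 : fderiv ℝ G 0 (1, 0, 0) ≠ 0) :
    ∃ Z : ℝ × (E × ℝ) → ℝ, ContDiffAt ℝ ∞ Z 0 ∧ Z 0 = 0 ∧ (∀ᶠ q in 𝓝 0, G (Z q, q) = 0) ∧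
      ∀ᶠ q : ℝ × E in 𝓝 0, Z (q.1, q.2, 0) = Z (0, q.2, 0) := by
  have hG' : ContDiff ℝ ∞ fun v : (ℝ × (E × ℝ)) × ℝ => G (v.2, v.1) := hG.comp (by fun_prop)
  have hd : HasDerivAt (fun y => G (y, 0)) (fderiv ℝ G 0 (1, 0, 0)) 0 :=
    hasDerivAt_slice_fst_real (hG.of_le (natCast_le_infty 1)) 0 0 0
  obtain ⟨Z, hZ, hZ0, hZ1, hZ2⟩ := exists_implicit (q₀ := 0) hG'.contDiffAt h0 hd h1
  refine ⟨Z, hZ, hZ0, hZ1, ?_⟩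
  have hZc : ContinuousAt Z 0 := hZ.continuousAt
  have c1 : Tendsto (fun q : ℝ × E => ((0, q.2, 0) : ℝ × (E × ℝ))) (𝓝 0) (𝓝 0) :=
    (by fun_prop : Continuous fun q : ℝ × E => ((0, q.2, 0) : ℝ × (E × ℝ))).tendsto' _ _ rfl
  have c2 : Tendsto (fun q : ℝ × E => ((q.1, q.2, 0) : ℝ × (E × ℝ))) (𝓝 0) (𝓝 0) :=
    (by fun_prop : Continuous fun q : ℝ × E => ((q.1, q.2, 0) : ℝ × (E × ℝ))).tendsto' _ _ rfl
  have c3 : Tendsto (fun q : ℝ × E => Z (0, q.2, 0)) (𝓝 0) (𝓝 0) := by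
    have := hZc.tendsto.comp c1
    rwa [hZ0] at this
  filter_upwards [c1.eventually hZ1, (c2.prodMk_nhds c3).eventually hZ2] with q h2 h3
  exact (h3 (by
    rw [hind, h2])).symm

theorem hasDerivAt_comp_sigma [FiniteDimensional ℝ E] {F : ℝ × ℝ × (E × ℝ) → ℝ}
    (hF : ContDiff ℝ ∞ F) {z : ℝ → ℝ} {z' : ℝ} (hz : HasDerivAt z z' 0) (x : ℝ) :
    HasDerivAt (fun σ => F (z σ, x, 0, σ))
      (z' * fderiv ℝ F (z 0, x, 0) (1, 0, 0) + fderiv ℝ F (z 0, x, 0) (0, 0, 0, 1)) 0 := by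
  have h2 : HasDerivAt (fun σ : ℝ => ((z σ, x, 0, σ) : ℝ × ℝ × (E × ℝ))) (z', 0, 0, 1) 0 :=
    hz.prodMk ((hasDerivAt_const _ x).prodMk ((hasDerivAt_const _ 0).prodMk (hasDerivAt_id _)))
  have h3 := ((hF.differentiable (by simp)) (z 0, x, 0, 0)).hasFDerivAt.comp_hasDerivAt 0 h2
  have e : ((z', 0, 0, 1) : ℝ × ℝ × (E × ℝ)) = z' • (1, 0, 0) + (0, 0, 0, 1) := by simp
  rw [e, map_add, map_smul, smul_eq_mul] at h3
  exact h3

/-- Along a curve `x₁ = Z (x₂, p) + t`, a function that does not depend on `x₂` for `σ = 0` is,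
up to a term that does not depend on `x₂`, divisible by `σ`. -/
theorem exists_eq_snd_mul_of_curve [FiniteDimensional ℝ E] {F : ℝ × ℝ × (E × ℝ) → ℝ}
    (hF : ContDiff ℝ ∞ F) (hind : ∀ x₁ x₂ (δ : E), F (x₁, x₂, δ, 0) = F (x₁, 0, δ, 0))
    (h0 : fderiv ℝ F 0 (1, 0, 0) = 0) {Z : ℝ × (E × ℝ) → ℝ} (hZ : ContDiffAt ℝ ∞ Z 0)
    (hZ0 : Z 0 = 0) (hZi : ∀ᶠ q : ℝ × E in 𝓝 0, Z (q.1, q.2, 0) = Z (0, q.2, 0)) :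
    ∃ K : (ℝ × ℝ) × (E × ℝ) → ℝ, ContDiffAt ℝ ∞ K 0 ∧
      (∀ᶠ z : (ℝ × ℝ) × (E × ℝ) in 𝓝 0, F (Z (z.1.2, z.2) + z.1.1, z.1.2, z.2)
        = F (Z (0, z.2) + z.1.1, 0, z.2) + z.2.2 * K z) ∧
      ∀ᶠ x₂ in 𝓝 (0 : ℝ), K ((0, x₂), 0)
        = fderiv ℝ F (0, x₂, 0) (0, 0, 0, 1) - fderiv ℝ F 0 (0, 0, 0, 1) := by
  set M : (ℝ × ℝ) × (E × ℝ) → ℝ := fun z => F (Z (z.1.2, z.2) + z.1.1, z.1.2, z.2)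
    - F (Z (0, z.2) + z.1.1, 0, z.2) with hM
  have hMc : ContDiffAt ℝ ∞ M 0 := by
    have z1 : ContDiffAt ℝ ∞ (fun z : (ℝ × ℝ) × (E × ℝ) => Z (z.1.2, z.2)) 0 :=
      ContDiffAt.comp (g := Z) (f := fun z : (ℝ × ℝ) × (E × ℝ) => (z.1.2, z.2)) _ hZ (by fun_prop)
    have z2 : ContDiffAt ℝ ∞ (fun z : (ℝ × ℝ) × (E × ℝ) => Z (0, z.2)) 0 :=
      ContDiffAt.comp (g := Z) (f := fun z : (ℝ × ℝ) × (E × ℝ) => ((0 : ℝ), z.2)) _ hZ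
        (by fun_prop)
    refine ContDiffAt.sub ?_ ?_
    · exact hF.contDiffAt.comp (f := fun z : (ℝ × ℝ) × (E × ℝ) =>
        (Z (z.1.2, z.2) + z.1.1, z.1.2, z.2)) _ (by fun_prop)
    · exact hF.contDiffAt.comp (f := fun z : (ℝ × ℝ) × (E × ℝ) =>
        (Z (0, z.2) + z.1.1, (0 : ℝ), z.2)) _ (by fun_prop)
  obtain ⟨K, hK, hK1, hK2⟩ := exists_eq_snd_mul hMc (by
    have c : Tendsto (fun q : (ℝ × ℝ) × E => (q.1.2, q.2)) (𝓝 0) (𝓝 0) :=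
      (by fun_prop : Continuous fun q : (ℝ × ℝ) × E => (q.1.2, q.2)).tendsto' _ _ rfl
    filter_upwards [c.eventually hZi] with q hq
    simp only [hM]
    rw [hq, hind, sub_self])
  refine ⟨K, hK, ?_, ?_⟩
  · filter_upwards [hK1] with z hz
    rw [← hz]
    simp only [hM]
    ring
  · have c1 : Tendsto (fun x : ℝ => ((0, x) : ℝ × ℝ)) (𝓝 0) (𝓝 0) :=
      (by fun_prop : Continuous fun x : ℝ => ((0, x) : ℝ × ℝ)).tendsto' _ _ rfl
    have c2 : Tendsto (fun x : ℝ => ((x, 0) : ℝ × E)) (𝓝 0) (𝓝 0) :=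
      (by fun_prop : Continuous fun x : ℝ => ((x, 0) : ℝ × E)).tendsto' _ _ rfl
    have c3 : Tendsto (fun x : ℝ => ((x, 0) : ℝ × (E × ℝ))) (𝓝 0) (𝓝 0) :=
      (by fun_prop : Continuous fun x : ℝ => ((x, 0) : ℝ × (E × ℝ))).tendsto' _ _ rfl
    have hZd : ∀ᶠ q in 𝓝 (0 : ℝ × (E × ℝ)), DifferentiableAt ℝ Z q :=
      ((hZ.of_le (natCast_le_infty 1)).eventually (by simp)).mono
        fun q hq => hq.differentiableAt (by simp)
    have hZd0 := hZd.self_of_nhds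
    have hD0 : ∀ x₂ : ℝ, fderiv ℝ F (0, x₂, 0) (1, 0, 0) = 0 := by
      intro x₂
      have h2 := hasDerivAt_slice_fst_real (hF.of_le (natCast_le_infty 1)) 0 x₂ 0
      have h3 := hasDerivAt_slice_fst_real (hF.of_le (natCast_le_infty 1)) 0 0 0
      have e : (fun y => F (y, x₂, 0)) = fun y => F (y, 0, 0) := by
        funext y; exact hind y x₂ 0
      rw [e] at h2
      exact (h2.unique h3).trans h0
    filter_upwards [c1.eventually hK2, c2.eventually hZi, c3.eventually hZd] with x h1 h2 h3
    have hline : ∀ y : ℝ, HasDerivAt (fun σ : ℝ => ((y, 0, σ) : ℝ × (E × ℝ))) (0, 0, 1) 0 :=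
      fun y => (hasDerivAt_const _ y).prodMk ((hasDerivAt_const _ 0).prodMk (hasDerivAt_id _))
    have d1 : HasDerivAt (fun σ : ℝ => Z (x, 0, σ) + 0) (fderiv ℝ Z (x, 0) (0, 0, 1)) 0 :=
      (HasFDerivAt.comp_hasDerivAt (0 : ℝ) (f := fun σ : ℝ => ((x, 0, σ) : ℝ × (E × ℝ)))
        h3.hasFDerivAt (hline x)).add_const 0
    have d2 : HasDerivAt (fun σ : ℝ => Z (0, 0, σ) + 0) (fderiv ℝ Z 0 (0, 0, 1)) 0 :=
      (HasFDerivAt.comp_hasDerivAt (0 : ℝ) (f := fun σ : ℝ => ((0, 0, σ) : ℝ × (E × ℝ)))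
        hZd0.hasFDerivAt (hline 0)).add_const 0
    have zx : Z (x, 0, 0) + 0 = 0 := by rw [h2, add_zero]; exact hZ0
    have zx0 : Z (0, 0, 0) + 0 = 0 := by rw [add_zero]; exact hZ0
    have e1 := hasDerivAt_comp_sigma hF d1 x
    have e2 := hasDerivAt_comp_sigma hF d2 0
    rw [zx, hD0, mul_zero, zero_add] at e1
    rw [zx0, hD0, mul_zero, zero_add] at e2
    exact h1.unique (e1.sub e2)

end

/-! ### The case of a nondegenerate critical point -/

section

variable {E : Type} [NormedAddCommGroup E]

theorem exists_forall_of_eventually_nhds {Q : (ℝ × ℝ) × (E × ℝ) → Prop}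
    (h : ∀ᶠ z in 𝓝 0, Q z) : ∃ R > 0, ∀ (t x : ℝ) (p : E × ℝ), |t| ≤ R → |x| ≤ R → ‖p‖ ≤ R →
      Q ((t, x), p) := by
  obtain ⟨R, hR, hb⟩ := Metric.eventually_nhds_iff_ball.1 h
  refine ⟨R / 2, half_pos hR, fun t x p ht hx hp => hb _ ?_⟩
  rw [mem_ball_zero_iff, Prod.norm_mk, Prod.norm_mk]
  have := half_lt_self hR
  exact max_lt (max_lt (ht.trans_lt this) (hx.trans_lt this)) (hp.trans_lt this)

theorem norm_prod_prod_le {t x R : ℝ} {p : E × ℝ} (ht : |t| ≤ R) (hx : |x| ≤ R) (hp : ‖p‖ ≤ R) :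
    ‖((t, x), p)‖ ≤ R := by
  rw [Prod.norm_mk, Prod.norm_mk]
  exact max_le (max_le ht hx) hp

theorem integral_eq_integral_add {f : ℝ → ℂ} {η z T : ℝ} (hη : 0 ≤ η)
    (hf : ∀ x, η ≤ |x| → f x = 0) (hz : |z| + η ≤ T) :
    ∫ x in (-η)..η, f x = ∫ t in (-T)..T, f (z + t) := by
  rw [intervalIntegral.integral_comp_add_left f z]
  have h := abs_le.1 (le_refl |z|)
  refine (intervalIntegral_eq_of_eq_zero (by linarith) (by linarith) (by linarith)
    fun x _ hx => hf x ?_).symm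
  by_contra! h1
  exact hx (abs_le.1 h1.le)

variable [NormedSpace ℝ E]

/-- The derivative `∂₁ F`. -/
noncomputable def partialFst (F : ℝ × ℝ × (E × ℝ) → ℝ) (y : ℝ × ℝ × (E × ℝ)) : ℝ :=
  fderiv ℝ F y (1, 0, 0)

theorem contDiff_partialFst {F : ℝ × ℝ × (E × ℝ) → ℝ} (hF : ContDiff ℝ ∞ F) :
    ContDiff ℝ ∞ (partialFst F) :=
  (hF.fderiv_right (m := ∞) (by simp)).clm_apply contDiff_const

theorem hasDerivAt_partialFst {F : ℝ × ℝ × (E × ℝ) → ℝ} (hF : ContDiff ℝ ∞ F) (y x : ℝ)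
    (p : E × ℝ) : HasDerivAt (fun y => F (y, x, p)) (partialFst F (y, x, p)) y :=
  hasDerivAt_slice_fst_real (hF.of_le (natCast_le_infty 1)) y x p

theorem partialFst_indep {F : ℝ × ℝ × (E × ℝ) → ℝ} (hF : ContDiff ℝ ∞ F)
    (hind : ∀ x₁ x₂ (δ : E), F (x₁, x₂, δ, 0) = F (x₁, 0, δ, 0)) (x₁ x₂ : ℝ) (δ : E) :
    partialFst F (x₁, x₂, δ, 0) = partialFst F (x₁, 0, δ, 0) := by
  have h2 := hasDerivAt_partialFst hF x₁ x₂ (δ, 0)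
  have e : (fun y => F (y, x₂, δ, 0)) = fun y => F (y, 0, δ, 0) := by
    funext y; exact hind y x₂ δ
  rw [e] at h2
  exact h2.unique (hasDerivAt_partialFst hF x₁ 0 (δ, 0))

set_option maxHeartbeats 1000000 in
/-- Stationary phase in `x₁`, with decay in `x₂` along the translates of the critical curve. -/
theorem hasAiryBound_of_deriv_two_ne_zero [FiniteDimensional ℝ E] {F : ℝ × ℝ × (E × ℝ) → ℝ}
    (hF : ContDiff ℝ ∞ F) (hind : ∀ x₁ x₂ (δ : E), F (x₁, x₂, δ, 0) = F (x₁, 0, δ, 0))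
    {m : ℕ} (hm : 2 ≤ m) (h1 : partialFst F 0 = 0) (h2 : partialFst (partialFst F) 0 ≠ 0)
    (hx : iteratedDeriv m (fun x₂ => fderiv ℝ F (0, x₂, 0) (0, 0, 0, 1)) 0 ≠ 0) :
    HasAiryBound F m := by
  have hDc := contDiff_partialFst hF
  obtain ⟨Z, hZ, hZ0, hZ1, hZi⟩ := exists_zero_curve hDc (partialFst_indep hF hind) h1 h2
  obtain ⟨K, hK, hK1, hK2⟩ := exists_eq_snd_mul_of_curve hF hind h1 hZ hZ0 hZi
  -- on the translates of the critical curve, `∂₁ F` is divisible by the translation parameter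
  obtain ⟨e, he, he1, he2⟩ := exists_eq_add_mul (q₀ := (0 : ℝ × (E × ℝ)))
    (G := fun v : (ℝ × (E × ℝ)) × ℝ => partialFst F (Z v.1 + v.2, v.1)) (by
      have z1 : ContDiffAt ℝ ∞ (fun v : (ℝ × (E × ℝ)) × ℝ => Z v.1) (0, 0) :=
        ContDiffAt.comp (g := Z) (f := fun v : (ℝ × (E × ℝ)) × ℝ => v.1) _ hZ (by fun_prop)
      exact hDc.contDiffAt.comp (f := fun v : (ℝ × (E × ℝ)) × ℝ => (Z v.1 + v.2, v.1)) _
        (by fun_prop))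
  have he0 : e (0, 0) = partialFst (partialFst F) 0 := by
    have a1 := he2.self_of_nhds
    have a2 := hasDerivAt_partialFst hDc 0 0 0
    dsimp only at a1
    rw [hZ0] at a1
    simp only [zero_add] at a1
    exact a1.unique a2
  set e' : (ℝ × ℝ) × (E × ℝ) → ℝ := fun z => e ((z.1.2, z.2), z.1.1) with he'
  have he'c : ContDiffAt ℝ ∞ e' 0 := ContDiffAt.comp (g := e)
    (f := fun z : (ℝ × ℝ) × (E × ℝ) => ((z.1.2, z.2), z.1.1)) _ he (by fun_prop)
  obtain ⟨Zg, hZg, hZgeq⟩ := exists_contDiff_eventuallyEq_of_contDiffAt hZ (m + 5)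
  obtain ⟨Kg, hKg, hKgeq⟩ := exists_contDiff_eventuallyEq_of_contDiffAt hK (m + 5)
  obtain ⟨eg, heg, hegeq⟩ := exists_contDiff_eventuallyEq_of_contDiffAt he'c (m + 5)
  have heg0 : eg 0 ≠ 0 := by
    rw [hegeq.eq_of_nhds]
    change e (0, 0) ≠ 0
    rw [he0]
    exact h2
  obtain ⟨V, hV, R₁, hR₁, hegV⟩ := exists_contDiff_mul_eq_one (natCast_le_infty _) heg heg0
  have hZg0 : Zg 0 = 0 := by rw [hZgeq.eq_of_nhds, hZ0]
  have cx : Tendsto (fun z : (ℝ × ℝ) × (E × ℝ) => (z.1.2, z.2)) (𝓝 0) (𝓝 0) :=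
    (by fun_prop : Continuous fun z : (ℝ × ℝ) × (E × ℝ) => (z.1.2, z.2)).tendsto' _ _ rfl
  have cxt : Tendsto (fun z : (ℝ × ℝ) × (E × ℝ) => ((z.1.2, z.2), z.1.1)) (𝓝 0)
      (𝓝 ((0 : ℝ × (E × ℝ)), (0 : ℝ))) :=
    (by fun_prop : Continuous fun z : (ℝ × ℝ) × (E × ℝ) => ((z.1.2, z.2), z.1.1)).tendsto' _ _ rfl
  -- the lower bound for the `m`-th derivative in `x₂`
  have hKgm : ContDiff ℝ m Kg := hKg.of_le (by norm_cast; omega)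
  have hline : ∀ (t x : ℝ) (p : E × ℝ), iteratedDeriv m (fun x => Kg ((t, x), p)) x
      = iteratedFDeriv ℝ m Kg ((t, x), p) fun _ => ((0, 1), 0) := by
    intro t x p
    have := iteratedDeriv_comp_line hKgm ((t, 0), p) ((0, 1), 0) x
    have e1 : ∀ x : ℝ, ((t, 0), p) + x • (((0, 1), 0) : (ℝ × ℝ) × (E × ℝ)) = ((t, x), p) :=
      fun x => by simp
    simpa only [e1] using this
  have hKg0 : iteratedFDeriv ℝ m Kg 0 (fun _ => ((0, 1), 0)) ≠ 0 := by
    have a1 := hline 0 0 0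
    rw [show (((0, 0), 0) : (ℝ × ℝ) × (E × ℝ)) = 0 from rfl] at a1
    rw [← a1, Filter.EventuallyEq.iteratedDeriv_eq m (g := fun x₂ =>
      fderiv ℝ F (0, x₂, 0) (0, 0, 0, 1) - fderiv ℝ F 0 (0, 0, 0, 1))]
    · obtain ⟨k, rfl⟩ := Nat.exists_eq_add_of_le' hm
      rw [iteratedDeriv_succ', show (deriv fun x₂ : ℝ => fderiv ℝ F (0, x₂, 0) (0, 0, 0, 1)
        - fderiv ℝ F 0 (0, 0, 0, 1)) = deriv fun x₂ : ℝ => fderiv ℝ F (0, x₂, 0) (0, 0, 0, 1) by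
          funext x; rw [deriv_sub_const], ← iteratedDeriv_succ']
      exact hx
    · have c1 : Tendsto (fun x : ℝ => (((0, x), 0) : (ℝ × ℝ) × (E × ℝ))) (𝓝 0) (𝓝 0) :=
        (by fun_prop : Continuous fun x : ℝ => (((0, x), 0) : (ℝ × ℝ) × (E × ℝ))).tendsto' _ _ rfl
      filter_upwards [c1.eventually hKgeq, hK2] with x b1 b2
      rw [b1, b2]
  set c : ℝ := |iteratedFDeriv ℝ m Kg 0 fun _ => ((0, 1), 0)| / 2 with hc
  have hc0 : 0 < c := half_pos (abs_pos.2 hKg0)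
  have hcev : ∀ᶠ z in 𝓝 0, c < |iteratedFDeriv ℝ m Kg z fun _ => ((0, 1), 0)| :=
    (continuous_iteratedFDeriv_apply hKgm _).abs.continuousAt.eventually_const_lt
      (half_lt_self (abs_pos.2 hKg0))
  have c0x : Tendsto (fun z : (ℝ × ℝ) × (E × ℝ) => ((0, z.2) : ℝ × (E × ℝ))) (𝓝 0) (𝓝 0) :=
    (by fun_prop : Continuous fun z : (ℝ × ℝ) × (E × ℝ) => ((0, z.2) : ℝ × (E × ℝ))).tendsto' _ _
      rfl
  obtain ⟨R₂, hR₂, hall⟩ := exists_forall_of_eventually_nhds ((cx.eventually hZgeq).and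
    ((c0x.eventually hZgeq).and (hKgeq.and (hegeq.and (hK1.and ((cxt.eventually he1).and
      ((cx.eventually hZ1).and hcev)))))))
  set T : ℝ := min (min R₁ R₂) 1 with hT
  have hT0 : 0 < T := by positivity
  have hTR₁ : T ≤ R₁ := (min_le_left _ _).trans (min_le_left _ _)
  have hTR₂ : T ≤ R₂ := (min_le_left _ _).trans (min_le_right _ _)
  have hT1 : T ≤ 1 := min_le_right _ _
  have hZgc : Continuous Zg := hZg.continuous
  obtain ⟨R₃, hR₃, hZsmall⟩ := Metric.continuousAt_iff.1 (hZgc.continuousAt (x := 0)) (T / 2)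
    (by positivity)
  set η : ℝ := min (T / 2) (R₃ / 2) with hη
  have hη0 : 0 < η := by positivity
  have hηT : η ≤ T / 2 := min_le_left _ _
  have hηR : η < R₃ := (min_le_right _ _).trans_lt (half_lt_self hR₃)
  refine ⟨η, hη0, fun a ha ha0 => ?_⟩
  obtain ⟨cv, hcv, hvdc⟩ := exists_oscBound_of_iteratedDeriv m hm
  have hZg2 : ContDiff ℝ 2 Zg := hZg.of_le (by norm_cast; omega)
  set b : (ℝ × ℝ) × (E × ℝ) → ℂ := fun z => a (Zg (z.1.2, z.2) + z.1.1, z.1.2, z.2) * (V z : ℂ)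
    with hb
  have hZz : ContDiff ℝ 2 fun z : (ℝ × ℝ) × (E × ℝ) => Zg (z.1.2, z.2) :=
    hZg2.comp (f := fun z : (ℝ × ℝ) × (E × ℝ) => (z.1.2, z.2)) (by fun_prop)
  have hbc : ContDiff ℝ 2 b := by
    refine ContDiff.mul (ha.comp (f := fun z : (ℝ × ℝ) × (E × ℝ) =>
      (Zg (z.1.2, z.2) + z.1.1, z.1.2, z.2)) (by fun_prop)) (Complex.ofRealCLM.contDiff.comp
        (hV.of_le (by norm_cast; omega)))
  have hb1 : ContDiff ℝ 1 b := hbc.of_le (by norm_num)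
  set b₀ : (ℝ × ℝ) × (E × ℝ) → ℂ := fun z => (eg z : ℂ) * b z with hb₀
  have hb₀1 : ContDiff ℝ 1 b₀ :=
    ContDiff.mul (Complex.ofRealCLM.contDiff.comp (heg.of_le (by norm_cast; omega))) hb1
  set b₂ : (ℝ × ℝ) × (E × ℝ) → ℂ := fun z => fderiv ℝ b z ((1, 0), 0) with hb₂
  have hb₂1 : ContDiff ℝ 1 b₂ := by
    have : ContDiff ℝ 1 (fderiv ℝ b) := hbc.fderiv_right (by norm_num)
    exact this.clm_apply contDiff_const
  have hbd : ∀ f : (ℝ × ℝ) × (E × ℝ) → ℂ, ContDiff ℝ 1 f → ∃ C, 0 ≤ C ∧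
      ∀ y, ‖y‖ ≤ 1 → ‖f y‖ ≤ C ∧ ‖fderiv ℝ f y‖ ≤ C := by
    intro f hf
    obtain ⟨C0, hC0, b0⟩ := exists_norm_le_of_norm_le hf.continuous 1
    obtain ⟨C1, hC1, b1⟩ := exists_norm_le_of_norm_le (hf.continuous_fderiv (by simp)) 1
    exact ⟨C0 + C1, by positivity, fun y hy => ⟨(b0 y hy).trans (by linarith),
      (b1 y hy).trans (by linarith)⟩⟩
  obtain ⟨C₀, hC₀, bd₀⟩ := hbd _ hb₀1
  obtain ⟨C₁, hC₁, bd₁⟩ := hbd _ hb1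
  obtain ⟨C₂, hC₂, bd₂⟩ := hbd _ hb₂1
  set Ko : ℝ := 2 + cv * c ^ (-(1 : ℝ) / m) with hKo
  have hKo0 : 0 ≤ Ko := by positivity
  set CC : ℝ := C₀ + C₁ + C₂ with hCC
  have hCC0 : 0 ≤ CC := by positivity
  refine ⟨(8 + 2 * T) * (Ko * (CC * 3)), by positivity, fun lam p hlam hp2 hp => ?_⟩
  have hpT : ‖p‖ ≤ T := hp.trans (by linarith)
  have hσ0 : 0 < |p.2| := abs_pos.2 hp2
  have hσ1 : |p.2| ≤ 1 := (norm_snd_le_of_norm_le hp).trans (by linarith)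
  have hxT : ∀ x ∈ Icc (-η) η, |x| ≤ T := fun x hx => (abs_le.2 hx).trans (by linarith)
  have hZb : ∀ x ∈ Icc (-η) η, |Zg (x, p)| + η ≤ T := by
    intro x hx
    have a1 := hZsmall (x := (x, p)) (by
      rw [dist_zero_right, Prod.norm_mk]
      exact max_lt ((abs_le.2 hx).trans_lt hηR) (hp.trans_lt hηR))
    rw [hZg0, Real.dist_eq, sub_zero] at a1
    linarith
  have hFc := hF.continuous
  have hac := ha.continuous
  have hegc := heg.continuous
  have hbcc := hbc.continuous
  have hb₂c := hb₂1.continuous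
  set σm : ℝ := min 1 ((lam * |p.2|) ^ (-(1 : ℝ) / m)) with hσm
  have hσm0 : 0 ≤ σm := by positivity
  have hZgm : ContDiff ℝ m Zg := hZg.of_le (by norm_cast; omega)
  have hO : ∀ t ∈ Icc (-T) T,
      OscBound (fun x => lam * F (Zg (x, p) + t, x, p)) (-η) η (Ko * σm) := by
    intro t ht
    have htT := abs_le.2 ht
    rcases min_cases 1 ((lam * |p.2|) ^ (-(1 : ℝ) / m)) with ⟨h4, -⟩ | ⟨h4, -⟩
    · refine (oscBound_length (by linarith)).mono (by linarith) ?_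
      rw [hσm, h4, hKo]
      have : 0 ≤ cv * c ^ (-(1 : ℝ) / m) := by positivity
      linarith
    · have hφ : ContDiff ℝ m fun x => lam * F (Zg (x, p) + t, x, p) := by
        refine contDiff_const.mul ((hF.of_le (natCast_le_infty m)).comp
          (f := fun x : ℝ => (Zg (x, p) + t, x, p)) ?_)
        have : ContDiff ℝ m fun x : ℝ => Zg (x, p) :=
          hZgm.comp (f := fun x : ℝ => (x, p)) (by fun_prop)
        fun_prop
      have := hvdc _ (-η) η (c * (lam * |p.2|)) hφ (by linarith) (by positivity) fun x hx => by
        have hev : (fun x => lam * F (Zg (x, p) + t, x, p)) =ᶠ[𝓝 x] fun x =>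
            (lam * F (Zg (0, p) + t, 0, p)) + (lam * p.2) * Kg ((t, x), p) := by
          filter_upwards [Ioo_mem_nhds (show -T < x by linarith [hx.1])
            (show x < T by linarith [hx.2])] with y hy
          have a1 := hall t y p (htT.trans hTR₂)
            ((abs_le.2 ⟨hy.1.le, hy.2.le⟩).trans hTR₂) (hpT.trans hTR₂)
          have a2 := a1.2.2.2.2.1
          rw [a1.1, a1.2.1, a1.2.2.1]
          dsimp only at a2 ⊢
          rw [a2]
          ring
        have hcst : ∀ f : ℝ → ℝ, iteratedDeriv m (fun x => lam * F (Zg (0, p) + t, 0, p) + f x) x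
            = iteratedDeriv m f x := by
          intro f
          obtain ⟨k, rfl⟩ := Nat.exists_eq_add_of_le' hm
          have hd : deriv (fun x => lam * F (Zg (0, p) + t, 0, p) + f x) = deriv f := by
            funext y
            rw [deriv_const_add]
          rw [iteratedDeriv_succ', hd, ← iteratedDeriv_succ']
        rw [hev.iteratedDeriv_eq, hcst, iteratedDeriv_const_mul_field, hline, abs_mul, abs_mul,
          abs_of_pos hlam, mul_comm]
        have a1 := (hall t x p (htT.trans hTR₂) ((hxT x hx).trans hTR₂)
          (hpT.trans hTR₂)).2.2.2.2.2.2.2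
        exact mul_le_mul_of_nonneg_left a1.le (by positivity)
      refine this.mono (by linarith) ?_
      rw [Real.mul_rpow hc0.le (by positivity), ← mul_assoc, hσm, h4]
      gcongr
      linarith
  have hgen : ∀ g : (ℝ × ℝ) × (E × ℝ) → ℂ, ContDiff ℝ 1 g →
      (∀ y, ‖y‖ ≤ 1 → ‖g y‖ ≤ CC ∧ ‖fderiv ℝ g y‖ ≤ CC) → ∀ t ∈ Icc (-T) T,
      ‖∫ x in (-η)..η, Complex.exp (Complex.I * ((lam * F (Zg (x, p) + t, x, p) : ℝ) : ℂ)) *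
        g ((t, x), p)‖ ≤ Ko * (CC * 3) * σm := by
    intro g hg hgM t ht
    have hl : ∀ x : ℝ, ((t, 0), p) + x • (((0, 1), 0) : (ℝ × ℝ) × (E × ℝ)) = ((t, x), p) :=
      fun x => by simp
    have hv : ‖(((0, 1), 0) : (ℝ × ℝ) × (E × ℝ))‖ = 1 := by simp [Prod.norm_mk]
    have hy : ∀ x ∈ Icc (-η) η, ‖((t, x), p)‖ ≤ 1 := fun x hx =>
      norm_prod_prod_le ((abs_le.2 ht).trans hT1) ((hxT x hx).trans hT1) (hpT.trans hT1)
    have := (hO t ht).norm_integral_comp_line_le (by linarith) (C := CC) hg ((t, 0), p)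
      ((0, 1), 0) (fun x hx => by rw [hl]; exact (hgM _ (hy x hx)).1)
      (fun x hx => by rw [hl]; exact (hgM _ (hy x hx)).2)
    simp only [hl, hv] at this
    refine this.trans ?_
    calc Ko * σm * (CC * (1 + 1 * (η - -η))) ≤ Ko * σm * (CC * 3) := by
          gcongr; linarith
      _ = _ := by ring
  have key := norm_integral_integral_stationary_le
    (Φ := fun t x => F (Zg (x, p) + t, x, p)) (E := fun t x => eg ((t, x), p))
    (β := fun t x => b ((t, x), p)) (βt := fun t x => b₂ ((t, x), p))
    (T := T) (a := -η) (b := η) (lam := lam) (M := Ko * (CC * 3) * σm) hT0 (by linarith) hlam ?_ ?_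
    (by fun_prop) (by fun_prop) (by fun_prop) (by fun_prop) ?_
    (hgen _ hb1 fun y hy => ⟨(bd₁ y hy).1.trans (by linarith), (bd₁ y hy).2.trans (by linarith)⟩)
    (hgen _ hb₂1 fun y hy => ⟨(bd₂ y hy).1.trans (by linarith), (bd₂ y hy).2.trans (by linarith)⟩)
  · have e1 : ∫ x₂ in (-η)..η, ∫ x₁ in (-η)..η,
        Complex.exp (Complex.I * ((lam * F (x₁, x₂, p) : ℝ) : ℂ)) * a (x₁, x₂, p)
        = ∫ x in (-η)..η, ∫ t in (-T)..T,
          Complex.exp (Complex.I * ((lam * F (Zg (x, p) + t, x, p) : ℝ) : ℂ)) *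
            ((eg ((t, x), p) : ℂ) * b ((t, x), p)) := by
      refine intervalIntegral.integral_congr fun x hx => ?_
      rw [uIcc_of_le (by linarith)] at hx
      rw [integral_eq_integral_add (f := fun x₁ =>
        Complex.exp (Complex.I * ((lam * F (x₁, x, p) : ℝ) : ℂ)) * a (x₁, x, p)) hη0.le
        (fun x₁ h => by rw [ha0 x₁ x p (Or.inl h), mul_zero]) (hZb x hx)]
      refine intervalIntegral.integral_congr fun t ht => ?_
      rw [uIcc_of_le (by linarith)] at ht
      have a1 := hegV ((t, x), p) (norm_prod_prod_le ((abs_le.2 ht).trans hTR₁)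
        ((hxT x hx).trans hTR₁) (hpT.trans hTR₁))
      have a2 : (eg ((t, x), p) : ℂ) * (V ((t, x), p) : ℂ) = 1 := by exact_mod_cast a1
      simp only [hb]
      linear_combination -(Complex.exp (Complex.I * ((lam * F (Zg (x, p) + t, x, p) : ℝ) : ℂ)) *
        a (Zg (x, p) + t, x, p)) * a2
    rw [e1]
    refine key.trans ?_
    have a3 := rpow_mul_min_le_airyRhs hm hlam hσ0 hσ1
    calc (8 + 2 * T) * (Ko * (CC * 3) * σm * lam ^ (-(1 / 2) : ℝ))
        = (8 + 2 * T) * (Ko * (CC * 3)) * (lam ^ (-(1 / 2) : ℝ) * σm) := by ring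
      _ ≤ _ := by gcongr
  · intro t ht x hx
    have a1 := hall t x p ((abs_le.2 ht).trans hTR₂) ((hxT x hx).trans hTR₂) (hpT.trans hTR₂)
    have a2 : partialFst F (Zg (x, p) + t, x, p) = t * eg ((t, x), p) := by
      have b1 := a1.1
      have b2 := a1.2.2.2.1
      have b3 := a1.2.2.2.2.2.1
      have b4 := a1.2.2.2.2.2.2.1
      simp only [add_zero] at b1 b2 b3 b4
      rw [b1, b2, b3, b4, zero_add]
    rw [← a2]
    have a3 := (hasDerivAt_partialFst hF (Zg (x, p) + t) x p).comp_const_add (Zg (x, p)) t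
    exact a3
  · intro t _ x _
    have a4 : HasDerivAt (fun t : ℝ => (((t, x), p) : (ℝ × ℝ) × (E × ℝ))) ((1, 0), 0) t :=
      ((hasDerivAt_id t).prodMk (hasDerivAt_const t x)).prodMk (hasDerivAt_const t p)
    exact ((hb1.differentiable (by simp)) _).hasFDerivAt.comp_hasDerivAt t a4
  · exact hgen _ hb₀1 fun y hy => ⟨(bd₀ y hy).1.trans (by linarith),
      (bd₀ y hy).2.trans (by linarith)⟩

end

/-! ### Reduction of the degenerate case to the normal form -/

theorem ContDiffAt.fderiv_apply_infty {X F : Type*} [NormedAddCommGroup X] [NormedSpace ℝ X]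
    [NormedAddCommGroup F] [NormedSpace ℝ F] {f : X → F} {x₀ : X} (hf : ContDiffAt ℝ ∞ f x₀)
    (v : X) : ContDiffAt ℝ ∞ (fun x => fderiv ℝ f x v) x₀ :=
  (hf.fderiv_right (m := ∞) (by simp)).clm_apply contDiffAt_const

theorem ContDiffAt.eventually_differentiableAt {X F : Type*} [NormedAddCommGroup X]
    [NormedSpace ℝ X] [NormedAddCommGroup F] [NormedSpace ℝ F] {f : X → F} {x₀ : X}
    (hf : ContDiffAt ℝ ∞ f x₀) : ∀ᶠ x in 𝓝 x₀, DifferentiableAt ℝ f x :=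
  ((hf.of_le (natCast_le_infty 1)).eventually (by simp)).mono
    fun _ hq => hq.differentiableAt (by simp)

theorem ContDiffAt.eventually_hasDerivAt_snd {X : Type*} [NormedAddCommGroup X] [NormedSpace ℝ X]
    {f : X × ℝ → ℝ} {x₀ : X × ℝ} (hf : ContDiffAt ℝ ∞ f x₀) :
    ∀ᶠ z in 𝓝 x₀, HasDerivAt (fun s => f (z.1, s)) (fderiv ℝ f z (0, 1)) z.2 := by
  filter_upwards [hf.eventually_differentiableAt] with z hz
  have h3 : HasDerivAt (fun y : ℝ => (z.1, y)) ((0 : X), (1 : ℝ)) z.2 :=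
    (hasDerivAt_const _ _).prodMk (hasDerivAt_id z.2)
  exact HasFDerivAt.comp_hasDerivAt z.2 (f := fun y : ℝ => (z.1, y)) hz.hasFDerivAt h3

theorem ContDiffAt.deriv_infty {f : ℝ → ℝ} {x₀ : ℝ} (hf : ContDiffAt ℝ ∞ f x₀) :
    ContDiffAt ℝ ∞ (deriv f) x₀ :=
  hf.fderiv_apply_infty 1

/-- The leading term of the chain rule at a zero of order `k`. -/
theorem iteratedDeriv_mul_comp_of_vanish {φ : ℝ → ℝ} (hφ : ContDiffAt ℝ ∞ φ 0) (hφ0 : φ 0 = 0)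
    (k : ℕ) : ∀ {f u : ℝ → ℝ}, ContDiffAt ℝ ∞ f 0 → ContDiffAt ℝ ∞ u 0 →
    (∀ l < k, iteratedDeriv l f 0 = 0) →
    iteratedDeriv k (fun x => u x * f (φ x)) 0 = u 0 * iteratedDeriv k f 0 * deriv φ 0 ^ k := by
  induction k with
  | zero =>
    intro f u _ _ _
    simp [hφ0]
  | succ k ih =>
    intro f u hf hu hv
    have hf' : ContDiffAt ℝ ∞ f (φ 0) := by rwa [hφ0]
    have hfφ : ContDiffAt ℝ ∞ (fun x => f (φ x)) 0 := hf'.comp 0 hφ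
    have hdf' : ContDiffAt ℝ ∞ (deriv f) (φ 0) := by rw [hφ0]; exact hf.deriv_infty
    have hdfφ : ContDiffAt ℝ ∞ (fun x => deriv f (φ x)) 0 := hdf'.comp 0 hφ
    have hev : deriv (fun x => u x * f (φ x)) =ᶠ[𝓝 0]
        fun x => deriv u x * f (φ x) + (u x * deriv φ x) * deriv f (φ x) := by
      have hft : ∀ᶠ x in 𝓝 (0 : ℝ), DifferentiableAt ℝ f (φ x) :=
        hφ.continuousAt.eventually hf'.eventually_differentiableAt
      filter_upwards [hft, hφ.eventually_differentiableAt, hu.eventually_differentiableAt]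
        with x h1 h2 h3
      have h4 := h3.hasDerivAt.mul (h1.hasDerivAt.comp x h2.hasDerivAt)
      rw [show (fun x => u x * f (φ x)) = u * (f ∘ φ) from rfl, h4.deriv]
      simp only [Function.comp]
      ring
    have hk : (k : WithTop ℕ∞) ≤ ∞ := natCast_le_infty k
    rw [iteratedDeriv_succ', hev.iteratedDeriv_eq k, iteratedDeriv_fun_add
      ((hu.deriv_infty.mul hfφ).of_le hk)
      (((hu.mul hφ.deriv_infty).mul hdfφ).of_le hk),
      ih hf hu.deriv_infty fun l hl => hv l (hl.trans (Nat.lt_succ_self k)),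
      ih hf.deriv_infty (hu.mul hφ.deriv_infty) fun l hl => by
        rw [← iteratedDeriv_succ']
        exact hv (l + 1) (by omega),
      hv k (Nat.lt_succ_self k), ← iteratedDeriv_succ']
    ring

theorem iteratedDeriv_comp_ne_zero {f φ : ℝ → ℝ} {m : ℕ} (hm : 1 ≤ m) (hf : ContDiffAt ℝ ∞ f 0)
    (hφ : ContDiffAt ℝ ∞ φ 0) (hφ0 : φ 0 = 0) (hφ1 : deriv φ 0 ≠ 0)
    (hv : ∀ l, 1 ≤ l → l < m → iteratedDeriv l f 0 = 0) (hne : iteratedDeriv m f 0 ≠ 0) :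
    iteratedDeriv m (fun x => f (φ x)) 0 ≠ 0 := by
  obtain ⟨k, rfl⟩ := Nat.exists_eq_add_of_le' hm
  have hf' : ContDiffAt ℝ ∞ f (φ 0) := by rwa [hφ0]
  have hev : deriv (fun x => f (φ x)) =ᶠ[𝓝 0] fun x => deriv φ x * deriv f (φ x) := by
    have hft : ∀ᶠ x in 𝓝 (0 : ℝ), DifferentiableAt ℝ f (φ x) :=
      hφ.continuousAt.eventually hf'.eventually_differentiableAt
    filter_upwards [hft, hφ.eventually_differentiableAt] with x h1 h2
    rw [show (fun x => f (φ x)) = f ∘ φ from rfl, (h1.hasDerivAt.comp x h2.hasDerivAt).deriv,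
      mul_comm]
  rw [iteratedDeriv_succ', hev.iteratedDeriv_eq k,
    iteratedDeriv_mul_comp_of_vanish hφ hφ0 k hf.deriv_infty hφ.deriv_infty fun l hl => by
      rw [← iteratedDeriv_succ']
      exact hv (l + 1) (by omega) (by omega),
    ← iteratedDeriv_succ']
  positivity

/-- The one-variable Morse lemma with parameters: `G (q, Y (q, s)) = G (q, 0) + s ^ 2`. The
coordinate change `Y` depends on `q` only through the function `G (q, ·)`, which is expressed by
the last conclusion: if the functions for the parameters `i w` and `j w` agree, so do the coordinate
changes. -/
theorem exists_square_coordinate {X P : Type*} [NormedAddCommGroup X] [NormedSpace ℝ X]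
    [FiniteDimensional ℝ X] [NormedAddCommGroup P] {G G' : X × ℝ → ℝ} (hG : ContDiffAt ℝ ∞ G 0)
    (hG1 : ∀ᶠ z in 𝓝 (0 : X × ℝ), HasDerivAt (fun y => G (z.1, y)) (G' z) z.2)
    (h0 : ∀ᶠ q in 𝓝 (0 : X), G' (q, 0) = 0) {d : ℝ} (hd : 0 < d)
    (hG2 : HasDerivAt (fun y => G' (0, y)) d 0) {i j : P → X} (hi : Tendsto i (𝓝 0) (𝓝 0))
    (hj : Tendsto j (𝓝 0) (𝓝 0))
    (hij : ∀ᶠ w in 𝓝 (0 : P × ℝ), G (i w.1, w.2) = G (j w.1, w.2)) :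
    ∃ Y : X × ℝ → ℝ, ContDiffAt ℝ ∞ Y 0 ∧ (∀ᶠ q in 𝓝 0, Y (q, 0) = 0) ∧
      (∃ e > 0, HasDerivAt (fun s => Y (0, s)) e 0) ∧
      (∀ᶠ z in 𝓝 0, G (z.1, Y z) = G (z.1, 0) + z.2 ^ 2) ∧
      ∀ᶠ w in 𝓝 (0 : P × ℝ), Y (i w.1, w.2) = Y (j w.1, w.2) := by
  have cq : Tendsto (fun q : X => (q, (0 : ℝ))) (𝓝 0) (𝓝 0) :=
    (by fun_prop : Continuous fun q : X => (q, (0 : ℝ))).tendsto' _ _ rfl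
  have cy : Tendsto (fun y : ℝ => ((0 : X), y)) (𝓝 0) (𝓝 0) :=
    (by fun_prop : Continuous fun y : ℝ => ((0 : X), y)).tendsto' _ _ rfl
  have cf : Tendsto (fun z : X × ℝ => z.1) (𝓝 0) (𝓝 0) :=
    (by fun_prop : Continuous fun z : X × ℝ => z.1).tendsto' _ _ rfl
  obtain ⟨K, hK, hK1, hK2⟩ := exists_eq_add_mul (q₀ := (0 : X)) hG
  obtain ⟨D, hD, hD1, hD2⟩ := exists_eq_add_mul (q₀ := (0 : X)) hK
  have hK0 : ∀ᶠ q in 𝓝 (0 : X), K (q, 0) = 0 := by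
    filter_upwards [hK2, cq.eventually hG1, h0] with q a1 a2 a3
    rw [a1.unique a2, a3]
  have hGD : ∀ᶠ z in 𝓝 (0 : X × ℝ), G z = G (z.1, 0) + z.2 ^ 2 * D z := by
    filter_upwards [hK1, hD1, cf.eventually hK0] with z a1 a2 a3
    rw [a1, a2, a3]
    ring
  have hD0 : D 0 = d / 2 := by
    have hKl : ContDiffAt ℝ ∞ (fun y : ℝ => K (0, y)) 0 :=
      ContDiffAt.comp (g := K) (f := fun y : ℝ => ((0 : X), y)) _ hK (by fun_prop)
    have a1 : deriv (fun y : ℝ => K (0, y)) 0 = D 0 := hD2.self_of_nhds.deriv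
    have a2 : (fun y : ℝ => G' (0, y)) =ᶠ[𝓝 0]
        fun y => K (0, y) + y * deriv (fun y : ℝ => K (0, y)) y := by
      have hev := cy.eventually hK1.eventually_nhds
      filter_upwards [cy.eventually hG1, hev, hKl.eventually_differentiableAt] with y b1 b2 b3
      have b4 : (fun y : ℝ => G (0, y)) =ᶠ[𝓝 y] fun y => G (0, 0) + y * K (0, y) :=
        ((by fun_prop : Continuous fun y : ℝ => ((0 : X), y)).tendsto y).eventually b2
      have b5 := ((hasDerivAt_id y).mul b3.hasDerivAt).const_add (G (0, 0))
      have b6 := (b1.congr_of_eventuallyEq b4.symm).unique b5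
      rw [b6]
      simp only [id]
      ring
    have a3 := (hKl.eventually_differentiableAt.self_of_nhds.hasDerivAt.add
      ((hasDerivAt_id (0 : ℝ)).mul
        hKl.deriv_infty.eventually_differentiableAt.self_of_nhds.hasDerivAt)).congr_of_eventuallyEq
          a2
    have a4 := hG2.unique a3
    rw [a1] at a4
    simp only [id] at a4
    linarith
  have hDpos : ∀ᶠ z in 𝓝 (0 : X × ℝ), 0 < D z :=
    hD.continuousAt.eventually (lt_mem_nhds (by
      rw [show D (0, 0) = d / 2 from hD0]; positivity))
  set r : X × ℝ → ℝ := fun z => Real.sqrt (D z) with hr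
  have hrc : ContDiffAt ℝ ∞ r 0 := hD.sqrt (by
    rw [show D (0, 0) = d / 2 from hD0]; positivity)
  have hr0 : 0 < r 0 := Real.sqrt_pos.2 (by rw [hD0]; positivity)
  have hrl : ContDiffAt ℝ ∞ (fun y : ℝ => r (0, y)) 0 :=
    ContDiffAt.comp (g := r) (f := fun y : ℝ => ((0 : X), y)) _ hrc (by fun_prop)
  have hSd : HasDerivAt (fun y : ℝ => y * r (0, y)) (r 0) 0 := by
    have := (hasDerivAt_id (0 : ℝ)).mul hrl.eventually_differentiableAt.self_of_nhds.hasDerivAt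
    simp only [id, one_mul, zero_mul, add_zero] at this
    exact this
  obtain ⟨Y, hY, hY0, hY1, hY2⟩ := exists_implicit (q₀ := (0 : X × ℝ)) (d := r 0)
    (G := fun v : (X × ℝ) × ℝ => v.2 * r (v.1.1, v.2) - v.1.2) (by
      have : ContDiffAt ℝ ∞ (fun v : (X × ℝ) × ℝ => r (v.1.1, v.2)) (0, 0) :=
        ContDiffAt.comp (g := r) (f := fun v : (X × ℝ) × ℝ => (v.1.1, v.2)) _ hrc (by fun_prop)
      exact (contDiffAt_snd.mul this).sub (by fun_prop)) (by simp) (by simpa using hSd) hr0.ne'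
  have hYt : Tendsto Y (𝓝 0) (𝓝 0) := by simpa [hY0] using hY.continuousAt.tendsto
  have cY : Tendsto (fun z : X × ℝ => (z.1, Y z)) (𝓝 0) (𝓝 (0, 0)) := cf.prodMk_nhds hYt
  refine ⟨Y, hY, ?_, ?_, ?_, ?_⟩
  · have c : Tendsto (fun q : X => ((q, (0 : ℝ)), (0 : ℝ))) (𝓝 0) (𝓝 (0, 0)) :=
      (by fun_prop : Continuous fun q : X => ((q, (0 : ℝ)), (0 : ℝ))).tendsto' _ _ rfl
    filter_upwards [c.eventually hY2] with q hq
    exact (hq (by simp)).symm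
  · have hYl : ContDiffAt ℝ ∞ (fun y : ℝ => Y (0, y)) 0 :=
      ContDiffAt.comp (g := Y) (f := fun y : ℝ => ((0 : X), y)) _ hY (by fun_prop)
    have a1 := hYl.eventually_differentiableAt.self_of_nhds.hasDerivAt
    have a2 : HasDerivAt (fun s : ℝ => s) (r 0 * deriv (fun y : ℝ => Y (0, y)) 0) 0 := by
      have b1 : HasDerivAt (fun y : ℝ => y * r (0, y)) (r 0) (Y (0, 0)) := by
        rw [show Y (0, 0) = 0 from hY0]; exact hSd
      refine (b1.comp (0 : ℝ) a1).congr_of_eventuallyEq ?_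
      filter_upwards [cy.eventually hY1] with s hs
      simp only [Function.comp]
      linarith
    have a3 := a2.unique (hasDerivAt_id (0 : ℝ))
    refine ⟨_, ?_, a1⟩
    by_contra! h
    nlinarith
  · filter_upwards [cY.eventually hGD, cY.eventually hDpos, hY1] with z a1 a2 a3
    rw [a1]
    have a4 : z.2 = Y z * Real.sqrt (D (z.1, Y z)) := by
      simp only [hr] at a3
      linarith
    rw [a4, mul_pow, Real.sq_sqrt a2.le]
  · have ci : Tendsto (fun w : P × ℝ => i w.1) (𝓝 0) (𝓝 0) :=
      hi.comp ((by fun_prop : Continuous fun w : P × ℝ => w.1).tendsto' _ _ rfl)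
    have cj : Tendsto (fun w : P × ℝ => j w.1) (𝓝 0) (𝓝 0) :=
      hj.comp ((by fun_prop : Continuous fun w : P × ℝ => w.1).tendsto' _ _ rfl)
    have c1 : Tendsto (fun w : P × ℝ => w.1) (𝓝 0) (𝓝 0) :=
      (by fun_prop : Continuous fun w : P × ℝ => w.1).tendsto' _ _ rfl
    have c2 : Tendsto (fun w : P × ℝ => w.2) (𝓝 0) (𝓝 0) :=
      (by fun_prop : Continuous fun w : P × ℝ => w.2).tendsto' _ _ rfl
    have cz : Tendsto (fun _ : P × ℝ => (0 : ℝ)) (𝓝 0) (𝓝 0) := tendsto_const_nhds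
    have cyj : Tendsto (fun w : P × ℝ => Y (j w.1, w.2)) (𝓝 0) (𝓝 0) :=
      hYt.comp (cj.prodMk_nhds c2)
    filter_upwards [(cj.prodMk_nhds c2).eventually hY1,
      ((ci.prodMk_nhds c2).prodMk_nhds cyj).eventually hY2,
      (c1.prodMk_nhds cyj).eventually hij, (c1.prodMk_nhds cz).eventually hij,
      (ci.prodMk_nhds cyj).eventually hGD, (cj.prodMk_nhds cyj).eventually hGD]
      with w a1 a2 a3 a4 a5 a6
    refine (a2 ?_).symm
    have : Y (j w.1, w.2) * r (i w.1, Y (j w.1, w.2))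
        = Y (j w.1, w.2) * r (j w.1, Y (j w.1, w.2)) := by
      by_cases hy : Y (j w.1, w.2) = 0
      · rw [hy, zero_mul, zero_mul]
      · have b1 : Y (j w.1, w.2) ^ 2 * D (i w.1, Y (j w.1, w.2))
            = Y (j w.1, w.2) ^ 2 * D (j w.1, Y (j w.1, w.2)) := by
          linarith
        have b2 := mul_left_cancel₀ (pow_ne_zero 2 hy) b1
        simp only [hr, b2]
    rw [this, a1]

theorem eq_of_hasDerivAt_eq {f g f' : ℝ → ℝ} {R : ℝ}
    (hf : ∀ s, |s| ≤ R → HasDerivAt f (f' s) s) (hg : ∀ s, |s| ≤ R → HasDerivAt g (f' s) s)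
    (h0 : f 0 = g 0) {s : ℝ} (hs : |s| ≤ R) : f s = g s := by
  have hR : 0 ≤ R := (abs_nonneg s).trans hs
  have h1 : ∀ t ∈ Icc (-R) R, HasDerivWithinAt (fun t => f t - g t) 0 (Icc (-R) R) t := by
    intro t ht
    have := ((hf t (abs_le.2 ht)).sub (hg t (abs_le.2 ht))).hasDerivWithinAt (s := Icc (-R) R)
    rwa [sub_self] at this
  have h2 := (convex_Icc (-R) R).norm_image_sub_le_of_norm_hasDerivWithin_le (C := 0) h1
    (fun t _ => by simp) (show (0 : ℝ) ∈ Icc (-R) R from ⟨by linarith, hR⟩) (abs_le.1 hs)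
  rw [zero_mul] at h2
  have h3 := norm_le_zero_iff.1 h2
  linarith

section

variable {E : Type} [NormedAddCommGroup E] [NormedSpace ℝ E]

/-- On the curve `s ↦ Y (q, s)` the phase `F` has the `s`-derivative
`(∂₁ F (ξ q, q) + s ^ 2) ∂ₛ Y`, where `ξ` is the zero of `∂₁² F`; both `∂₁ F (ξ q, q)` and `∂ₛ Y`
depend on `x₂` only up to a multiple of `σ`. The first of these multiples is taken as the new
coordinate `x` in place of `x₂ = X (x, p)`. -/
theorem exists_airyNormalForm [FiniteDimensional ℝ E] {F : ℝ × ℝ × (E × ℝ) → ℝ}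
    (hF : ContDiff ℝ ∞ F) (hind : ∀ x₁ x₂ (δ : E), F (x₁, x₂, δ, 0) = F (x₁, 0, δ, 0))
    {m : ℕ} (hm : 2 ≤ m) (h1 : partialFst F 0 = 0) (h2 : partialFst (partialFst F) 0 = 0)
    (h3 : 0 < partialFst (partialFst (partialFst F)) 0)
    (hmix : deriv (fun x₂ => fderiv ℝ (partialFst F) (0, x₂, 0) (0, 0, 0, 1)) 0 ≠ 0)
    (hv : ∀ l, 1 ≤ l → l < m →
      iteratedDeriv l (fun x₂ => fderiv ℝ F (0, x₂, 0) (0, 0, 0, 1)) 0 = 0)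
    (hx : iteratedDeriv m (fun x₂ => fderiv ℝ F (0, x₂, 0) (0, 0, 0, 1)) 0 ≠ 0) :
    ∃ (N : AiryNormalForm E m) (X ξ : ℝ × (E × ℝ) → ℝ) (Y : (ℝ × (E × ℝ)) × ℝ → ℝ)
      (H : E × ℝ → ℝ), ContDiff ℝ 3 X ∧ ContDiff ℝ 3 ξ ∧ ContDiff ℝ 3 Y ∧ X 0 = 0 ∧ ξ 0 = 0 ∧
      (∃ d ≠ 0, HasDerivAt (fun x => X (x, 0)) d 0) ∧ Y 0 = 0 ∧
      (∃ e > 0, HasDerivAt (fun s => Y (0, s)) e 0) ∧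
      ∃ R > 0, ∀ (s x : ℝ) (p : E × ℝ), |s| ≤ R → |x| ≤ R → ‖p‖ ≤ R →
        F (ξ (X (x, p), p) + Y ((X (x, p), p), s), X (x, p), p) = H p + N.phase s x p := by
  have hF1 := contDiff_partialFst hF
  have hF2 := contDiff_partialFst hF1
  have hi1 := partialFst_indep hF hind
  obtain ⟨ξ, hξ, hξ0, hξ1, hξi⟩ := exists_zero_curve hF2 (partialFst_indep hF1 hi1) h2 h3.ne'
  obtain ⟨KH, hKH, hKH1, hKH2⟩ := exists_eq_snd_mul_of_curve hF hind h1 hξ hξ0 hξi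
  obtain ⟨Kv, hKv, hKv1, hKv2⟩ := exists_eq_snd_mul_of_curve hF1 hi1 h2 hξ hξ0 hξi
  have cx : Tendsto (fun x : ℝ => ((x, 0) : ℝ × (E × ℝ))) (𝓝 0) (𝓝 0) :=
    (by fun_prop : Continuous fun x : ℝ => ((x, 0) : ℝ × (E × ℝ))).tendsto' _ _ rfl
  have ci : Tendsto (fun q : ℝ × E => ((q.1, q.2, 0) : ℝ × (E × ℝ))) (𝓝 0) (𝓝 0) :=
    (by fun_prop : Continuous fun q : ℝ × E => ((q.1, q.2, 0) : ℝ × (E × ℝ))).tendsto' _ _ rfl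
  have cj : Tendsto (fun q : ℝ × E => ((0, q.2, 0) : ℝ × (E × ℝ))) (𝓝 0) (𝓝 0) :=
    (by fun_prop : Continuous fun q : ℝ × E => ((0, q.2, 0) : ℝ × (E × ℝ))).tendsto' _ _ rfl
  -- the coordinate `s`
  obtain ⟨Y, hY, hY0, ⟨e, he, hYe⟩, hY1, hYi⟩ := exists_square_coordinate
    (G := fun v : (ℝ × (E × ℝ)) × ℝ => partialFst F (ξ v.1 + v.2, v.1))
    (G' := fun v => partialFst (partialFst F) (ξ v.1 + v.2, v.1)) (by
      have z1 : ContDiffAt ℝ ∞ (fun v : (ℝ × (E × ℝ)) × ℝ => ξ v.1) 0 :=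
        ContDiffAt.comp (g := ξ) (f := fun v : (ℝ × (E × ℝ)) × ℝ => v.1) _ hξ (by fun_prop)
      exact hF1.contDiffAt.comp (f := fun v : (ℝ × (E × ℝ)) × ℝ => (ξ v.1 + v.2, v.1)) _
        (by fun_prop))
    (Eventually.of_forall fun z => (hasDerivAt_partialFst hF1 _ z.1.1 z.1.2).comp_const_add
      (ξ z.1) z.2)
    (by
      filter_upwards [hξ1] with q hq
      rw [add_zero, hq]) h3 (by
      have := hasDerivAt_partialFst hF2 0 0 0
      simp only [hξ0, zero_add]
      exact this) ci cj (by
      have c : Tendsto (fun w : (ℝ × E) × ℝ => w.1) (𝓝 0) (𝓝 0) :=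
        (by fun_prop : Continuous fun w : (ℝ × E) × ℝ => w.1).tendsto' _ _ rfl
      filter_upwards [c.eventually hξi] with w hw
      rw [hw, hi1])
  -- the coordinate `x`: the equation `Kv ((0, x₂), p) = x` is solved for `x₂`, which is possible
  -- because of the mixed derivative
  have hKvl : ContDiffAt ℝ ∞ (fun y : ℝ => Kv ((0, y), 0)) 0 :=
    ContDiffAt.comp (g := Kv) (f := fun y : ℝ => (((0, y), 0) : (ℝ × ℝ) × (E × ℝ))) _ hKv
      (by fun_prop)
  have hKv0 : Kv ((0, 0), 0) = 0 := by
    have := hKv2.self_of_nhds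
    rw [this]
    exact sub_self _
  have hKvd : HasDerivAt (fun y : ℝ => Kv ((0, y), 0))
      (deriv (fun x₂ => fderiv ℝ (partialFst F) (0, x₂, 0) (0, 0, 0, 1)) 0) 0 := by
    have a1 := hKvl.eventually_differentiableAt.self_of_nhds.hasDerivAt
    have a2 : deriv (fun y : ℝ => Kv ((0, y), 0)) 0 = _ :=
      EventuallyEq.deriv_eq (f := fun x₂ => fderiv ℝ (partialFst F) (0, x₂, 0) (0, 0, 0, 1) -
        fderiv ℝ (partialFst F) 0 (0, 0, 0, 1)) hKv2
    rw [deriv_sub_const] at a2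
    rwa [a2] at a1
  obtain ⟨X, hX, hX0, hX1, -⟩ := exists_implicit (q₀ := (0 : ℝ × (E × ℝ)))
    (d := deriv (fun x₂ => fderiv ℝ (partialFst F) (0, x₂, 0) (0, 0, 0, 1)) 0)
    (G := fun v : (ℝ × (E × ℝ)) × ℝ => Kv ((0, v.2), v.1.2) - v.1.1) (by
      have : ContDiffAt ℝ ∞ (fun v : (ℝ × (E × ℝ)) × ℝ => Kv ((0, v.2), v.1.2)) (0, 0) :=
        ContDiffAt.comp (g := Kv) (f := fun v : (ℝ × (E × ℝ)) × ℝ =>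
          ((((0 : ℝ), v.2), v.1.2) : (ℝ × ℝ) × (E × ℝ))) _ hKv (by fun_prop)
      exact this.sub (by fun_prop)) (by simpa using hKv0) (by simpa using hKvd) hmix
  have hXt : Tendsto X (𝓝 0) (𝓝 0) := by simpa [hX0] using hX.continuousAt.tendsto
  have hXl : ContDiffAt ℝ ∞ (fun x : ℝ => X (x, 0)) 0 :=
    ContDiffAt.comp (g := X) (f := fun x : ℝ => ((x, 0) : ℝ × (E × ℝ))) _ hX (by fun_prop)
  have hXd := hXl.eventually_differentiableAt.self_of_nhds.hasDerivAt
  have hXd0 : deriv (fun x : ℝ => X (x, 0)) 0 ≠ 0 := by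
    intro h0
    have b1 : HasDerivAt (fun y : ℝ => Kv ((0, y), 0))
        (deriv (fun x₂ => fderiv ℝ (partialFst F) (0, x₂, 0) (0, 0, 0, 1)) 0) (X (0, 0)) := by
      rw [show X (0, 0) = 0 from hX0]
      exact hKvd
    have b2 := b1.comp (0 : ℝ) hXd
    have b3 : (fun x : ℝ => x) =ᶠ[𝓝 0] (fun y : ℝ => Kv ((0, y), 0)) ∘ fun x : ℝ => X (x, 0) := by
      filter_upwards [cx.eventually hX1] with x hx
      simp only [Function.comp]
      linarith
    have b4 := (b2.congr_of_eventuallyEq b3).unique (hasDerivAt_id (0 : ℝ))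
    rw [h0, mul_zero] at b4
    exact zero_ne_one b4
  -- the weight `∂ₛ Y`, which depends on `x₂` only up to a multiple of `σ`
  set Ys : (ℝ × (E × ℝ)) × ℝ → ℝ := fun v => fderiv ℝ Y v (0, 1) with hYs
  have hYsc : ContDiffAt ℝ ∞ Ys 0 := hY.fderiv_apply_infty _
  have hYs1 : ∀ᶠ z in 𝓝 (0 : (ℝ × (E × ℝ)) × ℝ), HasDerivAt (fun s => Y (z.1, s)) (Ys z) z.2 :=
    hY.eventually_hasDerivAt_snd
  obtain ⟨L, hL, hL1, -⟩ := exists_eq_snd_mul (Y := ℝ × ℝ) (E := E)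
    (M := fun z : (ℝ × ℝ) × (E × ℝ) => Ys ((z.1.2, z.2), z.1.1) - Ys ((0, z.2), z.1.1)) (by
      have z1 : ContDiffAt ℝ ∞ (fun z : (ℝ × ℝ) × (E × ℝ) => Ys ((z.1.2, z.2), z.1.1)) 0 :=
        ContDiffAt.comp (g := Ys)
          (f := fun z : (ℝ × ℝ) × (E × ℝ) => ((z.1.2, z.2), z.1.1)) _ hYsc (by fun_prop)
      have z2 : ContDiffAt ℝ ∞ (fun z : (ℝ × ℝ) × (E × ℝ) => Ys ((0, z.2), z.1.1)) 0 :=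
        ContDiffAt.comp (g := Ys)
          (f := fun z : (ℝ × ℝ) × (E × ℝ) => (((0 : ℝ), z.2), z.1.1)) _ hYsc (by fun_prop)
      exact z1.sub z2) (by
      have c : Tendsto (fun q : (ℝ × ℝ) × E => ((q.1.2, q.2), q.1.1)) (𝓝 0) (𝓝 0) :=
        (by fun_prop : Continuous fun q : (ℝ × ℝ) × E => ((q.1.2, q.2), q.1.1)).tendsto' _ _ rfl
      have c1 : Tendsto (fun q : (ℝ × ℝ) × E => (((q.1.2, q.2, (0 : ℝ)), q.1.1) :
          (ℝ × (E × ℝ)) × ℝ)) (𝓝 0) (𝓝 0) := (by fun_prop : Continuous fun q : (ℝ × ℝ) × E =>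
            (((q.1.2, q.2, (0 : ℝ)), q.1.1) : (ℝ × (E × ℝ)) × ℝ)).tendsto' _ _ rfl
      have c2 : Tendsto (fun q : (ℝ × ℝ) × E => ((((0 : ℝ), q.2, (0 : ℝ)), q.1.1) :
          (ℝ × (E × ℝ)) × ℝ)) (𝓝 0) (𝓝 0) := (by fun_prop : Continuous fun q : (ℝ × ℝ) × E =>
            ((((0 : ℝ), q.2, (0 : ℝ)), q.1.1) : (ℝ × (E × ℝ)) × ℝ)).tendsto' _ _ rfl
      filter_upwards [c.eventually hYi.eventually_nhds, c1.eventually hYs1, c2.eventually hYs1]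
        with q a1 a2 a3
      have a4 : (fun s => Y ((q.1.2, q.2, 0), s)) =ᶠ[𝓝 q.1.1] fun s => Y ((0, q.2, 0), s) :=
        ((by fun_prop : Continuous fun s : ℝ => ((q.1.2, q.2), s)).tendsto q.1.1).eventually a1
      rw [(a2.congr_of_eventuallyEq a4.symm).unique a3, sub_self])
  -- globally defined functions with these germs
  have gW0 : ContDiffAt ℝ ∞ (fun v : ℝ × (E × ℝ) => Ys ((0, v.2), v.1)) 0 :=
    ContDiffAt.comp (g := Ys) (f := fun v : ℝ × (E × ℝ) => (((0 : ℝ), v.2), v.1)) _ hYsc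
      (by fun_prop)
  have gX1 : ContDiffAt ℝ ∞ (fun v : ℝ × ℝ × (E × ℝ) => X v.2) 0 :=
    ContDiffAt.comp (g := X) (f := fun v : ℝ × ℝ × (E × ℝ) => v.2) _ hX (by fun_prop)
  have gW1 : ContDiffAt ℝ ∞ (fun v : ℝ × ℝ × (E × ℝ) => L ((v.1, X v.2), v.2.2)) 0 := by
    refine ContDiffAt.comp (g := L) (f := fun v : ℝ × ℝ × (E × ℝ) => ((v.1, X v.2), v.2.2)) _ ?_
      (by fun_prop)
    change ContDiffAt ℝ ∞ L ((0, X 0), 0)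
    rw [hX0]
    exact hL
  have gh : ContDiffAt ℝ ∞ (fun v : ℝ × (E × ℝ) => KH ((0, X v), v.2)) 0 := by
    refine ContDiffAt.comp (g := KH) (f := fun v : ℝ × (E × ℝ) => (((0 : ℝ), X v), v.2)) _ ?_
      (by fun_prop)
    change ContDiffAt ℝ ∞ KH ((0, X 0), 0)
    rw [hX0]
    exact hKH
  obtain ⟨W₀, hW₀, hW₀e⟩ := exists_contDiff_eventuallyEq_of_contDiffAt gW0 (m + 5)
  obtain ⟨W₁, hW₁, hW₁e⟩ := exists_contDiff_eventuallyEq_of_contDiffAt gW1 (m + 5)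
  obtain ⟨h, hh, hhe⟩ := exists_contDiff_eventuallyEq_of_contDiffAt gh (m + 5)
  obtain ⟨Xg, hXg, hXge⟩ := exists_contDiff_eventuallyEq_of_contDiffAt hX 3
  obtain ⟨ξg, hξg, hξge⟩ := exists_contDiff_eventuallyEq_of_contDiffAt hξ 3
  obtain ⟨Yg, hYg, hYge⟩ := exists_contDiff_eventuallyEq_of_contDiffAt hY 3
  have cfl : ContDiff ℝ ∞ fun x₂ : ℝ => fderiv ℝ F (0, x₂, 0) (0, 0, 0, 1) :=
    ((hF.fderiv_right (m := ∞) (by simp)).clm_apply contDiff_const).comp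
      (f := fun x₂ : ℝ => ((0, x₂, 0) : ℝ × ℝ × (E × ℝ))) (by fun_prop)
  have hcst : ∀ l, 1 ≤ l → ∀ c : ℝ,
      iteratedDeriv l (fun x₂ => fderiv ℝ F (0, x₂, 0) (0, 0, 0, 1) - c) 0
      = iteratedDeriv l (fun x₂ => fderiv ℝ F (0, x₂, 0) (0, 0, 0, 1)) 0 := by
    intro l hl c
    obtain ⟨k, rfl⟩ := Nat.exists_eq_add_of_le' hl
    have hd : deriv (fun x₂ : ℝ => fderiv ℝ F (0, x₂, 0) (0, 0, 0, 1) - c)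
        = deriv fun x₂ : ℝ => fderiv ℝ F (0, x₂, 0) (0, 0, 0, 1) := by
      funext y
      rw [deriv_sub_const]
    rw [iteratedDeriv_succ', hd, ← iteratedDeriv_succ']
  have hXx : Tendsto (fun x : ℝ => X (x, 0)) (𝓝 0) (𝓝 0) := hXt.comp cx
  let N : AiryNormalForm E m :=
    { W₀ := W₀
      W₁ := W₁
      h := h
      B := fun p => partialFst F (ξ (0, p), 0, p)
      contDiff_W₀ := hW₀
      contDiff_W₁ := hW₁
      contDiff_h := hh
      continuousAt_B := by
        have z1 : ContinuousAt (fun p : E × ℝ => ξ (0, p)) 0 :=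
          ContinuousAt.comp (g := ξ) (f := fun p : E × ℝ => ((0 : ℝ), p)) hξ.continuousAt
            (by fun_prop)
        exact ContinuousAt.comp (g := partialFst F) (f := fun p : E × ℝ => (ξ (0, p), (0 : ℝ), p))
          hF1.continuous.continuousAt (by fun_prop)
      B_zero := by
        rw [show ξ (0, 0) = 0 from hξ0]
        exact h1
      W₀_pos := by
        rw [hW₀e.eq_of_nhds]
        have a1 := hYs1.self_of_nhds.unique hYe
        change 0 < Ys 0
        rw [a1]
        exact he
      two_le := hm
      h_ne := by
        have a1 : (fun x : ℝ => h (x, 0)) =ᶠ[𝓝 0] fun x => (fun x₂ : ℝ =>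
            fderiv ℝ F (0, x₂, 0) (0, 0, 0, 1) - fderiv ℝ F 0 (0, 0, 0, 1)) (X (x, 0)) := by
          filter_upwards [cx.eventually hhe, hXx.eventually hKH2] with x b1 b2
          rw [b1, b2]
        rw [a1.iteratedDeriv_eq]
        refine iteratedDeriv_comp_ne_zero (by omega) (cfl.sub contDiff_const).contDiffAt hXl hX0
          hXd0 (fun l hl hlm => ?_) ?_
        · rw [hcst l hl]; exact hv l hl hlm
        · rw [hcst m (by omega)]; exact hx }
  refine ⟨N, Xg, ξg, Yg, fun p => F (ξ (0, p), 0, p), hXg, hξg, hYg, ?_, ?_,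
    ⟨_, hXd0, hXd.congr_of_eventuallyEq (cx.eventually hXge)⟩, ?_, ⟨e, he,
      hYe.congr_of_eventuallyEq ?_⟩, ?_⟩
  · rw [hXge.eq_of_nhds, hX0]
  · rw [hξge.eq_of_nhds, hξ0]
  · rw [hYge.eq_of_nhds]; exact hY0.self_of_nhds
  · have cy : Tendsto (fun s : ℝ => ((0, s) : (ℝ × (E × ℝ)) × ℝ)) (𝓝 0) (𝓝 0) :=
      (by fun_prop : Continuous fun s : ℝ => ((0, s) : (ℝ × (E × ℝ)) × ℝ)).tendsto' _ _ rfl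
    exact cy.eventually hYge
  have c0 : Tendsto (fun z : (ℝ × ℝ) × (E × ℝ) => (z.1.2, z.2)) (𝓝 0) (𝓝 0) :=
    (by fun_prop : Continuous fun z : (ℝ × ℝ) × (E × ℝ) => (z.1.2, z.2)).tendsto' _ _ rfl
  have cX : Tendsto (fun z : (ℝ × ℝ) × (E × ℝ) => X (z.1.2, z.2)) (𝓝 0) (𝓝 0) := hXt.comp c0
  have cp : Tendsto (fun z : (ℝ × ℝ) × (E × ℝ) => z.2) (𝓝 0) (𝓝 0) :=
    (by fun_prop : Continuous fun z : (ℝ × ℝ) × (E × ℝ) => z.2).tendsto' _ _ rfl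
  have cs : Tendsto (fun z : (ℝ × ℝ) × (E × ℝ) => z.1.1) (𝓝 0) (𝓝 0) :=
    (by fun_prop : Continuous fun z : (ℝ × ℝ) × (E × ℝ) => z.1.1).tendsto' _ _ rfl
  have cz : Tendsto (fun _ : (ℝ × ℝ) × (E × ℝ) => (0 : ℝ)) (𝓝 0) (𝓝 0) := tendsto_const_nhds
  have cq := cX.prodMk_nhds cp
  have cqs := cq.prodMk_nhds cs
  have csX := (cs.prodMk_nhds cX).prodMk_nhds cp
  have c0X := (cz.prodMk_nhds cX).prodMk_nhds cp
  obtain ⟨R, hR, hall⟩ := exists_forall_of_eventually_nhds ((cqs.eventually hYs1).and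
    ((cqs.eventually hY1).and ((cq.eventually hY0).and ((csX.eventually hL1).and
    (((cs.prodMk_nhds cp).eventually hW₀e).and (((cs.prodMk_nhds c0).eventually hW₁e).and
    ((c0.eventually hhe).and ((c0X.eventually hKv1).and ((c0.eventually hX1).and
    ((c0X.eventually hKH1).and ((cqs.eventually hYge).and ((cq.eventually hξge).and
    (c0.eventually hXge)))))))))))))
  refine ⟨R, hR, fun s x p hs hx hp => ?_⟩
  have hpt := fun s hs => hall s x p hs hx hp
  obtain ⟨-, -, y0, -, -, -, eh, ev, eX, eH, -, eξ, eXg⟩ := hpt s hs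
  obtain ⟨-, -, -, -, -, -, -, -, -, -, eY, -, -⟩ := hpt s hs
  dsimp only at y0 eh ev eX eH eY eξ eXg
  simp only [add_zero] at ev eH
  rw [eXg, eξ, eY]
  have hWc : Continuous N.W := by
    have a1 := hW₀.continuous
    have a2 := hW₁.continuous
    change Continuous fun y : ℝ × ℝ × (E × ℝ) => W₀ (y.1, y.2.2) + y.2.2.2 * W₁ y
    fun_prop
  refine eq_of_hasDerivAt_eq (R := R)
    (f := fun s => F (ξ (X (x, p), p) + Y ((X (x, p), p), s), X (x, p), p))
    (g := fun s => F (ξ (0, p), 0, p) + N.phase s x p)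
    (f' := fun s => (N.B p + p.2 * x + s ^ 2) * N.W (s, x, p)) (fun s hs => ?_) (fun s _ => ?_) ?_
    hs
  · obtain ⟨b1, b2, -, b4, b5, b6, -, -, -, -, -, -, -⟩ := hpt s hs
    dsimp only at b1 b2 b4 b5 b6
    simp only [add_zero] at b2
    have d1 := (hasDerivAt_partialFst hF (ξ (X (x, p), p) + Y ((X (x, p), p), s)) (X (x, p)) p).comp
      s (b1.const_add (ξ (X (x, p), p)))
    refine d1.congr_deriv ?_
    have e1 : N.W (s, x, p) = Ys ((X (x, p), p), s) := by
      change W₀ (s, p) + p.2 * W₁ (s, x, p) = _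
      rw [b5, b6]
      linarith
    have e2 : N.B p + p.2 * x = partialFst F (ξ (X (x, p), p), X (x, p), p) := by
      change partialFst F (ξ (0, p), 0, p) + p.2 * x = _
      rw [ev]
      rw [sub_eq_zero.1 eX]
    rw [e1, e2, b2]
  · have := ((hasDerivAt_airyPrim hWc s (N.B p + p.2 * x) x 1 p).const_add
      (p.2 * N.h (x, p))).const_add (F (ξ (0, p), 0, p))
    rwa [one_mul] at this
  · have a1 : N.phase 0 x p = p.2 * h (x, p) := by
      simp [AiryNormalForm.phase, airyPrim_eq_integral, N]
    simp only [y0, add_zero, a1, eh]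
    rw [eH]

end

/-! ### The estimate in the degenerate case -/

theorem exists_forall_mul_pos_of_hasDerivAt {f : ℝ → ℝ} {d : ℝ} (hd : d ≠ 0)
    (hf : HasDerivAt f d 0) (h0 : f 0 = 0) :
    ∃ r > 0, ∀ s, |s| ≤ r → s ≠ 0 → 0 < (d * s) * f s := by
  have h1 := (hasDerivAt_iff_isLittleO.1 hf).def (half_pos (abs_pos.2 hd))
  obtain ⟨r, hr, hb⟩ := Metric.eventually_nhds_iff_ball.1 h1
  refine ⟨r / 2, half_pos hr, fun s hs hs0 => ?_⟩
  have h2 := hb s (by rw [mem_ball_zero_iff, Real.norm_eq_abs]; linarith)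
  rw [h0, sub_zero, sub_zero, smul_eq_mul, Real.norm_eq_abs, Real.norm_eq_abs] at h2
  have h3 : |d * s * (f s - s * d)| ≤ |d * s| * (|d| / 2 * |s|) := by
    rw [abs_mul]
    exact mul_le_mul_of_nonneg_left h2 (abs_nonneg _)
  have h4 : |d * s| * (|d| / 2 * |s|) = (d * s) ^ 2 / 2 := by
    rw [← sq_abs (d * s), abs_mul]; ring
  have h5 : 0 < (d * s) ^ 2 := by positivity
  have h6 := (abs_le.1 h3).1
  nlinarith

/-- The integral of a function between points on both sides of its support, in either order. -/
theorem norm_integral_eq_of_mul_neg {g : ℝ → ℂ} {η α β : ℝ} (hη : 0 ≤ η)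
    (hg : ∀ x, η ≤ |x| → g x = 0) (hα : η ≤ |α|) (hβ : η ≤ |β|) (hαβ : α * β < 0) :
    ‖∫ x in α..β, g x‖ = ‖∫ x in (-η)..η, g x‖ := by
  have hz : ∀ x : ℝ, x ∉ Icc (-η) η → g x = 0 := fun x hx => hg x (by
    by_contra! h
    exact hx (abs_le.1 h.le))
  rcases mul_neg_iff.1 hαβ with ⟨h1, h2⟩ | ⟨h1, h2⟩
  · rw [abs_of_pos h1] at hα
    rw [abs_of_neg h2] at hβ
    rw [intervalIntegral.integral_symm, norm_neg, intervalIntegral_eq_of_eq_zero (by linarith)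
      (by linarith) hα fun x _ => hz x]
  · rw [abs_of_neg h1] at hα
    rw [abs_of_pos h2] at hβ
    rw [intervalIntegral_eq_of_eq_zero (by linarith) (by linarith) hβ fun x _ => hz x]

section

variable {E : Type} [NormedAddCommGroup E] [NormedSpace ℝ E]

set_option maxHeartbeats 1000000 in
/-- The estimate in the coordinates of the normal form is carried back by the successive
substitutions `x₁ = ξ + Y (s)` and `x₂ = X (x)`. No orientation of `X` is needed, since only
absolute values are estimated, and where `|X| ≥ η` both sides of the first substitution vanish. -/
theorem hasAiryBound_of_deriv_three_pos [FiniteDimensional ℝ E] {F : ℝ × ℝ × (E × ℝ) → ℝ}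
    (hF : ContDiff ℝ ∞ F) (hind : ∀ x₁ x₂ (δ : E), F (x₁, x₂, δ, 0) = F (x₁, 0, δ, 0))
    {m : ℕ} (hm : 2 ≤ m) (h1 : partialFst F 0 = 0) (h2 : partialFst (partialFst F) 0 = 0)
    (h3 : 0 < partialFst (partialFst (partialFst F)) 0)
    (hmix : deriv (fun x₂ => fderiv ℝ (partialFst F) (0, x₂, 0) (0, 0, 0, 1)) 0 ≠ 0)
    (hv : ∀ l, 1 ≤ l → l < m →
      iteratedDeriv l (fun x₂ => fderiv ℝ F (0, x₂, 0) (0, 0, 0, 1)) 0 = 0)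
    (hx : iteratedDeriv m (fun x₂ => fderiv ℝ F (0, x₂, 0) (0, 0, 0, 1)) 0 ≠ 0) :
    HasAiryBound F m := by
  obtain ⟨N, X, ξ, Y, H, hX, hξ, hY, hX0, hξ0, ⟨d, hd, hXd⟩, hY0, ⟨e, he, hYe⟩, R, hR, hid⟩ :=
    exists_airyNormalForm hF hind hm h1 h2 h3 hmix hv hx
  obtain ⟨r₁, hr₁, hYr⟩ := exists_forall_mul_pos_of_hasDerivAt he.ne' hYe hY0
  obtain ⟨r₂, hr₂, hXr⟩ := exists_forall_mul_pos_of_hasDerivAt hd hXd hX0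
  obtain ⟨ρ, hρ, hρR, ρ', hρ', hbound⟩ :=
    N.exists_norm_integral_le (R := min R (min r₁ r₂)) (by positivity)
  have hρR' : ρ ≤ R := hρR.trans (min_le_left _ _)
  have hρ₁ : ρ ≤ r₁ := hρR.trans ((min_le_right _ _).trans (min_le_left _ _))
  have hρ₂ : ρ ≤ r₂ := hρR.trans ((min_le_right _ _).trans (min_le_right _ _))
  have hρa : |ρ| = ρ := abs_of_pos hρ
  have hρn : |-ρ| = ρ := by rw [abs_neg, hρa]
  -- the images of the end points lie on both sides of the origin
  have ypos : 0 < Y (0, ρ) := pos_of_mul_pos_right (hYr ρ (by rw [hρa]; exact hρ₁) hρ.ne')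
    (by positivity)
  have yneg : Y (0, -ρ) < 0 := by
    have := hYr (-ρ) (by rw [hρn]; exact hρ₁) (by linarith)
    by_contra! h
    have : 0 ≤ e * ρ * Y (0, -ρ) := by positivity
    linarith
  have x₀ : X (-ρ, 0) * X (ρ, 0) < 0 := by
    have b1 := hXr ρ (by rw [hρa]; exact hρ₂) hρ.ne'
    have b2 := hXr (-ρ) (by rw [hρn]; exact hρ₂) (by linarith)
    have b3 := mul_pos b1 b2
    have b4 : 0 < (d * ρ) ^ 2 := by positivity
    by_contra! h
    nlinarith [mul_nonneg b4.le h]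
  have xpos : 0 < |X (ρ, 0)| := abs_pos.2 fun h => by simp [h] at x₀
  have xneg : 0 < |X (-ρ, 0)| := abs_pos.2 fun h => by simp [h] at x₀
  have hXc := hX.continuous
  have hξc := hξ.continuous
  have hYc := hY.continuous
  have ev1 : ∀ᶠ q : ℝ × (E × ℝ) in 𝓝 0, Y (0, ρ) / 2 < ξ q + Y (q, ρ) :=
    (by fun_prop : Continuous fun q : ℝ × (E × ℝ) => ξ q + Y (q, ρ)).continuousAt.eventually
      (lt_mem_nhds (by
        change Y (0, ρ) / 2 < ξ 0 + Y (0, ρ)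
        rw [hξ0]
        linarith))
  have ev2 : ∀ᶠ q : ℝ × (E × ℝ) in 𝓝 0, ξ q + Y (q, -ρ) < Y (0, -ρ) / 2 :=
    (by fun_prop : Continuous fun q : ℝ × (E × ℝ) => ξ q + Y (q, -ρ)).continuousAt.eventually
      (gt_mem_nhds (by
        change ξ 0 + Y (0, -ρ) < Y (0, -ρ) / 2
        rw [hξ0]
        linarith))
  have ev3 : ∀ᶠ p : E × ℝ in 𝓝 0, X (-ρ, p) * X (ρ, p) < 0 :=
    (by fun_prop : Continuous fun p : E × ℝ => X (-ρ, p) * X (ρ, p)).continuousAt.eventually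
      (gt_mem_nhds x₀)
  have ev4 : ∀ᶠ p : E × ℝ in 𝓝 0, |X (ρ, 0)| / 2 < |X (ρ, p)| :=
    (by fun_prop : Continuous fun p : E × ℝ => |X (ρ, p)|).continuousAt.eventually
      (lt_mem_nhds (by linarith))
  have ev5 : ∀ᶠ p : E × ℝ in 𝓝 0, |X (-ρ, 0)| / 2 < |X (-ρ, p)| :=
    (by fun_prop : Continuous fun p : E × ℝ => |X (-ρ, p)|).continuousAt.eventually
      (lt_mem_nhds (by linarith))
  obtain ⟨κ₁, hκ₁, hb1⟩ := Metric.eventually_nhds_iff_ball.1 (ev1.and ev2)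
  obtain ⟨κ₂, hκ₂, hb2⟩ := Metric.eventually_nhds_iff_ball.1 (ev3.and (ev4.and ev5))
  -- for small `p`, an amplitude supported in the square of size `η` lies, in the coordinates
  -- `(s, x)`, within `|s|, |x| < ρ`
  obtain ⟨η, hη0, hη⟩ : ∃ η > 0, η ≤ Y (0, ρ) / 2 ∧ η ≤ -Y (0, -ρ) / 2 ∧ η ≤ |X (ρ, 0)| / 2 ∧
      η ≤ |X (-ρ, 0)| / 2 ∧ η ≤ κ₁ / 2 ∧ η ≤ κ₂ / 2 ∧ η ≤ ρ' ∧ η ≤ R := by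
    have yneg' : 0 < -Y (0, -ρ) / 2 := by linarith
    refine ⟨min (Y (0, ρ) / 2) (min (-Y (0, -ρ) / 2) (min (|X (ρ, 0)| / 2) (min (|X (-ρ, 0)| / 2)
      (min (κ₁ / 2) (min (κ₂ / 2) (min ρ' R)))))), by positivity, ?_⟩
    simp
  obtain ⟨e1, e2, e3, e4, e5, e6, e7, e8⟩ := hη
  refine ⟨η, hη0, fun a ha ha0 => ?_⟩
  set Ys : (ℝ × (E × ℝ)) × ℝ → ℝ := fun v => fderiv ℝ Y v (0, 1) with hYs
  set Xx : ℝ × (E × ℝ) → ℝ := fun v => fderiv ℝ X v (1, 0) with hXx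
  have hYsc : ContDiff ℝ 2 Ys := (hY.fderiv_right (m := 2) (by norm_num)).clm_apply contDiff_const
  have hXxc : ContDiff ℝ 2 Xx := (hX.fderiv_right (m := 2) (by norm_num)).clm_apply contDiff_const
  have hX2 : ContDiff ℝ 2 X := hX.of_le (by norm_num)
  have hξ2 : ContDiff ℝ 2 ξ := hξ.of_le (by norm_num)
  have hY2 : ContDiff ℝ 2 Y := hY.of_le (by norm_num)
  have hYd : ∀ q s, HasDerivAt (fun s => Y (q, s)) (Ys (q, s)) s := fun q s =>
    ((hY.differentiable (by simp)) (q, s)).hasFDerivAt.comp_hasDerivAt s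
      ((hasDerivAt_const s q).prodMk (hasDerivAt_id s))
  have hXd' : ∀ x p, HasDerivAt (fun x => X (x, p)) (Xx (x, p)) x := fun x p =>
    ((hX.differentiable (by simp)) (x, p)).hasFDerivAt.comp_hasDerivAt x
      ((hasDerivAt_id x).prodMk (hasDerivAt_const x p))
  set A : ℝ × ℝ × (E × ℝ) → ℂ := fun v =>
    ((Xx v.2 * Ys ((X v.2, v.2.2), v.1) : ℝ) : ℂ) *
      a (ξ (X v.2, v.2.2) + Y ((X v.2, v.2.2), v.1), X v.2, v.2.2) with hA
  have hAc : ContDiff ℝ 2 A := by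
    have c1 : ContDiff ℝ 2 fun v : ℝ × ℝ × (E × ℝ) => X v.2 := hX2.comp contDiff_snd
    have c2 : ContDiff ℝ 2 fun v : ℝ × ℝ × (E × ℝ) => ξ (X v.2, v.2.2) :=
      hξ2.comp (f := fun v : ℝ × ℝ × (E × ℝ) => (X v.2, v.2.2)) (by fun_prop)
    have c3 : ContDiff ℝ 2 fun v : ℝ × ℝ × (E × ℝ) => Y ((X v.2, v.2.2), v.1) :=
      hY2.comp (f := fun v : ℝ × ℝ × (E × ℝ) => ((X v.2, v.2.2), v.1)) (by fun_prop)
    have c4 : ContDiff ℝ 2 fun v : ℝ × ℝ × (E × ℝ) => Ys ((X v.2, v.2.2), v.1) :=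
      hYsc.comp (f := fun v : ℝ × ℝ × (E × ℝ) => ((X v.2, v.2.2), v.1)) (by fun_prop)
    have c5 : ContDiff ℝ 2 fun v : ℝ × ℝ × (E × ℝ) => Xx v.2 := hXxc.comp contDiff_snd
    exact (Complex.ofRealCLM.contDiff.comp (c5.mul c4)).mul
      (ha.comp (f := fun v : ℝ × ℝ × (E × ℝ) =>
        (ξ (X v.2, v.2.2) + Y ((X v.2, v.2.2), v.1), X v.2, v.2.2)) (by fun_prop))
  obtain ⟨C, hC, hC'⟩ := hbound A hAc
  refine ⟨C, hC, fun lam p hlam hp2 hp => ?_⟩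
  have hFc := hF.continuous
  have hac := ha.continuous
  have hYsc' := hYsc.continuous
  have hXxc' := hXxc.continuous
  have hq : ∀ x, |X (x, p)| < η → η < ξ (X (x, p), p) + Y ((X (x, p), p), ρ) ∧
      ξ (X (x, p), p) + Y ((X (x, p), p), -ρ) < -η := by
    intro x hx
    have := hb1 (X (x, p), p) (by
      rw [mem_ball_zero_iff, Prod.norm_mk, Real.norm_eq_abs]
      exact max_lt (by linarith) (by linarith))
    constructor <;> linarith [this.1, this.2]
  have hpb := hb2 p (by rw [mem_ball_zero_iff]; linarith)
  set g : ℝ → ℝ → ℂ := fun x₂ x₁ =>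
    Complex.exp (Complex.I * ((lam * F (x₁, x₂, p) : ℝ) : ℂ)) * a (x₁, x₂, p) with hg
  have hgc : Continuous fun v : ℝ × ℝ => g v.1 v.2 := by
    simp only [hg]
    fun_prop
  have hgz : ∀ x₂ x₁, η ≤ |x₁| ∨ η ≤ |x₂| → g x₂ x₁ = 0 := fun x₂ x₁ h => by
    simp only [hg]
    rw [ha0 x₁ x₂ p h, mul_zero]
  have inner : ∀ x, ∫ x₁ in (-η)..η, g (X (x, p)) x₁ = ∫ s in (-ρ)..ρ, Ys ((X (x, p), p), s) •
      g (X (x, p)) (ξ (X (x, p), p) + Y ((X (x, p), p), s)) := by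
    intro x
    rcases le_or_gt η |X (x, p)| with h | h
    · rw [intervalIntegral_eq_zero (by linarith) fun x₁ _ => hgz _ x₁ (Or.inr h),
        intervalIntegral_eq_zero (by linarith) fun s _ => by rw [hgz _ _ (Or.inr h), smul_zero]]
    · have a1 := hq x h
      have := intervalIntegral.integral_deriv_smul_comp (a := -ρ) (b := ρ)
        (f := fun s => ξ (X (x, p), p) + Y ((X (x, p), p), s))
        (f' := fun s => Ys ((X (x, p), p), s)) (g := g (X (x, p)))
        (fun s _ => (hYd _ s).const_add _) (by fun_prop) (by fun_prop)
      simp only [Function.comp] at this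
      rw [this]
      refine (intervalIntegral_eq_of_eq_zero a1.2.le (by linarith) a1.1.le fun x₁ _ hx₁ =>
        hgz _ x₁ (Or.inl ?_)).symm
      by_contra! h'
      exact hx₁ (abs_le.1 h'.le)
  have hIc : Continuous fun x₂ => ∫ x₁ in (-η)..η, g x₂ x₁ :=
    intervalIntegral.continuous_parametric_intervalIntegral_of_continuous' (f := g) hgc _ _
  have outer := intervalIntegral.integral_deriv_smul_comp (a := -ρ) (b := ρ)
    (f := fun x => X (x, p)) (f' := fun x => Xx (x, p)) (g := fun x₂ => ∫ x₁ in (-η)..η, g x₂ x₁)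
    (fun x _ => hXd' x p) (by fun_prop) hIc
  have key : ∫ x in (-ρ)..ρ, Xx (x, p) • ∫ x₁ in (-η)..η, g (X (x, p)) x₁
      = Complex.exp (Complex.I * ((lam * H p : ℝ) : ℂ)) * ∫ x in (-ρ)..ρ, ∫ s in (-ρ)..ρ,
        Complex.exp (Complex.I * ((lam * N.phase s x p : ℝ) : ℂ)) * A (s, x, p) := by
    rw [← intervalIntegral.integral_const_mul]
    refine intervalIntegral.integral_congr fun x hx => ?_
    rw [inner, ← intervalIntegral.integral_const_mul, ← intervalIntegral.integral_smul]
    refine intervalIntegral.integral_congr fun s hs => ?_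
    rw [uIcc_of_le (by linarith)] at hx hs
    have a1 := hid s x p ((abs_le.2 hs).trans hρR') ((abs_le.2 hx).trans hρR') (hp.trans e8)
    simp only [hg, hA, Complex.real_smul]
    rw [a1, mul_add, Complex.ofReal_add, mul_add, Complex.exp_add, Complex.ofReal_mul (Xx (x, p))]
    ring
  simp only [Function.comp] at outer
  rw [key] at outer
  change ‖∫ x₂ in (-η)..η, ∫ x₁ in (-η)..η, g x₂ x₁‖ ≤ _
  rw [← norm_integral_eq_of_mul_neg hη0.le (g := fun x₂ => ∫ x₁ in (-η)..η, g x₂ x₁)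
    (α := X (-ρ, p)) (β := X (ρ, p))
    (fun x₂ h => intervalIntegral_eq_zero (by linarith) fun x₁ _ => hgz x₂ x₁ (Or.inr h))
    (e4.trans hpb.2.2.le) (e3.trans hpb.2.1.le) hpb.1, ← outer, norm_mul, mul_comm Complex.I,
    Complex.norm_exp_ofReal_mul_I, one_mul]
  refine hC' lam p hlam hp2 (hp.trans e7) fun x hx => ?_
  rcases le_or_gt η |X (x, p)| with h | h
  · simp only [hA]
    rw [ha0 _ _ _ (Or.inr h), ha0 _ _ _ (Or.inr h), mul_zero, mul_zero]
    exact ⟨rfl, rfl⟩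
  · have a1 := hq x h
    have a2 := neg_le_abs (ξ (X (x, p), p) + Y ((X (x, p), p), -ρ))
    simp only [hA]
    rw [ha0 _ _ _ (Or.inl (a1.1.le.trans (le_abs_self _))),
      ha0 _ _ _ (Or.inl (by linarith)), mul_zero, mul_zero]
    exact ⟨rfl, rfl⟩

/-- Complex conjugation changes the sign of the phase. -/
theorem HasAiryBound.of_neg {F : ℝ × ℝ × (E × ℝ) → ℝ} {m : ℕ}
    (h : HasAiryBound (fun y => -F y) m) : HasAiryBound F m := by
  obtain ⟨η, hη, hb⟩ := h
  refine ⟨η, hη, fun a ha ha0 => ?_⟩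
  obtain ⟨C, hC, h⟩ := hb (fun y => (starRingEnd ℂ) (a y))
    (Complex.conjCLE.contDiff.comp ha) (fun x₁ x₂ p h => by rw [ha0 x₁ x₂ p h, map_zero])
  refine ⟨C, hC, fun lam p hlam hp2 hp => ?_⟩
  refine le_of_eq_of_le ?_ (h lam p hlam hp2 hp)
  rw [← RCLike.norm_conj, ← intervalIntegral.intervalIntegral_conj]
  congr 1
  refine intervalIntegral.integral_congr fun x₂ _ => ?_
  dsimp only
  rw [← intervalIntegral.intervalIntegral_conj]
  refine intervalIntegral.integral_congr fun x₁ _ => ?_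
  simp only [map_mul, ← Complex.exp_conj, Complex.conj_I, Complex.conj_ofReal]
  congr 2
  push_cast
  ring

end

/-! ### The phase `g₁ + σ g₂` -/

section

variable {E : Type} [NormedAddCommGroup E] [NormedSpace ℝ E]

theorem hasAiryBound_of_deriv_three_ne_zero [FiniteDimensional ℝ E] {F : ℝ × ℝ × (E × ℝ) → ℝ}
    (hF : ContDiff ℝ ∞ F) (hind : ∀ x₁ x₂ (δ : E), F (x₁, x₂, δ, 0) = F (x₁, 0, δ, 0))
    {m : ℕ} (hm : 2 ≤ m) (h1 : partialFst F 0 = 0) (h2 : partialFst (partialFst F) 0 = 0)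
    (h3 : partialFst (partialFst (partialFst F)) 0 ≠ 0)
    (hmix : deriv (fun x₂ => fderiv ℝ (partialFst F) (0, x₂, 0) (0, 0, 0, 1)) 0 ≠ 0)
    (hv : ∀ l, 1 ≤ l → l < m →
      iteratedDeriv l (fun x₂ => fderiv ℝ F (0, x₂, 0) (0, 0, 0, 1)) 0 = 0)
    (hx : iteratedDeriv m (fun x₂ => fderiv ℝ F (0, x₂, 0) (0, 0, 0, 1)) 0 ≠ 0) :
    HasAiryBound F m := by
  rcases h3.lt_or_gt with h | h
  · have hn : ∀ G : ℝ × ℝ × (E × ℝ) → ℝ, partialFst (fun y => -G y) = fun y => -partialFst G y := by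
      intro G
      funext y
      simp only [partialFst, fderiv_fun_neg, neg_apply]
    have hn' : ∀ (G : ℝ × ℝ × (E × ℝ) → ℝ), (fun x₂ : ℝ =>
        fderiv ℝ (fun y => -G y) (0, x₂, 0) (0, 0, 0, 1))
        = fun x₂ => -fderiv ℝ G (0, x₂, 0) (0, 0, 0, 1) := by
      intro G
      funext x
      simp only [fderiv_fun_neg, neg_apply]
    refine HasAiryBound.of_neg (hasAiryBound_of_deriv_three_pos hF.neg
      (fun x₁ x₂ δ => by simp only [hind x₁ x₂ δ]) hm ?_ ?_ ?_ ?_ (fun l hl hlm => ?_) ?_)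
    · simp only [hn, h1, neg_zero]
    · simp only [hn, h2, neg_zero]
    · rw [hn, hn, hn]
      exact neg_pos.2 h
    · rw [hn, hn', deriv.fun_neg]
      exact neg_ne_zero.2 hmix
    · rw [hn', iteratedDeriv_fun_neg, hv l hl hlm, neg_zero]
    · rw [hn', iteratedDeriv_fun_neg]
      exact neg_ne_zero.2 hx
  · exact hasAiryBound_of_deriv_three_pos hF hind hm h1 h2 h hmix hv hx

/-- The phase `g₁ (x₁, δ) + σ g₂ (x₁, x₂, δ)` in the variables `(x₁, x₂, δ, σ)`. -/
def sigmaPhase (g₁ : ℝ × E → ℝ) (g₂ : (ℝ × ℝ) × E → ℝ) (y : ℝ × ℝ × (E × ℝ)) : ℝ :=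
  g₁ (y.1, y.2.2.1) + y.2.2.2 * g₂ ((y.1, y.2.1), y.2.2.1)

theorem contDiff_sigmaPhase {g₁ : ℝ × E → ℝ} {g₂ : (ℝ × ℝ) × E → ℝ} (h₁ : ContDiff ℝ ∞ g₁)
    (h₂ : ContDiff ℝ ∞ g₂) : ContDiff ℝ ∞ (sigmaPhase g₁ g₂) := by
  have c1 : ContDiff ℝ ∞ fun y : ℝ × ℝ × (E × ℝ) => g₁ (y.1, y.2.2.1) :=
    h₁.comp (f := fun y : ℝ × ℝ × (E × ℝ) => (y.1, y.2.2.1)) (by fun_prop)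
  have c2 : ContDiff ℝ ∞ fun y : ℝ × ℝ × (E × ℝ) => g₂ ((y.1, y.2.1), y.2.2.1) :=
    h₂.comp (f := fun y : ℝ × ℝ × (E × ℝ) => ((y.1, y.2.1), y.2.2.1)) (by fun_prop)
  unfold sigmaPhase
  fun_prop

theorem hasDerivAt_fst_slice {g : ℝ × E → ℝ} (hg : ContDiff ℝ ∞ g) (t : ℝ) (δ : E) :
    HasDerivAt (fun t => g (t, δ)) (fderiv ℝ g (t, δ) (1, 0)) t :=
  ((hg.differentiable (by simp)) (t, δ)).hasFDerivAt.comp_hasDerivAt t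
    ((hasDerivAt_id t).prodMk (hasDerivAt_const t δ))

theorem hasDerivAt_fst_fst_slice {F : Type*} [NormedAddCommGroup F] [NormedSpace ℝ F]
    {g : (ℝ × ℝ) × E → F} (hg : ContDiff ℝ 1 g) (s t : ℝ) (δ : E) :
    HasDerivAt (fun s => g ((s, t), δ)) (fderiv ℝ g ((s, t), δ) ((1, 0), 0)) s :=
  ((hg.differentiable (by simp)) ((s, t), δ)).hasFDerivAt.comp_hasDerivAt s
    (((hasDerivAt_id s).prodMk (hasDerivAt_const s t)).prodMk (hasDerivAt_const s δ))

theorem hasDerivAt_fst_snd_slice {F : Type*} [NormedAddCommGroup F] [NormedSpace ℝ F]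
    {g : (ℝ × ℝ) × E → F} (hg : ContDiff ℝ 1 g) (s t : ℝ) (δ : E) :
    HasDerivAt (fun t => g ((s, t), δ)) (fderiv ℝ g ((s, t), δ) ((0, 1), 0)) t :=
  ((hg.differentiable (by simp)) ((s, t), δ)).hasFDerivAt.comp_hasDerivAt t
    (((hasDerivAt_const t s).prodMk (hasDerivAt_id t)).prodMk (hasDerivAt_const t δ))

theorem partialFst_sigmaPhase {g₁ : ℝ × E → ℝ} {g₂ : (ℝ × ℝ) × E → ℝ} (h₁ : ContDiff ℝ ∞ g₁)
    (h₂ : ContDiff ℝ ∞ g₂) : partialFst (sigmaPhase g₁ g₂) =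
      sigmaPhase (fun z => fderiv ℝ g₁ z (1, 0)) (fun z => fderiv ℝ g₂ z ((1, 0), 0)) := by
  funext ⟨x₁, x₂, δ, σ⟩
  refine (hasDerivAt_partialFst (contDiff_sigmaPhase h₁ h₂) x₁ x₂ (δ, σ)).unique ?_
  exact (hasDerivAt_fst_slice h₁ x₁ δ).add
    ((hasDerivAt_fst_fst_slice (h₂.of_le (natCast_le_infty 1)) x₁ x₂ δ).const_mul σ)

theorem fderiv_sigmaPhase_sigma {g₁ : ℝ × E → ℝ} {g₂ : (ℝ × ℝ) × E → ℝ} (h₁ : ContDiff ℝ ∞ g₁)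
    (h₂ : ContDiff ℝ ∞ g₂) (x₁ x₂ : ℝ) :
    fderiv ℝ (sigmaPhase g₁ g₂) (x₁, x₂, 0) (0, 0, 0, 1) = g₂ ((x₁, x₂), 0) := by
  have d1 : HasDerivAt (fun σ : ℝ => ((x₁, x₂, 0, σ) : ℝ × ℝ × (E × ℝ))) (0, 0, 0, 1) 0 :=
    (hasDerivAt_const _ _).prodMk ((hasDerivAt_const _ _).prodMk ((hasDerivAt_const _ _).prodMk
      (hasDerivAt_id _)))
  have d2 := (((contDiff_sigmaPhase h₁ h₂).differentiable (by simp))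
    (x₁, x₂, 0, 0)).hasFDerivAt.comp_hasDerivAt (0 : ℝ) d1
  refine d2.unique ?_
  have d3 : HasDerivAt (fun σ : ℝ => g₁ (x₁, 0) + σ * g₂ ((x₁, x₂), 0)) (g₂ ((x₁, x₂), 0)) 0 := by
    simpa using ((hasDerivAt_id (0 : ℝ)).mul_const (g₂ ((x₁, x₂), 0))).const_add (g₁ (x₁, 0))
  exact d3

/-- The three cases, according to the order of the first derivative of `g₁` that does not
vanish. -/
theorem hasAiryBound_sigmaPhase [FiniteDimensional ℝ E] {g₁ : ℝ × E → ℝ} {g₂ : (ℝ × ℝ) × E → ℝ}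
    (hg₁ : ContDiff ℝ ∞ g₁) (hg₂ : ContDiff ℝ ∞ g₂)
    (h₁ : |iteratedDeriv 1 (fun t : ℝ => g₁ (t, 0)) 0|
        + |iteratedDeriv 2 (fun t : ℝ => g₁ (t, 0)) 0|
        + |iteratedDeriv 3 (fun t : ℝ => g₁ (t, 0)) 0| ≠ 0)
    (h₁₂ : deriv (fun s : ℝ => deriv (fun t : ℝ => g₂ ((s, t), 0)) 0) 0 ≠ 0)
    {m : ℕ} (hm : 2 ≤ m)
    (hv : ∀ l : ℕ, 1 ≤ l → l < m → iteratedDeriv l (fun t : ℝ => g₂ ((0, t), 0)) 0 = 0)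
    (hx : iteratedDeriv m (fun t : ℝ => g₂ ((0, t), 0)) 0 ≠ 0) :
    HasAiryBound (sigmaPhase g₁ g₂) m := by
  have hF := contDiff_sigmaPhase hg₁ hg₂
  have hd : ∀ {g : ℝ × E → ℝ}, ContDiff ℝ ∞ g → ContDiff ℝ ∞ fun z => fderiv ℝ g z (1, 0) :=
    fun hg => (hg.fderiv_right (m := ∞) (by simp)).clm_apply contDiff_const
  have hd₂ : ∀ {g : (ℝ × ℝ) × E → ℝ} (v : (ℝ × ℝ) × E), ContDiff ℝ ∞ g →
      ContDiff ℝ ∞ fun z => fderiv ℝ g z v :=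
    fun v hg => (hg.fderiv_right (m := ∞) (by simp)).clm_apply contDiff_const
  have hder : ∀ {g : ℝ × E → ℝ}, ContDiff ℝ ∞ g →
      deriv (fun t => g (t, 0)) = fun t => fderiv ℝ g (t, 0) (1, 0) := fun hg => by
    funext t
    exact (hasDerivAt_fst_slice hg t 0).deriv
  have hz : ∀ (g : ℝ × E → ℝ) (k : (ℝ × ℝ) × E → ℝ), sigmaPhase g k 0 = g (0, 0) := fun g k => by
    simp [sigmaPhase]
  have e1 : iteratedDeriv 1 (fun t : ℝ => g₁ (t, 0)) 0 = partialFst (sigmaPhase g₁ g₂) 0 := by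
    rw [iteratedDeriv_one, hder hg₁, partialFst_sigmaPhase hg₁ hg₂, hz]
  have e2 : iteratedDeriv 2 (fun t : ℝ => g₁ (t, 0)) 0
      = partialFst (partialFst (sigmaPhase g₁ g₂)) 0 := by
    rw [iteratedDeriv_succ', iteratedDeriv_one, hder hg₁, hder (hd hg₁),
      partialFst_sigmaPhase hg₁ hg₂, partialFst_sigmaPhase (hd hg₁) (hd₂ _ hg₂), hz]
  have e3 : iteratedDeriv 3 (fun t : ℝ => g₁ (t, 0)) 0
      = partialFst (partialFst (partialFst (sigmaPhase g₁ g₂))) 0 := by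
    rw [iteratedDeriv_succ', iteratedDeriv_succ', iteratedDeriv_one, hder hg₁, hder (hd hg₁),
      hder (hd (hd hg₁)), partialFst_sigmaPhase hg₁ hg₂,
      partialFst_sigmaPhase (hd hg₁) (hd₂ _ hg₂),
      partialFst_sigmaPhase (hd (hd hg₁)) (hd₂ _ (hd₂ _ hg₂)), hz]
  rw [e1, e2, e3] at h₁
  have hσ : (fun x₂ => fderiv ℝ (sigmaPhase g₁ g₂) (0, x₂, 0) (0, 0, 0, 1))
      = fun t : ℝ => g₂ ((0, t), 0) := by
    funext x₂
    exact fderiv_sigmaPhase_sigma hg₁ hg₂ 0 x₂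
  have hmix : deriv (fun x₂ => fderiv ℝ (partialFst (sigmaPhase g₁ g₂)) (0, x₂, 0) (0, 0, 0, 1)) 0
      ≠ 0 := by
    have a1 : (fun x₂ => fderiv ℝ (partialFst (sigmaPhase g₁ g₂)) (0, x₂, 0) (0, 0, 0, 1))
        = fun x₂ : ℝ => fderiv ℝ g₂ ((0, x₂), 0) ((1, 0), 0) := by
      funext x₂
      rw [partialFst_sigmaPhase hg₁ hg₂, fderiv_sigmaPhase_sigma (hd hg₁) (hd₂ _ hg₂)]
    have a2 : (fun s : ℝ => deriv (fun t : ℝ => g₂ ((s, t), 0)) 0)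
        = fun s : ℝ => fderiv ℝ g₂ ((s, 0), 0) ((0, 1), 0) := by
      funext s
      exact (hasDerivAt_fst_snd_slice (hg₂.of_le (natCast_le_infty 1)) s 0 0).deriv
    have hdd : ContDiff ℝ 1 (fderiv ℝ g₂) := hg₂.fderiv_right (m := 1) (by
      exact_mod_cast natCast_le_infty 2)
    have a3 := ((hasDerivAt_fst_snd_slice hdd 0 0 0).clm_apply
      (hasDerivAt_const 0 (((1, 0), 0) : (ℝ × ℝ) × E))).deriv
    have a4 := ((hasDerivAt_fst_fst_slice hdd 0 0 0).clm_apply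
      (hasDerivAt_const 0 (((0, 1), 0) : (ℝ × ℝ) × E))).deriv
    have a5 : IsSymmSndFDerivAt ℝ g₂ ((0, 0), 0) := hg₂.contDiffAt.isSymmSndFDerivAt (by
      simpa using natCast_le_infty 2)
    rw [a2, a4] at h₁₂
    rw [a1, a3]
    simp only [map_zero, add_zero] at h₁₂ ⊢
    rw [a5]
    exact h₁₂
  have hind : ∀ x₁ x₂ (δ : E), sigmaPhase g₁ g₂ (x₁, x₂, δ, 0) = sigmaPhase g₁ g₂ (x₁, 0, δ, 0) :=
    fun x₁ x₂ δ => by simp [sigmaPhase]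
  rw [← hσ] at hx
  simp only [← hσ] at hv
  by_cases b1 : partialFst (sigmaPhase g₁ g₂) 0 = 0
  · by_cases b2 : partialFst (partialFst (sigmaPhase g₁ g₂)) 0 = 0
    · refine hasAiryBound_of_deriv_three_ne_zero hF hind hm b1 b2 (fun b3 => h₁ ?_) hmix hv hx
      rw [b1, b2, b3]
      simp
    · exact hasAiryBound_of_deriv_two_ne_zero hF hind hm b1 b2 hx
  · exact hasAiryBound_of_deriv_ne_zero hF hm b1

end

/-! ### Localization -/

theorem integral_prod_eq_intervalIntegral {f : ℝ × ℝ → ℂ} (hf : Continuous f) {η : ℝ}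
    (h0 : ∀ x₁ x₂, η ≤ |x₁| ∨ η ≤ |x₂| → f (x₁, x₂) = 0) :
    ∫ x : ℝ × ℝ, f x = ∫ x₂ in (-η)..η, ∫ x₁ in (-η)..η, f (x₁, x₂) := by
  have hc : HasCompactSupport f := by
    refine HasCompactSupport.intro ((isCompact_Icc (a := -η) (b := η)).prod
      (isCompact_Icc (a := -η) (b := η))) fun x hx => h0 x.1 x.2 ?_
    by_contra! h
    exact hx ⟨abs_le.1 h.1.le, abs_le.1 h.2.le⟩
  have hs : ∀ g : ℝ → ℂ, (∀ x, η ≤ |x| → g x = 0) → ∫ x, g x = ∫ x in (-η)..η, g x := by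
    intro g hg
    refine (intervalIntegral.integral_eq_integral_of_support_subset fun x hx => ?_).symm
    have : |x| < η := by
      by_contra! h
      exact hx (hg x h)
    exact ⟨(abs_lt.1 this).1, (abs_lt.1 this).2.le⟩
  rw [Measure.volume_eq_prod, integral_prod_symm _ (by
    rw [← Measure.volume_eq_prod]; exact hf.integrable_of_hasCompactSupport hc), hs]
  · refine intervalIntegral.integral_congr fun x₂ _ => ?_
    exact hs _ fun x₁ h => h0 x₁ x₂ (Or.inl h)
  · intro x₂ h
    simp only [h0 _ x₂ (Or.inr h), integral_zero]

/-- An amplitude that is smooth near the parameters in a closed ball agrees there with a globally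
smooth one. -/
theorem exists_contDiff_amplitude {E : Type} [NormedAddCommGroup E] [InnerProductSpace ℝ E]
    [FiniteDimensional ℝ E] {a : (ℝ × ℝ) × E → ℂ} {W : Set E} (hW : IsOpen W) {r : ℝ} (hr : 0 < r)
    (hrW : Metric.closedBall 0 r ⊆ W) (ha : ContDiffOn ℝ ∞ a (univ ×ˢ W)) :
    ∃ b : ℝ × ℝ × (E × ℝ) → ℂ, ContDiff ℝ ∞ b ∧
      (∀ (x₁ x₂ : ℝ) (p : E × ℝ), ‖p.1‖ ≤ r → b (x₁, x₂, p) = a ((x₁, x₂), p.1)) ∧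
      ∀ (x₁ x₂ : ℝ), (∀ δ ∈ W, a ((x₁, x₂), δ) = 0) → ∀ p : E × ℝ, b (x₁, x₂, p) = 0 := by
  have : ProperSpace E := FiniteDimensional.proper ℝ E
  obtain ⟨κ, hκ, hκW⟩ := (isCompact_closedBall (0 : E) r).exists_thickening_subset_open hW hrW
  rw [thickening_closedBall hκ hr.le] at hκW
  let χ : ContDiffBump (0 : E) := ⟨r, r + κ / 2, hr, by linarith⟩
  have hχW : ∀ δ, δ ∉ W → δ ∉ tsupport χ := fun δ hδ h => by
    rw [χ.tsupport_eq] at h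
    exact hδ (hκW (Metric.closedBall_subset_ball (by change r + κ / 2 < κ + r; linarith) h))
  refine ⟨fun y => χ y.2.2.1 • a ((y.1, y.2.1), y.2.2.1), ?_, fun x₁ x₂ p hp => ?_,
    fun x₁ x₂ h p => ?_⟩
  · rw [contDiff_iff_contDiffAt]
    intro y
    have hc : ContDiffAt ℝ ∞ (fun y : ℝ × ℝ × (E × ℝ) => y.2.2.1) y := by fun_prop
    by_cases hy : y.2.2.1 ∈ W
    · have h1 : ContDiffAt ℝ ∞ a ((y.1, y.2.1), y.2.2.1) :=
        ha.contDiffAt ((isOpen_univ.prod hW).mem_nhds ⟨mem_univ _, hy⟩)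
      have h2 : ContDiffAt ℝ ∞ (fun y : ℝ × ℝ × (E × ℝ) => a ((y.1, y.2.1), y.2.2.1)) y :=
        ContDiffAt.comp (g := a) (f := fun y : ℝ × ℝ × (E × ℝ) => ((y.1, y.2.1), y.2.2.1)) y h1
          (by fun_prop)
      exact (χ.contDiff.contDiffAt.comp y hc).smul h2
    · have h1 : ∀ᶠ z : ℝ × ℝ × (E × ℝ) in 𝓝 y, z.2.2.1 ∉ tsupport χ :=
        hc.continuousAt.eventually ((isClosed_tsupport χ).isOpen_compl.mem_nhds (hχW _ hy))
      refine (contDiffAt_const (c := (0 : ℂ))).congr_of_eventuallyEq ?_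
      filter_upwards [h1] with z hz
      rw [image_eq_zero_of_notMem_tsupport hz, zero_smul]
  · dsimp only
    rw [χ.one_of_mem_closedBall (mem_closedBall_zero_iff.2 hp), one_smul]
  · dsimp only
    by_cases hp : p.1 ∈ W
    · rw [h _ hp, smul_zero]
    · rw [image_eq_zero_of_notMem_tsupport (hχW _ hp), zero_smul]

theorem theorem4p5 (ν : ℕ)
    (V₁ : Set (ℝ × EuclideanSpace ℝ (Fin ν)))
    (V₂ : Set ((ℝ × ℝ) × EuclideanSpace ℝ (Fin ν)))
    (hV₁ : IsOpen V₁) (h0V₁ : (0, 0) ∈ V₁)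
    (hV₂ : IsOpen V₂) (h0V₂ : ((0, 0), 0) ∈ V₂)
    (f₁ : ℝ × EuclideanSpace ℝ (Fin ν) → ℝ)
    (f₂ : (ℝ × ℝ) × EuclideanSpace ℝ (Fin ν) → ℝ)
    (hf₁ : ContDiffOn ℝ ∞ f₁ V₁) (hf₂ : ContDiffOn ℝ ∞ f₂ V₂)
    (h₁ : |iteratedDeriv 1 (fun t : ℝ => f₁ (t, 0)) 0|
        + |iteratedDeriv 2 (fun t : ℝ => f₁ (t, 0)) 0|
        + |iteratedDeriv 3 (fun t : ℝ => f₁ (t, 0)) 0| ≠ 0)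
    (h₁₂ : deriv (fun s : ℝ => deriv (fun t : ℝ => f₂ ((s, t), 0)) 0) 0 ≠ 0)
    (m : ℕ) (hm : 2 ≤ m)
    (hvanish : ∀ l : ℕ, 1 ≤ l → l < m → iteratedDeriv l (fun t : ℝ => f₂ ((0, t), 0)) 0 = 0)
    (hexact : iteratedDeriv m (fun t : ℝ => f₂ ((0, t), 0)) 0 ≠ 0) :
    ∃ (U : Set (ℝ × ℝ)) (ε ε' : ℝ),
      IsOpen U ∧ (0, 0) ∈ U ∧ 0 < ε ∧ 0 < ε' ∧
      (∀ x ∈ U, ∀ δ : EuclideanSpace ℝ (Fin ν), ‖δ‖ ≤ ε' → (x.1, δ) ∈ V₁ ∧ (x, δ) ∈ V₂) ∧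
      ∀ (W : Set (EuclideanSpace ℝ (Fin ν))) (a : (ℝ × ℝ) × EuclideanSpace ℝ (Fin ν) → ℂ),
        IsOpen W → Metric.closedBall 0 ε' ⊆ W → IsAmplitudeIn U W a →
        ∃ C : ℝ, ∀ (lam σ : ℝ) (δ : EuclideanSpace ℝ (Fin ν)),
          0 < lam → σ ≠ 0 → |σ| + ‖δ‖ < ε' →
          ‖airyIntegral f₁ f₂ a lam σ δ‖
            ≤ C / (lam ^ (1 / 2 + ε) * |σ| ^ (airyL m + airyC m * ε)) := by
  -- only the germs of `f₁` and `f₂` at the origin matter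
  obtain ⟨g₁, hg₁, hg₁e⟩ := exists_contDiff_eventuallyEq le_rfl hV₁ hf₁ h0V₁
  obtain ⟨g₂, hg₂, hg₂e⟩ := exists_contDiff_eventuallyEq le_rfl hV₂ hf₂ h0V₂
  have c1 : Tendsto (fun t : ℝ => ((t, 0) : ℝ × EuclideanSpace ℝ (Fin ν))) (𝓝 0) (𝓝 (0, 0)) :=
    (by fun_prop : Continuous fun t : ℝ => ((t, 0) : ℝ × EuclideanSpace ℝ (Fin ν))).tendsto' _ _ rfl
  have c2 : Tendsto (fun t : ℝ => (((0, t), 0) : (ℝ × ℝ) × EuclideanSpace ℝ (Fin ν))) (𝓝 0)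
      (𝓝 ((0, 0), 0)) := (by fun_prop : Continuous fun t : ℝ =>
        (((0, t), 0) : (ℝ × ℝ) × EuclideanSpace ℝ (Fin ν))).tendsto' _ _ rfl
  have c3 : Tendsto (fun s : ℝ => (((s, 0), 0) : (ℝ × ℝ) × EuclideanSpace ℝ (Fin ν))) (𝓝 0)
      (𝓝 ((0, 0), 0)) := (by fun_prop : Continuous fun s : ℝ =>
        (((s, 0), 0) : (ℝ × ℝ) × EuclideanSpace ℝ (Fin ν))).tendsto' _ _ rfl
  have e1 : (fun t : ℝ => f₁ (t, 0)) =ᶠ[𝓝 0] fun t => g₁ (t, 0) :=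
    (c1.eventually hg₁e).mono fun _ h => h.symm
  have e2 : (fun t : ℝ => f₂ ((0, t), 0)) =ᶠ[𝓝 0] fun t => g₂ ((0, t), 0) :=
    (c2.eventually hg₂e).mono fun _ h => h.symm
  have e3 : (fun s : ℝ => deriv (fun t : ℝ => f₂ ((s, t), 0)) 0) =ᶠ[𝓝 0]
      fun s => deriv (fun t : ℝ => g₂ ((s, t), 0)) 0 := by
    filter_upwards [c3.eventually hg₂e.eventually_nhds] with s hs
    refine EventuallyEq.deriv_eq ?_
    exact (((by fun_prop : Continuous fun t : ℝ =>
      (((s, t), 0) : (ℝ × ℝ) × EuclideanSpace ℝ (Fin ν))).tendsto 0).eventually hs).mono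
        fun _ h => h.symm
  simp only [e1.iteratedDeriv_eq] at h₁
  simp only [e2.iteratedDeriv_eq] at hvanish hexact
  rw [e3.deriv_eq] at h₁₂
  obtain ⟨η, hη, hbound⟩ := hasAiryBound_sigmaPhase hg₁ hg₂ h₁ h₁₂ hm hvanish hexact
  have d1 : Tendsto (fun z : (ℝ × ℝ) × (EuclideanSpace ℝ (Fin ν) × ℝ) => (z.1.1, z.2.1)) (𝓝 0)
      (𝓝 (0, 0)) := (by fun_prop : Continuous fun z : (ℝ × ℝ) × (EuclideanSpace ℝ (Fin ν) × ℝ) =>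
        (z.1.1, z.2.1)).tendsto' _ _ rfl
  have d2 : Tendsto (fun z : (ℝ × ℝ) × (EuclideanSpace ℝ (Fin ν) × ℝ) => (z.1, z.2.1)) (𝓝 0)
      (𝓝 ((0, 0), 0)) := (by fun_prop : Continuous fun z : (ℝ × ℝ) ×
        (EuclideanSpace ℝ (Fin ν) × ℝ) => (z.1, z.2.1)).tendsto' _ _ rfl
  obtain ⟨R, hR, hall⟩ := exists_forall_of_eventually_nhds ((d1.eventually hg₁e).and
    ((d2.eventually hg₂e).and ((d1.eventually (hV₁.mem_nhds h0V₁)).and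
      (d2.eventually (hV₂.mem_nhds h0V₂)))))
  set r : ℝ := min η R with hr
  have hr0 : 0 < r := by positivity
  have hrη : r ≤ η := min_le_left _ _
  have hrR : r ≤ R := min_le_right _ _
  have hnear : ∀ x ∈ Metric.ball (0 : ℝ × ℝ) r, |x.1| < r ∧ |x.2| < r := fun x hx => by
    rw [mem_ball_zero_iff] at hx
    exact ⟨(le_max_left ‖x.1‖ ‖x.2‖).trans_lt hx, (le_max_right ‖x.1‖ ‖x.2‖).trans_lt hx⟩
  have hloc : ∀ x ∈ Metric.ball (0 : ℝ × ℝ) r, ∀ δ : EuclideanSpace ℝ (Fin ν), ‖δ‖ ≤ r →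
      g₁ (x.1, δ) = f₁ (x.1, δ) ∧ g₂ (x, δ) = f₂ (x, δ) ∧ (x.1, δ) ∈ V₁ ∧ (x, δ) ∈ V₂ := by
    intro x hx δ hδ
    refine hall x.1 x.2 (δ, 0) ((hnear x hx).1.le.trans hrR) ((hnear x hx).2.le.trans hrR) ?_
    rw [Prod.norm_mk, norm_zero]
    exact max_le (hδ.trans hrR) hR.le
  refine ⟨Metric.ball 0 r, airyEps m, r, Metric.isOpen_ball, Metric.mem_ball_self hr0,
    airyEps_pos m, hr0, fun x hx δ hδ => (hloc x hx δ hδ).2.2, ?_⟩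
  rintro W a hW hrW ⟨ha, K, -, hKU, hK⟩
  have hz : ∀ x δ, δ ∈ W → x ∉ Metric.ball (0 : ℝ × ℝ) r → a (x, δ) = 0 := fun x δ hδ hx =>
    image_eq_zero_of_notMem_tsupport (f := fun x => a (x, δ)) fun h => hx (hKU (hK δ hδ h))
  obtain ⟨b, hb, hba, hb0⟩ := exists_contDiff_amplitude hW hr0 hrW ha
  have hbz : ∀ (x₁ x₂ : ℝ) (p : EuclideanSpace ℝ (Fin ν) × ℝ), η ≤ |x₁| ∨ η ≤ |x₂| →
      b (x₁, x₂, p) = 0 := fun x₁ x₂ p h => hb0 x₁ x₂ (fun δ hδ => hz _ δ hδ fun hx => by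
    have := hnear _ hx
    dsimp only at this
    rcases h with h | h <;> linarith) p
  obtain ⟨C, -, hC⟩ := hbound b (hb.of_le (natCast_le_infty 2)) hbz
  refine ⟨C, fun lam σ δ hlam hσ hσδ => ?_⟩
  have hδr : ‖δ‖ ≤ r := by linarith [abs_nonneg σ]
  have hpη : ‖(δ, σ)‖ ≤ η := by
    rw [Prod.norm_mk]
    exact max_le (hδr.trans hrη) (by rw [Real.norm_eq_abs]; linarith [norm_nonneg δ])
  -- the phases agree on the ball, and the amplitude vanishes outside of it
  have hint : airyIntegral f₁ f₂ a lam σ δ = ∫ x : ℝ × ℝ, Complex.exp (Complex.I *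
      ((lam * sigmaPhase g₁ g₂ (x.1, x.2, δ, σ) : ℝ) : ℂ)) * b (x.1, x.2, δ, σ) := by
    refine integral_congr_ae (Eventually.of_forall fun x => ?_)
    dsimp only
    rw [hba x.1 x.2 (δ, σ) hδr]
    by_cases hx : x ∈ Metric.ball (0 : ℝ × ℝ) r
    · have := hloc x hx δ hδr
      rw [sigmaPhase, airyPhase]
      simp only [Prod.mk.eta]
      rw [this.1, this.2.1]
    · simp only [Prod.mk.eta]
      rw [hz x δ (hrW (mem_closedBall_zero_iff.2 hδr)) hx, mul_zero, mul_zero]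
  have hFc := (contDiff_sigmaPhase hg₁ hg₂).continuous
  have hbc := hb.continuous
  rw [hint, integral_prod_eq_intervalIntegral (by fun_prop) fun x₁ x₂ h => by
    rw [hbz x₁ x₂ _ h, mul_zero]]
  refine (hC lam (δ, σ) hlam hσ hpη).trans_eq ?_
  rw [airyRhs, Real.rpow_neg hlam.le, Real.rpow_neg (abs_nonneg _), ← mul_inv, ← div_eq_mul_inv]
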